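/- Let $\mathcal T$ be the category of pointed compactly generated spaces ($k$-spaces: spaces whose topology is coinduced by the continuous maps from compact Hausdorff spaces), with its smash product $\wedge$ and mapping spaces $\mathrm{Map}_*$. **Source.** A symmetric functor sequence $\mathcal F$ consists of a functor $\mathcal F_N:\mathcal T^N\to\mathcal T$ for every nonempty finite set $N$ (equivalently, functors $\mathcal F_n$ of $n$ variables for $n\ge 1$ with compatible $\Sigma_n$-symmetries), together with natural isomorphisms $\mathcal F_N((X_n)_{n\in N})\cong\mathcal F_M((X_{e(m)})_{m\in M})$ for bijections $e:M\to N$, compatible with identities and composition. Morphisms are families of natural transformations that respect the symmetries. The sequence is multipointed if $\mathcal F_N(X)$ is a point whenever some $X_n$ is a point, and continuous if the maps $\prod_n\mathrm{Map}_*(X_n,Y_n)\to\mathrm{Map}_*(\mathcal F_N(X),\mathcal F_N(Y))$ are continuous. Let $\mathrm{SymmFun}_*(\mathcal T)$ be the category of continuous multipointed symmetric functor sequences. The composition is $$(\mathcal G\circ\mathcal F)_N(X)=\bigvee_{\pi}\mathcal G_{N/\pi}\bigl((\mathcal F_{B}(X|_{B}))_{B\in N/\pi}\bigr),$$ the wedge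 over all unordered partitions $\pi$ of $N$ into nonempty blocks $B$, and the unit is $\mathrm{id}$, the identity functor for $|N|=1$ and the one-point functor for $|N|>1$. There are canonical isomorphisms $\mathrm{id}\circ\mathcal F\cong\mathcal F\cong\mathcal F\circ\mathrm{id}$ and a canonical comparison map $(\mathcal H\circ\mathcal G)\circ\mathcal F\to\mathcal H\circ(\mathcal G\circ\mathcal F)$, which for $N\twoheadrightarrow K\twoheadrightarrow L$ sends the corresponding wedge summand $\mathcal H_L(\mathcal G_{K_l}(\mathcal F_{N_k}))$ into the summand $\mathcal H_L((\mathcal G\circ\mathcal F)_{N_l})$ through the inclusions $\mathcal G_{K_l}(\mathcal F_{N_k})\to(\mathcal G\circ\mathcal F)_{N_l}$ (the comparison map need not be invertible when $\mathcal H$ does not preserve wedges). **Target.** $\mathrm{SymmSeq}(\mathcal T)$ is the category of functors from nonempty finite sets and bijections to $\mathcal T$, with the composition product $(A\circ B)(N)=\bigvee_\pi A(N/\pi)\wedge\bigwedge_{B'\in N/\pi}B(B')$ and with unit $S^0$ for $|N|=1$ and a point for $|N|>1$. **Functor.** Let $\mathbb I$ be (a skeleton of) the category of finite sets and injections. Let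 $S^1$ be the one-point compactification of $(0,\infty)$ and $S^U$ the smash product of $U$ copies of $S^1$. For $\mathcal F\in\mathrm{SymmFun}_*(\mathcal T)$ put $$\mathbb D_1^{(N)}\mathcal F_N(S^0)=\operatorname*{hocolim}_{(U_n)\in\mathbb I^N}\Omega^{U_1}\cdots\Omega^{U_n}\mathcal F_N(S^{U_1},\dots,S^{U_n}),\qquad \Omega^{U_1}\cdots\Omega^{U_n}Y=\mathrm{Map}_*(S^{U_1\sqcup\dots\sqcup U_n},Y).$$ Here the structure maps along injections $U_n\to U_n'$ smash with the complementary spheres and assemble them into $\mathcal F_N$, and $\operatorname{hocolim}$ is the pointed Bousfield–Kan homotopy colimit. Bijections of $N$ permute the variables and block-permute the loop coordinates. This defines a functor $\mathbb D_1^{(*)}-(S^0):\mathrm{SymmFun}_*(\mathcal T)\to\mathrm{SymmSeq}(\mathcal T)$. **Theorem.** 1. With the canonical comparison maps, $(\mathrm{SymmFun}_*(\mathcal T),\circ,\mathrm{id})$ is a skew-monoidal category with invertible unit maps: that is, it satisfies the axioms of a monoidal category, namely naturality, the pentagon and the unit axioms, except that $(\mathcal H\circ\mathcal G)\circ\mathcal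 F\to\mathcal H\circ(\mathcal G\circ\mathcal F)$ is not required to be invertible. With the canonical rebracketings, $\mathrm{SymmSeq}(\mathcal T)$ is a monoidal category. 2. The functor $\mathbb D_1^{(*)}-(S^0)$ is lax monoidal with respect to these structures. There are a map $\epsilon$ from the unit of $\mathrm{SymmSeq}(\mathcal T)$ to $\mathbb D_1^{(*)}\mathrm{id}(S^0)$, i.e. $S^0\to\mathbb D_1\mathrm{id}(S^0)$, and natural maps $$\mu:\ \mathbb D_1^{(*)}\mathcal G(S^0)\circ\mathbb D_1^{(*)}\mathcal F(S^0)\to\mathbb D_1^{(*)}(\mathcal G\circ\mathcal F)(S^0)$$ that satisfy the associativity diagram and both unit diagrams of a lax monoidal functor. They are the following maps. * $\epsilon$ is the inclusion of the object $U=\emptyset$, i.e. $S^0=\mathrm{id}(S^0)\to\operatorname{hocolim}_U\Omega^U S^U$. * On the wedge summand of a partition $p:N\twoheadrightarrow K$, $\mu$ is induced by maps $$\mathrm{Map}_*(S^{\sqcup_kU_k},\mathcal G_K(S^{U_k}))\wedge\bigwedge_k\mathrm{Map}_*(S^{\sqcup_{p(n)=k}V_n},\mathcal F_{p^{-1}(k)}(S^{V_n}))\to\mathrm{Map}_*(S^{\sqcup_nW_n},(\mathcal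 G\circ\mathcal F)_N(S^{W_n})),\quad W_n=U_{p(n)}\sqcup V_n,$$ together with reindexing of the homotopy colimits along $\sqcup:\mathbb I\times\mathbb I\to\mathbb I$. The product of $f$ and $(g_k)_k$ is the following. Let $\mathbf S_J$ be the $J$-th space of the sphere operad, the one-point compactification of the open simplex $\{t\in(0,\infty)^J:\sum_jt_j=1\}$, and identify $\mathbf S_J\wedge S^1\cong S^J$ by $(t,r)\mapsto(rt_j)_j$. Taking this for every $a\in U_k$, with $J=p^{-1}(k)$, write a point of $S^{\sqcup_nW_n}$ as $(t,r,v)$, where $t$ has components $t_{k,a}\in\mathbf S_{p^{-1}(k)}$ for $a\in U_k$, $r\in S^{\sqcup_kU_k}$ and $v_k\in S^{\sqcup_{p(n)=k}V_n}$. Then $(t,r,v)$ is sent to $\mathcal G_K(\varphi_k)(f(r))$, included into $(\mathcal G\circ\mathcal F)_N$. Here $$\varphi_k:S^{U_k}\to\mathcal F_{p^{-1}(k)}(S^{W_n}),\qquad \varphi_k(x)=\mathcal F_{p^{-1}(k)}\bigl(((t_{k,a,n}x_a)_{a\in U_k}\wedge-):S^{V_n}\to S^{W_n}\bigr)_{n\in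 p^{-1}(k)}\,(g_k(v_k)),$$ i.e. the sphere-operad coordinates and the values of $g$ are assembled into the variables of $\mathcal G$, and the spheres $S^{U_k}$ into the variables of $\mathcal F$. -/

import Mathlib

set_option linter.unusedVariables false

open CategoryTheory Topology

/-- The compact Hausdorff spaces, as a family of test spaces. -/
abbrev cptHaus : CompHaus.{0} → Type := fun S => S

/-- `Y` is compactly generated: its topology is coinduced by all maps from compact Hausdorff
spaces. -/
abbrev IsCG (Y : Type) [TopologicalSpace Y] : Prop := IsGeneratedBy cptHaus Y

/-- The `k`-ification of a topological space. -/
abbrev Kify (Y : Type) [TopologicalSpace Y] : Type := WithGeneratedByTopology cptHaus Y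

instance (S : CompHaus.{0}) : CompactSpace (cptHaus S) := S.is_compact
instance (S : CompHaus.{0}) : T2Space (cptHaus S) := S.is_hausdorff
theorem locallyCompact_of_compact (A : Type) [TopologicalSpace A] [CompactSpace A] [T2Space A] :
    LocallyCompactSpace A := inferInstance
instance (S : CompHaus.{0}) : LocallyCompactSpace (cptHaus S) := locallyCompact_of_compact _

theorem isCG_of_compact (A : Type) [TopologicalSpace A] [CompactSpace A] [T2Space A] : IsCG A :=
  inferInstanceAs (IsGeneratedBy cptHaus (cptHaus (CompHaus.of A)))

/-- A pointed compactly generated space. -/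
structure PtdSpace where
  carrier : Type
  [top : TopologicalSpace carrier]
  [cg : IsCG carrier]
  pt : carrier

namespace PtdSpace

instance : CoeSort PtdSpace Type := ⟨carrier⟩
instance (X : PtdSpace) : TopologicalSpace X := X.top
instance (X : PtdSpace) : IsCG X := X.cg

/-- Pointed continuous maps. -/
@[ext] structure Hom (X Y : PtdSpace) where
  toFun : X → Y
  cont : Continuous toFun
  map_pt : toFun X.pt = Y.pt

instance : Category PtdSpace where
  Hom := Hom
  id X := ⟨id, continuous_id, rfl⟩
  comp f g := ⟨g.toFun ∘ f.toFun, g.cont.comp f.cont, by simp [f.map_pt, g.map_pt]⟩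

instance (X Y : PtdSpace) : CoeFun (X ⟶ Y) (fun _ => X → Y) := ⟨Hom.toFun⟩

@[ext] theorem hom_ext {X Y : PtdSpace} {f g : X ⟶ Y} (h : ∀ x, f x = g x) : f = g :=
  Hom.ext (funext h)

@[simp] theorem id_apply {X : PtdSpace} (x : X) : (𝟙 X : X ⟶ X) x = x := rfl

@[simp] theorem comp_apply {X Y Z : PtdSpace} (f : X ⟶ Y) (g : Y ⟶ Z) (x : X) :
    (f ≫ g) x = g (f x) := rfl

/-- The constant map at the base point. -/
def zeroHom (X Y : PtdSpace) : X ⟶ Y := ⟨fun _ => Y.pt, continuous_const, rfl⟩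

/-- The set of pointed maps carries the compact-open topology (tested on compact Hausdorff spaces
mapping to the source). -/
instance (X Y : PtdSpace) : TopologicalSpace (X ⟶ Y) :=
  TopologicalSpace.induced
    (fun f => (⟨f, f.cont.continuousGeneratedBy⟩ : ContinuousMapGeneratedBy cptHaus X Y))
    inferInstance

/-- The pointed mapping space, i.e. the internal hom of pointed compactly generated spaces. -/
def mapSpace (X Y : PtdSpace) : PtdSpace where
  carrier := Kify (X ⟶ Y)
  pt := (WithGeneratedByTopology.equiv (X := cptHaus)).symm (zeroHom X Y)

/-- The pointed map underlying a point of the mapping space. -/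
def mapSpace.toHom {X Y : PtdSpace} (f : mapSpace X Y) : X ⟶ Y :=
  WithGeneratedByTopology.equiv (X := cptHaus) f

/-- A pointed map as a point of the mapping space. -/
def mapSpace.ofHom {X Y : PtdSpace} (f : X ⟶ Y) : mapSpace X Y :=
  (WithGeneratedByTopology.equiv (X := cptHaus)).symm f

theorem continuous_toHom {X Y : PtdSpace} :
    Continuous (mapSpace.toHom : mapSpace X Y → (X ⟶ Y)) :=
  WithGeneratedByTopology.continuous_equiv (X := cptHaus) (Y := (X ⟶ Y))

theorem continuous_hom_of_joint {A : Type} [TopologicalSpace A] {X Y : PtdSpace} (φ : A → (X ⟶ Y))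
    (h : Continuous (fun p : A × X => φ p.1 p.2)) : Continuous φ := by
  rw [continuous_induced_rng, ContinuousMapGeneratedBy.continuous_iff]
  intro i f
  exact (ContinuousMap.curry ⟨fun p : A × _ => φ p.1 (f p.2),
    h.comp (continuous_fst.prodMk (f.continuous.comp continuous_snd))⟩).continuous

theorem continuous_prod_of_tests {A X Y : Type} [TopologicalSpace A] [TopologicalSpace X]
    [TopologicalSpace Y] [LocallyCompactSpace A] [IsCG X] (g : A × X → Y)
    (h : ∀ (S : CompHaus.{0}) (f : C(S, X)), Continuous (fun p : A × S => g (p.1, f p.2))) :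
    Continuous g := by
  let q : (Σ f : (Σ S : CompHaus.{0}, C(cptHaus S, X)), cptHaus f.1) → X := fun x => x.1.2 x.2
  have hq : IsQuotientMap q := by
    refine ⟨?_, ?_⟩
    · exact ⟨(IsGeneratedBy.generatedBy_eq (X := cptHaus) (Y := X)).symm.trans
        (TopologicalSpace.generatedBy_eq_coinduced cptHaus)⟩
    · intro x
      exact ⟨⟨⟨CompHaus.of PUnit, ContinuousMap.const _ x⟩, PUnit.unit⟩, rfl⟩
  refine hq.continuous_lift_prod_right (g := g) ?_
  rw [← (Homeomorph.prodComm _ _).comp_continuous_iff']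
  rw [← (Homeomorph.sigmaProdDistrib).symm.comp_continuous_iff', continuous_sigma_iff]
  intro f
  exact (h f.1 f.2).comp continuous_swap

theorem joint_of_continuous_hom {A : Type} [TopologicalSpace A] [LocallyCompactSpace A]
    {X Y : PtdSpace} (φ : A → (X ⟶ Y)) (h : Continuous φ) :
    Continuous (fun p : A × X => φ p.1 p.2) := by
  refine continuous_prod_of_tests _ fun S f => ?_
  rw [continuous_induced_rng, ContinuousMapGeneratedBy.continuous_iff] at h
  exact ContinuousMap.continuous_uncurry_of_continuous ⟨_, h S f⟩

theorem continuous_of_tests {X : PtdSpace} {Y : Type} [TopologicalSpace Y] (g : X → Y)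
    (h : ∀ (S : CompHaus.{0}) (f : C(S, X)), Continuous (g ∘ f)) : Continuous g :=
  (IsGeneratedBy.continuous_iff cptHaus g).2 h

theorem continuous_ofHom {A : Type} [TopologicalSpace A] [IsCG A] {X Y : PtdSpace}
    {φ : A → (X ⟶ Y)} (h : Continuous φ) : Continuous (fun a => mapSpace.ofHom (φ a)) :=
  (IsGeneratedBy.equiv_symm_comp_continuous_iff (X := cptHaus) φ).2 h

end PtdSpace

/-! ### Pointed quotients -/

/-- Glue `a` to `b` whenever `r a b`, and collapse `a` to the added base point whenever `z a`. -/
inductive PQuotRel {E : Type} (r : E → E → Prop) (z : E → Prop) : Unit ⊕ E → Unit ⊕ E → Prop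
  | glue {a b : E} : r a b → PQuotRel r z (Sum.inr a) (Sum.inr b)
  | base {a : E} : z a → PQuotRel r z (Sum.inr a) (Sum.inl ())

/-- The quotient of `E` with a disjoint base point by the relations of `PQuotRel`. -/
def PQuot (E : Type) [TopologicalSpace E] [IsCG E] (r : E → E → Prop) (z : E → Prop) : PtdSpace where
  carrier := Quot (PQuotRel r z)
  pt := Quot.mk _ (Sum.inl ())

namespace PQuot
variable {E : Type} [TopologicalSpace E] [IsCG E] {r : E → E → Prop} {z : E → Prop}

/-- The class of a point. -/
def mk (e : E) : PQuot E r z := Quot.mk _ (Sum.inr e)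

theorem continuous_mk : Continuous (mk : E → PQuot E r z) :=
  continuous_quot_mk.comp continuous_inr

theorem mk_glue {a b : E} (h : r a b) : (mk a : PQuot E r z) = mk b := Quot.sound (.glue h)

theorem mk_base {a : E} (h : z a) : (mk a : PQuot E r z) = (PQuot E r z).pt := Quot.sound (.base h)

theorem ind {P : PQuot E r z → Prop} (hpt : P (PQuot E r z).pt) (hmk : ∀ e, P (mk e)) :
    ∀ x, P x := by
  rintro ⟨_ | e⟩
  · exact hpt
  · exact hmk e

theorem hom_ext {Y : PtdSpace} {f g : PQuot E r z ⟶ Y} (h : ∀ e, f (mk e) = g (mk e)) : f = g :=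
  PtdSpace.hom_ext (ind (f.map_pt.trans g.map_pt.symm) h)

/-- The map out of a pointed quotient induced by a compatible continuous map. -/
def desc {Y : PtdSpace} (h : E → Y) (hc : Continuous h) (hr : ∀ a b, r a b → h a = h b)
    (hz : ∀ a, z a → h a = Y.pt) : PQuot E r z ⟶ Y where
  toFun := Quot.lift (Sum.elim (fun _ => Y.pt) h) (by
    rintro _ _ (⟨hab⟩ | ⟨ha⟩)
    · exact hr _ _ hab
    · exact hz _ ha)
  cont := continuous_quot_lift _ (continuous_const.sumElim hc)
  map_pt := rfl

@[simp] theorem desc_mk {Y : PtdSpace} (h : E → Y) (hc : Continuous h)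
    (hr : ∀ a b, r a b → h a = h b) (hz : ∀ a, z a → h a = Y.pt) (e : E) :
    (desc h hc hr hz : PQuot E r z ⟶ Y) (mk e) = h e := rfl

theorem continuous_joint {A Y : Type} [TopologicalSpace A] [LocallyCompactSpace A]
    [TopologicalSpace Y] (g : A × PQuot E r z → Y)
    (h₁ : Continuous (fun p : A × E => g (p.1, mk p.2)))
    (h₂ : Continuous (fun a : A => g (a, (PQuot E r z).pt))) : Continuous g := by
  have hq : IsQuotientMap (Quot.mk (PQuotRel r z)) := isQuotientMap_quot_mk
  refine hq.continuous_lift_prod_right (g := g) ?_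
  rw [← (Homeomorph.prodComm _ _).comp_continuous_iff']
  rw [← (Homeomorph.sumProdDistrib).symm.comp_continuous_iff', continuous_sum_dom]
  exact ⟨h₂.comp continuous_snd, h₁.comp continuous_swap⟩

end PQuot

/-! ### Wedges -/

/-- The wedge of a family of pointed spaces. -/
def Wedge {ι : Type} (X : ι → PtdSpace) : PtdSpace :=
  PQuot (Σ i, X i) (fun _ _ => False) (fun e => e.2 = (X e.1).pt)

namespace Wedge
variable {ι : Type} {X : ι → PtdSpace} {Y : PtdSpace}

/-- The inclusion of a summand. -/
def incl (X : ι → PtdSpace) (i : ι) : X i ⟶ Wedge X where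
  toFun x := PQuot.mk ⟨i, x⟩
  cont := PQuot.continuous_mk.comp continuous_sigmaMk
  map_pt := PQuot.mk_base rfl

/-- The map out of a wedge given by its restrictions to the summands. -/
def desc (f : ∀ i, X i ⟶ Y) : Wedge X ⟶ Y :=
  PQuot.desc (fun e => f e.1 e.2) (continuous_sigma fun i => (f i).cont) (fun _ _ h => h.elim)
    (by rintro ⟨i, x⟩ h; simp only at h; rw [h, (f i).map_pt])

@[simp] theorem incl_desc (f : ∀ i, X i ⟶ Y) (i : ι) : incl X i ≫ desc f = f i := rfl

@[simp] theorem incl_desc_assoc (f : ∀ i, X i ⟶ Y) (i : ι) {Z : PtdSpace} (g : Y ⟶ Z) :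
    incl X i ≫ desc f ≫ g = f i ≫ g := rfl

theorem hom_ext {f g : Wedge X ⟶ Y} (h : ∀ i, incl X i ≫ f = incl X i ≫ g) : f = g :=
  PQuot.hom_ext fun ⟨i, x⟩ => congrArg (fun k : X i ⟶ Y => k x) (h i)

/-- Functoriality of the wedge for a fixed index set. -/
def map {X' : ι → PtdSpace} (f : ∀ i, X i ⟶ X' i) : Wedge X ⟶ Wedge X' :=
  desc fun i => f i ≫ incl X' i

theorem continuous_desc {A : Type} [TopologicalSpace A] [LocallyCompactSpace A]
    (φ : A → ∀ i, X i ⟶ Y) (h : ∀ i, Continuous fun a => φ a i) :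
    Continuous fun a => (desc (φ a) : Wedge X ⟶ Y) := by
  refine PtdSpace.continuous_hom_of_joint _ (PQuot.continuous_joint _ ?_ continuous_const)
  rw [← (Homeomorph.prodComm _ _).comp_continuous_iff']
  rw [← (Homeomorph.sigmaProdDistrib).symm.comp_continuous_iff', continuous_sigma_iff]
  exact fun i => (PtdSpace.joint_of_continuous_hom _ (h i)).comp continuous_swap

theorem subsingleton (h : ∀ i, Subsingleton (X i)) : Subsingleton (Wedge X) := by
  have : ∀ x : Wedge X, x = (Wedge X).pt :=
    PQuot.ind rfl fun ⟨i, x⟩ => PQuot.mk_base (Subsingleton.elim _ _)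
  exact ⟨fun a b => (this a).trans (this b).symm⟩

end Wedge

theorem PtdSpace.continuous_postcomp {A : Type} [TopologicalSpace A] [LocallyCompactSpace A]
    {X Y Z : PtdSpace} (φ : A → (X ⟶ Y)) (h : Continuous φ) (g : Y ⟶ Z) :
    Continuous fun a => φ a ≫ g :=
  PtdSpace.continuous_hom_of_joint _ (g.cont.comp (PtdSpace.joint_of_continuous_hom _ h))

/-! ### Finite sets, partitions -/

/-- A nonempty finite set. -/
structure FinSet where
  carrier : Type
  [fin : Finite carrier]
  [ne : Nonempty carrier]

namespace FinSet
instance : CoeSort FinSet Type := ⟨carrier⟩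
instance (N : FinSet) : Finite N := N.fin
instance (N : FinSet) : Nonempty N := N.ne

/-- The category of nonempty finite sets and bijections. -/
instance : Category FinSet where
  Hom M N := M ≃ N
  id M := Equiv.refl M
  comp e f := e.trans f
end FinSet

/-- A surjection of finite sets, i.e. a partition of `N` with blocks labelled by `K`. -/
structure Surj (N K : FinSet) where
  toFun : N → K
  surj : Function.Surjective toFun

namespace Surj
variable {N K L : FinSet}

instance : CoeFun (Surj N K) (fun _ => N → K) := ⟨toFun⟩

/-- A block of the partition. -/
abbrev fib (p : Surj N K) (k : K) : FinSet where
  carrier := {n : N // p n = k}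
  ne := (p.surj k).elim fun n h => ⟨⟨n, h⟩⟩

/-- Composition of surjections. -/
def comp (p : Surj N K) (q : Surj K L) : Surj N L := ⟨fun n => q (p n), q.surj.comp p.surj⟩

/-- The identity partition, with one-point blocks. -/
def id (N : FinSet) : Surj N N := ⟨fun n => n, fun n => ⟨n, rfl⟩⟩

/-- The restriction of `p` to a block of `q ∘ p`. -/
def restr (p : Surj N K) (q : Surj K L) (l : L) : Surj ((p.comp q).fib l) (q.fib l) :=
  ⟨fun n => ⟨p n.1, n.2⟩, by
    rintro ⟨k, hk⟩
    obtain ⟨n, rfl⟩ := p.surj k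
    exact ⟨⟨n, hk⟩, rfl⟩⟩

/-- The blocks of `p.restr q l` are blocks of `p`. -/
def restrFib (p : Surj N K) (q : Surj K L) (l : L) (k : q.fib l) :
    (p.restr q l).fib k ≃ p.fib k.1 where
  toFun n := ⟨n.1.1, congrArg Subtype.val n.2⟩
  invFun n := ⟨⟨n.1, (congrArg q n.2).trans k.2⟩, Subtype.ext n.2⟩
  left_inv _ := rfl
  right_inv _ := rfl

/-- The only block of a partition with a single block. -/
def onlyFib (p : Surj N K) (hK : Subsingleton K) (k : K) : N ≃ p.fib k where
  toFun n := ⟨n, hK.elim _ _⟩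
  invFun n := n.1
  left_inv _ := rfl
  right_inv _ := rfl

/-- The bijection of blocks induced by a bijection of partitions. -/
def fibEquiv {N' K' : FinSet} (p' : Surj N' K') (p : Surj N K) (e : N' ≃ N) (c : K' ≃ K)
    (h : ∀ n, p (e n) = c (p' n)) (k : K') : p'.fib k ≃ p.fib (c k) where
  toFun n := ⟨e n.1, (h n.1).trans (congrArg c n.2)⟩
  invFun n := ⟨e.symm n.1, c.injective (by rw [← h, e.apply_symm_apply, n.2])⟩
  left_inv n := Subtype.ext (e.symm_apply_apply n.1)
  right_inv n := Subtype.ext (e.apply_symm_apply n.1)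

end Surj

/-- The set of blocks of an unordered partition (an equivalence relation). -/
abbrev FinSet.quot {N : FinSet} (π : Setoid N) : FinSet where
  carrier := Quotient π
  ne := N.ne.map (Quotient.mk π)

/-- The surjection from `N` to the set of blocks of a partition. -/
def FinSet.proj {N : FinSet} (π : Setoid N) : Surj N (FinSet.quot π) :=
  ⟨Quotient.mk π, Quotient.mk_surjective⟩

/-- The blocks of the pulled back partition along a bijection. -/
def FinSet.quotEquiv {M N : FinSet} (e : M ≃ N) (π : Setoid N) :
    FinSet.quot (π.comap e) ≃ FinSet.quot π :=
  Quotient.congr e fun _ _ => Iff.rfl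

/-- The blocks of the unordered partition underlying a surjection. -/
noncomputable def Surj.kerEquiv {N K : FinSet} (p : Surj N K) :
    FinSet.quot (Setoid.ker p) ≃ K :=
  Setoid.quotientKerEquivOfSurjective p.toFun p.surj

/-! ### Symmetric functor sequences -/

/-- A symmetric functor sequence of pointed spaces: a functor of `N` variables for every
nonempty finite set `N`, with its symmetries. -/
structure SymmFunctor where
  obj (N : FinSet) : (N → PtdSpace) ⥤ PtdSpace
  perm {M N : FinSet} (e : M ≃ N) (X : N → PtdSpace) :
    (obj N).obj X ⟶ (obj M).obj (fun m => X (e m))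
  perm_natural {M N : FinSet} (e : M ≃ N) {X Y : N → PtdSpace} (f : X ⟶ Y) :
    (obj N).map f ≫ perm e Y = perm e X ≫ (obj M).map (fun m => f (e m))
  perm_refl (N : FinSet) (X : N → PtdSpace) : perm (Equiv.refl N) X = 𝟙 _
  perm_trans {L M N : FinSet} (d : L ≃ M) (e : M ≃ N) (X : N → PtdSpace) :
    perm (d.trans e) X = perm e X ≫ perm d (fun m => X (e m))

namespace SymmFunctor

/-- Morphisms: families of natural transformations that respect the symmetries. -/
@[ext] structure Hom (F G : SymmFunctor) where
  app (N : FinSet) : F.obj N ⟶ G.obj N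
  equivariant {M N : FinSet} (e : M ≃ N) (X : N → PtdSpace) :
    (app N).app X ≫ G.perm e X = F.perm e X ≫ (app M).app (fun m => X (e m))

instance : Category SymmFunctor where
  Hom := Hom
  id F := ⟨fun N => 𝟙 _, fun e X => by simp⟩
  comp f g := ⟨fun N => f.app N ≫ g.app N, fun e X => by
    simp only [NatTrans.comp_app, Category.assoc]
    rw [g.equivariant, ← Category.assoc, f.equivariant, Category.assoc]⟩

@[ext] theorem hom_ext {F G : SymmFunctor} {f g : F ⟶ G}
    (h : ∀ N X, (f.app N).app X = (g.app N).app X) : f = g :=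
  Hom.ext (funext fun N => NatTrans.ext (funext fun X => h N X))

@[simp] theorem id_app (F : SymmFunctor) (N : FinSet) : Hom.app (𝟙 F) N = 𝟙 _ := rfl
@[simp] theorem comp_app {F G H : SymmFunctor} (f : F ⟶ G) (g : G ⟶ H) (N : FinSet) :
    Hom.app (f ≫ g) N = Hom.app f N ≫ Hom.app g N := rfl

variable (G F : SymmFunctor)

/-- Functoriality in the index set and the variables at once. -/
def transport {K K' : FinSet} (c : K' ≃ K) {Y : K → PtdSpace} {Y' : K' → PtdSpace}
    (h : ∀ k, Y (c k) ⟶ Y' k) : (G.obj K).obj Y ⟶ (G.obj K').obj Y' :=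
  G.perm c Y ≫ (G.obj K').map h

theorem transport_comp {K K' K'' : FinSet} (c : K' ≃ K) (c' : K'' ≃ K') {Y : K → PtdSpace}
    {Y' : K' → PtdSpace} {Y'' : K'' → PtdSpace} (h : ∀ k, Y (c k) ⟶ Y' k)
    (h' : ∀ k, Y' (c' k) ⟶ Y'' k) :
    G.transport c h ≫ G.transport c' h' =
      G.transport (c'.trans c) (fun k => h (c' k) ≫ h' k) := by
  refine PtdSpace.hom_ext fun x => ?_
  have h₁ := congrArg (fun k : (G.obj K').obj (fun k => Y (c k)) ⟶ _ => k (G.perm c Y x))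
    (G.perm_natural c' (X := fun k => Y (c k)) (Y := Y') h)
  have h₂ := congrArg (fun k : (G.obj K).obj Y ⟶ _ => k x) (G.perm_trans c' c Y)
  have h₃ := congrArg (fun k => PtdSpace.Hom.toFun k (G.perm c' _ (G.perm c Y x)))
    ((G.obj K'').map_comp (fun k => h (c' k)) h')
  exact (congrArg ((G.obj K'').map h') h₁).trans
    (h₃.symm.trans (congrArg ((G.obj K'').map fun k => h (c' k) ≫ h' k) h₂.symm))

theorem transport_refl {K : FinSet} {Y Y' : K → PtdSpace} (h : ∀ k, Y k ⟶ Y' k) :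
    G.transport (Equiv.refl K) (Y := Y) (Y' := Y') h = (G.obj K).map h := by
  simp only [transport]
  erw [G.perm_refl, Category.id_comp]
  rfl

/-- The term `G_K(F_{N_1}, …, F_{N_k})` for a partition `p` of `N` into blocks `N_i`. -/
def summand {N K : FinSet} (p : Surj N K) (X : N → PtdSpace) : PtdSpace :=
  (G.obj K).obj (fun k => (F.obj (p.fib k)).obj (fun n => X n.1))

/-- Bijections of partitions act on the terms of the composition. -/
def sqMap {N K N' K' : FinSet} (p' : Surj N' K') (p : Surj N K) (e : N' ≃ N) (c : K' ≃ K)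
    (h : ∀ n, p (e n) = c (p' n)) (X : N → PtdSpace) :
    summand G F p X ⟶ summand G F p' (fun n => X (e n)) :=
  G.transport c (fun k => F.perm (Surj.fibEquiv p' p e c h k) _)

theorem sqMap_refl {N K : FinSet} (p : Surj N K) (c : K ≃ K) (h : ∀ n, p n = c (p n))
    (X : N → PtdSpace) : sqMap G F p p (Equiv.refl N) c h X = 𝟙 _ := by
  obtain rfl : c = Equiv.refl K :=
    Equiv.ext fun k => by obtain ⟨n, rfl⟩ := p.surj k; exact (h n).symm
  have : ∀ k, F.perm (Surj.fibEquiv p p (Equiv.refl N) (Equiv.refl K) h k)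
      (fun n => X n.1) = 𝟙 _ := fun k => F.perm_refl _ _
  refine (G.transport_refl _).trans ?_
  refine Eq.trans ?_ ((G.obj K).map_id _)
  congr 1
  funext k
  exact this k

theorem sqMap_trans {N K N' K' N'' K'' : FinSet} (p'' : Surj N'' K'') (p' : Surj N' K')
    (p : Surj N K) (d : N'' ≃ N') (e : N' ≃ N) (b : K'' ≃ K') (c : K' ≃ K) (a : K'' ≃ K)
    (h : ∀ n, p (e n) = c (p' n)) (h' : ∀ n, p' (d n) = b (p'' n))
    (h'' : ∀ n, p (e (d n)) = a (p'' n)) (X : N → PtdSpace) :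
    sqMap G F p'' p (d.trans e) a h'' X =
      sqMap G F p' p e c h X ≫ sqMap G F p'' p' d b h' (fun n => X (e n)) := by
  obtain rfl : a = b.trans c := Equiv.ext fun k => by
    obtain ⟨n, rfl⟩ := p''.surj k
    rw [← h'', h, h']; rfl
  refine Eq.trans ?_ (G.transport_comp _ _ _ _).symm
  refine congrArg (G.transport (b.trans c)) (funext fun k => ?_)
  exact F.perm_trans (Surj.fibEquiv p'' p' d b h' k) (Surj.fibEquiv p' p e c h (b k)) _

/-- Functoriality of the terms of the composition in the variables. -/
def summandMap {N K : FinSet} (p : Surj N K) {X Y : N → PtdSpace} (f : ∀ n, X n ⟶ Y n) :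
    summand G F p X ⟶ summand G F p Y :=
  (G.obj K).map (fun k => (F.obj (p.fib k)).map (fun n => f n.1))

theorem summandMap_id {N K : FinSet} (p : Surj N K) (X : N → PtdSpace) :
    summandMap G F p (fun n => 𝟙 (X n)) = 𝟙 _ :=
  (congrArg (G.obj K).map (funext fun k => (F.obj (p.fib k)).map_id _)).trans ((G.obj K).map_id _)

theorem summandMap_comp {N K : FinSet} (p : Surj N K) {X Y Z : N → PtdSpace}
    (f : ∀ n, X n ⟶ Y n) (g : ∀ n, Y n ⟶ Z n) :
    summandMap G F p (fun n => f n ≫ g n) = summandMap G F p f ≫ summandMap G F p g :=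
  (congrArg (G.obj K).map (funext fun k => (F.obj (p.fib k)).map_comp _ _)).trans
    ((G.obj K).map_comp _ _)

theorem sqMap_natural {N K N' K' : FinSet} (p' : Surj N' K') (p : Surj N K) (e : N' ≃ N)
    (c : K' ≃ K) (h : ∀ n, p (e n) = c (p' n)) {X Y : N → PtdSpace} (f : ∀ n, X n ⟶ Y n) :
    summandMap G F p f ≫ sqMap G F p' p e c h Y =
      sqMap G F p' p e c h X ≫ summandMap G F p' (fun n => f (e n)) := by
  have h₁ : summandMap G F p f = G.transport (Equiv.refl K) (fun k =>
    (F.obj (p.fib k)).map (fun n => f n.1)) := (G.transport_refl _).symm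
  have h₂ : summandMap G F p' (fun n => f (e n)) = G.transport (Equiv.refl K') (fun k =>
    (F.obj (p'.fib k)).map (fun n => f (e n.1))) := (G.transport_refl _).symm
  rw [h₁, h₂]
  refine (G.transport_comp _ _ _ _).trans (Eq.trans ?_ (G.transport_comp _ _ _ _).symm)
  exact congrArg (G.transport c) (funext fun k =>
    F.perm_natural (Surj.fibEquiv p' p e c h k) (fun n => f n.1))

/-- The composition of symmetric functor sequences: `(G ∘ F)_N` is the wedge of the functors
`G_k(F_{N_1}, …, F_{N_k})` over all unordered partitions of `N` into nonempty blocks. -/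
def comp : SymmFunctor where
  obj N :=
    { obj X := Wedge fun π : Setoid N => summand G F (FinSet.proj π) X
      map f := Wedge.map fun π => summandMap G F (FinSet.proj π) f
      map_id X := Wedge.hom_ext fun π =>
        congrArg (fun k => k ≫ Wedge.incl (fun π : Setoid N => summand G F (FinSet.proj π) X) π)
          (summandMap_id G F (FinSet.proj π) X)
      map_comp {_ _ Z} f g := Wedge.hom_ext fun π =>
        congrArg (fun k => k ≫ Wedge.incl (fun π : Setoid N => summand G F (FinSet.proj π) Z) π)
          (summandMap_comp G F (FinSet.proj π) f g) }
  perm {M _} e X := Wedge.desc fun π =>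
    sqMap G F (FinSet.proj (π.comap e)) (FinSet.proj π) e (FinSet.quotEquiv e π)
      (fun _ => rfl) X ≫
    Wedge.incl (fun π : Setoid M => summand G F (FinSet.proj π) fun m => X (e m)) (π.comap e)
  perm_natural {M _} e _ Y f := Wedge.hom_ext fun π =>
    congrArg (fun k => k ≫ Wedge.incl (fun π : Setoid M => summand G F (FinSet.proj π)
      fun m => Y (e m)) (π.comap e)) (sqMap_natural G F (FinSet.proj (π.comap e))
        (FinSet.proj π) e (FinSet.quotEquiv e π) (fun _ => rfl) f)
  perm_refl N X := Wedge.hom_ext fun π =>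
    congrArg (fun k => k ≫ Wedge.incl (fun π : Setoid N => summand G F (FinSet.proj π) X) π)
      (sqMap_refl G F (FinSet.proj π) (FinSet.quotEquiv (Equiv.refl N) π)
        (fun n => (rfl : FinSet.proj π n = FinSet.quotEquiv (Equiv.refl N) π (Quotient.mk π n))) X)
  perm_trans {L _ _} d e X := Wedge.hom_ext fun π =>
    congrArg (fun k => k ≫ Wedge.incl (fun π : Setoid L => summand G F (FinSet.proj π)
      fun l => X (e (d l))) (π.comap (d.trans e)))
      (sqMap_trans G F (FinSet.proj (π.comap (d.trans e)))
        (FinSet.proj (π.comap e)) (FinSet.proj π) d e (FinSet.quotEquiv d (π.comap e))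
        (FinSet.quotEquiv e π) (FinSet.quotEquiv (d.trans e) π) (fun _ => rfl) (fun _ => rfl)
        (fun _ => rfl) X)

/-- The inclusion into `(G ∘ F)_N` of the term of a labelled partition `p : N ↠ K`. -/
noncomputable def compIncl {N K : FinSet} (p : Surj N K) (X : N → PtdSpace) :
    summand G F p X ⟶ ((comp G F).obj N).obj X :=
  sqMap G F (FinSet.proj (Setoid.ker p)) p (Equiv.refl N) p.kerEquiv (fun _ => rfl) X ≫
    Wedge.incl (fun π : Setoid N => summand G F (FinSet.proj π) X) (Setoid.ker p)

variable {G F}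

/-- Functoriality of the terms of the composition in `G` and `F`. -/
def summandHom {G' F' : SymmFunctor} (g : G ⟶ G') (f : F ⟶ F') {N K : FinSet} (p : Surj N K)
    (X : N → PtdSpace) : summand G F p X ⟶ summand G' F' p X :=
  (g.app K).app _ ≫ (G'.obj K).map (fun k => (f.app (p.fib k)).app _)

theorem transport_hom {G' : SymmFunctor} (g : G ⟶ G') {K K' : FinSet} (c : K' ≃ K)
    {Y : K → PtdSpace} {Y' : K' → PtdSpace} (h : ∀ k, Y (c k) ⟶ Y' k) :
    (g.app K).app Y ≫ G'.transport c h = G.transport c h ≫ (g.app K').app Y' := by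
  simp only [transport, Category.assoc]
  rw [(g.app K').naturality, ← Category.assoc, ← Category.assoc, g.equivariant]

theorem summandHom_natural {G' F' : SymmFunctor} (g : G ⟶ G') (f : F ⟶ F') {N K : FinSet}
    (p : Surj N K) {X Y : N → PtdSpace} (h : ∀ n, X n ⟶ Y n) :
    summandMap G F p h ≫ summandHom g f p Y = summandHom g f p X ≫ summandMap G' F' p h := by
  refine (congrArg (fun k => k ≫ (G'.obj K).map fun k => (f.app (p.fib k)).app fun n => Y n.1)
    ((g.app K).naturality fun k => (F.obj (p.fib k)).map fun n => h n.1)).trans ?_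
  refine congrArg (fun k => (g.app K).app (fun k => (F.obj (p.fib k)).obj fun n => X n.1) ≫ k)
    (((G'.obj K).map_comp _ _).symm.trans (Eq.trans ?_ ((G'.obj K).map_comp _ _)))
  exact congrArg (G'.obj K).map (funext fun k => (f.app (p.fib k)).naturality fun n => h n.1)

theorem summandHom_equivariant {G' F' : SymmFunctor} (g : G ⟶ G') (f : F ⟶ F')
    {N K N' K' : FinSet} (p' : Surj N' K') (p : Surj N K) (e : N' ≃ N) (c : K' ≃ K)
    (h : ∀ n, p (e n) = c (p' n)) (X : N → PtdSpace) :
    summandHom g f p X ≫ sqMap G' F' p' p e c h X =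
      sqMap G F p' p e c h X ≫ summandHom g f p' (fun n => X (e n)) := by
  have h₁ : summandHom g f p X = (g.app K).app _ ≫ G'.transport (Equiv.refl K) (fun k =>
    (f.app (p.fib k)).app fun n => X n.1) := congrArg _ (G'.transport_refl _).symm
  have h₂ : summandHom g f p' (fun n => X (e n)) = (g.app K').app _ ≫
    G'.transport (Equiv.refl K') (fun k => (f.app (p'.fib k)).app fun n => X (e n.1)) :=
      congrArg _ (G'.transport_refl _).symm
  have h₃ := transport_hom g c (Y := fun k => (F.obj (p.fib k)).obj fun n => X n.1)
    (Y' := fun k => (F.obj (p'.fib k)).obj fun n => X (e n.1)) (fun k => F.perm (Surj.fibEquiv p' p e c h k) fun n => X n.1)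
  rw [h₁, h₂]
  refine Eq.trans ?_ (congrArg (fun j => j ≫ G'.transport (Equiv.refl K') (fun k =>
    (f.app (p'.fib k)).app fun n => X (e n.1))) h₃)
  have h₄ : G'.transport (Equiv.refl K) (fun k => (f.app (p.fib k)).app fun n => X n.1) ≫
      sqMap G' F' p' p e c h X =
      G'.transport c (Y := fun k => (F.obj (p.fib k)).obj fun n => X n.1)
        (Y' := fun k => (F.obj (p'.fib k)).obj fun n => X (e n.1))
        (fun k => F.perm (Surj.fibEquiv p' p e c h k) fun n => X n.1) ≫
      G'.transport (Equiv.refl K') (fun k => (f.app (p'.fib k)).app fun n => X (e n.1)) := by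
    refine (G'.transport_comp _ _ _ _).trans (Eq.trans ?_ (G'.transport_comp _ _ _ _).symm)
    exact congrArg (G'.transport c) (funext fun k => f.equivariant (Surj.fibEquiv p' p e c h k) _)
  exact congrArg (fun k => (g.app K).app (fun k => (F.obj (p.fib k)).obj fun n => X n.1) ≫ k) h₄

theorem summandHom_id {N K : FinSet} (p : Surj N K) (X : N → PtdSpace) :
    summandHom (𝟙 G) (𝟙 F) p X = 𝟙 _ := (G.obj K).map_id _

theorem summandHom_comp {G' G'' F' F'' : SymmFunctor} (g : G ⟶ G') (f : F ⟶ F') (g' : G' ⟶ G'')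
    (f' : F' ⟶ F'') {N K : FinSet} (p : Surj N K) (X : N → PtdSpace) :
    summandHom (g ≫ g') (f ≫ f') p X = summandHom g f p X ≫ summandHom g' f' p X := by
  refine (congrArg (fun k => ((g ≫ g').app K).app _ ≫ k) ((G''.obj K).map_comp
    (fun k => (f.app (p.fib k)).app fun n => X n.1)
    (fun k => (f'.app (p.fib k)).app fun n => X n.1))).trans ?_
  exact congrArg (fun k => (g.app K).app _ ≫ k ≫ (G''.obj K).map fun k =>
    (f'.app (p.fib k)).app fun n => X n.1) ((g'.app K).naturality fun k =>
      (f.app (p.fib k)).app fun n => X n.1).symm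

/-- Functoriality of the composition in both factors. -/
def compHom {G' F' : SymmFunctor} (g : G ⟶ G') (f : F ⟶ F') : comp G F ⟶ comp G' F' where
  app N :=
    { app X := Wedge.map fun π => summandHom g f (FinSet.proj π) X
      naturality _ Y h := Wedge.hom_ext fun π =>
        congrArg (fun k => k ≫ Wedge.incl (fun π : Setoid N => summand G' F' (FinSet.proj π) Y) π)
          (summandHom_natural g f (FinSet.proj π) h) }
  equivariant {M _} e X := Wedge.hom_ext fun π =>
    congrArg (fun k => k ≫ Wedge.incl (fun π : Setoid M => summand G' F' (FinSet.proj π)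
      fun m => X (e m)) (π.comap e))
      (summandHom_equivariant g f (FinSet.proj (π.comap e)) (FinSet.proj π) e
        (FinSet.quotEquiv e π) (fun _ => rfl) X)

theorem compHom_id : compHom (𝟙 G) (𝟙 F) = 𝟙 (comp G F) :=
  hom_ext fun N X => Wedge.hom_ext fun π =>
    congrArg (fun k => k ≫ Wedge.incl (fun π : Setoid N => summand G F (FinSet.proj π) X) π)
      (summandHom_id (FinSet.proj π) X)

theorem compHom_comp {G' G'' F' F'' : SymmFunctor} (g : G ⟶ G') (f : F ⟶ F') (g' : G' ⟶ G'')
    (f' : F' ⟶ F'') : compHom (g ≫ g') (f ≫ f') = compHom g f ≫ compHom g' f' :=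
  hom_ext fun N X => Wedge.hom_ext fun π =>
    congrArg (fun k => k ≫ Wedge.incl (fun π : Setoid N => summand G'' F'' (FinSet.proj π) X) π)
      (summandHom_comp g f g' f' (FinSet.proj π) X)

/-- The unit for the composition: the identity functor of one variable in degree `1`, and the
one-point space in all other degrees. -/
def unit : SymmFunctor where
  obj N :=
    { obj X := Wedge fun i : {_n : N // Subsingleton N} => X i.1
      map f := Wedge.map fun i => f i.1
      map_id X := Wedge.hom_ext fun i => rfl
      map_comp f g := Wedge.hom_ext fun i => rfl }
  perm {M N} e X := Wedge.desc fun i =>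
    eqToHom (by simp) ≫ Wedge.incl (fun i : {_m : M // Subsingleton M} => X (e i.1))
      ⟨e.symm i.1, @Equiv.subsingleton _ _ e i.2⟩
  perm_natural {M N} e X Y f := Wedge.hom_ext fun i => by
    have : ∀ (n n' : N) (h : n = n'), f n ≫ eqToHom (congrArg Y h) =
        eqToHom (congrArg X h) ≫ f n' := by rintro n _ rfl; simp
    have := this i.1 (e (e.symm i.1)) (by simp)
    simp only [Wedge.map, Wedge.incl_desc, Wedge.incl_desc_assoc, Category.assoc]
    rw [← Category.assoc, this, Category.assoc]
  perm_refl N X := Wedge.hom_ext fun i => rfl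
  perm_trans {L M N} d e X := Wedge.hom_ext fun i => by
    have : ∀ (A B C : PtdSpace) (h : A = B) (h' : B = C),
        eqToHom (h.trans h') = eqToHom h ≫ eqToHom h' := by rintro A _ _ rfl rfl; rfl
    exact congrArg (fun k => k ≫ Wedge.incl (fun i : {_l : L // Subsingleton L} =>
      X (e (d i.1))) ⟨(d.trans e).symm i.1, @Equiv.subsingleton _ _ (d.trans e) i.2⟩)
      (this _ _ _ (congrArg X (e.apply_symm_apply i.1).symm)
        (congrArg (fun m => X (e m)) (d.apply_symm_apply (e.symm i.1)).symm))

end SymmFunctor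

/-- A multipointed continuous symmetric functor sequence of pointed spaces. -/
structure SymmFun extends SymmFunctor where
  /-- If one of the variables is a one-point space, so is the value. -/
  pointed (N : FinSet) (X : N → PtdSpace) (n : N) (h : Subsingleton (X n)) :
    Subsingleton ((obj N).obj X)
  /-- The action on (k-ified) mapping spaces is continuous. -/
  continuous (N : FinSet) (X Y : N → PtdSpace) :
    ContinuousGeneratedBy cptHaus
      (fun f : ∀ n, X n ⟶ Y n => ((obj N).map f : (obj N).obj X ⟶ (obj N).obj Y))

namespace SymmFun

/-- Morphisms of multipointed continuous symmetric functor sequences. -/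
instance : Category SymmFun where
  Hom F G := F.toSymmFunctor ⟶ G.toSymmFunctor
  id F := 𝟙 F.toSymmFunctor
  comp f g := SymmFunctor.Hom.mk (fun N => f.app N ≫ g.app N)
    (CategoryStruct.comp (obj := SymmFunctor) f g).equivariant
  id_comp f := Category.id_comp (obj := SymmFunctor) f
  comp_id f := Category.comp_id (obj := SymmFunctor) f
  assoc f g h := Category.assoc (obj := SymmFunctor) f g h

/-- The composition `G ∘ F`. -/
def comp (G F : SymmFun) : SymmFun where
  toSymmFunctor := SymmFunctor.comp G.toSymmFunctor F.toSymmFunctor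
  pointed N X n h := Wedge.subsingleton fun π =>
    G.pointed _ _ (Quotient.mk π n) (F.pointed _ _ ⟨n, rfl⟩ h)
  continuous N X Y := fun S f => by
    have : ∀ π : Setoid N, Continuous fun s : cptHaus S => SymmFunctor.summandMap G.toSymmFunctor
        F.toSymmFunctor (FinSet.proj π) (f s) := fun π => by
      have h₁ : ∀ k, Continuous fun s : cptHaus S =>
          ((F.obj ((FinSet.proj π).fib k)).map fun n => f s n.1 :
            (F.obj ((FinSet.proj π).fib k)).obj (fun n => X n.1) ⟶
              (F.obj ((FinSet.proj π).fib k)).obj (fun n => Y n.1)) := fun k =>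
        F.continuous ((FinSet.proj π).fib k) (fun n => X n.1) (fun n => Y n.1)
          (i := S) ⟨fun s n => f s n.1, by
            exact continuous_pi fun n => (continuous_apply n.1).comp f.continuous⟩
      exact G.continuous (FinSet.quot π) _ _ (i := S) ⟨_, continuous_pi h₁⟩
    exact Wedge.continuous_desc _ fun π => PtdSpace.continuous_postcomp _ (this π) _

/-- The unit for the composition. -/
def unit : SymmFun where
  toSymmFunctor := SymmFunctor.unit
  pointed N X n h := Wedge.subsingleton fun i => by
    obtain rfl : n = i.1 := @Subsingleton.elim _ i.2 _ _
    exact h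
  continuous N X Y := fun S f => Wedge.continuous_desc _ fun i : {_n : N // Subsingleton N} =>
    PtdSpace.continuous_postcomp _ ((continuous_apply (A := fun n => X n ⟶ Y n) i.1).comp f.continuous) _

/-- The composition as a functor in both factors. -/
def compFunctor : SymmFun × SymmFun ⥤ SymmFun where
  obj P := comp P.1 P.2
  map f := SymmFunctor.compHom f.1 f.2
  map_id _ := SymmFunctor.compHom_id
  map_comp f g := SymmFunctor.compHom_comp f.1 f.2 g.1 g.2

/-- The map of mapping spaces induced by `F`: a family of maps `X_n → Y_n` parametrized by `Z` is
sent to the corresponding family of maps `F(X) → F(Y)`. For the family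
`Z → Map(X_n, Z ∧ X_n)` this is the adjoint of the assembly map `Z ∧ F(X) → F(Z ∧ X)`. -/
def assemble (F : SymmFun) {N : FinSet} {Z : PtdSpace} {X Y : N → PtdSpace}
    (ψ : ∀ n, Z ⟶ PtdSpace.mapSpace (X n) (Y n)) :
    Z ⟶ PtdSpace.mapSpace ((F.obj N).obj X) ((F.obj N).obj Y) where
  toFun x := PtdSpace.mapSpace.ofHom ((F.obj N).map fun n => PtdSpace.mapSpace.toHom (ψ n x))
  cont := PtdSpace.continuous_ofHom (PtdSpace.continuous_of_tests _ fun S f =>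
    F.continuous N X Y (i := S) ⟨fun s n => PtdSpace.mapSpace.toHom (ψ n (f s)), continuous_pi fun n =>
      PtdSpace.continuous_toHom.comp ((ψ n).cont.comp f.continuous)⟩)
  map_pt := congrArg PtdSpace.mapSpace.ofHom (by
    obtain ⟨n₀⟩ := N.ne
    classical
    let P : N → PtdSpace := Function.update X n₀ ⟨Unit, ()⟩
    have hP : Subsingleton ((F.obj N).obj P) := F.pointed N P n₀ (by
      simp only [P, Function.update_self]; exact inferInstanceAs (Subsingleton Unit))
    have hz : (fun n => PtdSpace.mapSpace.toHom (ψ n Z.pt) : ∀ n, X n ⟶ Y n) =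
        fun n => (PtdSpace.zeroHom (X n) (P n)) ≫ PtdSpace.zeroHom (P n) (Y n) :=
      funext fun n => by rw [(ψ n).map_pt]; rfl
    have hc := (F.obj N).map_comp (X := X) (Y := P) (Z := Y)
      (fun n => PtdSpace.zeroHom (X n) (P n)) (fun n => PtdSpace.zeroHom (P n) (Y n))
    refine PtdSpace.hom_ext fun x => ?_
    rw [hz]
    refine (congrArg (fun k : (F.obj N).obj X ⟶ (F.obj N).obj Y => k x) hc).trans ?_
    refine (congrArg ((F.obj N).map fun n => PtdSpace.zeroHom (P n) (Y n))
      (Subsingleton.elim _ ((F.obj N).obj P).pt)).trans ?_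
    exact PtdSpace.Hom.map_pt _)

/-- The inclusion into `(G ∘ F)_N` of `G_K(F_{p⁻¹(k)})` for a partition `p : N ↠ K`. -/
noncomputable def incl (G F : SymmFun) {N K : FinSet} (p : Surj N K) (X : N → PtdSpace) :
    (G.obj K).obj (fun k => (F.obj (p.fib k)).obj fun n => X n.1) ⟶ ((comp G F).obj N).obj X :=
  SymmFunctor.compIncl G.toSymmFunctor F.toSymmFunctor p X

end SymmFun

/-- Evaluation of a mapping space at a point. -/
def PtdSpace.evalAt {X Y : PtdSpace} (x : X) : PtdSpace.mapSpace X Y ⟶ Y where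
  toFun f := PtdSpace.mapSpace.toHom f x
  cont := PtdSpace.continuous_of_tests _ fun S f =>
    (PtdSpace.joint_of_continuous_hom _ (PtdSpace.continuous_toHom.comp f.continuous)).comp
      (Continuous.prodMk_left x)
  map_pt := rfl

/-! ### Symmetric sequences and the composition product -/

/-- Symmetric sequences of pointed spaces, indexed by nonempty finite sets. -/
abbrev SymmSeq : Type 1 := FinSet ⥤ PtdSpace

instance (P : Prop) : IsCG {_u : Unit // P} := isCG_of_compact _

/-- The `0`-sphere if `P` holds, and a point otherwise. -/
def zeroSphereIf (P : Prop) : PtdSpace :=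
  PQuot {_u : Unit // P} (fun _ _ => False) (fun _ => False)

/-- The `0`-sphere. -/
abbrev zeroSphere : PtdSpace := zeroSphereIf True

namespace SymmSeq

/-- `A ∧ Y_1 ∧ ⋯ ∧ Y_k`, as a quotient of the product in compactly generated spaces. -/
def smash {κ : Type} (A : PtdSpace) (Y : κ → PtdSpace) : PtdSpace :=
  PQuot (Kify (A × ∀ k, Y k)) (fun _ _ => False) fun e =>
    (WithGeneratedByTopology.equiv (X := cptHaus) e).1 = A.pt ∨
      ∃ k, (WithGeneratedByTopology.equiv (X := cptHaus) e).2 k = (Y k).pt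

/-- The class of a tuple in the smash product. -/
def smash.mk {κ : Type} {A : PtdSpace} {Y : κ → PtdSpace} (a : A) (y : ∀ k, Y k) : smash A Y :=
  PQuot.mk ((WithGeneratedByTopology.equiv (X := cptHaus)).symm (a, y))

/-- Functoriality of the smash product, including relabellings of the factors. -/
def smash.map {κ κ' : Type} {A A' : PtdSpace} {Y : κ → PtdSpace} {Y' : κ' → PtdSpace}
    (a : A ⟶ A') (c : κ' ≃ κ) (f : ∀ k, Y (c k) ⟶ Y' k) : smash A Y ⟶ smash A' Y' :=
  PQuot.desc (fun e => smash.mk (a (WithGeneratedByTopology.equiv (X := cptHaus) e).1)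
      (fun k => f k ((WithGeneratedByTopology.equiv (X := cptHaus) e).2 (c k))))
    (PQuot.continuous_mk.comp ((IsGeneratedBy.equiv_symm_comp_continuous_iff
      (X := cptHaus) _).2
      ((a.cont.comp (continuous_fst.comp WithGeneratedByTopology.continuous_equiv)).prodMk
        (continuous_pi fun k => (f k).cont.comp ((continuous_apply (c k)).comp
          (continuous_snd.comp WithGeneratedByTopology.continuous_equiv))))))
    (fun _ _ h => h.elim)
    (by
      rintro e (h | ⟨k, h⟩)
      · exact PQuot.mk_base (Or.inl ((congrArg a h).trans a.map_pt))
      · refine PQuot.mk_base (Or.inr ⟨c.symm k, ?_⟩)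
        have : ∀ k', k' = k → (WithGeneratedByTopology.equiv (X := cptHaus) e).2 k' =
          (Y k').pt := by rintro _ rfl; exact h
        exact (congrArg (f _) (this _ (c.apply_symm_apply k))).trans (f _).map_pt)

theorem smash.hom_ext {κ : Type} {A : PtdSpace} {Y : κ → PtdSpace} {Z : PtdSpace}
    {f g : smash A Y ⟶ Z} (h : ∀ a y, f (smash.mk a y) = g (smash.mk a y)) : f = g :=
  PQuot.hom_ext fun e => h (WithGeneratedByTopology.equiv (X := cptHaus) e).1
    (WithGeneratedByTopology.equiv (X := cptHaus) e).2

/-- The symmetric functor sequence `Y ↦ A(k) ∧ Y_1 ∧ ⋯ ∧ Y_k` of a symmetric sequence `A`. -/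
def toFunctor (A : SymmSeq) : SymmFunctor where
  obj K :=
    { obj Y := smash (A.obj K) Y
      map f := smash.map (𝟙 _) (Equiv.refl _) f
      map_id Y := smash.hom_ext fun a y => rfl
      map_comp f g := smash.hom_ext fun a y => rfl }
  perm {M N} e X := smash.map (A.map (X := N) (Y := M) e.symm) e (fun m => 𝟙 (X (e m)))
  perm_natural e X Y f := smash.hom_ext fun a y => rfl
  perm_refl N X := smash.hom_ext fun a y =>
    congrArg (fun k : A.obj N ⟶ A.obj N => (smash.mk (k a) y : smash (A.obj N) X)) (A.map_id N)
  perm_trans {L M N} d e X := smash.hom_ext fun a y =>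
    congrArg (fun k : A.obj N ⟶ A.obj L =>
        (smash.mk (k a) (fun l => y (e (d l))) : smash (A.obj L) fun l => X (e (d l))))
      (A.map_comp (X := N) (Y := M) (Z := L) e.symm d.symm)

/-- A symmetric sequence as a symmetric functor sequence that ignores its variables. -/
def constFunctor (B : SymmSeq) : SymmFunctor where
  obj K := (Functor.const _).obj (B.obj K)
  perm {M N} e X := B.map (X := N) (Y := M) e.symm
  perm_natural e X Y f := rfl
  perm_refl N X := B.map_id N
  perm_trans {L M N} d e X := B.map_comp (X := N) (Y := M) (Z := L) e.symm d.symm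

end SymmSeq

/-- The symmetric sequence of values of a symmetric functor sequence on constant families. -/
def SymmFunctor.eval (F : SymmFunctor) (X : PtdSpace) : SymmSeq where
  obj N := (F.obj N).obj fun _ => X
  map {N M} e := F.perm (Equiv.symm e : M ≃ N) fun _ => X
  map_id N := F.perm_refl N _
  map_comp {N M L} e f := F.perm_trans (Equiv.symm f : L ≃ M) (Equiv.symm e : M ≃ N) _

namespace SymmSeq

/-- The composition product: `(A ∘ B)(N)` is the wedge over all unordered partitions `π` of `N`
into nonempty blocks of the smash product of `A(N / π)` and the `B(q)` for all blocks `q`. -/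
def comp (A B : SymmSeq) : SymmSeq :=
  (SymmFunctor.comp A.toFunctor B.constFunctor).eval zeroSphere

theorem comp_obj (A B : SymmSeq) (N : FinSet) :
    (comp A B).obj N = Wedge fun π : Setoid N =>
      smash (A.obj (FinSet.quot π)) fun q => B.obj ((FinSet.proj π).fib q) := rfl

/-- Functoriality of the composition product in both factors. -/
def compHom {A A' B B' : SymmSeq} (a : A ⟶ A') (b : B ⟶ B') : comp A B ⟶ comp A' B' :=
  let a' : A.toFunctor ⟶ A'.toFunctor := SymmFunctor.Hom.mk
    (fun N =>
      { app Y := smash.map (a.app N) (Equiv.refl _) fun n => 𝟙 (Y n)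
        naturality X Y f := smash.hom_ext fun x y => rfl })
    (fun {M N} e X => smash.hom_ext fun x y =>
      congrArg (fun k : A.obj N ⟶ A'.obj M =>
        (smash.mk (k x) (fun m => y (e m)) : smash (A'.obj M) fun m => X (e m)))
        (a.naturality (X := N) (Y := M) e.symm).symm)
  let b' : B.constFunctor ⟶ B'.constFunctor := SymmFunctor.Hom.mk
    (fun N => { app Y := b.app N, naturality X Y f := rfl })
    (fun {M N} e X => (b.naturality (X := N) (Y := M) e.symm).symm)
  { app N := ((SymmFunctor.compHom a' b').app N).app fun _ => zeroSphere
    naturality N M e := ((SymmFunctor.compHom a' b').equivariant (M := M) (N := N)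
      (Equiv.symm e) _).symm }

/-- The composition product as a functor in both factors. -/
def compFunctor : SymmSeq × SymmSeq ⥤ SymmSeq where
  obj P := comp P.1 P.2
  map f := compHom f.1 f.2
  map_id P := NatTrans.ext (funext fun N => Wedge.hom_ext fun π => smash.hom_ext fun a y => rfl)
  map_comp f g :=
    NatTrans.ext (funext fun N => Wedge.hom_ext fun π => smash.hom_ext fun a y => rfl)

/-- The unit for the composition product: `S^0` in degree `1` and a point in all other degrees. -/
def unit : SymmSeq where
  obj N := zeroSphereIf (Subsingleton N)
  map {N M} e :=
      PQuot.desc (fun u : {_u : Unit // Subsingleton N} => PQuot.mk ⟨(), @Equiv.subsingleton _ _ (Equiv.symm e : M ≃ N) u.2⟩)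
      (PQuot.continuous_mk.comp continuous_of_discreteTopology)
      (fun _ _ h => h.elim) (fun _ h => h.elim)
  map_id N := PQuot.hom_ext fun u => rfl
  map_comp e f := PQuot.hom_ext fun u => rfl

/-- The point of `S^0` different from the base point, in degree `1` of the unit. -/
def unitPoint {N : FinSet} (h : Subsingleton N) : unit.obj N :=
  PQuot.mk ⟨(), h⟩

/-- The point of `(A ∘ B)(N)` given by a partition `p : N ↠ K`, a point `a` of `A(K)` and a point
of `B(p⁻¹(k))` for every `k`. -/
noncomputable def compMk {A B : SymmSeq} {N K : FinSet} (p : Surj N K) (a : A.obj K)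
    (b : ∀ k, B.obj (p.fib k)) : (comp A B).obj N :=
  (SymmFunctor.compIncl A.toFunctor B.constFunctor p fun _ => zeroSphere) (smash.mk a b)

end SymmSeq

/-! ### Spheres -/

/-- The positive real numbers, whose one-point compactification is `S^1`. -/
abbrev PosReal : Type := {x : ℝ // 0 < x}

/-- The circle. -/
abbrev Circ : Type := OnePoint PosReal

instance : LocallyCompactSpace PosReal := (isOpen_lt continuous_const continuous_id).locallyCompactSpace

instance (U : Type) : IsCG (U → Circ) := isCG_of_compact _

/-- The sphere `S^U`: the smash product of `U` copies of `S^1`; it is `S^0` for empty `U`. -/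
def Sphere (U : Type) : PtdSpace := PQuot (U → Circ) (fun _ _ => False) fun x => ∃ u, x u = OnePoint.infty

namespace Sphere

/-- The class of a tuple of points of `S^1`. -/
def mk {U : Type} (x : U → Circ) : Sphere U := PQuot.mk x

/-- The point of `S^U` with finite coordinates. -/
def fin {U : Type} (x : U → PosReal) : Sphere U := mk fun u => (x u : Circ)

/-- Relabelling of the coordinates. -/
def relabel {A B : Type} (c : A ≃ B) : Sphere A ⟶ Sphere B :=
  PQuot.desc (fun x => mk fun b => x (c.symm b))
    (PQuot.continuous_mk.comp (continuous_pi fun b => continuous_apply _))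
    (fun _ _ h => h.elim)
    (fun x ⟨a, h⟩ => PQuot.mk_base ⟨c a, (congrArg x (c.symm_apply_apply a)).trans h⟩)

theorem continuous_extend {A B : Type} (φ : A ↪ B) :
    Continuous fun p : (B → Circ) × (A → Circ) => Function.extend φ p.2 p.1 := by
  refine continuous_pi fun b => ?_
  by_cases hb : ∃ a, φ a = b
  · obtain ⟨a, rfl⟩ := hb
    simp only [φ.injective.extend_apply]
    exact (continuous_apply a).comp continuous_snd
  · simp only [Function.extend_apply' _ _ _ hb]
    exact (continuous_apply b).comp continuous_fst

/-- Smashing with a point `w` of the complementary sphere: the map `S^A → S^B` whose coordinates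
outside of `A` are those of `w`. -/
noncomputable def insert {A B : Type} (φ : A ↪ B) (w : B → Circ) : Sphere A ⟶ Sphere B :=
  PQuot.desc (fun x => mk (Function.extend φ x w))
    (PQuot.continuous_mk.comp ((continuous_extend φ).comp (Continuous.prodMk_right w)))
    (fun _ _ h => h.elim)
    (fun x ⟨a, h⟩ => PQuot.mk_base ⟨φ a, (φ.injective.extend_apply x w a).trans h⟩)

theorem continuous_insert {A B : Type} (φ : A ↪ B) :
    Continuous fun w : B → Circ => insert φ w :=
  PtdSpace.continuous_hom_of_joint _ (PQuot.continuous_joint _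
    (PQuot.continuous_mk.comp (continuous_extend φ)) continuous_const)

theorem insert_zero {A B : Type} (φ : A ↪ B) (w : B → Circ) (b : B) (hb : ¬ ∃ a, φ a = b)
    (h : w b = OnePoint.infty) : insert φ w = PtdSpace.zeroHom _ _ :=
  PQuot.hom_ext fun x => PQuot.mk_base ⟨b, (Function.extend_apply' _ _ _ hb).trans h⟩

theorem insert_refl {A : Type} (w : A → Circ) : insert (Function.Embedding.refl A) w = 𝟙 _ :=
  PQuot.hom_ext fun x => congrArg mk (funext fun a =>
    (Function.Embedding.refl A).injective.extend_apply x w a)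

theorem insert_trans {A B C : Type} (φ : A ↪ B) (χ : B ↪ C) (w : C → Circ) :
    insert (φ.trans χ) w = insert φ (fun b => w (χ b)) ≫ insert χ w :=
  PQuot.hom_ext fun x => congrArg mk (funext fun c => by
    by_cases hc : ∃ b, χ b = c
    · obtain ⟨b, rfl⟩ := hc
      rw [χ.injective.extend_apply]
      by_cases hb : ∃ a, φ a = b
      · obtain ⟨a, rfl⟩ := hb
        rw [φ.injective.extend_apply]
        exact (φ.trans χ).injective.extend_apply x w a
      · rw [Function.extend_apply' _ _ _ hb]
        refine Function.extend_apply' _ _ _ ?_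
        rintro ⟨a, ha⟩
        exact hb ⟨a, χ.injective ha⟩
    · rw [Function.extend_apply' _ _ _ hc]
      refine Function.extend_apply' _ _ _ ?_
      rintro ⟨a, ha⟩
      exact hc ⟨φ a, ha⟩)

/-- Multiplication by a positive number, as a homeomorphism of `S^1`. -/
noncomputable def mulCirc (t : PosReal) : Circ ≃ₜ Circ :=
  Homeomorph.onePointCongr
    { toEquiv := Equiv.mulLeft t
      continuous_toFun := Continuous.subtype_mk (continuous_const.mul continuous_subtype_val) _
      continuous_invFun := Continuous.subtype_mk (continuous_const.mul continuous_subtype_val) _ }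

/-- Multiplication of the coordinates by positive numbers. -/
noncomputable def scale {A : Type} (t : A → PosReal) : Sphere A ⟶ Sphere A :=
  PQuot.desc (fun x => mk fun a => mulCirc (t a) (x a))
    (PQuot.continuous_mk.comp (continuous_pi fun a =>
      (mulCirc (t a)).continuous.comp (continuous_apply a)))
    (fun _ _ h => h.elim)
    (fun x ⟨a, h⟩ => PQuot.mk_base ⟨a, congrArg (mulCirc (t a)) h⟩)

/-- The adjoint `S^A → Map(S^B, S^C)` of `S^A ∧ S^B ≅ S^C` for `C = A ⊔ B`. -/
noncomputable def pairing {A B C : Type} (c : A ⊕ B ≃ C) :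
    Sphere A ⟶ PtdSpace.mapSpace (Sphere B) (Sphere C) :=
  PQuot.desc (fun x => PtdSpace.mapSpace.ofHom (insert (Function.Embedding.inr.trans c.toEmbedding)
      fun i => Sum.elim x (fun _ => OnePoint.infty) (c.symm i)))
    (PtdSpace.continuous_ofHom ((continuous_insert _).comp (continuous_pi fun i => by
      rcases c.symm i with a | b
      · exact continuous_apply a
      · exact continuous_const)))
    (fun _ _ h => h.elim)
    (fun x ⟨a, h⟩ => congrArg PtdSpace.mapSpace.ofHom (insert_zero _ _ (c (Sum.inl a))
      (by rintro ⟨b, hb⟩; exact Sum.inr_ne_inl (c.injective hb))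
      (by rw [c.symm_apply_apply]; exact h)))

theorem pairing_mk {A B C : Type} (c : A ⊕ B ≃ C) (x : A → Circ) (y : B → Circ) :
    PtdSpace.mapSpace.toHom (pairing c (mk x)) (mk y) = mk fun i => Sum.elim x y (c.symm i) := by
  refine congrArg mk (funext fun i => ?_)
  obtain ⟨a | b, rfl⟩ := c.surjective i
  · rw [Function.extend_apply']
    · simp
    · rintro ⟨b, hb⟩; exact Sum.inr_ne_inl (c.injective hb)
  · rw [c.symm_apply_apply]
    exact (Function.Embedding.inr.trans c.toEmbedding).injective.extend_apply _ _ b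

end Sphere

/-! ### The multilinearization -/

/-- The skeleton of the category of finite sets and injections. -/
structure FinInj where
  card : ℕ

namespace FinInj

instance : SmallCategory FinInj where
  Hom m n := Fin m.card ↪ Fin n.card
  id m := Function.Embedding.refl _
  comp f g := f.trans g

/-- The injection underlying a morphism. -/
def emb {m n : FinInj} (f : m ⟶ n) : Fin m.card ↪ Fin n.card := f

instance (m n : FinInj) : CoeFun (m ⟶ n) (fun _ => Fin m.card → Fin n.card) := ⟨fun f => emb f⟩

/-- The disjoint union of finite sets, on objects. -/
def add (m n : FinInj) : FinInj := ⟨m.card + n.card⟩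

/-- The disjoint union of finite sets, on morphisms. -/
def addMap {m m' n n' : FinInj} (f : m ⟶ m') (g : n ⟶ n') : add m n ⟶ add m' n' :=
  finSumFinEquiv.symm.toEmbedding.trans
    ((Function.Embedding.sumMap (emb f) (emb g)).trans finSumFinEquiv.toEmbedding)

theorem addMap_id (m n : FinInj) : addMap (𝟙 m) (𝟙 n) = 𝟙 (add m n) :=
  Function.Embedding.ext fun a => by
    obtain ⟨b, rfl⟩ := finSumFinEquiv.surjective a
    refine (congrArg finSumFinEquiv (congrArg (Sum.map id id)
      (finSumFinEquiv.symm_apply_apply b))).trans ?_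
    rw [Sum.map_id_id]
    rfl

theorem addMap_comp {m m' m'' n n' n'' : FinInj} (f : m ⟶ m') (g : n ⟶ n') (f' : m' ⟶ m'')
    (g' : n' ⟶ n'') : addMap (f ≫ f') (g ≫ g') = addMap f g ≫ addMap f' g' :=
  Function.Embedding.ext fun a => by
    obtain ⟨b, rfl⟩ := finSumFinEquiv.surjective a
    have h : ∀ {p q r s : FinInj} (u : p ⟶ r) (v : q ⟶ s) (b : Fin p.card ⊕ Fin q.card),
        addMap u v (finSumFinEquiv b) = finSumFinEquiv (Sum.map u v b) := fun u v b =>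
      congrArg finSumFinEquiv (congrArg (Sum.map u v) (finSumFinEquiv.symm_apply_apply b))
    refine (h _ _ _).trans (Eq.trans ?_ (((congrArg (addMap f' g') (h f g b)).trans
      (h f' g' _)).symm))
    rcases b with b | b <;> rfl

end FinInj

namespace SymmFun

/-- A multipointed functor sends families of maps with a constant member to constant maps. -/
theorem map_zero (F : SymmFun) {N : FinSet} {X Y : N → PtdSpace} (g : ∀ n, X n ⟶ Y n) (n : N)
    (h : g n = PtdSpace.zeroHom _ _) : (F.obj N).map g = PtdSpace.zeroHom _ _ := by
  have : ∀ m, ∃ (P : PtdSpace) (a : X m ⟶ P) (b : P ⟶ Y m), a ≫ b = g m ∧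
      (m = n → Subsingleton P) := fun m => by
    by_cases hm : m = n
    · subst hm
      exact ⟨⟨Unit, ()⟩, PtdSpace.zeroHom _ _, PtdSpace.zeroHom _ _, h.symm,
        fun _ => inferInstanceAs (Subsingleton Unit)⟩
    · exact ⟨_, g m, 𝟙 _, Category.comp_id _, fun h' => (hm h').elim⟩
  choose P a b hab hP using this
  have hs := F.pointed N P n (hP n rfl)
  have hc : (F.obj N).map g = (F.obj N).map (X := X) (Y := P) a ≫ (F.obj N).map b :=
    (congrArg (F.obj N).map (funext fun m => (hab m).symm)).trans
      ((F.obj N).map_comp (X := X) (Y := P) (Z := Y) a b)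
  rw [hc]
  exact PtdSpace.hom_ext fun x => (congrArg ((F.obj N).map b)
    (Subsingleton.elim _ ((F.obj N).obj P).pt)).trans (PtdSpace.Hom.map_pt _)

/-- The tuple of spheres `(S^{U_n})_n`. -/
def spheres {N : FinSet} (U : N → FinInj) (n : N) : PtdSpace := Sphere (Fin (U n).card)

/-- The space `Ω^{U_1} ⋯ Ω^{U_n} F(S^{U_1}, …, S^{U_n})`. -/
def loops (F : SymmFun) {N : FinSet} (U : N → FinInj) : PtdSpace :=
  PtdSpace.mapSpace (Sphere (Σ n, Fin (U n).card)) ((F.obj N).obj (spheres U))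

section stabilization
variable (F : SymmFun) {N : FinSet} {U U' : N → FinInj} (φ : ∀ n, U n ⟶ U' n)

/-- The values of the stabilization of a loop along injections `φ`: the coordinates outside of the
images of `φ` are assembled into the variables of `F`. -/
noncomputable def stabFun (f : Sphere (Σ n, Fin (U n).card) ⟶ (F.obj N).obj (spheres U))
    (w : (Σ n, Fin (U' n).card) → Circ) : (F.obj N).obj (spheres U') :=
  (F.obj N).map (X := spheres U) (Y := spheres U')
    (fun n => Sphere.insert (φ n) fun b => w ⟨n, b⟩) (f (Sphere.mk fun a => w ⟨a.1, φ a.1 a.2⟩))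

theorem continuous_stabFun {A : Type} [TopologicalSpace A] [LocallyCompactSpace A]
    (f : A → (Sphere (Σ n, Fin (U n).card) ⟶ (F.obj N).obj (spheres U))) (hf : Continuous f) :
    Continuous fun p : A × ((Σ n, Fin (U' n).card) → Circ) => stabFun F φ (f p.1) p.2 := by
  have h₁ : Continuous fun w : (Σ n, Fin (U' n).card) → Circ =>
      ((F.obj N).map (X := spheres U) (Y := spheres U')
        (fun n => Sphere.insert (φ n) fun b => w ⟨n, b⟩) :
        (F.obj N).obj (spheres U) ⟶ (F.obj N).obj (spheres U')) :=
    F.continuous N (spheres U) (spheres U')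
      (i := CompHaus.of ((Σ n, Fin (U' n).card) → Circ))
      ⟨fun w n => Sphere.insert (φ n) fun b => w ⟨n, b⟩, continuous_pi fun n =>
        (Sphere.continuous_insert (φ n)).comp (continuous_pi fun b => continuous_apply _)⟩
  have h₂ : Continuous fun p : A × ((Σ n, Fin (U' n).card) → Circ) =>
      (p.2, f p.1 (Sphere.mk fun a => p.2 ⟨a.1, φ a.1 a.2⟩)) :=
    continuous_snd.prodMk ((PtdSpace.joint_of_continuous_hom f hf).comp
      (continuous_fst.prodMk (PQuot.continuous_mk.comp
        (continuous_pi fun a => (continuous_apply _).comp continuous_snd))))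
  exact (PtdSpace.joint_of_continuous_hom _ h₁).comp h₂

/-- The stabilization of a single loop. -/
noncomputable def stabHom (f : Sphere (Σ n, Fin (U n).card) ⟶ (F.obj N).obj (spheres U)) :
    Sphere (Σ n, Fin (U' n).card) ⟶ (F.obj N).obj (spheres U') :=
  PQuot.desc (stabFun F φ f)
    ((continuous_stabFun F φ (A := Unit) (fun _ => f) continuous_const).comp
      (Continuous.prodMk_right ()))
    (fun _ _ h => h.elim)
    (by
      rintro w ⟨⟨n, b⟩, h⟩
      by_cases hb : ∃ a, φ n a = b
      · obtain ⟨a, rfl⟩ := hb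
        have : (Sphere.mk fun a => w ⟨a.1, φ a.1 a.2⟩ : Sphere (Σ n, Fin (U n).card)) =
          (Sphere _).pt := PQuot.mk_base ⟨⟨n, a⟩, h⟩
        unfold stabFun
        rw [this, f.map_pt]
        exact PtdSpace.Hom.map_pt _
      · exact congrArg (fun k : (F.obj N).obj (spheres U) ⟶ (F.obj N).obj (spheres U') =>
          k (f (Sphere.mk fun a => w ⟨a.1, φ a.1 a.2⟩)))
          (F.map_zero (X := spheres U) (Y := spheres U')
            (fun n => Sphere.insert (φ n) fun b => w ⟨n, b⟩) n
            (Sphere.insert_zero (φ n) _ b hb h)))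

/-- The stabilization map of loop spaces. -/
noncomputable def stab : F.loops U ⟶ F.loops U' where
  toFun f := PtdSpace.mapSpace.ofHom (stabHom F φ (PtdSpace.mapSpace.toHom f))
  cont := PtdSpace.continuous_ofHom (PtdSpace.continuous_of_tests _ fun S f =>
    PtdSpace.continuous_hom_of_joint _ (PQuot.continuous_joint _
      (continuous_stabFun F φ _ (PtdSpace.continuous_toHom.comp f.continuous)) continuous_const))
  map_pt := congrArg PtdSpace.mapSpace.ofHom (PQuot.hom_ext fun w => PtdSpace.Hom.map_pt _)

end stabilization

theorem loops_ext (F : SymmFun) {N : FinSet} {U : N → FinInj} {f g : F.loops U}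
    (h : ∀ w, PtdSpace.mapSpace.toHom f (Sphere.mk w) = PtdSpace.mapSpace.toHom g (Sphere.mk w)) :
    f = g :=
  congrArg PtdSpace.mapSpace.ofHom (PQuot.hom_ext (f := PtdSpace.mapSpace.toHom f) h)

/-- The diagram `(U_n) ↦ Ω^{U_1} ⋯ Ω^{U_n} F(S^{U_1}, …, S^{U_n})`. -/
noncomputable def loopDiagram (F : SymmFun) (N : FinSet) : (N → FinInj) ⥤ PtdSpace where
  obj U := F.loops U
  map φ := F.stab φ
  map_id U := PtdSpace.hom_ext fun f => F.loops_ext fun w => by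
    have : (fun n => Sphere.insert (𝟙 (U n)) fun b => w ⟨n, b⟩ :
        ∀ n, spheres U n ⟶ spheres U n) = fun n => 𝟙 _ := funext fun n => Sphere.insert_refl _
    refine (congrArg (fun k => PtdSpace.Hom.toFun ((F.obj N).map (X := spheres U)
      (Y := spheres U) k) (PtdSpace.mapSpace.toHom f (Sphere.mk w))) this).trans ?_
    exact congrArg (fun k : (F.obj N).obj (spheres U) ⟶ (F.obj N).obj (spheres U) =>
      k (PtdSpace.mapSpace.toHom f (Sphere.mk w))) ((F.obj N).map_id (spheres U))
  map_comp {U U' U''} φ χ := PtdSpace.hom_ext fun f => F.loops_ext fun w => by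
    have : (fun n => Sphere.insert ((φ ≫ χ) n) fun b => w ⟨n, b⟩ :
        ∀ n, spheres U n ⟶ spheres U'' n) = fun n =>
          (Sphere.insert (φ n) fun b => w ⟨n, χ n b⟩ : spheres U n ⟶ spheres U' n) ≫
            (Sphere.insert (χ n) fun b => w ⟨n, b⟩ : spheres U' n ⟶ spheres U'' n) :=
      funext fun n => Sphere.insert_trans (φ n) (χ n) _
    refine (congrArg (fun k => PtdSpace.Hom.toFun ((F.obj N).map (X := spheres U)
      (Y := spheres U'') k) (PtdSpace.mapSpace.toHom f
        (Sphere.mk fun a => w ⟨a.1, χ a.1 (φ a.1 a.2)⟩))) this).trans ?_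
    exact congrArg (fun k : (F.obj N).obj (spheres U) ⟶ (F.obj N).obj (spheres U'') =>
      k (PtdSpace.mapSpace.toHom f (Sphere.mk fun a => w ⟨a.1, χ a.1 (φ a.1 a.2)⟩)))
      ((F.obj N).map_comp (X := spheres U) (Y := spheres U') (Z := spheres U'') _ _)

end SymmFun

/-! ### Homotopy colimits -/

/-- The points of the pointed homotopy colimit: a chain `c_0 → ⋯ → c_n`, a point of the simplex
`Δ^n` and a point of `X(c_0)`. -/
abbrev HocolimPre {C : Type} [SmallCategory C] (X : C ⥤ PtdSpace) : Type :=
  Σ c : (Σ n : ℕ, ComposableArrows C n),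
    Kify (stdSimplex ℝ (Fin (c.1 + 1)) × X.obj (c.2.obj 0))

namespace HocolimPre
variable {C : Type} [SmallCategory C] {X : C ⥤ PtdSpace}

/-- Constructor for `HocolimPre`. -/
def mk {n : ℕ} (σ : ComposableArrows C n) (t : stdSimplex ℝ (Fin (n + 1))) (x : X.obj (σ.obj 0)) :
    HocolimPre X :=
  ⟨⟨n, σ⟩, (WithGeneratedByTopology.equiv (X := cptHaus)).symm (t, x)⟩

/-- The simplicial identifications. -/
inductive Rel : HocolimPre X → HocolimPre X → Prop
  | glue {m n : ℕ} (θ : Fin (m + 1) →o Fin (n + 1)) (σ : ComposableArrows C n)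
      (t : stdSimplex ℝ (Fin (m + 1))) (x : X.obj (σ.obj 0)) :
      Rel (mk (n := m) (θ.monotone.functor ⋙ σ) t
          (X.map (σ.map (homOfLE (Fin.zero_le (θ 0)))) x))
        (mk σ (stdSimplex.map θ t) x)

end HocolimPre

/-- The pointed (Bousfield-Kan) homotopy colimit of a diagram of pointed spaces: the realization
of the simplicial pointed space with `n`-simplices `⋁_{c_0 → ⋯ → c_n} X(c_0)`. -/
def Hocolim {C : Type} [SmallCategory C] (X : C ⥤ PtdSpace) : PtdSpace :=
  PQuot (HocolimPre X) HocolimPre.Rel fun e =>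
    (WithGeneratedByTopology.equiv (X := cptHaus) e.2).2 = (X.obj (e.1.2.obj 0)).pt

namespace Hocolim
variable {C D : Type} [SmallCategory C] [SmallCategory D] {X : C ⥤ PtdSpace} {Y : D ⥤ PtdSpace}

/-- The class of a point in the homotopy colimit. -/
def mk {n : ℕ} (σ : ComposableArrows C n) (t : stdSimplex ℝ (Fin (n + 1))) (x : X.obj (σ.obj 0)) :
    Hocolim X := PQuot.mk (HocolimPre.mk σ t x)

theorem hom_ext {Z : PtdSpace} {f g : Hocolim X ⟶ Z}
    (h : ∀ (n : ℕ) (σ : ComposableArrows C n) t x, f (mk σ t x) = g (mk σ t x)) : f = g :=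
  PQuot.hom_ext fun e => h e.1.1 e.1.2 (WithGeneratedByTopology.equiv (X := cptHaus) e.2).1
    (WithGeneratedByTopology.equiv (X := cptHaus) e.2).2

/-- Functoriality of the homotopy colimit in the indexing category and the diagram. -/
def map (Φ : C ⥤ D) (α : X ⟶ Φ ⋙ Y) : Hocolim X ⟶ Hocolim Y :=
  PQuot.desc (fun e => mk (n := e.1.1) (e.1.2 ⋙ Φ) (WithGeneratedByTopology.equiv (X := cptHaus) e.2).1
      (α.app _ (WithGeneratedByTopology.equiv (X := cptHaus) e.2).2))
    (PQuot.continuous_mk.comp (continuous_sigma fun c => by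
      have h : Continuous fun e : Kify (stdSimplex ℝ (Fin (c.1 + 1)) × X.obj (c.2.obj 0)) =>
          (WithGeneratedByTopology.equiv (X := cptHaus)).symm
            ((WithGeneratedByTopology.equiv (X := cptHaus) e).1,
            α.app (c.2.obj 0) (WithGeneratedByTopology.equiv (X := cptHaus) e).2) :=
        (IsGeneratedBy.equiv_symm_comp_continuous_iff (X := cptHaus) _).2
          ((continuous_fst.comp WithGeneratedByTopology.continuous_equiv).prodMk
            ((α.app (c.2.obj 0)).cont.comp
              (continuous_snd.comp WithGeneratedByTopology.continuous_equiv)))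
      exact (continuous_sigmaMk (σ := fun c : (Σ n : ℕ, ComposableArrows D n) =>
        Kify (stdSimplex ℝ (Fin (c.1 + 1)) × Y.obj (c.2.obj 0)))
        (i := ⟨c.1, c.2 ⋙ Φ⟩)).comp h))
    (by
      rintro _ _ ⟨θ, σ, t, x⟩
      have h := congrArg (fun k : X.obj (σ.obj 0) ⟶ Y.obj (Φ.obj (σ.obj (θ 0))) => k x)
        (α.naturality (σ.map (homOfLE (Fin.zero_le (θ 0)))))
      refine Eq.trans ?_ (PQuot.mk_glue (HocolimPre.Rel.glue (X := Y) θ (σ ⋙ Φ) t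
        (α.app (σ.obj 0) x)))
      exact congrArg (fun y => mk (X := Y) ((θ.monotone.functor ⋙ σ) ⋙ Φ) t y) h)
    (fun e h => PQuot.mk_base ((congrArg (α.app _) h).trans (α.app _).map_pt))

@[simp] theorem map_mk (Φ : C ⥤ D) (α : X ⟶ Φ ⋙ Y) {n : ℕ} (σ : ComposableArrows C n)
    (t : stdSimplex ℝ (Fin (n + 1))) (x : X.obj (σ.obj 0)) :
    map Φ α (mk σ t x) = mk (n := n) (σ ⋙ Φ) t (α.app _ x) := rfl

end Hocolim

namespace SymmFun

/-- Relabelling of tuples of finite sets. -/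
def relabelSets {N M : FinSet} (e : M ≃ N) : (N → FinInj) ⥤ (M → FinInj) where
  obj U m := U (e m)
  map φ m := φ (e m)

/-- The action of a bijection on loops: it permutes the variables of `F` and the blocks of loop
coordinates. -/
def permLoops (F : SymmFun) {N M : FinSet} (e : M ≃ N) (U : N → FinInj) :
    F.loops U ⟶ F.loops (fun m => U (e m)) where
  toFun f := PtdSpace.mapSpace.ofHom
    (Sphere.relabel (Equiv.sigmaCongrLeft (β := fun n => Fin (U n).card) e) ≫
      PtdSpace.mapSpace.toHom f ≫ F.perm e (spheres U))
  cont := PtdSpace.continuous_ofHom (PtdSpace.continuous_of_tests _ fun S f =>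
    PtdSpace.continuous_hom_of_joint _ ((F.perm e (spheres U)).cont.comp
      ((PtdSpace.joint_of_continuous_hom _ (PtdSpace.continuous_toHom.comp f.continuous)).comp
        (continuous_fst.prodMk ((Sphere.relabel _).cont.comp continuous_snd)))))
  map_pt := congrArg PtdSpace.mapSpace.ofHom (PtdSpace.hom_ext fun x => PtdSpace.Hom.map_pt _)

theorem permLoops_natural (F : SymmFun) {N M : FinSet} (e : M ≃ N) {U U' : N → FinInj}
    (φ : ∀ n, U n ⟶ U' n) :
    F.stab φ ≫ F.permLoops e U' =
      F.permLoops e U ≫ F.stab (U := fun m => U (e m)) (U' := fun m => U' (e m))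
        fun m => φ (e m) :=
  PtdSpace.hom_ext fun f => F.loops_ext fun w => by
    let c := Equiv.sigmaCongrLeft (β := fun n => Fin (U n).card) e
    let c' := Equiv.sigmaCongrLeft (β := fun n => Fin (U' n).card) e
    have h₁ : (fun a : Σ n, Fin (U n).card => w (c'.symm ⟨a.1, φ a.1 a.2⟩)) =
        fun a => w ⟨(c.symm a).1, φ (e (c.symm a).1) (c.symm a).2⟩ := funext fun a => by
      obtain ⟨⟨m, a⟩, rfl⟩ := c.surjective a
      rw [c.symm_apply_apply]
      exact congrArg w (c'.symm_apply_apply ⟨m, φ (e m) a⟩)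
    have h₂ : (fun m => Sphere.insert (φ (e m)) fun b => w (c'.symm ⟨e m, b⟩) :
        ∀ m, spheres U (e m) ⟶ spheres U' (e m)) =
          fun m => Sphere.insert (φ (e m)) fun b => w ⟨m, b⟩ :=
      funext fun m => congrArg (Sphere.insert (φ (e m))) (funext fun b =>
        congrArg w (c'.symm_apply_apply ⟨m, b⟩))
    have h₃ := congrArg (fun k : (F.obj N).obj (spheres U) ⟶ _ =>
        k (PtdSpace.mapSpace.toHom f (Sphere.mk fun a => w (c'.symm ⟨a.1, φ a.1 a.2⟩))))
      (F.perm_natural e (X := spheres U) (Y := spheres U')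
        fun n => Sphere.insert (φ n) fun b => w (c'.symm ⟨n, b⟩))
    refine h₃.trans ?_
    refine (congrArg (fun k => PtdSpace.Hom.toFun ((F.obj M).map (X := fun m => spheres U (e m))
      (Y := fun m => spheres U' (e m)) k) (F.perm e (spheres U) (PtdSpace.mapSpace.toHom f
        (Sphere.mk fun a => w (c'.symm ⟨a.1, φ a.1 a.2⟩))))) h₂).trans ?_
    exact congrArg (fun v => PtdSpace.Hom.toFun ((F.obj M).map (X := fun m => spheres U (e m))
      (Y := fun m => spheres U' (e m)) fun m => Sphere.insert (φ (e m)) fun b => w ⟨m, b⟩)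
        (F.perm e (spheres U) (PtdSpace.mapSpace.toHom f (Sphere.mk v)))) h₁

/-- The multilinearization `D_1^{(N)} F (S^0)` over finite sets and injections, with its action of
bijections. -/
noncomputable def multilin (F : SymmFun) : SymmSeq where
  obj N := Hocolim (F.loopDiagram N)
  map {N M} e := Hocolim.map (relabelSets (Equiv.symm e : M ≃ N))
    { app U := F.permLoops (Equiv.symm e : M ≃ N) U
      naturality U U' φ := F.permLoops_natural (Equiv.symm e : M ≃ N) φ }
  map_id N := Hocolim.hom_ext fun n σ t f => congrArg (Hocolim.mk (X := F.loopDiagram N) σ t)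
    (F.loops_ext fun w => by
      have h := congrArg (fun k : (F.obj N).obj (spheres (σ.obj 0)) ⟶ _ =>
        k (PtdSpace.mapSpace.toHom f (Sphere.mk w))) (F.perm_refl N (spheres (σ.obj 0)))
      refine Eq.trans ?_ h
      refine congrArg (fun v => F.perm (Equiv.refl N) (spheres (σ.obj 0))
        (PtdSpace.mapSpace.toHom f (Sphere.mk v))) (funext fun a => ?_)
      exact congrArg w ((Equiv.sigmaCongrLeft (β := fun n => Fin (σ.obj 0 n).card)
        (Equiv.refl N)).symm_apply_apply a))
  map_comp {N M L} e e' := Hocolim.hom_ext fun n σ t f =>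
    congrArg (Hocolim.mk (X := F.loopDiagram L)
      (σ ⋙ relabelSets ((Equiv.symm e' : L ≃ M).trans (Equiv.symm e : M ≃ N))) t)
    (F.loops_ext fun w => by
      have h := fun y => congrArg (fun k : (F.obj N).obj (spheres (σ.obj 0)) ⟶ _ => k y)
        (F.perm_trans (Equiv.symm e' : L ≃ M) (Equiv.symm e : M ≃ N) (spheres (σ.obj 0)))
      refine (h _).trans ?_
      refine congrArg (fun v => F.perm (Equiv.symm e' : L ≃ M) _ (F.perm (Equiv.symm e : M ≃ N)
        (spheres (σ.obj 0)) (PtdSpace.mapSpace.toHom f (Sphere.mk v)))) (funext fun a => ?_)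
      let c := Equiv.sigmaCongrLeft (β := fun n => Fin (σ.obj 0 n).card) (Equiv.symm e : M ≃ N)
      let c' := Equiv.sigmaCongrLeft (β := fun m => Fin (σ.obj 0 (Equiv.symm e m)).card)
        (Equiv.symm e' : L ≃ M)
      let c'' := Equiv.sigmaCongrLeft (β := fun n => Fin (σ.obj 0 n).card)
        ((Equiv.symm e' : L ≃ M).trans (Equiv.symm e : M ≃ N))
      change w (c''.symm a) = w (c'.symm (c.symm a))
      refine congrArg w (c''.symm_apply_eq.2 ?_)
      obtain ⟨b, rfl⟩ := c.surjective a
      obtain ⟨b, rfl⟩ := c'.surjective b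
      rw [c.symm_apply_apply, c'.symm_apply_apply]
      rfl)

/-- The action of a morphism of functor sequences on loops. -/
def loopsMap {F G : SymmFun} (η : F ⟶ G) {N : FinSet} (U : N → FinInj) :
    F.loops U ⟶ G.loops U where
  toFun f := PtdSpace.mapSpace.ofHom (PtdSpace.mapSpace.toHom f ≫ (η.app N).app (spheres U))
  cont := PtdSpace.continuous_ofHom (PtdSpace.continuous_of_tests _ fun S f =>
    PtdSpace.continuous_postcomp _ (PtdSpace.continuous_toHom.comp f.continuous) _)
  map_pt := congrArg PtdSpace.mapSpace.ofHom (PtdSpace.hom_ext fun x => PtdSpace.Hom.map_pt _)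

/-- The multilinearization evaluated at `S^0`, as a functor from multipointed symmetric functor
sequences to symmetric sequences. -/
noncomputable def multilinFunctor : SymmFun ⥤ SymmSeq where
  obj F := F.multilin
  map {F G} η :=
    { app N := Hocolim.map (𝟭 _)
        { app U := loopsMap η U
          naturality U U' φ := PtdSpace.hom_ext fun f => G.loops_ext fun w =>
            congrArg (fun k : (F.obj N).obj (spheres U) ⟶ (G.obj N).obj (spheres U') =>
              k (PtdSpace.mapSpace.toHom f (Sphere.mk fun a => w ⟨a.1, φ a.1 a.2⟩)))
              ((η.app N).naturality (X := spheres U) (Y := spheres U')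
                fun n => Sphere.insert (φ n) fun b => w ⟨n, b⟩) }
      naturality N M e := Hocolim.hom_ext fun n σ t f =>
        congrArg (Hocolim.mk (X := G.loopDiagram M)
          (σ ⋙ relabelSets (Equiv.symm e : M ≃ N)) t) (G.loops_ext fun w =>
            (congrArg (fun k : (F.obj N).obj (spheres (σ.obj 0)) ⟶ _ =>
              k (PtdSpace.mapSpace.toHom f (Sphere.relabel (Equiv.sigmaCongrLeft
                (β := fun n => Fin (σ.obj 0 n).card) (Equiv.symm e : M ≃ N)) (Sphere.mk w))))
              (η.equivariant (M := M) (N := N) (Equiv.symm e) (spheres (σ.obj 0)))).symm) }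
  map_id F := NatTrans.ext (funext fun N => Hocolim.hom_ext fun n σ t f => rfl)
  map_comp η θ := NatTrans.ext (funext fun N => Hocolim.hom_ext fun n σ t f => rfl)

end SymmFun

/-! ### Lax monoidal functors -/

open scoped CategoryTheory.Prod

/-- A (left) skew-monoidal structure: the structure of a monoidal category, except that the
comparison maps `(A ⊗ B) ⊗ D ⟶ A ⊗ (B ⊗ D)`, `I ⊗ A ⟶ A` and `A ⟶ A ⊗ I` need not be invertible.
If they are, this is a monoidal category. -/
structure SkewMonoidal {C : Type*} [Category C] (tensor : C × C ⥤ C) (unit : C) where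
  assoc (A B D : C) :
    tensor.obj (tensor.obj (A, B), D) ⟶ tensor.obj (A, tensor.obj (B, D))
  lam (A : C) : tensor.obj (unit, A) ⟶ A
  rho (A : C) : A ⟶ tensor.obj (A, unit)
  assoc_natural {A A' B B' D D' : C} (a : A ⟶ A') (b : B ⟶ B') (d : D ⟶ D') :
    tensor.map (tensor.map (a ×ₘ b) ×ₘ d) ≫ assoc A' B' D' =
      assoc A B D ≫ tensor.map (a ×ₘ tensor.map (b ×ₘ d))
  lam_natural {A A' : C} (a : A ⟶ A') : tensor.map (𝟙 unit ×ₘ a) ≫ lam A' = lam A ≫ a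
  rho_natural {A A' : C} (a : A ⟶ A') : rho A ≫ tensor.map (a ×ₘ 𝟙 unit) = a ≫ rho A'
  pentagon (A B D E : C) :
    tensor.map (assoc A B D ×ₘ 𝟙 E) ≫ assoc A (tensor.obj (B, D)) E ≫
        tensor.map (𝟙 A ×ₘ assoc B D E) =
      assoc (tensor.obj (A, B)) D E ≫ assoc A B (tensor.obj (D, E))
  assoc_lam (A B : C) :
    assoc unit A B ≫ lam (tensor.obj (A, B)) = tensor.map (lam A ×ₘ 𝟙 B)
  triangle (A B : C) :
    tensor.map (rho A ×ₘ 𝟙 B) ≫ assoc A unit B ≫ tensor.map (𝟙 A ×ₘ lam B) = 𝟙 _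
  rho_assoc (A B : C) :
    rho (tensor.obj (A, B)) ≫ assoc A B unit = tensor.map (𝟙 A ×ₘ rho B)
  rho_lam : rho unit ≫ lam unit = 𝟙 unit

/-- The structure of a lax monoidal functor on a functor `D`. -/
structure LaxMonoidal {C C' : Type*} [Category C] [Category C'] {tensor : C × C ⥤ C} {unit : C}
    {tensor' : C' × C' ⥤ C'} {unit' : C'} (S : SkewMonoidal tensor unit)
    (S' : SkewMonoidal tensor' unit') (D : C ⥤ C') where
  ε : unit' ⟶ D.obj unit
  μ (A B : C) : tensor'.obj (D.obj A, D.obj B) ⟶ D.obj (tensor.obj (A, B))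
  μ_natural {A A' B B' : C} (a : A ⟶ A') (b : B ⟶ B') :
    tensor'.map (D.map a ×ₘ D.map b) ≫ μ A' B' = μ A B ≫ D.map (tensor.map (a ×ₘ b))
  associativity (A B E : C) :
    tensor'.map (μ A B ×ₘ 𝟙 (D.obj E)) ≫ μ (tensor.obj (A, B)) E ≫ D.map (S.assoc A B E) =
      S'.assoc (D.obj A) (D.obj B) (D.obj E) ≫ tensor'.map (𝟙 (D.obj A) ×ₘ μ B E) ≫
        μ A (tensor.obj (B, E))
  left_unitality (A : C) :
    tensor'.map (ε ×ₘ 𝟙 (D.obj A)) ≫ μ unit A ≫ D.map (S.lam A) = S'.lam (D.obj A)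
  right_unitality (A : C) :
    S'.rho (D.obj A) ≫ tensor'.map (𝟙 (D.obj A) ×ₘ ε) ≫ μ A unit = D.map (S.rho A)

/-! ### The canonical comparison maps -/

/-- The component of a morphism of symmetric functor sequences. -/
def SymmFun.component {F G : SymmFun} (η : F ⟶ G) {N : FinSet} (X : N → PtdSpace) :
    (F.obj N).obj X ⟶ (G.obj N).obj X :=
  (SymmFunctor.Hom.app η N).app X

theorem Surj.fib_subsingleton {N K : FinSet} (p : Surj N K) (h : Function.Injective p) (k : K) :
    Subsingleton (p.fib k) :=
  ⟨fun a b => Subtype.ext (h (a.2.trans b.2.symm))⟩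

/-- The comparison maps for the composition of symmetric functor sequences are the evident ones:
`(H ∘ G) ∘ F ⟶ H ∘ (G ∘ F)` sends the term `H_L(G_K, …)(F, …)` of partitions `N ↠ K ↠ L`
to the term `H_L` of `N ↠ L` by including the composites `G(F, …)` into `G ∘ F`, and the unit maps
identify the terms `id(F_N(X))` and `F_N(id(X), …, id(X))` with `F_N(X)`. -/
structure IsCanonicalFun (S : SkewMonoidal SymmFun.compFunctor SymmFun.unit) : Prop where
  assoc (H G F : SymmFun) {N K L : FinSet} (p : Surj N K) (q : Surj K L) (X : N → PtdSpace) :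
    SymmFun.incl H G q (fun k => (F.obj (p.fib k)).obj fun n => X n.1) ≫
        SymmFun.incl (H.comp G) F p X ≫ SymmFun.component (S.assoc H G F) X =
      (H.obj L).map
          (X := fun l => (G.obj (q.fib l)).obj fun k => (F.obj (p.fib k.1)).obj fun n => X n.1)
          (Y := fun l => ((G.comp F).obj ((p.comp q).fib l)).obj fun n => X n.1)
          (fun l =>
            (G.obj (q.fib l)).map
                (X := fun k => (F.obj (p.fib k.1)).obj fun n => X n.1)
                (Y := fun k => (F.obj ((p.restr q l).fib k)).obj fun n => X n.1.1)
                (fun k => F.perm (p.restrFib q l k) fun n => X n.1) ≫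
              SymmFun.incl G F (p.restr q l) fun n => X n.1) ≫
        SymmFun.incl H (G.comp F) (p.comp q) X
  lam (F : SymmFun) {N K : FinSet} (p : Surj N K) (hK : Subsingleton K) (k : K)
      (X : N → PtdSpace) :
    Wedge.incl (fun i : {_k : K // Subsingleton K} =>
          (F.obj (p.fib i.1)).obj fun n => X n.1) ⟨k, hK⟩ ≫
        SymmFun.incl SymmFun.unit F p X ≫ SymmFun.component (S.lam F) X =
      F.perm (p.onlyFib hK k) fun n => X n.1
  rho (F : SymmFun) (N : FinSet) (X : N → PtdSpace) :
    SymmFun.component (S.rho F) X =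
      (F.obj N).map (X := X)
          (Y := fun n => (SymmFun.unit.obj ((Surj.id N).fib n)).obj fun m => X m.1)
          (fun n => Wedge.incl (fun i : {_m : (Surj.id N).fib n // Subsingleton ((Surj.id N).fib n)} =>
            X i.1.1) ⟨⟨n, rfl⟩, (Surj.id N).fib_subsingleton (fun _ _ h => h) n⟩) ≫
        SymmFun.incl F SymmFun.unit (Surj.id N) X

/-- The comparison maps for the composition product of symmetric sequences are the evident
rebracketings `(a; b; c) ↦ (a; (b; c))`, `(1; a) ↦ a` and `a ↦ (a; 1, …, 1)`. -/
structure IsCanonicalSeq (S : SkewMonoidal SymmSeq.compFunctor SymmSeq.unit) : Prop where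
  assoc (A B C : SymmSeq) {N K L : FinSet} (p : Surj N K) (q : Surj K L) (a : A.obj L)
      (b : ∀ l, B.obj (q.fib l)) (c : ∀ k, C.obj (p.fib k)) :
    (S.assoc A B C).app N (SymmSeq.compMk (A := A.comp B) p (SymmSeq.compMk q a b) c) =
      SymmSeq.compMk (B := B.comp C) (p.comp q) a fun l =>
        SymmSeq.compMk (p.restr q l) (b l) fun k =>
          C.map (X := p.fib k.1) (Y := (p.restr q l).fib k) (p.restrFib q l k).symm (c k.1)
  lam (A : SymmSeq) {N K : FinSet} (p : Surj N K) (hK : Subsingleton K) (k : K)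
      (a : ∀ k, A.obj (p.fib k)) :
    (S.lam A).app N (SymmSeq.compMk p (SymmSeq.unitPoint hK) a) =
      A.map (X := p.fib k) (Y := N) (p.onlyFib hK k).symm (a k)
  rho (A : SymmSeq) (N : FinSet) (a : A.obj N) :
    (S.rho A).app N a = SymmSeq.compMk (Surj.id N) a fun n =>
      SymmSeq.unitPoint ((Surj.id N).fib_subsingleton (fun _ _ h => h) n)

/-! ### The sphere operad and the product maps -/

/-- The sum of positive numbers. -/
noncomputable def posSum {J : FinSet} (u : J → PosReal) : PosReal :=
  ⟨∑ᶠ j, (u j : ℝ), by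
    have := Fintype.ofFinite J
    rw [finsum_eq_sum_of_fintype]
    exact Finset.sum_pos (fun j _ => (u j).2) Finset.univ_nonempty⟩

/-- The open simplex on a finite set `J` of vertices. Its one-point compactification is the `J`-th space
of the sphere operad. -/
def OpenSimplex (J : FinSet) : Type :=
  {t : J → PosReal // (posSum t : ℝ) = 1}

/-- Polar coordinates `(0, ∞)^J ≃ Δ°_J × (0, ∞)`, inverse to `(t, r) ↦ (t_j r)_j`. On one-point
compactifications this is the identification of `S^J` with the smash product of the `J`-th space
of the sphere operad and `S^1`. -/
noncomputable def polar {J : FinSet} :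
    (J → PosReal) ≃ OpenSimplex J × PosReal where
  toFun u := (⟨fun j => ⟨(u j : ℝ) / posSum u, div_pos (u j).2 (posSum u).2⟩, by
    have h := (posSum u).2.ne'
    change ∑ᶠ j, (u j : ℝ) / (posSum u : ℝ) = 1
    have := Fintype.ofFinite J
    rw [finsum_eq_sum_of_fintype, ← Finset.sum_div, div_eq_one_iff_eq h]
    exact (finsum_eq_sum_of_fintype _).symm⟩, posSum u)
  invFun x j := ⟨(x.1.1 j : ℝ) * x.2, mul_pos (x.1.1 j).2 x.2.2⟩
  left_inv u := funext fun j => Subtype.ext (div_mul_cancel₀ _ (posSum u).2.ne')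
  right_inv := by
    rintro ⟨⟨t, ht⟩, r⟩
    have hr : (posSum fun j => (⟨(t j : ℝ) * r, mul_pos (t j).2 r.2⟩ : PosReal)) = r := by
      refine Subtype.ext ?_
      change ∑ᶠ j, (t j : ℝ) * (r : ℝ) = r
      change ∑ᶠ j, (t j : ℝ) = 1 at ht
      have := Fintype.ofFinite J
      rw [finsum_eq_sum_of_fintype] at ht ⊢
      rw [← Finset.sum_mul, ht, one_mul]
    refine Prod.ext (Subtype.ext (funext fun j => Subtype.ext ?_)) hr
    change (t j : ℝ) * r / (posSum fun j => (⟨(t j : ℝ) * r, mul_pos (t j).2 r.2⟩ : PosReal) : PosReal) = t j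
    rw [hr, mul_div_cancel_right₀ _ r.2.ne']

namespace SymmFun

section product
variable {N K : FinSet} (p : Surj N K)

/-- The tuple `W_n = U_{p(n)} ⊔ V_n`. -/
def joinSets (U : K → FinInj) (V : ∀ k, p.fib k → FinInj) (n : N) : FinInj :=
  FinInj.add (U (p n)) (V (p n) ⟨n, rfl⟩)

/-- Reindexing of chains along the disjoint union. -/
def joinChain {n : ℕ} (σ : ComposableArrows (K → FinInj) n)
    (τ : ∀ k, ComposableArrows (p.fib k → FinInj) n) : ComposableArrows (N → FinInj) n where
  obj i := joinSets p (σ.obj i) fun k => (τ k).obj i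
  map f m := FinInj.addMap (σ.map f (p m)) ((τ (p m)).map f ⟨m, rfl⟩)
  map_id i := funext fun m => by
    have h₁ : σ.map (𝟙 i) (p m) = 𝟙 _ := congrFun (σ.map_id i) (p m)
    have h₂ : (τ (p m)).map (𝟙 i) ⟨m, rfl⟩ = 𝟙 _ := congrFun ((τ (p m)).map_id i) ⟨m, rfl⟩
    rw [h₁, h₂]
    exact FinInj.addMap_id _ _
  map_comp f g := funext fun m => by
    have h₁ : σ.map (f ≫ g) (p m) = σ.map f (p m) ≫ σ.map g (p m) :=
      congrFun (σ.map_comp f g) (p m)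
    have h₂ : (τ (p m)).map (f ≫ g) ⟨m, rfl⟩ = (τ (p m)).map f ⟨m, rfl⟩ ≫
      (τ (p m)).map g ⟨m, rfl⟩ := congrFun ((τ (p m)).map_comp f g) ⟨m, rfl⟩
    rw [h₁, h₂]
    exact FinInj.addMap_comp _ _ _ _

variable (U : K → FinInj) (V : ∀ k, p.fib k → FinInj)

/-- The identification `U_k ⊔ V_{k,n} ≃ W_n` for `n` in the block of `k`. -/
def joinEquiv : ∀ (k : K) (n : p.fib k),
    Fin (U k).card ⊕ Fin (V k n).card ≃ Fin (joinSets p U V n.1).card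
  | _, ⟨_, rfl⟩ => finSumFinEquiv

/-- For a point `w` of `S^{W_n}, …` and `a ∈ U_k`, the coordinates `w_{n,a}` for `n` in the block of
`k`, in polar coordinates: a point of the sphere operad and a point of `S^1`. -/
noncomputable def polarCoord (w : (Σ n, Fin (joinSets p U V n).card) → PosReal) (k : K)
    (a : Fin (U k).card) : OpenSimplex (p.fib k) × PosReal :=
  polar fun n => w ⟨n.1, joinEquiv p U V k n (Sum.inl a)⟩

/-- The part of `w` in `S^{V_k}`. -/
def restCoord (w : (Σ n, Fin (joinSets p U V n).card) → PosReal) (k : K) :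
    (Σ n, Fin (V k n).card) → PosReal :=
  fun b => w ⟨b.1.1, joinEquiv p U V k b.1 (Sum.inr b.2)⟩

/-- The value at `w` of the product of the loops `f ∈ Ω^U G(S^U)` and `g_k ∈ Ω^{V_k} F(S^{V_k})`.
The coordinates of `w` in the copies of `U_k` are split into a point `t` of the sphere operad and a
point `r` of `S^{U_k}`, to which `f` is applied. Then `t` and the values of `g` are assembled into
the variables of `G`, and the resulting spheres `S^{U_k}` into the variables of `F`:
the copy for `n` in the block of `k` is smashed with the variable `S^{V_{k,n}}` of `F`. -/
noncomputable def productValue (G F : SymmFun) (f : G.loops U) (g : ∀ k, F.loops (V k))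
    (w : (Σ n, Fin (joinSets p U V n).card) → PosReal) :
    ((comp G F).obj N).obj (spheres (joinSets p U V)) :=
  incl G F p (spheres (joinSets p U V))
    ((G.obj K).map (X := spheres U)
      (Y := fun k => (F.obj (p.fib k)).obj fun n => spheres (joinSets p U V) n.1)
      (fun k =>
        F.assemble (N := p.fib k) (Z := spheres U k) (X := spheres (V k))
            (Y := fun n => spheres (joinSets p U V) n.1)
            (fun n => Sphere.scale (fun a => (polarCoord p U V w k a).1.1 n) ≫
              Sphere.pairing (joinEquiv p U V k n)) ≫
          PtdSpace.evalAt (PtdSpace.mapSpace.toHom (g k) (Sphere.fin (restCoord p U V w k))))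
      (PtdSpace.mapSpace.toHom f (Sphere.fin fun a => (polarCoord p U V w a.1 a.2).2)))

end product

/-- The unit map is the inclusion of the first object `id(S^0)` into the homotopy colimit. -/
def IsUnitMap (ε : SymmSeq.unit ⟶ multilin SymmFun.unit) : Prop :=
  ∀ (N : FinSet) (hN : Subsingleton N) (n : N),
    ∃ ℓ : SymmFun.unit.loops (fun _ : N => (⟨0⟩ : FinInj)),
      PtdSpace.mapSpace.toHom ℓ (Sphere.fin fun a => Fin.elim0 a.2) =
        Wedge.incl (fun i : {_n : N // Subsingleton N} =>
          spheres (fun _ : N => (⟨0⟩ : FinInj)) i.1) ⟨n, hN⟩ (Sphere.fin fun a => Fin.elim0 a) ∧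
      ε.app N (SymmSeq.unitPoint hN) =
        Hocolim.mk (X := SymmFun.unit.loopDiagram N)
          (ComposableArrows.mk₀ fun _ : N => (⟨0⟩ : FinInj)) (stdSimplex.vertex 0) ℓ

/-- The product map is given on homotopy colimits by reindexing along the disjoint union, and on
loops by the sphere operad and assembly. -/
def IsProductMap (G F : SymmFun) (μ : SymmSeq.comp G.multilin F.multilin ⟶ (comp G F).multilin) :
    Prop :=
  ∀ {N K : FinSet} (p : Surj N K) (n : ℕ) (t : stdSimplex ℝ (Fin (n + 1)))
    (σ : ComposableArrows (K → FinInj) n) (τ : ∀ k, ComposableArrows (p.fib k → FinInj) n)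
    (f : G.loops (σ.obj 0)) (g : ∀ k, F.loops ((τ k).obj 0)),
    ∃ ℓ : (comp G F).loops (joinSets p (σ.obj 0) fun k => (τ k).obj 0),
      (∀ w, PtdSpace.mapSpace.toHom ℓ (Sphere.fin w) =
        productValue p (σ.obj 0) (fun k => (τ k).obj 0) G F f g w) ∧
      μ.app N (SymmSeq.compMk (A := G.multilin) (B := F.multilin) p
          (Hocolim.mk (X := G.loopDiagram K) σ t f)
          fun k => Hocolim.mk (X := F.loopDiagram (p.fib k)) (τ k) t (g k)) =
        Hocolim.mk (X := (comp G F).loopDiagram N) (joinChain p σ τ) t ℓ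

end SymmFun

/-!
The theorem has three parts: the coherence of the two compositions, the construction of the product
maps, and the coherence of the product maps.

**Compositions.** Maps out of a composition are determined by their restrictions to the terms of
labelled partitions `p : N ↠ K` (`compIncl`, `compMk`), and these terms are natural in isomorphisms
of labelled partitions. All canonical maps are characterized by their values on such terms
(`assocHom_incl`, `lamHom_incl`, `assocApp_compMk`, …). Working with labels instead of equivalence
relations turns the axioms into identities between maps on the terms of chains `N ↠ K ↠ L ↠ M`,
where both sides restrict all partitions to the blocks of the coarsest one. For symmetric sequences
the rebracketing is bijective, because a point different from the base point determines its
partitions and its entries (`ker_eq_of_assocVal_eq`, `eq_of_compMk_eq`), and its inverse is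
continuous because test maps can be lifted (`isIso_assocApp`).

**Continuity.** In compactly generated spaces, continuity can be checked on maps from compact
Hausdorff spaces. `Detects` isolates classes of test maps that suffice for this. For quotients,
wedges, smash products and homotopy colimits they are the maps that move the representatives
continuously, and `detects_pi` treats functions of several variables.

**Products of loops.** At points with finite coordinates the product of loops is given by a formula
in polar coordinates. The coordinates with labels in `U_k` are replaced by their sum and by a point
of an open simplex, in which the formula is not defined at infinity. The parameters of a block are
therefore compactified by one point, at which the assembled map `S^{U_k} → F(S^W)` becomes constant.
That it becomes constant continuously (`continuous_blockHomExt`) holds because polar coordinates are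
a homeomorphism at finite points, and the map is a continuous function on the compact product of
circles when written in the original coordinates (`continuous_extend_const`).

**Products of homotopy colimits.** A natural family of multipointed maps induces a map on homotopy
colimits, which is prescribed on chains of equal length with equal barycentric coordinates. Finitely
many points of simplices always have such a common presentation: regarded as measures on finite
ordinals, they have a coupling supported on a chain of the product of the ordinals, the quantile
coupling (`Coupling.exists_common`). A measure supported on a chain is determined by its marginals,
since its distribution function is the minimum of theirs (`Coupling.ChainSupp.ext`). Hence the value
does not depend on the presentation (`Coupling.eq_of_marginals`), and the product is well defined
and continuous (`MultiMap.prod`, `MultiMap.continuous_prod`).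

**Coherence of the products.** By common presentations, everything reduces to loops at points with
finite coordinates. There the formula is stated for arbitrary identifications of the coordinates
`W_n` with `U_{p(n)} ⊔ V_n` (`joinValue`), so that naturality, the unit axioms and associativity are
comparisons of coordinates (`joinValue_square`, `joinValue_unit_left`, `joinValue_unit_right`,
`joinValue_assoc`). Associativity holds because the coordinates of the sphere operad multiply: the
quotient of a coordinate by a partial sum, times the quotient of the partial sum by the total sum,
is the quotient of the coordinate by the total sum. The index sets of the two sides of an axiom
agree only up to casts of finite sets, and `mk_congr` identifies the corresponding points of the
homotopy colimits.
-/

/-! ### Detecting continuity on test maps -/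

/-- A class `P` of maps from compact Hausdorff spaces to `Y` *detects continuity* if a map out of
`A × Y`, with `A` any compact Hausdorff space of parameters, is continuous as soon as its
compositions with the maps in `P` are. -/
def Detects (Y : Type) [TopologicalSpace Y] (P : ∀ T : CompHaus.{0}, C(cptHaus T, Y) → Prop) :
    Prop :=
  ∀ (A : CompHaus.{0}) (Z : Type) [TopologicalSpace Z] (g : cptHaus A × Y → Z),
    (∀ T f, P T f → Continuous fun p : cptHaus A × cptHaus T => g (p.1, f p.2)) → Continuous g

/-- The class `P` of test maps is closed under precomposition. -/
def TestsClosed {Y : Type} [TopologicalSpace Y] (P : ∀ T : CompHaus.{0}, C(cptHaus T, Y) → Prop) :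
    Prop :=
  ∀ (T T' : CompHaus.{0}) (f : C(cptHaus T, Y)) (h : C(cptHaus T', cptHaus T)), P T f →
    P T' (f.comp h)

/-- A map that is continuous on all compact Hausdorff test spaces, of a single variable. -/
theorem Detects.continuous {Y : Type} [TopologicalSpace Y]
    {P : ∀ T : CompHaus.{0}, C(cptHaus T, Y) → Prop} (hP : Detects Y P) {Z : Type}
    [TopologicalSpace Z] {g : Y → Z} (h : ∀ T f, P T f → Continuous fun t => g (f t)) :
    Continuous g :=
  (hP (CompHaus.of PUnit) Z (fun p => g p.2) fun T f hf => (h T f hf).comp continuous_snd).comp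
    (Continuous.prodMk_right (PUnit.unit : PUnit.{1}))

/-- Continuity in a parameter and a test point implies continuity along every map from the parameter
space. -/
theorem Detects.continuous_diag {Y : Type} [TopologicalSpace Y]
    {P : ∀ T : CompHaus.{0}, C(cptHaus T, Y) → Prop} (hP : Detects Y P) {Z : Type}
    [TopologicalSpace Z] {B : CompHaus.{0}} (g : cptHaus B × Y → Z)
    (h : ∀ T f, P T f → Continuous fun p : cptHaus B × cptHaus T => g (p.1, f p.2))
    (f : C(cptHaus B, Y)) : Continuous fun b => g (b, f b) :=
  (hP B Z g h).comp (continuous_id.prodMk f.continuous)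

theorem detects_all (Y : Type) [TopologicalSpace Y] [IsCG Y] : Detects Y fun _ _ => True :=
  fun _ _ _ g h => PtdSpace.continuous_prod_of_tests g fun S f => h S f trivial

theorem testsClosed_all (Y : Type) [TopologicalSpace Y] :
    TestsClosed (Y := Y) fun _ _ => True := fun _ _ _ _ _ => trivial

/-- The test maps of a disjoint union: those into the summands. -/
theorem detects_sigma {ι : Type} (Y : ι → Type) [∀ i, TopologicalSpace (Y i)]
    {P : ∀ i, ∀ T : CompHaus.{0}, C(cptHaus T, Y i) → Prop} (hP : ∀ i, Detects (Y i) (P i)) :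
    Detects (Σ i, Y i) fun T f => ∃ i f', P i T f' ∧ ∀ t, f t = ⟨i, f' t⟩ := by
  intro A Z _ g h
  rw [← (Homeomorph.prodComm _ _).comp_continuous_iff',
    ← (Homeomorph.sigmaProdDistrib).symm.comp_continuous_iff', continuous_sigma_iff]
  intro i
  exact (hP i A Z (fun p => g (p.1, ⟨i, p.2⟩)) fun T f hf =>
    h T (ContinuousMap.comp ⟨_, continuous_sigmaMk⟩ f) ⟨i, f, hf, fun t => rfl⟩).comp
    continuous_swap

theorem detects_pquot {E : Type} [TopologicalSpace E] [IsCG E] {r : E → E → Prop} {z : E → Prop}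
    {P : ∀ T : CompHaus.{0}, C(cptHaus T, E) → Prop} (hP : Detects E P) :
    Detects (PQuot E r z) fun T f =>
      (∀ t, f t = (PQuot E r z).pt) ∨ ∃ f', P T f' ∧ ∀ t, f t = PQuot.mk (f' t) := by
  intro A Z _ g h
  refine PQuot.continuous_joint g ?_ ?_
  · exact hP A Z (fun p => g (p.1, PQuot.mk p.2)) fun T f hf =>
      h T (ContinuousMap.comp ⟨_, PQuot.continuous_mk⟩ f) (Or.inr ⟨f, hf, fun t => rfl⟩)
  · exact (h (CompHaus.of PUnit) (ContinuousMap.const _ (PQuot E r z).pt)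
      (Or.inl fun t => rfl)).comp (Continuous.prodMk_left (PUnit.unit : PUnit.{1}))

/-- The test maps of a finite product in compactly generated spaces: tuples of test maps. The
coordinates are replaced by test maps one at a time. -/
theorem detects_pi {ι : Type} [Finite ι] (Y : ι → Type) [∀ i, TopologicalSpace (Y i)]
    {P : ∀ i, ∀ T : CompHaus.{0}, C(cptHaus T, Y i) → Prop} (hP : ∀ i, Detects (Y i) (P i))
    (hc : ∀ i, TestsClosed (P i)) {A : CompHaus.{0}} {Z : Type} [TopologicalSpace Z]
    (g : cptHaus A × (∀ i, Y i) → Z)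
    (h : ∀ (T : CompHaus.{0}) (f : ∀ i, C(cptHaus T, Y i)), (∀ i, P i T (f i)) →
      Continuous fun p : cptHaus A × cptHaus T => g (p.1, fun i => f i p.2))
    (B : CompHaus.{0}) (α : C(cptHaus B, cptHaus A)) (f : ∀ i, C(cptHaus B, Y i)) :
    Continuous fun b => g (α b, fun i => f i b) := by
  classical
  have := Fintype.ofFinite ι
  suffices H : ∀ (s : Finset ι) (B : CompHaus.{0}) (α : C(cptHaus B, cptHaus A))
      (f : ∀ i, C(cptHaus B, Y i)), (∀ i ∉ s, P i B (f i)) →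
      Continuous fun b => g (α b, fun i => f i b) from
    H Finset.univ B α f fun i hi => (hi (Finset.mem_univ i)).elim
  intro s
  induction s using Finset.induction_on with
  | empty =>
    intro B α f hf
    exact (h B f fun i => hf i (Finset.notMem_empty i)).comp (α.continuous.prodMk continuous_id)
  | insert o s ho ih =>
    intro B α f hf
    have key := (hP o).continuous_diag (B := B)
      (fun p => g (α p.1, Function.update (fun i => f i p.1) o p.2)) (fun T φ hφ => by
        let B' : CompHaus.{0} := CompHaus.of (cptHaus B × cptHaus T)
        let f' : ∀ i, C(cptHaus B', Y i) := Function.update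
          (fun i => (f i).comp ⟨Prod.fst, continuous_fst⟩) o (φ.comp ⟨Prod.snd, continuous_snd⟩)
        have h' := ih B' (α.comp ⟨Prod.fst, continuous_fst⟩) f' (fun i hi => by
          by_cases hio : i = o
          · subst hio
            simp only [f', Function.update_self]
            exact hc i _ _ _ _ hφ
          · simp only [f', Function.update_of_ne hio]
            exact hc i _ _ _ _ (hf i (by simp [hio, hi])))
        refine h'.congr fun b => ?_
        refine congrArg (fun y => g (α b.1, y)) (funext fun i => ?_)
        by_cases hio : i = o
        · subst hio; simp [f']
        · simp [f', Function.update_of_ne hio]) (f o)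
    refine key.congr fun b => ?_
    simp

/-- A continuous map out of a compactly generated space is continuous for the compactly generated
topology on the target. -/
theorem continuous_kify_mk {A Y : Type} [TopologicalSpace A] [IsCG A] [TopologicalSpace Y]
    {f : A → Y} (h : Continuous f) :
    Continuous fun a => (WithGeneratedByTopology.equiv (X := cptHaus) (Y := Y)).symm (f a) :=
  (IsGeneratedBy.equiv_symm_comp_continuous_iff (X := cptHaus) f).2 h

/-- The test maps of a smash product: tuples of test maps. -/
def SmashTest {κ : Type} {A : PtdSpace} {Y : κ → PtdSpace}
    (PA : ∀ T : CompHaus.{0}, C(cptHaus T, A) → Prop)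
    (PY : ∀ k, ∀ T : CompHaus.{0}, C(cptHaus T, Y k) → Prop) (T : CompHaus.{0})
    (f : C(cptHaus T, SymmSeq.smash A Y)) : Prop :=
  (∀ t, f t = (SymmSeq.smash A Y).pt) ∨
    ∃ (a : C(cptHaus T, A)) (y : ∀ k, C(cptHaus T, Y k)), PA T a ∧ (∀ k, PY k T (y k)) ∧ ∀ t, f t =
      SymmSeq.smash.mk (a t) fun k => y k t

namespace SymmSeq

theorem smash.continuous_mk {κ : Type} {A : PtdSpace} {Y : κ → PtdSpace} {T : Type}
    [TopologicalSpace T] [IsCG T] {a : T → A} {y : ∀ k, T → Y k} (ha : Continuous a)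
    (hy : ∀ k, Continuous (y k)) :
    Continuous fun t => (smash.mk (a t) fun k => y k t : smash A Y) :=
  PQuot.continuous_mk.comp (continuous_kify_mk (ha.prodMk (continuous_pi hy)))

theorem smash.mk_pt_left {κ : Type} {A : PtdSpace} {Y : κ → PtdSpace} (y : ∀ k, Y k) :
    (smash.mk A.pt y : smash A Y) = (smash A Y).pt := PQuot.mk_base (Or.inl rfl)

theorem smash.mk_pt_right {κ : Type} {A : PtdSpace} {Y : κ → PtdSpace} (a : A) (y : ∀ k, Y k)
    (k : κ) (h : y k = (Y k).pt) : (smash.mk a y : smash A Y) = (smash A Y).pt :=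
  PQuot.mk_base (Or.inr ⟨k, h⟩)

theorem detects_smash {κ : Type} [Finite κ] {A : PtdSpace} {Y : κ → PtdSpace}
    {PA : ∀ T : CompHaus.{0}, C(cptHaus T, A) → Prop}
    {PY : ∀ k, ∀ T : CompHaus.{0}, C(cptHaus T, Y k) → Prop}
    (hA : Detects A PA) (cA : TestsClosed PA) (hY : ∀ k, Detects (Y k) (PY k))
    (cY : ∀ k, TestsClosed (PY k)) : Detects (smash A Y) (SmashTest PA PY) := by
  have h₀ := detects_pquot (r := fun _ _ => False)
    (z := fun e : Kify (A × ∀ k, Y k) => (WithGeneratedByTopology.equiv (X := cptHaus) e).1 = A.pt ∨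
      ∃ k, (WithGeneratedByTopology.equiv (X := cptHaus) e).2 k = (Y k).pt)
    (detects_all (Kify (A × ∀ k, Y k)))
  intro B Z _ g h
  refine h₀ B Z g fun T f hf => ?_
  rcases hf with hf | ⟨f', -, hf⟩
  · exact h T f (Or.inl hf)
  let e := WithGeneratedByTopology.equiv (X := cptHaus) (Y := A × ∀ k, Y k)
  have he : Continuous e := WithGeneratedByTopology.continuous_equiv
  let a : C(cptHaus T, A) := ⟨fun t => (e (f' t)).1, continuous_fst.comp (he.comp f'.continuous)⟩
  let y : ∀ k, C(cptHaus T, Y k) := fun k =>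
    ⟨fun t => (e (f' t)).2 k, (continuous_apply k).comp
      (continuous_snd.comp (he.comp f'.continuous))⟩
  let BT : CompHaus.{0} := CompHaus.of (cptHaus B × cptHaus T)
  have key := hA.continuous_diag (B := BT)
    (fun p => g (p.1.1, smash.mk p.2 fun k => y k p.1.2)) (fun T' a' ha' => by
      have := detects_pi (fun k => (Y k : Type)) hY cY
        (A := CompHaus.of (cptHaus B × cptHaus T'))
        (fun p => g (p.1.1, smash.mk (a' p.1.2) p.2)) (fun T'' y'' hy'' => by
          have h₁ := h (CompHaus.of (cptHaus T' × cptHaus T''))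
            ⟨fun t => smash.mk (a' t.1) fun k => y'' k t.2, smash.continuous_mk
              (a'.continuous.comp continuous_fst) fun k => (y'' k).continuous.comp continuous_snd⟩
            (Or.inr ⟨a'.comp ⟨_, continuous_fst⟩, fun k => (y'' k).comp ⟨_, continuous_snd⟩,
              cA _ _ _ _ ha', fun k => cY k _ _ _ _ (hy'' k), fun t => rfl⟩)
          exact h₁.comp (f := fun p : (cptHaus B × cptHaus T') × cptHaus T'' =>
            (p.1.1, ((p.1.2, p.2) : cptHaus T' × cptHaus T''))) (by fun_prop))
        (CompHaus.of (cptHaus BT × cptHaus T'))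
        ⟨fun p : (cptHaus B × cptHaus T) × cptHaus T' => (p.1.1, p.2),
          (continuous_fst.comp continuous_fst).prodMk continuous_snd⟩
        (fun k => ⟨fun p : (cptHaus B × cptHaus T) × cptHaus T' => y k p.1.2,
          (y k).continuous.comp (continuous_snd.comp continuous_fst)⟩)
      exact this)
    ⟨fun p => a p.2, a.continuous.comp continuous_snd⟩
  refine key.congr fun p => ?_
  exact congrArg (fun x => g (p.1, x)) (hf p.2).symm

/-- The map out of a smash product given by a function that is continuous on test spaces and takes
the base point if one of its variables does. -/
def smash.desc {κ : Type} {A : PtdSpace} {Y : κ → PtdSpace} {Z : PtdSpace}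
    (h : A → (∀ k, Y k) → Z)
    (hc : ∀ (T : CompHaus.{0}) (a : C(cptHaus T, A)) (y : ∀ k, C(cptHaus T, Y k)),
      Continuous fun t => h (a t) fun k => y k t)
    (hA : ∀ y, h A.pt y = Z.pt) (hY : ∀ a y k, y k = (Y k).pt → h a y = Z.pt) :
    smash A Y ⟶ Z :=
  PQuot.desc (fun e => h (WithGeneratedByTopology.equiv (X := cptHaus) e).1
      (WithGeneratedByTopology.equiv (X := cptHaus) e).2)
    ((detects_all (Kify (A × ∀ k, Y k))).continuous fun T f _ =>
      hc T ⟨_, continuous_fst.comp (WithGeneratedByTopology.continuous_equiv.comp f.continuous)⟩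
        fun k => ⟨_, (continuous_apply k).comp
          (continuous_snd.comp (WithGeneratedByTopology.continuous_equiv.comp f.continuous))⟩)
    (fun _ _ h => h.elim)
    (by
      rintro e (he | ⟨k, he⟩)
      · rw [he, hA]
      · exact hY _ _ k he)

theorem smash.cases {κ : Type} {A : PtdSpace} {Y : κ → PtdSpace} (x : smash A Y) :
    x = (smash A Y).pt ∨ ∃ a y, x = smash.mk a y :=
  PQuot.ind (P := fun x => x = (smash A Y).pt ∨ ∃ a y, x = smash.mk a y) (Or.inl rfl)
    (fun e => Or.inr ⟨(WithGeneratedByTopology.equiv (X := cptHaus) e).1,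
      (WithGeneratedByTopology.equiv (X := cptHaus) e).2, rfl⟩) x

end SymmSeq

/-- The test maps of a wedge: those into the summands. -/
def WedgeTest {ι : Type} {X : ι → PtdSpace} (P : ∀ i, ∀ T : CompHaus.{0}, C(cptHaus T, X i) → Prop)
    (T : CompHaus.{0}) (f : C(cptHaus T, Wedge X)) : Prop :=
  (∀ t, f t = (Wedge X).pt) ∨ ∃ i f', P i T f' ∧ ∀ t, f t = Wedge.incl X i (f' t)

namespace Wedge

theorem detects {ι : Type} {X : ι → PtdSpace}
    {P : ∀ i, ∀ T : CompHaus.{0}, C(cptHaus T, X i) → Prop}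
    (hP : ∀ i, Detects (X i) (P i)) : Detects (Wedge X) (WedgeTest P) := by
  have h₀ := detects_pquot (r := fun _ _ => False) (z := fun e : Σ i, X i => e.2 = (X e.1).pt)
    (detects_sigma (fun i => (X i : Type)) hP)
  intro B Z _ g h
  refine h₀ B Z g fun T f hf => h T f ?_
  rcases hf with hf | ⟨f', ⟨i, f'', hf'', h''⟩, hf⟩
  · exact Or.inl hf
  · exact Or.inr ⟨i, f'', hf'', fun t => (hf t).trans (congrArg PQuot.mk (h'' t))⟩

theorem cases {ι : Type} {X : ι → PtdSpace} (x : Wedge X) :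
    x = (Wedge X).pt ∨ ∃ i y, x = Wedge.incl X i y :=
  PQuot.ind (P := fun x => x = (Wedge X).pt ∨ ∃ i y, x = Wedge.incl X i y) (Or.inl rfl)
    (fun e => Or.inr ⟨e.1, e.2, rfl⟩) x

end Wedge

/-- A pointed map with a continuous inverse is an isomorphism: the inverse is automatically
pointed. -/
theorem PtdSpace.isIso_of_leftInverse {X Y : PtdSpace} (f : X ⟶ Y) (g : Y → X)
    (h₁ : ∀ x, g (f x) = x) (h₂ : ∀ y, f (g y) = y) (hg : Continuous g) : IsIso f :=
  ⟨⟨g, hg, by rw [← f.map_pt, h₁]⟩, PtdSpace.hom_ext h₁, PtdSpace.hom_ext h₂⟩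

/-! ### Couplings of points of simplices -/

namespace Coupling

theorem map_apply {X Y : Type} [Fintype X] [Fintype Y] [DecidableEq Y] (f : X → Y)
    (s : stdSimplex ℝ X) (y : Y) : stdSimplex.map f s y = ∑ x with f x = y, s x := by
  rw [stdSimplex.map_coe, FunOnFinite.linearMap_apply_apply]

theorem map_map {X Y Z : Type} [Fintype X] [Fintype Y] [Fintype Z] (f : X → Y) (g : Y → Z)
    (s : stdSimplex ℝ X) : stdSimplex.map g (stdSimplex.map f s) = stdSimplex.map (g ∘ f) s :=
  stdSimplex.map_comp_apply f g s

theorem sum_map {X Y : Type} [Fintype X] [Fintype Y] [DecidableEq Y] (f : X → Y)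
    (s : stdSimplex ℝ X) (p : Y → Prop) [DecidablePred p] :
    ∑ y with p y, stdSimplex.map f s y = ∑ x with p (f x), s x := by
  simp only [map_apply]
  rw [Finset.sum_comm' (t' := Finset.univ.filter fun x => p (f x)) (s' := fun x => {f x})]
  · simp
  · intro y x
    simp only [Finset.mem_filter, Finset.mem_univ, true_and, Finset.mem_singleton]
    constructor
    · rintro ⟨h, rfl⟩; exact ⟨rfl, h⟩
    · rintro ⟨rfl, h⟩; exact ⟨h, rfl⟩

theorem map_apply_inj {X Y : Type} [Fintype X] [Fintype Y] {f : X → Y}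
    (hf : Function.Injective f) (s : stdSimplex ℝ X) (x : X) : stdSimplex.map f s (f x) = s x := by
  classical
  rw [map_apply, Finset.sum_eq_single x]
  · intro b hb hx
    exact (hx (hf (Finset.mem_filter.1 hb).2)).elim
  · intro h
    exact (h (by simp)).elim

theorem map_injective {X Y : Type} [Fintype X] [Fintype Y] {f : X → Y}
    (hf : Function.Injective f) : Function.Injective (stdSimplex.map (S := ℝ) f) := by
  intro s t h
  refine stdSimplex.ext (funext fun x => ?_)
  rw [← map_apply_inj hf s x, ← map_apply_inj hf t x, h]

theorem le_map_apply {X Y : Type} [Fintype X] [Fintype Y] (f : X → Y)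
    (s : stdSimplex ℝ X) (x : X) : s x ≤ stdSimplex.map f s (f x) := by
  classical
  rw [map_apply]
  exact Finset.single_le_sum (f := fun x => s x) (fun i _ => stdSimplex.zero_le s i) (by simp)

theorem exists_pos_of_map_pos {X Y : Type} [Fintype X] [Fintype Y] (f : X → Y)
    (s : stdSimplex ℝ X) (y : Y) (h : 0 < stdSimplex.map f s y) : ∃ x, f x = y ∧ 0 < s x := by
  classical
  rw [map_apply] at h
  obtain ⟨x, hx, hx'⟩ := Finset.exists_lt_of_sum_lt (s := Finset.univ.filter fun x => f x = y)
    (f := fun _ => (0 : ℝ)) (g := fun x => s x) (by simpa using h)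
  exact ⟨x, (Finset.mem_filter.1 hx).2, hx'⟩

theorem exists_pos {X : Type} [Fintype X] (s : stdSimplex ℝ X) : ∃ x, 0 < s x := by
  obtain ⟨x, hx, hx'⟩ := Finset.exists_lt_of_sum_lt (s := (Finset.univ : Finset X))
    (f := fun _ => (0 : ℝ)) (g := fun x => s x) (by simp)
  exact ⟨x, hx'⟩

/-- A measure on a finite partially ordered set is determined by its distribution function. -/
theorem ext_cdf {P : Type} [Fintype P] [PartialOrder P] [DecidableLE P] {f g : P → ℝ}
    (h : ∀ x, ∑ y with y ≤ x, f y = ∑ y with y ≤ x, g y) : f = g := by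
  classical
  have hw : WellFounded ((· < ·) : P → P → Prop) := wellFounded_lt
  refine funext fun x => hw.induction (C := fun x => f x = g x) x fun x ih => ?_
  have hs : ∀ k : P → ℝ, ∑ y with y ≤ x, k y = k x + ∑ y with y < x, k y := fun k => by
    have : (Finset.univ.filter fun y => y ≤ x) = insert x (Finset.univ.filter fun y => y < x) := by
      ext y
      simp [le_iff_eq_or_lt]
    rw [this, Finset.sum_insert (by simp)]
  have h' : ∑ y with y < x, f y = ∑ y with y < x, g y :=
    Finset.sum_congr rfl fun y hy => ih y (Finset.mem_filter.1 hy).2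
  have := h x
  rw [hs f, hs g, h'] at this
  exact add_right_cancel this

variable {ι : Type} [Fintype ι] [DecidableEq ι] {n : ι → ℕ}

/-- The product of the vertex sets of a family of simplices. -/
abbrev Verts (n : ι → ℕ) : Type := ∀ i, Fin (n i + 1)

/-- The sum of the coordinates, a strictly monotone function on the vertices. -/
def rank (y : Verts n) : ℕ := ∑ i, (y i : ℕ)

theorem le_of_rank_le {y y' : Verts n} (h : y ≤ y' ∨ y' ≤ y) (hr : rank y ≤ rank y') : y ≤ y' := by
  rcases h with h | h
  · exact h
  · have := (Finset.sum_eq_sum_iff_of_le (s := Finset.univ) (f := fun i => (y' i : ℕ))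
      (g := fun i => (y i : ℕ)) fun i _ => h i).1
      (le_antisymm (Finset.sum_le_sum fun i _ => h i) hr)
    exact fun i => Fin.le_def.2 (this i (Finset.mem_univ i)).ge

/-- The support of a measure is totally ordered. -/
def ChainSupp (ν : stdSimplex ℝ (Verts n)) : Prop :=
  ∀ y y', 0 < ν y → 0 < ν y' → y ≤ y' ∨ y' ≤ y

theorem chainSupp_map {m : ℕ} (θ : Fin (m + 1) →o Verts n) (u : stdSimplex ℝ (Fin (m + 1))) :
    ChainSupp (stdSimplex.map θ u) := by
  intro y y' h h'
  obtain ⟨x, rfl, -⟩ := exists_pos_of_map_pos _ _ _ h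
  obtain ⟨x', rfl, -⟩ := exists_pos_of_map_pos _ _ _ h'
  rcases le_total x x' with hx | hx
  · exact Or.inl (θ.monotone hx)
  · exact Or.inr (θ.monotone hx)

open Classical in
/-- The distribution function of a measure supported on a chain is the minimum of the distribution
functions of its marginals. -/
theorem ChainSupp.cdf [Nonempty ι] {ν : stdSimplex ℝ (Verts n)} (hν : ChainSupp ν) (x : Verts n) :
    ∃ i, ∑ y with y ≤ x, ν y = ∑ y with y i ≤ x i, ν y := by
  by_contra! hne
  have hlt : ∀ i, ∃ y : Verts n, y i ≤ x i ∧ ¬ y ≤ x ∧ 0 < ν y := fun i => by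
    have hsub : (Finset.univ.filter fun y : Verts n => y ≤ x) ⊆
        Finset.univ.filter fun y => y i ≤ x i := by
      intro y hy
      simp only [Finset.mem_filter, Finset.mem_univ, true_and] at hy ⊢
      exact hy i
    by_contra! hn
    refine hne i (Finset.sum_subset hsub fun y hy hy' => ?_)
    simp only [Finset.mem_filter, Finset.mem_univ, true_and] at hy hy'
    exact le_antisymm (hn y hy hy') (stdSimplex.zero_le ν y)
  choose y h₁ h₂ h₃ using hlt
  obtain ⟨i₀, hi₀⟩ := Finite.exists_min fun i => rank (y i)
  exact h₂ i₀ fun i =>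
    (le_of_rank_le (hν _ _ (h₃ i₀) (h₃ i)) (hi₀ i) i).trans (h₁ i)

/-- A measure supported on a chain is determined by its marginals. -/
theorem ChainSupp.ext [Nonempty ι] {ν ν' : stdSimplex ℝ (Verts n)} (hν : ChainSupp ν)
    (hν' : ChainSupp ν')
    (h : ∀ i, stdSimplex.map (fun y : Verts n => y i) ν = stdSimplex.map (fun y => y i) ν') :
    ν = ν' := by
  classical
  refine stdSimplex.ext (ext_cdf fun x => ?_)
  have hm : ∀ i, ∑ y with y i ≤ x i, ν y = ∑ y with y i ≤ x i, ν' y := fun i => by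
    have := sum_map (fun y : Verts n => y i) ν fun a => a ≤ x i
    have h' := sum_map (fun y : Verts n => y i) ν' fun a => a ≤ x i
    rw [← this, ← h', h i]
  have hle : ∀ (ν : stdSimplex ℝ (Verts n)) i, ∑ y with y ≤ x, ν y ≤ ∑ y with y i ≤ x i, ν y :=
    fun ν i => Finset.sum_le_sum_of_subset_of_nonneg (by
      intro y hy
      simp only [Finset.mem_filter, Finset.mem_univ, true_and] at hy ⊢
      exact hy i) fun y _ _ => stdSimplex.zero_le ν y
  -- Both distribution functions are minima of those of the marginals.
  obtain ⟨i, hi⟩ := hν.cdf x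
  obtain ⟨i', hi'⟩ := hν'.cdf x
  refine le_antisymm ?_ ?_
  · rw [hi', ← hm i']; exact hle ν i'
  · rw [hi, hm i]; exact hle ν' i

theorem exists_enum_of_rank {Q : Type} [Fintype Q] {s : ℕ} (hs : Fintype.card Q = s + 1)
    (ρ : Q → ℕ) (hρ : Function.Injective ρ) :
    ∃ e : Fin (s + 1) ≃ Q, ∀ j j', ρ (e j) ≤ ρ (e j') ↔ j ≤ j' := by
  let _ : LinearOrder Q := LinearOrder.lift' ρ hρ
  let e : Fin (s + 1) ≃o Q := monoEquivOfFin Q hs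
  exact ⟨e.toEquiv, fun j j' => e.le_iff_le⟩

/-- A measure supported on a chain is the image of a measure on a simplex under an injective
monotone map onto its support. -/
theorem ChainSupp.exists_enum {ν : stdSimplex ℝ (Verts n)} (hν : ChainSupp ν) :
    ∃ (s : ℕ) (c : Fin (s + 1) →o Verts n) (w : stdSimplex ℝ (Fin (s + 1))),
      s < Fintype.card (Verts n) ∧ stdSimplex.map c w = ν ∧ (∀ j, 0 < w j) ∧
      (∀ j j', c j ≤ c j' → j ≤ j') := by
  classical
  let Q := {y : Verts n // 0 < ν y}
  -- The rank is strictly monotone on the support and enumerates it.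
  have hinj : Function.Injective fun q : Q => rank q.1 := fun q q' h =>
    Subtype.ext (le_antisymm (le_of_rank_le (hν _ _ q.2 q'.2) (le_of_eq h))
      (le_of_rank_le (hν _ _ q'.2 q.2) (le_of_eq h.symm)))
  obtain ⟨y₀, hy₀⟩ := exists_pos ν
  have hpos : 0 < Fintype.card Q := Fintype.card_pos_iff.2 ⟨⟨y₀, hy₀⟩⟩
  obtain ⟨s, hs⟩ := Nat.exists_eq_add_of_lt hpos
  rw [zero_add] at hs
  obtain ⟨e, he⟩ := exists_enum_of_rank hs _ hinj
  let c : Fin (s + 1) →o Verts n := ⟨fun j => (e j).1, fun j j' h =>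
    le_of_rank_le (hν _ _ (e j).2 (e j').2) ((he j j').2 h)⟩
  have hc : Function.Injective c := Subtype.val_injective.comp e.injective
  have hsum : ∑ j, ν (c j) = 1 := by
    rw [← stdSimplex.sum_eq_one ν, ← Finset.sum_subset (Finset.subset_univ (Finset.univ.image c)),
      Finset.sum_image fun _ _ _ _ h => hc h]
    intro y _ hy
    by_contra hne
    refine hy (Finset.mem_image.2 ⟨e.symm ⟨y, lt_of_le_of_ne (stdSimplex.zero_le ν y)
      (Ne.symm hne)⟩,
      Finset.mem_univ _, ?_⟩)
    change (e (e.symm _)).1 = y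
    rw [e.apply_symm_apply]
  let w : stdSimplex ℝ (Fin (s + 1)) := ⟨fun j => ν (c j), fun j => stdSimplex.zero_le ν _, hsum⟩
  refine ⟨s, c, w, ?_, ?_, fun j => (e j).2, fun j j' h => ?_⟩
  · have := Fintype.card_subtype_le fun y : Verts n => 0 < ν y
    have hs' : Fintype.card {y : Verts n // 0 < ν y} = s + 1 := by
      rw [← hs]
    omega
  · refine stdSimplex.ext (funext fun y => ?_)
    by_cases hy : 0 < ν y
    · have : y = c (e.symm ⟨y, hy⟩) := by
        change y = (e (e.symm _)).1
        rw [e.apply_symm_apply]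
      rw [this, map_apply_inj hc]
      rfl
    · rw [le_antisymm (not_lt.1 hy) (stdSimplex.zero_le ν y)]
      by_contra hne
      obtain ⟨j, rfl, -⟩ := exists_pos_of_map_pos c w y
        (lt_of_le_of_ne (stdSimplex.zero_le _ _) (Ne.symm hne))
      exact hy (e j).2
  · have : rank (e j).1 ≤ rank (e j').1 := Finset.sum_le_sum fun i _ => h i
    exact (he j j').1 this

/-- A point of a simplex lies in the interior of a face. -/
theorem exists_pos_face {m : ℕ} (u : stdSimplex ℝ (Fin (m + 1))) :
    ∃ (r : ℕ) (e : Fin (r + 1) →o Fin (m + 1)) (v : stdSimplex ℝ (Fin (r + 1))),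
      stdSimplex.map e v = u ∧ ∀ j, 0 < u (e j) := by
  let Q := {j : Fin (m + 1) // 0 < u j}
  obtain ⟨j₀, hj₀⟩ := exists_pos u
  obtain ⟨r, hr⟩ := Nat.exists_eq_add_of_lt (Fintype.card_pos_iff.2 ⟨(⟨j₀, hj₀⟩ : Q)⟩)
  rw [zero_add] at hr
  let e' : Fin (r + 1) ≃o Q := monoEquivOfFin Q hr
  let e : Fin (r + 1) →o Fin (m + 1) := ⟨fun j => (e' j).1, fun j j' h => e'.monotone h⟩
  have he : Function.Injective e := Subtype.val_injective.comp e'.injective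
  have hsum : ∑ j, u (e j) = 1 := by
    rw [← stdSimplex.sum_eq_one u, ← Finset.sum_subset (Finset.subset_univ (Finset.univ.image e)),
      Finset.sum_image fun _ _ _ _ h => he h]
    intro y _ hy
    by_contra hne
    refine hy (Finset.mem_image.2 ⟨e'.symm ⟨y, lt_of_le_of_ne (stdSimplex.zero_le u y)
      (Ne.symm hne)⟩,
      Finset.mem_univ _, ?_⟩)
    change (e' (e'.symm _)).1 = y
    rw [e'.apply_symm_apply]
  let v : stdSimplex ℝ (Fin (r + 1)) := ⟨fun j => u (e j), fun j => stdSimplex.zero_le u _, hsum⟩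
  have hv : stdSimplex.map e v = u := by
    refine stdSimplex.ext (funext fun y => ?_)
    by_cases hy : 0 < u y
    · have : y = e (e'.symm ⟨y, hy⟩) := by
        change y = (e' (e'.symm _)).1
        rw [e'.apply_symm_apply]
      rw [this, map_apply_inj he]
      rfl
    · rw [le_antisymm (not_lt.1 hy) (stdSimplex.zero_le u y)]
      by_contra hne
      obtain ⟨j, rfl, -⟩ := exists_pos_of_map_pos e v y
        (lt_of_le_of_ne (stdSimplex.zero_le _ _) (Ne.symm hne))
      exact hy (e' j).2
  exact ⟨r, e, v, hv, fun j => (e' j).2⟩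

theorem map_eq_of_comp_eq {X Y X' P : Type} [Fintype X] [Fintype Y] [Fintype X'] [Fintype P]
    {θ : X → P} {e : X' → X} {c : Y → P} {d : X' → Y} (h : c ∘ d = θ ∘ e)
    (hc : Function.Injective c) {u : stdSimplex ℝ X} {v : stdSimplex ℝ X'} {w : stdSimplex ℝ Y}
    (hu : stdSimplex.map θ u = stdSimplex.map c w) (hv : stdSimplex.map e v = u) :
    stdSimplex.map d v = w := map_injective hc (by rw [map_map, h, ← map_map, hv, hu])

/-- The simplicial relations identify any two presentations of points of simplices with the same
marginals: a function of presentations that is compatible with the simplicial relations only depends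
on the marginals. -/
theorem eq_of_marginals [Nonempty ι] {Z : Type*}
    (V : ∀ m : ℕ, (Fin (m + 1) →o Verts n) → stdSimplex ℝ (Fin (m + 1)) → Z)
    (hV : ∀ (m r : ℕ) (e : Fin (r + 1) →o Fin (m + 1)) (θ : Fin (m + 1) →o Verts n)
      (u : stdSimplex ℝ (Fin (r + 1))), V r (θ.comp e) u = V m θ (stdSimplex.map e u))
    {m m' : ℕ} (θ : Fin (m + 1) →o Verts n) (u : stdSimplex ℝ (Fin (m + 1)))
    (θ' : Fin (m' + 1) →o Verts n) (u' : stdSimplex ℝ (Fin (m' + 1)))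
    (h : ∀ i, stdSimplex.map (fun j => θ j i) u = stdSimplex.map (fun j => θ' j i) u') :
    V m θ u = V m' θ' u' := by
  classical
  have hν : stdSimplex.map θ u = stdSimplex.map θ' u' :=
    (chainSupp_map θ u).ext (chainSupp_map θ' u') fun i => by
      rw [map_map, map_map]; exact h i
  obtain ⟨s, c, w, -, hcw, hw, hc⟩ := (chainSupp_map θ u).exists_enum
  have hci : Function.Injective c := fun j j' e =>
    le_antisymm (hc _ _ (le_of_eq e)) (hc _ _ (le_of_eq e.symm))
  -- Every presentation reduces to the one on the support of the common measure.
  suffices H : ∀ (m : ℕ) (θ : Fin (m + 1) →o Verts n) (u : stdSimplex ℝ (Fin (m + 1))),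
      stdSimplex.map θ u = stdSimplex.map c w → V m θ u = V s c w from
    (H m θ u hcw.symm).trans (H m' θ' u' (hν.symm.trans hcw.symm)).symm
  intro m θ u hu
  obtain ⟨r, e, v, hv, he⟩ := exists_pos_face u
  have hd : ∀ j : Fin (r + 1), ∃ k, c k = θ (e j) := fun j => by
    have h₁ : 0 < stdSimplex.map θ u (θ (e j)) :=
      lt_of_lt_of_le (he j) (le_map_apply θ u (e j))
    rw [hu] at h₁
    obtain ⟨k, hk, -⟩ := exists_pos_of_map_pos _ _ _ h₁
    exact ⟨k, hk⟩
  choose d hd using hd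
  let d' : Fin (r + 1) →o Fin (s + 1) := ⟨d, fun j j' h => hc _ _ (by
    rw [hd, hd]; exact θ.monotone (e.monotone h))⟩
  have hcd : c.comp d' = θ.comp e := OrderHom.ext _ _ (funext hd)
  have hdv : stdSimplex.map d' v = w :=
    map_eq_of_comp_eq (θ := θ) (c := c) (funext hd) hci hu hv
  rw [← hv, ← hV, ← hcd, hV, hdv]

/-! #### Existence of couplings -/

section quantile
variable {m : ℕ} (t : stdSimplex ℝ (Fin (m + 1)))

/-- The distribution function of a measure on `Fin (m + 1)`. -/
noncomputable def cdf (a : Fin (m + 1)) : ℝ := ∑ b with b ≤ a, t b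

/-- The quantile function of a measure on `Fin (m + 1)`. -/
noncomputable def quantile (x : ℝ) : Fin (m + 1) :=
  if h : (Finset.univ.filter fun a => x < cdf t a).Nonempty then
    (Finset.univ.filter fun a => x < cdf t a).min' h else Fin.last m

theorem cdf_mono : Monotone (cdf t) := fun a b h =>
  Finset.sum_le_sum_of_subset_of_nonneg (fun c hc => by
    simp only [Finset.mem_filter, Finset.mem_univ, true_and] at hc ⊢
    exact hc.trans h) fun c _ _ => stdSimplex.zero_le t c

theorem cdf_last : cdf t (Fin.last m) = 1 := by
  rw [← stdSimplex.sum_eq_one t, cdf, Finset.filter_true_of_mem fun b _ => Fin.le_last b]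

theorem cdf_le_one (a : Fin (m + 1)) : cdf t a ≤ 1 := cdf_last t ▸ cdf_mono t (Fin.le_last a)

theorem cdf_nonneg (a : Fin (m + 1)) : 0 ≤ cdf t a := Finset.sum_nonneg fun c _ =>
    stdSimplex.zero_le t c

theorem quantile_le_iff {x : ℝ} (hx : x < 1) (a : Fin (m + 1)) :
    quantile t x ≤ a ↔ x < cdf t a := by
  have hne : (Finset.univ.filter fun a => x < cdf t a).Nonempty :=
    ⟨Fin.last m, by simp [cdf_last, hx]⟩
  rw [quantile, dif_pos hne]
  constructor
  · intro h
    have := (Finset.mem_filter.1 (Finset.min'_mem _ hne)).2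
    exact this.trans_le (cdf_mono t h)
  · intro h
    exact Finset.min'_le _ _ (by simp [h])

theorem quantile_mono {x y : ℝ} (hy : y < 1) (h : x ≤ y) : quantile t x ≤ quantile t y :=
  (quantile_le_iff t (h.trans_lt hy) _).2
    (h.trans_lt ((quantile_le_iff t hy _).1 le_rfl))

end quantile

open MeasureTheory in
/-- Every family of measures on finite ordinals has a coupling supported on a chain: the quantile
coupling, i.e. the image of Lebesgue measure on `[0, 1)` under the quantile functions. -/
theorem exists_chainSupp (t : ∀ i, stdSimplex ℝ (Fin (n i + 1))) :
    ∃ ν : stdSimplex ℝ (Verts n), ChainSupp ν ∧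
      ∀ i, stdSimplex.map (fun y : Verts n => y i) ν = t i := by
  classical
  -- The mass of a vertex is the length of the interval where it is the tuple of quantiles.
  let E : Verts n → Set ℝ := fun y => {x | x ∈ Set.Ico (0 : ℝ) 1 ∧ ∀ i, quantile (t i) x = y i}
  have hE : ∀ y, MeasurableSet (E y) := fun y => by
    have : (E y).OrdConnected := ⟨fun x hx x' hx' z hz =>
      ⟨⟨hx.1.1.trans hz.1, hz.2.trans_lt hx'.1.2⟩, fun i => le_antisymm
        (hx'.2 i ▸ quantile_mono (t i) hx'.1.2 hz.2)
        (hx.2 i ▸ quantile_mono (t i) (hz.2.trans_lt hx'.1.2) hz.1)⟩⟩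
    exact this.measurableSet
  have hsub : ∀ y, E y ⊆ Set.Ico 0 1 := fun y x hx => hx.1
  have hfin : ∀ y, volume (E y) ≠ ⊤ := fun y =>
    ((measure_mono (hsub y)).trans_lt (by simp)).ne
  have hsum : ∀ (p : Verts n → Prop) [DecidablePred p], ∑ y with p y, volume.real (E y) =
      volume.real {x | x ∈ Set.Ico (0 : ℝ) 1 ∧ p fun i => quantile (t i) x} := fun p _ => by
    rw [← measureReal_biUnion_finset (s := Finset.univ.filter p) (f := E)
      (fun y _ y' _ h => Set.disjoint_left.2 fun x hx hx' => h (funext fun i =>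
        (hx.2 i).symm.trans (hx'.2 i))) (fun y _ => hE y) (fun y _ => hfin y)]
    congr 1
    ext x
    simp only [Set.mem_iUnion, Finset.mem_filter, Finset.mem_univ, true_and, exists_prop,
      Set.mem_ofPred_eq]
    constructor
    · rintro ⟨y, hy, hx, h⟩
      exact ⟨hx, by rwa [show (fun i => quantile (t i) x) = y from funext h]⟩
    · rintro ⟨hx, h⟩
      exact ⟨_, h, hx, fun i => rfl⟩
  let ν : stdSimplex ℝ (Verts n) := ⟨fun y => volume.real (E y), fun y => measureReal_nonneg, by
    have := hsum fun _ => True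
    simp only [Finset.filter_true, and_true] at this
    rw [this]
    change volume.real (Set.Ico (0 : ℝ) 1) = 1
    simp [measureReal_def]⟩
  have hν : ∀ y, 0 < ν y → (E y).Nonempty := fun y hy => by
    by_contra hne
    rw [Set.not_nonempty_iff_eq_empty] at hne
    have : ν y = volume.real (E y) := rfl
    rw [this, hne] at hy
    simp at hy
  refine ⟨ν, fun y y' hy hy' => ?_, fun i => stdSimplex.ext (ext_cdf fun a => ?_)⟩
  · obtain ⟨x, hx⟩ := hν y hy
    obtain ⟨x', hx'⟩ := hν y' hy'
    rcases le_total x x' with h | h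
    · exact Or.inl fun i => hx.2 i ▸ hx'.2 i ▸ quantile_mono (t i) hx'.1.2 h
    · exact Or.inr fun i => hx.2 i ▸ hx'.2 i ▸ quantile_mono (t i) hx.1.2 h
  · rw [sum_map (fun y : Verts n => y i) ν fun b => b ≤ a]
    have h₁ := hsum fun y => y i ≤ a
    have h₂ : {x | x ∈ Set.Ico (0 : ℝ) 1 ∧ quantile (t i) x ≤ a} = Set.Ico 0 (cdf (t i) a) := by
      ext x
      constructor
      · rintro ⟨hx, h⟩
        exact ⟨hx.1, (quantile_le_iff _ hx.2 _).1 h⟩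
      · rintro ⟨h0, h⟩
        have hx := h.trans_le (cdf_le_one (t i) a)
        exact ⟨⟨h0, hx⟩, (quantile_le_iff _ hx _).2 h⟩
    refine Eq.trans h₁ ?_
    rw [h₂]
    simp [measureReal_def, cdf_nonneg]
    rfl

/-- Finitely many points of simplices are the images of a single point of a simplex of bounded
dimension under monotone maps. -/
theorem exists_common (t : ∀ i, stdSimplex ℝ (Fin (n i + 1))) :
    ∃ (s : ℕ) (c : Fin (s + 1) →o Verts n) (w : stdSimplex ℝ (Fin (s + 1))),
      s < Fintype.card (Verts n) ∧ ∀ i, stdSimplex.map (fun j => c j i) w = t i := by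
  obtain ⟨ν, hν, ht⟩ := exists_chainSupp t
  obtain ⟨s, c, w, hs, hw, -, -⟩ := hν.exists_enum
  refine ⟨s, c, w, hs, fun i => ?_⟩
  rw [← ht i, ← hw, map_map]
  rfl

end Coupling

/-! ### Products of homotopy colimits -/

/-- A function of finitely many variables that is compatible with a relation in each variable is
compatible with the generated equivalence relations. -/
theorem eq_of_quot_eq {ι : Type} [Finite ι] {E : ι → Type*} {r : ∀ i, E i → E i → Prop} {Z : Type*}
    [DecidableEq ι]
    (v : (∀ i, E i) → Z) (hv : ∀ e i b, r i (e i) b → v e = v (Function.update e i b))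
    {e e' : ∀ i, E i} (h : ∀ i, Quot.mk (r i) (e i) = Quot.mk (r i) (e' i)) : v e = v e' := by
  have := Fintype.ofFinite ι
  have step : ∀ (f : ∀ i, E i) (i : ι) (a b : E i), Quot.mk (r i) a = Quot.mk (r i) b →
      v (Function.update f i a) = v (Function.update f i b) := fun f i a b hab => by
    let w : Quot (r i) → Z := Quot.lift (fun a => v (Function.update f i a)) fun a b hr => by
      have := hv (Function.update f i a) i b (by rwa [Function.update_self])
      rwa [Function.update_idem] at this
    exact congrArg w hab
  suffices H : ∀ s : Finset ι, v e = v (fun i => if i ∈ s then e' i else e i) by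
    simpa using H Finset.univ
  intro s
  induction s using Finset.induction_on with
  | empty => simp
  | insert o s ho ih =>
    rw [ih]
    have h₁ : (fun i => if i ∈ s then e' i else e i) =
        Function.update (fun i => if i ∈ s then e' i else e i) o (e o) := by
      conv_lhs => rw [← Function.update_eq_self o (fun i => if i ∈ s then e' i else e i)]
      simp [ho]
    have h₂ : (fun i => if i ∈ insert o s then e' i else e i) =
        Function.update (fun i => if i ∈ s then e' i else e i) o (e' o) := by
      funext i
      by_cases hi : i = o
      · subst hi; simp
      · simp [hi]
    rw [h₁, h₂]
    exact step _ _ _ _ (h o)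

theorem PQuotRel.inr_cases {E : Type} {r : E → E → Prop} {z : E → Prop} {a : E} {b : Unit ⊕ E}
    (h : PQuotRel r z (Sum.inr a) b) :
    (∃ y, b = Sum.inr y ∧ r a y) ∨ (b = Sum.inl () ∧ z a) := by
  cases h with
  | glue h => exact Or.inl ⟨_, rfl, h⟩
  | base h => exact Or.inr ⟨rfl, h⟩

namespace Hocolim

/-- The test maps of a homotopy colimit: those that move a point of a fixed simplex and of the value
of the diagram. -/
def Test {C : Type} [SmallCategory C] (X : C ⥤ PtdSpace) (T : CompHaus.{0})
    (f : C(cptHaus T, Hocolim X)) : Prop :=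
  (∀ a, f a = (Hocolim X).pt) ∨ ∃ (n : ℕ) (σ : ComposableArrows C n)
    (t : C(cptHaus T, stdSimplex ℝ (Fin (n + 1)))) (x : C(cptHaus T, X.obj (σ.obj 0))),
    ∀ a, f a = mk σ (t a) (x a)

theorem detects {C : Type} [SmallCategory C] (X : C ⥤ PtdSpace) :
    Detects (Hocolim X) (Test X) := by
  have h₀ := detects_pquot (r := HocolimPre.Rel)
    (z := fun e : HocolimPre X =>
      (WithGeneratedByTopology.equiv (X := cptHaus) e.2).2 = (X.obj (e.1.2.obj 0)).pt)
    (detects_sigma (fun c : (Σ n : ℕ, ComposableArrows C n) =>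
      Kify (stdSimplex ℝ (Fin (c.1 + 1)) × X.obj (c.2.obj 0))) fun c => detects_all _)
  intro B Z _ g h
  refine h₀ B Z g fun T f hf => h T f ?_
  rcases hf with hf | ⟨f', ⟨c, f'', -, h''⟩, hf⟩
  · exact Or.inl hf
  · have hc := WithGeneratedByTopology.continuous_equiv (X := cptHaus)
      (Y := stdSimplex ℝ (Fin (c.1 + 1)) × X.obj (c.2.obj 0))
    exact Or.inr ⟨c.1, c.2, ⟨_, continuous_fst.comp (hc.comp f''.continuous)⟩,
      ⟨_, continuous_snd.comp (hc.comp f''.continuous)⟩, fun a =>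
        (hf a).trans (congrArg PQuot.mk (h'' a))⟩

theorem testsClosed {C : Type} [SmallCategory C] (X : C ⥤ PtdSpace) : TestsClosed (Test X) := by
  rintro T T' f h (hf | ⟨n, σ, t, x, hf⟩)
  · exact Or.inl fun a => hf _
  · exact Or.inr ⟨n, σ, t.comp h, x.comp h, fun a => hf _⟩

theorem mk_pt {C : Type} [SmallCategory C] {X : C ⥤ PtdSpace} {n : ℕ} (σ : ComposableArrows C n)
    (t : stdSimplex ℝ (Fin (n + 1))) : mk σ t (X.obj (σ.obj 0)).pt = (Hocolim X).pt :=
  PQuot.mk_base rfl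

theorem continuous_mk {C : Type} [SmallCategory C] {X : C ⥤ PtdSpace} {n : ℕ}
    (σ : ComposableArrows C n) {T : Type} [TopologicalSpace T] [IsCG T]
    {t : T → stdSimplex ℝ (Fin (n + 1))} {x : T → X.obj (σ.obj 0)} (ht : Continuous t)
    (hx : Continuous x) : Continuous fun a => mk σ (t a) (x a) :=
  PQuot.continuous_mk.comp ((continuous_sigmaMk (σ := fun c : (Σ n : ℕ, ComposableArrows C n) =>
    Kify (stdSimplex ℝ (Fin (c.1 + 1)) × X.obj (c.2.obj 0))) (i := ⟨n, σ⟩)).comp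
      (continuous_kify_mk (ht.prodMk hx)))

theorem mk_glue {C : Type} [SmallCategory C] {X : C ⥤ PtdSpace} {m n : ℕ}
    (θ : Fin (m + 1) →o Fin (n + 1)) (σ : ComposableArrows C n) (t : stdSimplex ℝ (Fin (m + 1)))
    (x : X.obj (σ.obj 0)) :
    mk (n := m) (θ.monotone.functor ⋙ σ) t (X.map (σ.map (homOfLE (Fin.zero_le (θ 0)))) x) =
      mk σ (stdSimplex.map θ t) x :=
  PQuot.mk_glue (.glue θ σ t x)

theorem cases {C : Type} [SmallCategory C] {X : C ⥤ PtdSpace} (y : Hocolim X) :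
    y = (Hocolim X).pt ∨ ∃ (n : ℕ) (σ : ComposableArrows C n) (t : _) (x : _), y = mk σ t x :=
  PQuot.ind (P := fun y => y = (Hocolim X).pt ∨
    ∃ (n : ℕ) (σ : ComposableArrows C n) (t : _) (x : _), y = mk σ t x) (Or.inl rfl)
    (fun e => Or.inr ⟨e.1.1, e.1.2, (WithGeneratedByTopology.equiv (X := cptHaus) e.2).1,
      (WithGeneratedByTopology.equiv (X := cptHaus) e.2).2, rfl⟩) y

/-- A natural family of multipointed maps `∏ X_i(c_i) → Y(Φ(c))` that are continuous on test
spaces. -/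
structure MultiMap {ι : Type} {C : ι → Type} [∀ i, SmallCategory (C i)]
    (X : ∀ i, C i ⥤ PtdSpace) {D : Type} [SmallCategory D] (Y : D ⥤ PtdSpace)
    (Φ : (∀ i, C i) ⥤ D) where
  app (c : ∀ i, C i) (x : ∀ i, (X i).obj (c i)) : Y.obj (Φ.obj c)
  natural {c c' : ∀ i, C i} (φ : c ⟶ c') (x : ∀ i, (X i).obj (c i)) :
    Y.map (Φ.map φ) (app c x) = app c' fun i => (X i).map (φ i) (x i)
  zero (c : ∀ i, C i) (x : ∀ i, (X i).obj (c i)) (i : ι) (h : x i = ((X i).obj (c i)).pt) :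
    app c x = (Y.obj (Φ.obj c)).pt
  cont (c : ∀ i, C i) (T : CompHaus.{0}) (x : ∀ i, C(cptHaus T, (X i).obj (c i))) :
    Continuous fun a => app c fun i => x i a

/-- A chain in `C` with a point of the value of `X` at its first object. -/
abbrev ChainPt {C : Type} [SmallCategory C] (X : C ⥤ PtdSpace) (m : ℕ) : Type :=
  Σ σ : ComposableArrows C m, X.obj (σ.obj 0)

/-- Pulling back a chain along a monotone map. -/
def ChainPt.pull {C : Type} [SmallCategory C] {X : C ⥤ PtdSpace} {m n : ℕ}
    (θ : Fin (m + 1) →o Fin (n + 1)) (ρ : ChainPt X n) : ChainPt X m :=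
  ⟨θ.monotone.functor ⋙ ρ.1, X.map (ρ.1.map (homOfLE (Fin.zero_le (θ 0)))) ρ.2⟩

theorem ChainPt.pull_pull {C : Type} [SmallCategory C] {X : C ⥤ PtdSpace} {l m n : ℕ}
    (φ : Fin (l + 1) →o Fin (m + 1)) (θ : Fin (m + 1) →o Fin (n + 1)) (ρ : ChainPt X n) :
    (ρ.pull θ).pull φ = ρ.pull (θ.comp φ) := by
  refine congrArg (Sigma.mk ((θ.comp φ).monotone.functor ⋙ ρ.1)) ?_
  have h := X.map_comp (ρ.1.map (homOfLE (Fin.zero_le (θ 0))))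
    (ρ.1.map (homOfLE (θ.monotone (Fin.zero_le (φ 0)))))
  rw [← ρ.1.map_comp] at h
  exact (congrArg (fun k => PtdSpace.Hom.toFun k ρ.2) h).symm

theorem ChainPt.pull_id {C : Type} [SmallCategory C] {X : C ⥤ PtdSpace} {n : ℕ}
    (ρ : ChainPt X n) : ρ.pull OrderHom.id = ρ := by
  refine congrArg (Sigma.mk ρ.1) ?_
  have h := X.map_id (ρ.1.obj 0)
  rw [← ρ.1.map_id] at h
  exact congrArg (fun k => PtdSpace.Hom.toFun k ρ.2) h

theorem mk_pull {C : Type} [SmallCategory C] {X : C ⥤ PtdSpace} {m n : ℕ}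
    (θ : Fin (m + 1) →o Fin (n + 1)) (ρ : ChainPt X n) (t : stdSimplex ℝ (Fin (m + 1))) :
    mk (ρ.pull θ).1 t (ρ.pull θ).2 = mk ρ.1 (stdSimplex.map θ t) ρ.2 :=
  mk_glue θ ρ.1 t ρ.2

/-- `ρ` and `u` present the point `e` of the homotopy colimit, by a degeneration of `e`. -/
def Presents {C : Type} [SmallCategory C] {X : C ⥤ PtdSpace} (e : Unit ⊕ HocolimPre X) {m : ℕ}
    (u : stdSimplex ℝ (Fin (m + 1))) (ρ : ChainPt X m) : Prop :=
  ∃ (n : ℕ) (ρ' : ChainPt X n) (θ : Fin (m + 1) →o Fin (n + 1)),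
    e = Sum.inr (HocolimPre.mk ρ'.1 (stdSimplex.map θ u) ρ'.2) ∧ ρ = ρ'.pull θ

namespace MultiMap

variable {ι : Type} [Finite ι] [Nonempty ι] {C : ι → Type} [∀ i, SmallCategory (C i)]
  {X : ∀ i, C i ⥤ PtdSpace} {D : Type} [SmallCategory D] {Y : D ⥤ PtdSpace}
  {Φ : (∀ i, C i) ⥤ D} (F : MultiMap X Y Φ)

/-- The value of a multipointed natural family on chains of the same length. -/
def val {m : ℕ} (u : stdSimplex ℝ (Fin (m + 1))) (ρ : ∀ i, ChainPt (X i) m) : Hocolim Y :=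
  Hocolim.mk (X := Y) (n := m) (Functor.pi' (fun i => (ρ i).1) ⋙ Φ) u
    (F.app (fun i => (ρ i).1.obj 0) fun i => (ρ i).2)

theorem val_pull {m n : ℕ} (θ : Fin (m + 1) →o Fin (n + 1)) (u : stdSimplex ℝ (Fin (m + 1)))
    (ρ : ∀ i, ChainPt (X i) n) :
    F.val u (fun i => (ρ i).pull θ) = F.val (stdSimplex.map θ u) ρ := by
  refine Eq.trans ?_ (mk_glue (X := Y) θ (Functor.pi' (fun i => (ρ i).1) ⋙ Φ) u
    (F.app (fun i => (ρ i).1.obj 0) fun i => (ρ i).2))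
  exact congrArg (Hocolim.mk (X := Y) (n := m) (θ.monotone.functor ⋙
    (Functor.pi' (fun i => (ρ i).1) ⋙ Φ)) u) (F.natural (c := fun i => (ρ i).1.obj 0)
      (c' := fun i => (ρ i).1.obj (θ 0))
      (fun i => (ρ i).1.map (homOfLE (Fin.zero_le (θ 0)))) fun i => (ρ i).2).symm

/-- The value only depends on the points of the homotopy colimits before degeneration. -/
theorem val_eq {n : ι → ℕ} (ρ : ∀ i, ChainPt (X i) (n i)) {m m' : ℕ}
    (θ : Fin (m + 1) →o Coupling.Verts n) (u : stdSimplex ℝ (Fin (m + 1)))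
    (θ' : Fin (m' + 1) →o Coupling.Verts n) (u' : stdSimplex ℝ (Fin (m' + 1)))
    (h : ∀ i, stdSimplex.map (fun j => θ j i) u = stdSimplex.map (fun j => θ' j i) u') :
    F.val u (fun i => (ρ i).pull ((Pi.evalOrderHom i).comp θ)) =
      F.val u' (fun i => (ρ i).pull ((Pi.evalOrderHom i).comp θ')) := by
  classical
  have := Fintype.ofFinite ι
  refine Coupling.eq_of_marginals (fun m θ u => F.val u fun i =>
    (ρ i).pull ((Pi.evalOrderHom i).comp θ)) (fun m r e θ u => ?_) θ u θ' u' h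
  rw [← val_pull]
  exact congrArg (F.val u) (funext fun i => (ChainPt.pull_pull e ((Pi.evalOrderHom i).comp θ)
    (ρ i)).symm)

theorem exists_presents (e : ∀ i, HocolimPre (X i)) : ∃ (m : ℕ) (u : stdSimplex ℝ (Fin (m + 1)))
    (ρ : ∀ i, ChainPt (X i) m), ∀ i, Presents (Sum.inr (e i)) u (ρ i) := by
  classical
  have := Fintype.ofFinite ι
  let t := fun i => (WithGeneratedByTopology.equiv (X := cptHaus) (e i).2).1
  obtain ⟨s, c, w, -, h⟩ := Coupling.exists_common t
  let ρ : ∀ i, ChainPt (X i) (e i).1.1 := fun i =>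
    ⟨(e i).1.2, (WithGeneratedByTopology.equiv (X := cptHaus) (e i).2).2⟩
  refine ⟨s, w, fun i => (ρ i).pull ((Pi.evalOrderHom i).comp c), fun i =>
    ⟨_, ρ i, (Pi.evalOrderHom i).comp c, ?_, rfl⟩⟩
  have h' : stdSimplex.map ((Pi.evalOrderHom i).comp c) w = t i := h i
  rw [h']
  rfl

theorem mk_inj {C : Type} [SmallCategory C] {X : C ⥤ PtdSpace} {n n' : ℕ} {ρ : ChainPt X n}
    {ρ' : ChainPt X n'} {t : stdSimplex ℝ (Fin (n + 1))} {t' : stdSimplex ℝ (Fin (n' + 1))}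
    (h : HocolimPre.mk ρ.1 t ρ.2 = HocolimPre.mk ρ'.1 t' ρ'.2) :
    ∃ hn : n = n', hn ▸ ρ = ρ' ∧ hn ▸ t = t' := by
  obtain ⟨σ, x⟩ := ρ
  obtain ⟨σ', x'⟩ := ρ'
  have h₁ := (Sigma.mk.inj h).1
  obtain rfl : n = n' := (Sigma.mk.inj h₁).1
  obtain rfl : σ = σ' := eq_of_heq (Sigma.mk.inj h₁).2
  have h₂ := Prod.mk.inj (Equiv.injective _ (eq_of_heq (Sigma.mk.inj h).2))
  obtain rfl : t = t' := h₂.1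
  obtain rfl : x = x' := h₂.2
  exact ⟨rfl, rfl, rfl⟩

/-- The value does not depend on the common presentation. -/
theorem val_eq_of_presents {e : ∀ i, Unit ⊕ HocolimPre (X i)} {m m' : ℕ}
    {u : stdSimplex ℝ (Fin (m + 1))} {ρ : ∀ i, ChainPt (X i) m} {u' : stdSimplex ℝ (Fin (m' + 1))}
    {ρ' : ∀ i, ChainPt (X i) m'} (h : ∀ i, Presents (e i) u (ρ i))
    (h' : ∀ i, Presents (e i) u' (ρ' i)) : F.val u ρ = F.val u' ρ' := by
  choose n τ θ he hρ using h
  choose n' τ' θ' he' hρ' using h'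
  have hi := fun i => mk_inj (Sum.inr.inj ((he i).symm.trans (he' i)))
  obtain rfl : n = n' := funext fun i => (hi i).1
  obtain rfl : τ = τ' := funext fun i => (hi i).2.1
  obtain rfl : ρ = _ := funext hρ
  obtain rfl : ρ' = _ := funext hρ'
  exact F.val_eq τ ⟨fun j i => θ i j, fun j j' hj i => (θ i).monotone hj⟩ u
    ⟨fun j i => θ' i j, fun j j' hj i => (θ' i).monotone hj⟩ u' fun i => (hi i).2.2

open Classical in
/-- The value on representatives of points of the homotopy colimits. There is a common presentation
unless one of the representatives is the base point, and then the value is the base point. -/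
noncomputable def preProd (e : ∀ i, Unit ⊕ HocolimPre (X i)) : Hocolim Y :=
  if h : ∃ (m : ℕ) (u : stdSimplex ℝ (Fin (m + 1))) (ρ : ∀ i, ChainPt (X i) m),
      ∀ i, Presents (e i) u (ρ i) then
    F.val h.choose_spec.choose h.choose_spec.choose_spec.choose
  else (Hocolim Y).pt

theorem preProd_eq {e : ∀ i, Unit ⊕ HocolimPre (X i)} {m : ℕ}
    {u : stdSimplex ℝ (Fin (m + 1))} {ρ : ∀ i, ChainPt (X i) m}
    (h : ∀ i, Presents (e i) u (ρ i)) : F.preProd e = F.val u ρ := by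
  have h' : ∃ (m : ℕ) (u : stdSimplex ℝ (Fin (m + 1))) (ρ : ∀ i, ChainPt (X i) m),
      ∀ i, Presents (e i) u (ρ i) := ⟨m, u, ρ, h⟩
  rw [preProd, dif_pos h']
  exact F.val_eq_of_presents h'.choose_spec.choose_spec.choose_spec h

theorem preProd_inl {e : ∀ i, Unit ⊕ HocolimPre (X i)} (i : ι) (h : e i = Sum.inl ()) :
    F.preProd e = (Hocolim Y).pt := by
  rw [preProd, dif_neg]
  rintro ⟨m, u, ρ, hρ⟩
  obtain ⟨n, ρ', θ, he, -⟩ := hρ i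
  rw [h] at he
  cases he

/-- The defining relations of a homotopy colimit lead from the pullback of a chain to the chain
itself, and a presentation by a degeneration of the former is one by a degeneration of the
latter. -/
theorem presents_of_rel {C : Type} [SmallCategory C] {X : C ⥤ PtdSpace} {a b : HocolimPre X}
    (h : HocolimPre.Rel a b) {m : ℕ} {u : stdSimplex ℝ (Fin (m + 1))} {ρ : ChainPt X m}
    (ha : Presents (Sum.inr a) u ρ) : Presents (Sum.inr b) u ρ := by
  obtain ⟨φ, σ, t, x⟩ := h
  obtain ⟨n', ρ', θ, he, rfl⟩ := ha
  have := mk_inj (ρ := ChainPt.pull φ ⟨σ, x⟩) (Sum.inr.inj he)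
  obtain ⟨rfl, rfl, rfl⟩ := this
  refine ⟨_, ⟨σ, x⟩, φ.comp θ, ?_, ChainPt.pull_pull _ _ _⟩
  exact congrArg (fun t => Sum.inr (HocolimPre.mk σ t x)) (Coupling.map_map _ _ _)

open Classical in
theorem preProd_rel (e : ∀ i, Unit ⊕ HocolimPre (X i)) (i : ι) (b : Unit ⊕ HocolimPre (X i))
    (h : PQuotRel HocolimPre.Rel (fun e : HocolimPre (X i) =>
      (WithGeneratedByTopology.equiv (X := cptHaus) e.2).2 = ((X i).obj (e.1.2.obj 0)).pt)
        (e i) b) : F.preProd e = F.preProd (Function.update e i b) := by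
  by_cases hin : ∃ j, e j = Sum.inl ()
  · obtain ⟨j, hj⟩ := hin
    rw [F.preProd_inl j hj]
    by_cases hij : j = i
    · subst hij
      rw [hj] at h
      cases h
    · exact (F.preProd_inl j (by rw [Function.update_of_ne hij, hj])).symm
  · have : ∀ j, ∃ a, e j = Sum.inr a := fun j => by
      rcases hj : e j with ⟨⟩ | a
      · exact (hin ⟨j, hj⟩).elim
      · exact ⟨a, rfl⟩
    choose a ha using this
    obtain rfl : e = fun i => Sum.inr (a i) := funext ha
    obtain ⟨m, u, ρ, hρ⟩ := exists_presents a
    rw [F.preProd_eq hρ]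
    rcases PQuotRel.inr_cases h with ⟨y, rfl, hr⟩ | ⟨rfl, hz⟩
    · refine (F.preProd_eq fun j => ?_).symm
      by_cases hij : j = i
      · subst hij
        rw [Function.update_self]
        exact presents_of_rel hr (hρ j)
      · rw [Function.update_of_ne hij]
        exact hρ j
    · rw [F.preProd_inl i (Function.update_self ..)]
      obtain ⟨n, ρ', θ, he, hρi⟩ := hρ i
      have hx : ρ'.2 = ((X i).obj (ρ'.1.obj 0)).pt := by
        have he' : a i = _ := Sum.inr.inj he
        rw [he'] at hz
        exact hz
      refine (congrArg _ (F.zero _ _ i ?_)).trans (mk_pt _ _)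
      rw [hρi]
      exact (congrArg _ hx).trans (PtdSpace.Hom.map_pt _)

/-- The map `∏ hocolim X_i → hocolim Y` induced by a natural family of multipointed maps. -/
noncomputable def prod (y : ∀ i, Hocolim (X i)) : Hocolim Y := F.preProd fun i => (y i).out

theorem prod_quot_mk (e : ∀ i, Unit ⊕ HocolimPre (X i)) :
    F.prod (fun i => (Quot.mk _ (e i) : Hocolim (X i))) = F.preProd e := by
  classical
  exact eq_of_quot_eq F.preProd F.preProd_rel fun i => Quot.out_eq _

/-- On chains of the same length with the same barycentric coordinates, the map is given by the maps
of the family. -/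
theorem prod_mk {m : ℕ} (u : stdSimplex ℝ (Fin (m + 1))) (ρ : ∀ i, ChainPt (X i) m) :
    F.prod (fun i => Hocolim.mk (ρ i).1 u (ρ i).2) = F.val u ρ :=
  (F.prod_quot_mk fun i => Sum.inr (HocolimPre.mk (ρ i).1 u (ρ i).2)).trans
    (F.preProd_eq fun i => ⟨m, ρ i, OrderHom.id, by
      have : stdSimplex.map (OrderHom.id : Fin (m + 1) →o Fin (m + 1)) u = u :=
        stdSimplex.map_id_apply u
      rw [this], (ChainPt.pull_id _).symm⟩)

theorem prod_pt (y : ∀ i, Hocolim (X i)) (i : ι) (h : y i = (Hocolim (X i)).pt) :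
    F.prod y = (Hocolim Y).pt := by
  classical
  have : y = fun j => (Quot.mk _ (if j = i then Sum.inl () else (y j).out) : Hocolim (X j)) :=
    funext fun j => by
      by_cases hj : j = i
      · subst hj; simp only [if_true]; exact h
      · simp only [if_neg hj]; exact (Quot.out_eq (y j)).symm
  rw [this, prod_quot_mk]
  exact F.preProd_inl i (if_pos rfl)

theorem prod_eq {n : ι → ℕ} (ρ : ∀ i, ChainPt (X i) (n i)) (t : ∀ i, stdSimplex ℝ (Fin (n i + 1)))
    {m : ℕ} (θ : Fin (m + 1) →o Coupling.Verts n) (u : stdSimplex ℝ (Fin (m + 1)))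
    (h : ∀ i, stdSimplex.map (fun j => θ j i) u = t i) :
    F.prod (fun i => Hocolim.mk (ρ i).1 (t i) (ρ i).2) =
      F.val u fun i => (ρ i).pull ((Pi.evalOrderHom i).comp θ) := by
  rw [← prod_mk]
  refine congrArg F.prod (funext fun i => ?_)
  rw [mk_pull, ← h i]
  rfl

/-- The product map is continuous on test spaces. For a family of points of simplices parametrized
by a compact Hausdorff space `T`, the pairs of a parameter and a common presentation form a compact
Hausdorff space that surjects onto `T`. -/
theorem continuous_prod_tests (T : CompHaus.{0}) (y : ∀ i, C(cptHaus T, Hocolim (X i)))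
    (hy : ∀ i, Test (X i) T (y i)) : Continuous fun a => F.prod fun i => y i a := by
  classical
  have := Fintype.ofFinite ι
  by_cases hpt : ∃ i, ∀ a, y i a = (Hocolim (X i)).pt
  · obtain ⟨i, hi⟩ := hpt
    rw [show (fun a => F.prod fun i => y i a) = fun _ => (Hocolim Y).pt from
      funext fun a => F.prod_pt _ i (hi a)]
    exact continuous_const
  choose n σ t x hyx using fun i => (hy i).resolve_left fun h => hpt ⟨i, h⟩
  -- The common presentations have bounded length, so finitely many monotone maps suffice.
  let Θ := Σ s : Fin (Fintype.card (Coupling.Verts n)), Fin (s + 1) →o Coupling.Verts n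
  have : Finite Θ := by
    have : ∀ s : Fin (Fintype.card (Coupling.Verts n)),
        Finite (Fin (s + 1) →o Coupling.Verts n) := fun s =>
      Finite.of_injective (fun f : Fin (s + 1) →o Coupling.Verts n => (f : _ → _))
        DFunLike.coe_injective
    infer_instance
  let R : ∀ θ : Θ, Set (cptHaus T × stdSimplex ℝ (Fin (θ.1 + 1))) := fun θ =>
    {p | ∀ i, stdSimplex.map (fun j => θ.2 j i) p.2 = t i p.1}
  have hR : ∀ θ, IsClosed (R θ) := fun θ => by
    simp only [R, Set.ofPred_forall]
    exact isClosed_iInter fun i => isClosed_eq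
      ((stdSimplex.continuous_map _).comp continuous_snd) ((t i).continuous.comp continuous_fst)
  have : ∀ θ, CompactSpace (R θ) := fun θ => isCompact_iff_compactSpace.1 (hR θ).isCompact
  -- Parameters with a common presentation form a compact space, and `T` is a quotient of it.
  let q : (Σ θ, R θ) → cptHaus T := fun p => p.2.1.1
  have hqc : Continuous q := continuous_sigma fun θ => continuous_fst.comp continuous_subtype_val
  have hqs : Function.Surjective q := fun a => by
    obtain ⟨s, c, w, hs, h⟩ := Coupling.exists_common fun i => t i a
    exact ⟨⟨⟨⟨s, hs⟩, c⟩, ⟨(a, w), h⟩⟩, rfl⟩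
  have hq : IsQuotientMap q := hqc.isClosedMap.isQuotientMap hqc hqs
  rw [hq.continuous_iff]
  refine continuous_sigma fun θ => ?_
  have heq : (fun p : R θ => F.prod fun i => y i p.1.1) = fun p : R θ =>
      Hocolim.mk (X := Y) (n := θ.1) (Functor.pi' (fun i =>
          ((Pi.evalOrderHom i).comp θ.2).monotone.functor ⋙ σ i) ⋙ Φ) p.1.2
        (F.app (fun i => (σ i).obj (θ.2 0 i)) fun i =>
          (X i).map ((σ i).map (homOfLE (Fin.zero_le (θ.2 0 i)))) (x i p.1.1)) :=
    funext fun p => by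
      rw [show (fun i => y i p.1.1) = fun i => Hocolim.mk (σ i) (t i p.1.1) (x i p.1.1) from
        funext fun i => hyx i _]
      exact F.prod_eq (fun i => ⟨σ i, x i p.1.1⟩) _ θ.2 p.1.2 p.2
  change Continuous fun p : R θ => F.prod fun i => y i p.1.1
  rw [heq]
  have : IsCG (R θ) := isCG_of_compact _
  refine continuous_mk (X := Y) (n := θ.1) _ (continuous_snd.comp continuous_subtype_val) ?_
  exact F.cont (fun i => (σ i).obj (θ.2 0 i)) (CompHaus.of (R θ)) fun i =>
    ⟨_, ((X i).map ((σ i).map (homOfLE (Fin.zero_le (θ.2 0 i))))).cont.comp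
      ((x i).continuous.comp (continuous_fst.comp continuous_subtype_val))⟩

theorem continuous_prod (T : CompHaus.{0}) (y : ∀ i, C(cptHaus T, Hocolim (X i))) :
    Continuous fun a => F.prod fun i => y i a :=
  detects_pi (fun i => (Hocolim (X i) : Type)) (fun i => detects (X i)) (fun i => testsClosed (X i))
    (A := CompHaus.of PUnit) (fun p => F.prod p.2)
    (fun T f hf => (F.continuous_prod_tests T f hf).comp continuous_snd) T
    (ContinuousMap.const _ PUnit.unit) y

end MultiMap

/-- The point `y` is presented by a chain of length `m` with barycentric coordinates `u`. -/
def HasChain {C : Type} [SmallCategory C] {X : C ⥤ PtdSpace} (y : Hocolim X) {m : ℕ}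
    (u : stdSimplex ℝ (Fin (m + 1))) : Prop :=
  ∃ (σ : ComposableArrows C m) (x : X.obj (σ.obj 0)), y = mk σ u x

theorem HasChain.pull {C : Type} [SmallCategory C] {X : C ⥤ PtdSpace} {y : Hocolim X} {m n : ℕ}
    (θ : Fin (m + 1) →o Fin (n + 1)) {u : stdSimplex ℝ (Fin (m + 1))}
    (h : HasChain y (stdSimplex.map θ u)) : HasChain y u := by
  obtain ⟨σ, x, rfl⟩ := h
  exact ⟨_, _, (mk_pull θ ⟨σ, x⟩ u).symm⟩

end Hocolim

/-! ### Continuity of the product of loops -/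

/-- Let `E` be open in `Q` and embedded in the compact space `Q'`. If a map on `E` extends to `Q'`
by the constant `y₀` off the image of `E`, then its extension to `Q` by the constant `y₀` is
continuous. -/
theorem continuous_extend_const {E Q Q' Y : Type*} [TopologicalSpace E] [TopologicalSpace Q]
    [TopologicalSpace Q'] [TopologicalSpace Y] [T2Space Q] [CompactSpace Q'] {j : E → Q}
    (hj : IsOpenEmbedding j) {j' : E → Q'} (hj' : IsEmbedding j') {y₀ : Y} {Θ : Q' → Y}
    (hΘ : Continuous Θ) (h₀ : ∀ x ∉ Set.range j', Θ x = y₀) {Θ' : Q → Y}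
    (h₁ : ∀ e, Θ' (j e) = Θ (j' e)) (h₂ : ∀ x ∉ Set.range j, Θ' x = y₀) : Continuous Θ' := by
  have key : ∀ O : Set Y, y₀ ∉ O → Θ' ⁻¹' O = j '' (j' ⁻¹' (Θ ⁻¹' O)) := fun O hO => by
    ext x
    constructor
    · intro hx
      by_cases hr : x ∈ Set.range j
      · obtain ⟨e, rfl⟩ := hr
        refine ⟨e, ?_, rfl⟩
        change Θ (j' e) ∈ O
        rw [← h₁ e]
        exact hx
      · exact (hO (by rw [← h₂ x hr]; exact hx)).elim
    · rintro ⟨e, he, rfl⟩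
      change Θ' (j e) ∈ O
      rw [h₁ e]
      exact he
  rw [continuous_def]
  intro O hO
  by_cases hy : y₀ ∈ O
  · rw [← isClosed_compl_iff, ← Set.preimage_compl, key _ (Set.notMem_compl_iff.2 hy)]
    have hK : IsCompact (Θ ⁻¹' Oᶜ) := (hO.isClosed_compl.preimage hΘ).isCompact
    refine ((hj'.isInducing.isCompact_preimage' hK fun x hx => ?_).image hj.continuous).isClosed
    by_contra hr
    exact hx (by rw [h₀ x hr]; exact hy)
  · rw [key O hy]
    exact hj.isOpenMap _ ((hO.preimage hΘ).preimage hj'.continuous)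

/-- The inclusion of the finite points of a product of circles. -/
def finPt {I : Type} (x : I → PosReal) : I → Circ := fun i => (x i : Circ)

theorem isOpenEmbedding_finPt {I : Type} [Finite I] : IsOpenEmbedding (finPt (I := I)) :=
  IsOpenEmbedding.piMap fun _ => OnePoint.isOpenEmbedding_coe

theorem finPt_cases {I : Type} (x : I → Circ) : (∃ y, finPt y = x) ∨ ∃ i, x i = OnePoint.infty := by
  by_cases h : ∃ i, x i = OnePoint.infty
  · exact Or.inr h
  · have := fun i => OnePoint.ne_infty_iff_exists.1 fun hi => h ⟨i, hi⟩
    choose y hy using this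
    exact Or.inl ⟨y, funext hy⟩

theorem finPt_ne_infty {I : Type} {x : I → Circ} (i : I) (h : x i = OnePoint.infty) :
    ¬ ∃ y, finPt y = x := by
  rintro ⟨y, rfl⟩
  exact OnePoint.coe_ne_infty _ h

theorem finPt_injective {I : Type} : Function.Injective (finPt (I := I)) := fun x y h =>
  funext fun i => OnePoint.coe_injective (congrFun h i)

theorem Sphere.mk_pt {U : Type} {x : U → Circ} (u : U) (h : x u = OnePoint.infty) :
    Sphere.mk x = (Sphere U).pt := PQuot.mk_base ⟨u, h⟩

theorem Sphere.continuous_mk {U : Type} : Continuous (Sphere.mk : (U → Circ) → Sphere U) :=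
  PQuot.continuous_mk

/-- Pointed maps out of a sphere are determined by their values at the points with finite
coordinates. -/
theorem Sphere.hom_ext_fin {U : Type} {Y : PtdSpace} {f g : Sphere U ⟶ Y}
    (h : ∀ x, f (Sphere.fin x) = g (Sphere.fin x)) : f = g :=
  PQuot.hom_ext fun x => by
    rcases finPt_cases x with ⟨y, rfl⟩ | ⟨i, hi⟩
    · exact h y
    · have : (PQuot.mk x : Sphere U) = (Sphere U).pt := PQuot.mk_base ⟨i, hi⟩
      rw [this, f.map_pt, g.map_pt]

/-! #### Polar coordinates -/

theorem continuous_posSum {J : FinSet} : Continuous (posSum : (J → PosReal) → PosReal) := by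
  have := Fintype.ofFinite J
  refine Continuous.subtype_mk ?_ _
  simp only [finsum_eq_sum_of_fintype]
  exact continuous_finsetSum _ fun j _ => continuous_subtype_val.comp (continuous_apply j)

instance (J : FinSet) : TopologicalSpace (OpenSimplex J) :=
  inferInstanceAs (TopologicalSpace {t : J → PosReal // (posSum t : ℝ) = 1})

instance (J : FinSet) : T2Space (OpenSimplex J) :=
  inferInstanceAs (T2Space {t : J → PosReal // (posSum t : ℝ) = 1})

instance (J : FinSet) : LocallyCompactSpace (OpenSimplex J) :=
  IsClosedEmbedding.locallyCompactSpace (IsClosed.isClosedEmbedding_subtypeVal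
    (isClosed_eq (continuous_subtype_val.comp continuous_posSum) continuous_const :
      IsClosed {t : J → PosReal | (posSum t : ℝ) = 1}))

theorem continuous_polar {J : FinSet} : Continuous (polar (J := J)) :=
  (Continuous.subtype_mk (continuous_pi fun j => Continuous.subtype_mk
    ((continuous_subtype_val.comp (continuous_apply j)).div
      (continuous_subtype_val.comp continuous_posSum) fun u => (posSum u).2.ne') _) _).prodMk
    continuous_posSum

theorem continuous_polar_symm {J : FinSet} : Continuous (polar (J := J)).symm :=
  continuous_pi fun j => Continuous.subtype_mk
    ((continuous_subtype_val.comp ((continuous_apply j).comp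
      (continuous_subtype_val.comp continuous_fst))).mul
      (continuous_subtype_val.comp continuous_snd)) _

namespace SymmFun

section block
variable (F : SymmFun) {J : FinSet} {A : Type} [Finite A] {V W : J → FinInj}
  (c : ∀ n, A ⊕ Fin (V n).card ≃ Fin (W n).card)

/-- The parameters on which the maps `S^A → F(S^W)` depend: for every coordinate in `A` a point of
the open simplex, and a finite point of the sphere on which the loops of `F` are defined. -/
abbrev BlockParam (J : FinSet) (A : Type) (V : J → FinInj) : Type :=
  (A → OpenSimplex J) × ((Σ n, Fin (V n).card) → PosReal)

/-- Assembly of a sphere with coordinates `A` into the variables of `F`, after multiplication by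
points of the open simplex. -/
noncomputable def blockHom (g : F.loops V) (τ : BlockParam J A V) :
    Sphere A ⟶ (F.obj J).obj (spheres W) :=
  F.assemble (N := J) (Z := Sphere A) (X := spheres V) (Y := spheres W)
      (fun n => Sphere.scale (fun a => (τ.1 a).1 n) ≫ Sphere.pairing (c n)) ≫
    PtdSpace.evalAt (PtdSpace.mapSpace.toHom g (Sphere.fin τ.2))

/-- Assembly of several spheres with coordinates `A`, one for every variable of `F`. -/
noncomputable def multiAssemble (g : F.loops V)
    (x : (J × A → Circ) × ((Σ n, Fin (V n).card) → Circ)) : (F.obj J).obj (spheres W) :=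
  (F.obj J).map (X := spheres V) (Y := spheres W)
    (fun n => PtdSpace.mapSpace.toHom (Sphere.pairing (c n) (Sphere.mk fun a => x.1 (n, a))))
    (PtdSpace.mapSpace.toHom g (Sphere.mk x.2))

theorem continuous_multiAssemble (S : CompHaus.{0}) (g : C(cptHaus S, F.loops V)) :
    Continuous fun p : cptHaus S × ((J × A → Circ) × ((Σ n, Fin (V n).card) → Circ)) =>
      multiAssemble F c (g p.1) p.2 := by
  have h₁ : Continuous fun u : (J × A → Circ) =>
      ((F.obj J).map (X := spheres V) (Y := spheres W) fun n =>
        PtdSpace.mapSpace.toHom (Sphere.pairing (c n) (Sphere.mk fun a => u (n, a))) :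
        (F.obj J).obj (spheres V) ⟶ (F.obj J).obj (spheres W)) :=
    F.continuous J (spheres V) (spheres W) (i := CompHaus.of (J × A → Circ))
      ⟨fun u n => PtdSpace.mapSpace.toHom (Sphere.pairing (c n) (Sphere.mk fun a => u (n, a))),
        continuous_pi fun n => PtdSpace.continuous_toHom.comp ((Sphere.pairing (c n)).cont.comp
          (Sphere.continuous_mk.comp (continuous_pi fun a => continuous_apply _)))⟩
  have h₂ := PtdSpace.joint_of_continuous_hom (A := cptHaus S) _
    (PtdSpace.continuous_toHom.comp g.continuous)
  exact (PtdSpace.joint_of_continuous_hom _ h₁).comp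
    ((continuous_fst.comp continuous_snd).prodMk (h₂.comp (continuous_fst.prodMk
      (Sphere.continuous_mk.comp (continuous_snd.comp continuous_snd)))))

theorem multiAssemble_pt (g : F.loops V)
    (x : (J × A → Circ) × ((Σ n, Fin (V n).card) → Circ))
    (h : (∃ i, x.1 i = OnePoint.infty) ∨ ∃ i, x.2 i = OnePoint.infty) :
    multiAssemble F c g x = ((F.obj J).obj (spheres W)).pt := by
  rcases h with ⟨⟨n, a⟩, h⟩ | ⟨i, h⟩
  · exact congrArg (fun k : (F.obj J).obj (spheres V) ⟶ (F.obj J).obj (spheres W) =>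
      k (PtdSpace.mapSpace.toHom g (Sphere.mk x.2))) (F.map_zero (X := spheres V) (Y := spheres W)
        (fun n => PtdSpace.mapSpace.toHom (Sphere.pairing (c n) (Sphere.mk fun a => x.1 (n, a)))) n
        (by
          have : (Sphere.mk fun a => x.1 (n, a)) = (Sphere A).pt := Sphere.mk_pt a h
          change PtdSpace.mapSpace.toHom (Sphere.pairing (c n) (Sphere.mk fun a => x.1 (n, a))) = _
          rw [this, PtdSpace.Hom.map_pt]
          rfl))
  · unfold multiAssemble
    rw [Sphere.mk_pt i h, PtdSpace.Hom.map_pt]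
    exact PtdSpace.Hom.map_pt _

/-- Multiplication of the coordinates in `A` by points of the open simplex, as a homeomorphism:
polar coordinates for every element of `A`. -/
noncomputable def blockPolar (J : FinSet) (A : Type) (V : J → FinInj) :
    BlockParam J A V × (A → PosReal) ≃ₜ (J × A → PosReal) × ((Σ n, Fin (V n).card) → PosReal) where
  toFun x := (fun i => polar.symm (x.1.1 i.2, x.2 i.2) i.1, x.1.2)
  invFun y := ((fun a => (polar fun n => y.1 (n, a)).1, y.2), fun a =>
    (polar fun n => y.1 (n, a)).2)
  left_inv x := by
    have : ∀ a, (polar fun n => polar.symm (x.1.1 a, x.2 a) n) = (x.1.1 a, x.2 a) := fun a =>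
      polar.apply_symm_apply _
    simp only [this]
  right_inv y := by
    refine Prod.ext (funext fun i => ?_) rfl
    exact congrFun (polar.symm_apply_apply fun n => y.1 (n, i.2)) i.1
  continuous_toFun := by
    refine (continuous_pi fun i => ?_).prodMk (continuous_snd.comp continuous_fst)
    exact (continuous_apply i.1).comp (continuous_polar_symm.comp
      (((continuous_apply i.2).comp (continuous_fst.comp continuous_fst)).prodMk
        ((continuous_apply i.2).comp continuous_snd)))
  continuous_invFun := by
    have h : ∀ a : A, Continuous fun y : (J × A → PosReal) × ((Σ n, Fin (V n).card) → PosReal) =>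
        polar (J := J) fun n => y.1 (n, a) := fun a => continuous_polar.comp
      (continuous_pi fun n => (continuous_apply _).comp continuous_fst)
    exact ((continuous_pi fun a => continuous_fst.comp (h a)).prodMk continuous_snd).prodMk
      (continuous_pi fun a => continuous_snd.comp (h a))

/-- The map `blockHom`, extended by the constant map to the point at infinity. -/
noncomputable def blockHomExt (g : F.loops V) (τ : OnePoint (BlockParam J A V)) :
    Sphere A ⟶ (F.obj J).obj (spheres W) :=
  τ.elim (PtdSpace.zeroHom _ _) (blockHom F c g)

/-- The assembled maps tend to the constant map as the parameters tend to infinity. In the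
coordinates before the passage to polar coordinates, the assembled map extends to a compact product
of circles by the base point. -/
theorem continuous_blockHomExt (S : CompHaus.{0}) (g : C(cptHaus S, F.loops V)) :
    Continuous fun p : cptHaus S × OnePoint (BlockParam J A V) => blockHomExt F c (g p.1) p.2 := by
  refine PtdSpace.continuous_hom_of_joint _ (PQuot.continuous_joint _ ?_ ?_)
  · let j : cptHaus S × (BlockParam J A V × (A → PosReal)) →
        (cptHaus S × OnePoint (BlockParam J A V)) × (A → Circ) :=
      fun p => ((p.1, (p.2.1 : OnePoint _)), finPt p.2.2)
    let j' : cptHaus S × (BlockParam J A V × (A → PosReal)) →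
        cptHaus S × ((J × A → Circ) × ((Σ n, Fin (V n).card) → Circ)) :=
      Prod.map id (Prod.map finPt finPt ∘ blockPolar J A V)
    have hj : IsOpenEmbedding j := by
      have h₁ : IsOpenEmbedding (Prod.map (Prod.map id OnePoint.some) finPt :
          (cptHaus S × BlockParam J A V) × (A → PosReal) →
            (cptHaus S × OnePoint (BlockParam J A V)) × (A → Circ)) :=
        (IsOpenEmbedding.id.prodMap OnePoint.isOpenEmbedding_coe).prodMap isOpenEmbedding_finPt
      exact h₁.comp (Homeomorph.prodAssoc _ _ _).symm.isOpenEmbedding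
    have hj' : IsOpenEmbedding j' := IsOpenEmbedding.id.prodMap
      ((isOpenEmbedding_finPt.prodMap isOpenEmbedding_finPt).comp
        (blockPolar J A V).isOpenEmbedding)
    refine continuous_extend_const hj hj'.isEmbedding (continuous_multiAssemble F c S g)
      (y₀ := ((F.obj J).obj (spheres W)).pt) ?_ (fun e => rfl) ?_
    · rintro ⟨s, u, v⟩ hr
      refine multiAssemble_pt F c _ _ ?_
      rcases finPt_cases u with ⟨u', rfl⟩ | h
      · rcases finPt_cases v with ⟨v', rfl⟩ | h
        · refine (hr ⟨(s, (blockPolar J A V).symm (u', v')), ?_⟩).elim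
          refine congrArg (Prod.mk s) ?_
          change Prod.map finPt finPt (blockPolar J A V ((blockPolar J A V).symm (u', v'))) = _
          rw [Homeomorph.apply_symm_apply]
          rfl
        · exact Or.inr h
      · exact Or.inl h
    · rintro ⟨⟨s, τ⟩, x⟩ hr
      induction τ using OnePoint.rec with
      | infty => rfl
      | coe τ =>
        rcases finPt_cases x with ⟨x', rfl⟩ | ⟨i, h⟩
        · exact (hr ⟨(s, (τ, x')), rfl⟩).elim
        · exact (congrArg (blockHom F c (g s) τ) (Sphere.mk_pt i h)).trans (PtdSpace.Hom.map_pt _)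
  · refine (continuous_const (y := ((F.obj J).obj (spheres W)).pt)).congr fun p => ?_
    exact (PtdSpace.Hom.map_pt _).symm

end block

section prod
variable {N K : FinSet} (p : Surj N K) (U : K → FinInj) (V : ∀ k, p.fib k → FinInj)

/-- The product of the loops `f` and `g_k` in terms of block parameters. -/
noncomputable def paramProd (G F : SymmFun) (f : G.loops U) (g : ∀ k, F.loops (V k))
    (τ : ∀ k, OnePoint (BlockParam (p.fib k) (Fin (U k).card) (V k)))
    (r : (Σ k, Fin (U k).card) → Circ) : ((comp G F).obj N).obj (spheres (joinSets p U V)) :=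
  incl G F p (spheres (joinSets p U V))
    ((G.obj K).map (X := spheres U)
      (Y := fun k => (F.obj (p.fib k)).obj fun n => spheres (joinSets p U V) n.1)
      (fun k => blockHomExt F (W := fun n : p.fib k => joinSets p U V n.1) (joinEquiv p U V k) (g k)
        (τ k))
      (PtdSpace.mapSpace.toHom f (Sphere.mk r)))

theorem paramProd_pt (G F : SymmFun) (f : G.loops U) (g : ∀ k, F.loops (V k))
    (τ : ∀ k, OnePoint (BlockParam (p.fib k) (Fin (U k).card) (V k)))
    (r : (Σ k, Fin (U k).card) → Circ)
    (h : (∃ k, τ k = OnePoint.infty) ∨ (∃ i, r i = OnePoint.infty)) :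
    paramProd p U V G F f g τ r = (((comp G F).obj N).obj (spheres (joinSets p U V))).pt := by
  unfold paramProd
  rcases h with ⟨k, h⟩ | ⟨i, h⟩
  · rw [G.map_zero (X := spheres U)
      (Y := fun k => (F.obj (p.fib k)).obj fun n => spheres (joinSets p U V) n.1)
      (fun k => blockHomExt F (W := fun n : p.fib k => joinSets p U V n.1) (joinEquiv p U V k) (g k)
        (τ k)) k
      (by
        change blockHomExt F (W := fun n : p.fib k => joinSets p U V n.1) (joinEquiv p U V k) (g k)
          (τ k) = _
        rw [h]; rfl)]
    exact PtdSpace.Hom.map_pt _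
  · rw [Sphere.mk_pt i h, PtdSpace.Hom.map_pt]
    exact (congrArg _ (PtdSpace.Hom.map_pt _)).trans (PtdSpace.Hom.map_pt _)

theorem continuous_paramProd (G F : SymmFun) (S : CompHaus.{0}) (f : C(cptHaus S, G.loops U))
    (g : ∀ k, C(cptHaus S, F.loops (V k))) :
    Continuous fun x : cptHaus S × ((∀ k, OnePoint (BlockParam (p.fib k) (Fin (U k).card) (V k))) ×
        ((Σ k, Fin (U k).card) → Circ)) =>
      paramProd p U V G F (f x.1) (fun k => g k x.1) x.2.1 x.2.2 := by
  have h₁ := G.continuous K (spheres U)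
    (fun k => (F.obj (p.fib k)).obj fun n => spheres (joinSets p U V) n.1)
    (i := CompHaus.of (cptHaus S × ∀ k, OnePoint (BlockParam (p.fib k) (Fin (U k).card) (V k))))
    ⟨fun x k => blockHomExt F (W := fun n : p.fib k => joinSets p U V n.1) (joinEquiv p U V k)
      (g k x.1)
      (x.2 k), continuous_pi fun k => (continuous_blockHomExt F _ S (g k)).comp
        (continuous_fst.prodMk ((continuous_apply k).comp continuous_snd))⟩
  have h₂ := PtdSpace.joint_of_continuous_hom (A := cptHaus S) _
    (PtdSpace.continuous_toHom.comp f.continuous)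
  have h₃ := PtdSpace.joint_of_continuous_hom (A := cptHaus S ×
    ∀ k, OnePoint (BlockParam (p.fib k) (Fin (U k).card) (V k))) _ h₁
  refine (incl G F p _).cont.comp (h₃.comp (f := fun x : cptHaus S ×
    ((∀ k, OnePoint (BlockParam (p.fib k) (Fin (U k).card) (V k))) ×
        ((Σ k, Fin (U k).card) → Circ)) => ((x.1, x.2.1), PtdSpace.mapSpace.toHom (f x.1)
          (Sphere.mk x.2.2))) ?_)
  exact (continuous_fst.prodMk (continuous_fst.comp continuous_snd)).prodMk
    (h₂.comp (continuous_fst.prodMk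
      (Sphere.continuous_mk.comp (continuous_snd.comp continuous_snd))))

/-- The coordinates of a sphere from polar coordinates on the blocks. -/
noncomputable def unpolarCoord
    (x : (∀ k, BlockParam (p.fib k) (Fin (U k).card) (V k)) × ((Σ k, Fin (U k).card) → PosReal))
    (n : N) : Fin (U (p n)).card ⊕ Fin (V (p n) ⟨n, rfl⟩).card → PosReal
  | Sum.inl a => polar.symm ((x.1 (p n)).1 a, x.2 ⟨p n, a⟩) ⟨n, rfl⟩
  | Sum.inr b => (x.1 (p n)).2 ⟨⟨n, rfl⟩, b⟩

/-- The coordinates of the sphere on which a product is defined, in terms of polar coordinates on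
the blocks, as a homeomorphism. -/
noncomputable def prodPolar : ((Σ n, Fin (joinSets p U V n).card) → PosReal) ≃ₜ
    (∀ k, BlockParam (p.fib k) (Fin (U k).card) (V k)) × ((Σ k, Fin (U k).card) → PosReal) where
  toFun w := (fun k => (fun a => (polarCoord p U V w k a).1, restCoord p U V w k),
    fun r => (polarCoord p U V w r.1 r.2).2)
  invFun x i := unpolarCoord p U V x i.1 ((joinEquiv p U V (p i.1) ⟨i.1, rfl⟩).symm i.2)
  left_inv w := funext fun ⟨n, i⟩ => by
    obtain ⟨i, rfl⟩ := (joinEquiv p U V (p n) ⟨n, rfl⟩).surjective i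
    change unpolarCoord p U V _ n ((joinEquiv p U V (p n) ⟨n, rfl⟩).symm
      (joinEquiv p U V (p n) ⟨n, rfl⟩ i)) = _
    rw [Equiv.symm_apply_apply]
    rcases i with a | b
    · exact congrFun (polar.symm_apply_apply fun m : p.fib (p n) =>
        w ⟨m.1, joinEquiv p U V (p n) m (Sum.inl a)⟩) ⟨n, rfl⟩
    · rfl
  right_inv x := by
    have h : ∀ k (n : p.fib k) i, unpolarCoord p U V x n.1
        ((joinEquiv p U V (p n.1) ⟨n.1, rfl⟩).symm (joinEquiv p U V k n i)) = Sum.elim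
          (fun a => polar.symm ((x.1 k).1 a, x.2 ⟨k, a⟩) n) (fun b => (x.1 k).2 ⟨n, b⟩) i := by
      rintro _ ⟨n, rfl⟩ i
      rw [Equiv.symm_apply_apply]
      rcases i with a | b <;> rfl
    have h₁ : ∀ k a, polarCoord p U V (fun i => unpolarCoord p U V x i.1
        ((joinEquiv p U V (p i.1) ⟨i.1, rfl⟩).symm i.2)) k a = ((x.1 k).1 a, x.2 ⟨k, a⟩) :=
      fun k a => by
        unfold polarCoord
        rw [show (fun n : p.fib k => _) = fun n : p.fib k => _ from funext fun n => h k n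
          (Sum.inl a)]
        exact polar.apply_symm_apply _
    refine Prod.ext (funext fun k => Prod.ext (funext fun a => ?_) (funext fun b => ?_))
      (funext fun r => ?_)
    · exact congrArg Prod.fst (h₁ k a)
    · exact h k b.1 (Sum.inr b.2)
    · exact congrArg Prod.snd (h₁ r.1 r.2)
  continuous_toFun := by
    have h : ∀ k a, Continuous fun w : ((Σ n, Fin (joinSets p U V n).card) → PosReal) =>
        polarCoord p U V w k a := fun k a =>
      continuous_polar.comp (continuous_pi fun n => continuous_apply _)
    exact (continuous_pi fun k => (continuous_pi fun a => continuous_fst.comp (h k a)).prodMk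
      (continuous_pi fun b => continuous_apply _)).prodMk
        (continuous_pi fun r => continuous_snd.comp (h r.1 r.2))
  continuous_invFun := by
    refine continuous_pi fun i => ?_
    rcases (joinEquiv p U V (p i.1) ⟨i.1, rfl⟩).symm i.2 with a | b
    · exact (continuous_apply _).comp (continuous_polar_symm.comp
        (((continuous_apply a).comp (continuous_fst.comp ((continuous_apply (p i.1)).comp
          continuous_fst))).prodMk ((continuous_apply _).comp continuous_snd)))
    · exact (continuous_apply _).comp (continuous_snd.comp ((continuous_apply (p i.1)).comp
        continuous_fst))

theorem productValue_eq (G F : SymmFun) (f : G.loops U) (g : ∀ k, F.loops (V k))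
    (w : (Σ n, Fin (joinSets p U V n).card) → PosReal) :
    productValue p U V G F f g w = paramProd p U V G F f g
      (fun k => ((prodPolar p U V w).1 k : OnePoint _)) (finPt (prodPolar p U V w).2) := rfl

open Classical in
/-- The product of loops at a point of the product of circles: `productValue` at points with finite
coordinates, and the base point otherwise. -/
noncomputable def prodFun (G F : SymmFun) (f : G.loops U) (g : ∀ k, F.loops (V k))
    (w : (Σ n, Fin (joinSets p U V n).card) → Circ) :
    ((comp G F).obj N).obj (spheres (joinSets p U V)) :=
  if h : ∃ y, finPt y = w then productValue p U V G F f g h.choose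
  else (((comp G F).obj N).obj (spheres (joinSets p U V))).pt

theorem prodFun_fin (G F : SymmFun) (f : G.loops U) (g : ∀ k, F.loops (V k))
    (w : (Σ n, Fin (joinSets p U V n).card) → PosReal) :
    prodFun p U V G F f g (finPt w) = productValue p U V G F f g w := by
  have h : ∃ y, finPt y = finPt w := ⟨w, rfl⟩
  rw [prodFun, dif_pos h, finPt_injective h.choose_spec]

theorem prodFun_infty (G F : SymmFun) (f : G.loops U) (g : ∀ k, F.loops (V k))
    (w : (Σ n, Fin (joinSets p U V n).card) → Circ) (i) (h : w i = OnePoint.infty) :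
    prodFun p U V G F f g w = (((comp G F).obj N).obj (spheres (joinSets p U V))).pt := by
  rw [prodFun, dif_neg (finPt_ne_infty i h)]

/-- The product of loops is continuous in the loops and in the point of the product of circles: in
polar coordinates it extends, by the base point, to the product of the compactified spaces of
parameters. -/
theorem continuous_prodFun (G F : SymmFun) (S : CompHaus.{0}) (f : C(cptHaus S, G.loops U))
    (g : ∀ k, C(cptHaus S, F.loops (V k))) :
    Continuous fun x : cptHaus S × ((Σ n, Fin (joinSets p U V n).card) → Circ) =>
      prodFun p U V G F (f x.1) (fun k => g k x.1) x.2 := by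
  let j : cptHaus S × ((Σ n, Fin (joinSets p U V n).card) → PosReal) →
      cptHaus S × ((Σ n, Fin (joinSets p U V n).card) → Circ) := Prod.map id finPt
  let j' : cptHaus S × ((Σ n, Fin (joinSets p U V n).card) → PosReal) →
      cptHaus S × ((∀ k, OnePoint (BlockParam (p.fib k) (Fin (U k).card) (V k))) ×
        ((Σ k, Fin (U k).card) → Circ)) :=
    Prod.map id (Prod.map (Pi.map fun k => OnePoint.some) finPt ∘ prodPolar p U V)
  have hj : IsOpenEmbedding j := IsOpenEmbedding.id.prodMap isOpenEmbedding_finPt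
  have hj' : IsOpenEmbedding j' := IsOpenEmbedding.id.prodMap
    (((IsOpenEmbedding.piMap fun k => OnePoint.isOpenEmbedding_coe).prodMap
      isOpenEmbedding_finPt).comp (prodPolar p U V).isOpenEmbedding)
  refine continuous_extend_const hj hj'.isEmbedding (continuous_paramProd p U V G F S f g)
    (y₀ := (((comp G F).obj N).obj (spheres (joinSets p U V))).pt) ?_
    (fun e => prodFun_fin p U V G F _ _ e.2) ?_
  · rintro ⟨s, τ, r⟩ hr
    refine paramProd_pt p U V G F _ _ _ _ ?_
    by_cases hτ : ∃ k, τ k = OnePoint.infty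
    · exact Or.inl hτ
    · rcases finPt_cases r with ⟨r', rfl⟩ | h
      · have := fun k => OnePoint.ne_infty_iff_exists.1 fun hi => hτ ⟨k, hi⟩
        choose τ' hτ' using this
        obtain rfl : (fun k => (τ' k : OnePoint _)) = τ := funext hτ'
        refine (hr ⟨(s, (prodPolar p U V).symm (τ', r')), ?_⟩).elim
        refine congrArg (Prod.mk s) ?_
        change Prod.map _ finPt (prodPolar p U V ((prodPolar p U V).symm (τ', r'))) = _
        rw [Homeomorph.apply_symm_apply]
        rfl
      · exact Or.inr h
  · rintro ⟨s, w⟩ hr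
    rcases finPt_cases w with ⟨w', rfl⟩ | ⟨i, h⟩
    · exact (hr ⟨(s, w'), rfl⟩).elim
    · exact prodFun_infty p U V G F _ _ w i h

/-- The product of the loops `f` and `g_k`. -/
noncomputable def prodLoop (G F : SymmFun) (f : G.loops U) (g : ∀ k, F.loops (V k)) :
    (comp G F).loops (joinSets p U V) :=
  PtdSpace.mapSpace.ofHom (PQuot.desc (prodFun p U V G F f g)
    ((continuous_prodFun p U V G F (CompHaus.of PUnit) (ContinuousMap.const _ f)
      fun k => ContinuousMap.const _ (g k)).comp (Continuous.prodMk_right PUnit.unit))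
    (fun _ _ h => h.elim) fun w ⟨i, h⟩ => prodFun_infty p U V G F f g w i h)

theorem prodLoop_fin (G F : SymmFun) (f : G.loops U) (g : ∀ k, F.loops (V k))
    (w : (Σ n, Fin (joinSets p U V n).card) → PosReal) :
    PtdSpace.mapSpace.toHom (prodLoop p U V G F f g) (Sphere.fin w) =
      productValue p U V G F f g w := prodFun_fin p U V G F f g w

theorem continuous_prodLoop (G F : SymmFun) (S : CompHaus.{0}) (f : C(cptHaus S, G.loops U))
    (g : ∀ k, C(cptHaus S, F.loops (V k))) :
    Continuous fun s => prodLoop p U V G F (f s) fun k => g k s :=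
  PtdSpace.continuous_ofHom (PtdSpace.continuous_hom_of_joint _ (PQuot.continuous_joint _
    (continuous_prodFun p U V G F S f g) continuous_const))

end prod

/-- Loops are determined by their values at the points with finite coordinates. -/
theorem loops_ext_fin (F : SymmFun) {N : FinSet} {U : N → FinInj} {f g : F.loops U}
    (h : ∀ w, PtdSpace.mapSpace.toHom f (Sphere.fin w) = PtdSpace.mapSpace.toHom g (Sphere.fin w)) :
    f = g :=
  congrArg PtdSpace.mapSpace.ofHom (Sphere.hom_ext_fin (f := PtdSpace.mapSpace.toHom f) h)

theorem prodLoop_pt {N K : FinSet} (p : Surj N K) (U : K → FinInj) (V : ∀ k, p.fib k → FinInj)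
    (G F : SymmFun) (f : G.loops U) (g : ∀ k, F.loops (V k))
    (h : f = (G.loops U).pt ∨ ∃ k, g k = (F.loops (V k)).pt) :
    prodLoop p U V G F f g = ((comp G F).loops (joinSets p U V)).pt := by
  refine loops_ext_fin _ fun w => (prodLoop_fin p U V G F f g w).trans ?_
  rw [productValue_eq]
  unfold paramProd
  rcases h with rfl | ⟨k, h⟩
  · exact (congrArg _ (PtdSpace.Hom.map_pt _)).trans (PtdSpace.Hom.map_pt _)
  · rw [G.map_zero (X := spheres U)
      (Y := fun k => (F.obj (p.fib k)).obj fun n => spheres (joinSets p U V) n.1)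
      (fun k => blockHomExt F (W := fun n : p.fib k => joinSets p U V n.1) (joinEquiv p U V k) (g k)
        ((prodPolar p U V w).1 k : OnePoint _)) k (by
        change blockHomExt F (W := fun n : p.fib k => joinSets p U V n.1) (joinEquiv p U V k) (g k)
          _ = _
        rw [h]
        exact PtdSpace.hom_ext fun x => PtdSpace.Hom.map_pt _)]
    exact PtdSpace.Hom.map_pt _

end SymmFun

/-! ### The composition of symmetric functor sequences on labelled partitions -/

namespace SymmFunctor

section
variable (G F : SymmFunctor)

theorem map_map_apply {K : FinSet} {X Y Z : K → PtdSpace} (f : ∀ k, X k ⟶ Y k)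
    (g : ∀ k, Y k ⟶ Z k) (x : (G.obj K).obj X) :
    (G.obj K).map (X := Y) (Y := Z) g ((G.obj K).map (X := X) (Y := Y) f x) =
      (G.obj K).map (X := X) (Y := Z) (fun k => f k ≫ g k) x :=
  congrArg (fun k => PtdSpace.Hom.toFun k x)
    ((G.obj K).map_comp (X := X) (Y := Y) (Z := Z) f g).symm

theorem map_id_apply {K : FinSet} {X : K → PtdSpace} (f : ∀ k, X k ⟶ X k) (h : ∀ k, f k = 𝟙 _)
    (x : (G.obj K).obj X) : (G.obj K).map (X := X) (Y := X) f x = x := by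
  obtain rfl : f = fun k => 𝟙 _ := funext h
  exact congrArg (fun k => PtdSpace.Hom.toFun k x) ((G.obj K).map_id X)

theorem map_congr {K : FinSet} {X Y : K → PtdSpace} {f g : ∀ k, X k ⟶ Y k} (h : ∀ k, f k = g k)
    (x : (G.obj K).obj X) :
    (G.obj K).map (X := X) (Y := Y) f x = (G.obj K).map (X := X) (Y := Y) g x := by
  rw [show f = g from funext h]

theorem perm_map_apply {M N : FinSet} (e : M ≃ N) {X Y : N → PtdSpace} (f : ∀ n, X n ⟶ Y n)
    (x : (G.obj N).obj X) :
    G.perm e Y ((G.obj N).map (X := X) (Y := Y) f x) =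
      (G.obj M).map (X := fun m => X (e m)) (Y := fun m => Y (e m)) (fun m => f (e m))
        (G.perm e X x) :=
  congrArg (fun k => PtdSpace.Hom.toFun k x) (G.perm_natural e (X := X) (Y := Y) f)

theorem perm_perm_apply {L M N : FinSet} (d : L ≃ M) (e : M ≃ N) (X : N → PtdSpace)
    (x : (G.obj N).obj X) :
    G.perm d (fun m => X (e m)) (G.perm e X x) = G.perm (d.trans e) X x :=
  congrArg (fun k => PtdSpace.Hom.toFun k x) (G.perm_trans d e X).symm

theorem perm_refl_apply {N : FinSet} (X : N → PtdSpace) (x : (G.obj N).obj X) :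
    G.perm (Equiv.refl N) X x = x :=
  congrArg (fun k => PtdSpace.Hom.toFun k x) (G.perm_refl N X)

theorem transport_congr {K K' : FinSet} (c : K' ≃ K) {Y : K → PtdSpace} {Y' : K' → PtdSpace}
    {h h' : ∀ k, Y (c k) ⟶ Y' k} (e : ∀ k, h k = h' k) (x : (G.obj K).obj Y) :
    G.transport c h x = G.transport c h' x := by
  rw [show h = h' from funext e]

theorem map_transport_apply {K K' : FinSet} (c : K' ≃ K) {Y : K → PtdSpace}
    {Y' Y'' : K' → PtdSpace} (h : ∀ k, Y (c k) ⟶ Y' k) (h' : ∀ k, Y' k ⟶ Y'' k)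
    (x : (G.obj K).obj Y) :
    (G.obj K').map (X := Y') (Y := Y'') h' (G.transport c h x) =
      G.transport c (fun k => h k ≫ h' k) x := map_map_apply G _ _ _

theorem transport_map_apply {K K' : FinSet} (c : K' ≃ K) {X Y : K → PtdSpace} {Y' : K' → PtdSpace}
    (h : ∀ k, X k ⟶ Y k) (h' : ∀ k, Y (c k) ⟶ Y' k) (x : (G.obj K).obj X) :
    G.transport c h' ((G.obj K).map (X := X) (Y := Y) h x) =
      G.transport c (Y := X) (fun k => h (c k) ≫ h' k) x :=
  (congrArg ((G.obj K').map (X := fun k => Y (c k)) (Y := Y') h') (perm_map_apply G c h x)).trans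
    (map_map_apply G _ _ _)

theorem transport_refl_apply {K : FinSet} {Y Y' : K → PtdSpace} (h : ∀ k, Y k ⟶ Y' k)
    (x : (G.obj K).obj Y) :
    G.transport (Equiv.refl K) (Y := Y) (Y' := Y') h x = (G.obj K).map (X := Y) (Y := Y') h x :=
  congrArg (fun k => PtdSpace.Hom.toFun k x) (G.transport_refl h)

theorem sqMap_incl_eq {N N' K : FinSet} (p : Surj N K) (e : N' ≃ N) (X : N → PtdSpace)
    {π π' : Setoid N'} (hπ : π = π') (c : FinSet.quot π ≃ K) (c' : FinSet.quot π' ≃ K)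
    (h : ∀ n, p (e n) = c (FinSet.proj π n)) (h' : ∀ n, p (e n) = c' (FinSet.proj π' n))
    (x : summand G F p X) :
    Wedge.incl (fun π : Setoid N' => summand G F (FinSet.proj π) fun n => X (e n)) π
        (sqMap G F (FinSet.proj π) p e c h X x) =
      Wedge.incl (fun π : Setoid N' => summand G F (FinSet.proj π) fun n => X (e n)) π'
        (sqMap G F (FinSet.proj π') p e c' h' X x) := by
  subst hπ
  obtain rfl : c = c' := Equiv.ext fun k => by
    obtain ⟨n, rfl⟩ := (FinSet.proj π).surj k
    exact (h n).symm.trans (h' n)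
  rfl

/-- The inclusions of the terms of labelled partitions are compatible with bijections of
partitions. -/
theorem compIncl_square {N K N' K' : FinSet} (p' : Surj N' K') (p : Surj N K) (e : N' ≃ N)
    (c : K' ≃ K) (h : ∀ n, p (e n) = c (p' n)) (X : N → PtdSpace) (x : summand G F p X) :
    (comp G F).perm e X (compIncl G F p X x) =
      compIncl G F p' (fun n => X (e n)) (sqMap G F p' p e c h X x) := by
  have h₁ := congrArg (fun k => PtdSpace.Hom.toFun k x)
    (sqMap_trans G F (FinSet.proj ((Setoid.ker p).comap e)) (FinSet.proj (Setoid.ker p)) p e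
      (Equiv.refl N) (FinSet.quotEquiv e _) p.kerEquiv
      ((FinSet.quotEquiv e _).trans p.kerEquiv) (fun _ => rfl) (fun _ => rfl) (fun _ => rfl) X)
  have h₂ := congrArg (fun k => PtdSpace.Hom.toFun k x)
    (sqMap_trans G F (FinSet.proj (Setoid.ker p')) p' p (Equiv.refl N') e p'.kerEquiv c
      (p'.kerEquiv.trans c) h (fun _ => rfl) (fun n => h n) X)
  refine (congrArg (Wedge.incl (fun π : Setoid N' => summand G F (FinSet.proj π) fun n => X (e n))
    ((Setoid.ker p).comap e)) h₁.symm).trans (Eq.trans ?_ (congrArg (Wedge.incl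
      (fun π : Setoid N' => summand G F (FinSet.proj π) fun n => X (e n)) (Setoid.ker p')) h₂))
  refine sqMap_incl_eq G F p e X ?_ _ _ _ _ x
  ext a b
  change p (e a) = p (e b) ↔ p' a = p' b
  rw [h, h, c.injective.eq_iff]

theorem compIncl_proj {N : FinSet} (π : Setoid N) (X : N → PtdSpace)
    (x : summand G F (FinSet.proj π) X) :
    compIncl G F (FinSet.proj π) X x =
      Wedge.incl (fun π : Setoid N => summand G F (FinSet.proj π) X) π x := by
  refine (sqMap_incl_eq G F (FinSet.proj π) (Equiv.refl N) X (Setoid.ker_mk_eq π)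
    (FinSet.proj π).kerEquiv (Equiv.refl _) (fun _ => rfl) (fun _ => rfl) x).trans ?_
  exact congrArg (Wedge.incl _ π) (congrArg (fun k => PtdSpace.Hom.toFun k x)
    (sqMap_refl G F (FinSet.proj π) (Equiv.refl _) (fun _ => rfl) X))

/-- Maps out of a composition are determined by their restrictions to the terms of labelled
partitions. -/
theorem comp_hom_ext {N : FinSet} {X : N → PtdSpace} {Z : PtdSpace}
    {f g : ((comp G F).obj N).obj X ⟶ Z}
    (h : ∀ (K : FinSet) (p : Surj N K) (x : summand G F p X),
      f (compIncl G F p X x) = g (compIncl G F p X x)) : f = g :=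
  Wedge.hom_ext fun π => PtdSpace.hom_ext fun x => by
    have := h _ (FinSet.proj π) x
    rw [compIncl_proj] at this
    exact this

theorem compIncl_map {N K : FinSet} (p : Surj N K) {X Y : N → PtdSpace} (f : ∀ n, X n ⟶ Y n)
    (x : summand G F p X) :
    ((comp G F).obj N).map (X := X) (Y := Y) f (compIncl G F p X x) =
      compIncl G F p Y (summandMap G F p f x) :=
  congrArg (Wedge.incl (fun π : Setoid N => summand G F (FinSet.proj π) Y) (Setoid.ker p))
    (congrArg (fun k => PtdSpace.Hom.toFun k x)
      (sqMap_natural G F (FinSet.proj (Setoid.ker p)) p (Equiv.refl N) p.kerEquiv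
        (fun _ => rfl) f)).symm

variable {G F} in
theorem compIncl_hom {G' F' : SymmFunctor} (g : G ⟶ G') (f : F ⟶ F') {N K : FinSet} (p : Surj N K)
    (X : N → PtdSpace) (x : summand G F p X) :
    ((compHom g f).app N).app X (compIncl G F p X x) =
      compIncl G' F' p X (summandHom g f p X x) :=
  congrArg (Wedge.incl (fun π : Setoid N => summand G' F' (FinSet.proj π) X) (Setoid.ker p))
    (congrArg (fun k => PtdSpace.Hom.toFun k x)
      (summandHom_equivariant g f (FinSet.proj (Setoid.ker p)) p (Equiv.refl N) p.kerEquiv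
        (fun _ => rfl) X)).symm

variable {G} in
theorem hom_map_apply {G' : SymmFunctor} (g : G ⟶ G') {N : FinSet} {X Y : N → PtdSpace}
    (f : ∀ n, X n ⟶ Y n) (x : (G.obj N).obj X) :
    (g.app N).app Y ((G.obj N).map (X := X) (Y := Y) f x) =
      (G'.obj N).map (X := X) (Y := Y) f ((g.app N).app X x) :=
  congrArg (fun k => PtdSpace.Hom.toFun k x) ((g.app N).naturality (X := X) (Y := Y) f)

variable {G} in
theorem hom_map_map_apply {G' : SymmFunctor} (g : G ⟶ G') {N : FinSet} {X Y Z : N → PtdSpace}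
    (f : ∀ n, X n ⟶ Y n) (f' : ∀ n, Y n ⟶ Z n) (x : (G.obj N).obj X) :
    (G'.obj N).map (X := Y) (Y := Z) f' ((g.app N).app Y ((G.obj N).map (X := X) (Y := Y) f x)) =
      (G'.obj N).map (X := X) (Y := Z) (fun n => f n ≫ f' n) ((g.app N).app X x) :=
  (congrArg ((G'.obj N).map (X := Y) (Y := Z) f') (hom_map_apply g f x)).trans
    (map_map_apply G' f f' _)

end

/-! ### The associativity comparison -/

section assoc
variable (H G F : SymmFunctor)

/-- The comparison of the terms of `(H ∘ G) ∘ F` and `H ∘ (G ∘ F)` for partitions `N ↠ K ↠ L`, in a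
single variable of `H`. -/
noncomputable def assocBlock {N K L : FinSet} (p : Surj N K) (q : Surj K L) (X : N → PtdSpace)
    (l : L) : (G.obj (q.fib l)).obj (fun k => (F.obj (p.fib k.1)).obj fun n => X n.1) ⟶
      ((comp G F).obj ((p.comp q).fib l)).obj fun n => X n.1 :=
  (G.obj (q.fib l)).map
      (X := fun k => (F.obj (p.fib k.1)).obj fun n => X n.1)
      (Y := fun k => (F.obj ((p.restr q l).fib k)).obj fun n => X n.1.1)
      (fun k => F.perm (p.restrFib q l k) fun n => X n.1) ≫
    compIncl G F (p.restr q l) fun n => X n.1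

/-- The comparison of the terms of `(H ∘ G) ∘ F` and `H ∘ (G ∘ F)` for partitions `N ↠ K ↠ L`. -/
noncomputable def assocTerm {N K L : FinSet} (p : Surj N K) (q : Surj K L) (X : N → PtdSpace) :
    summand H G q (fun k => (F.obj (p.fib k)).obj fun n => X n.1) ⟶
      ((comp H (comp G F)).obj N).obj X :=
  (H.obj L).map
      (X := fun l => (G.obj (q.fib l)).obj fun k => (F.obj (p.fib k.1)).obj fun n => X n.1)
      (Y := fun l => ((comp G F).obj ((p.comp q).fib l)).obj fun n => X n.1)
      (assocBlock G F p q X) ≫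
    compIncl H (comp G F) (p.comp q) X

/-- Naturality of the comparison of blocks in isomorphisms of chains of partitions. -/
theorem assocBlock_square {N K L N' K' L' : FinSet} (p : Surj N K) (q : Surj K L)
    (p' : Surj N' K') (q' : Surj K' L') (e : N' ≃ N) (c : K' ≃ K) (d : L' ≃ L)
    (hp : ∀ n, p (e n) = c (p' n)) (hq : ∀ k, q (c k) = d (q' k))
    (hpq : ∀ n, (p.comp q) (e n) = d ((p'.comp q') n)) (X : N → PtdSpace) (l : L')
    (x : (G.obj (q.fib (d l))).obj (fun k => (F.obj (p.fib k.1)).obj fun n => X n.1)) :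
    (comp G F).perm (Surj.fibEquiv (p'.comp q') (p.comp q) e d hpq l) (fun n => X n.1)
        (assocBlock G F p q X (d l) x) =
      assocBlock G F p' q' (fun n => X (e n)) l
        (G.transport (Surj.fibEquiv q' q c d hq l)
          (Y := fun k => (F.obj (p.fib k.1)).obj fun n => X n.1)
          (Y' := fun k => (F.obj (p'.fib k.1)).obj fun n => X (e n.1))
          (fun k => F.perm (Surj.fibEquiv p' p e c hp k.1) fun n => X n.1) x) := by
  refine (compIncl_square G F (p'.restr q' l) (p.restr q (d l))
    (Surj.fibEquiv (p'.comp q') (p.comp q) e d hpq l) (Surj.fibEquiv q' q c d hq l)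
    (fun n : (p'.comp q').fib l => Subtype.ext (hp n.1))
    (fun n : (p.comp q).fib (d l) => X n.1) _).trans ?_
  refine congrArg (compIncl G F (p'.restr q' l) fun n => X (e n.1)) ?_
  refine (transport_map_apply G _ _ _ _).trans (Eq.trans ?_ (map_transport_apply G _ _ _ _).symm)
  refine transport_congr G _ (fun k => PtdSpace.hom_ext fun y => ?_) x
  exact (perm_perm_apply F ((p'.restr q' l).fibEquiv (p.restr q (d l))
      (Surj.fibEquiv (p'.comp q') (p.comp q) e d hpq l) (q'.fibEquiv q c d hq l)
      (fun n : (p'.comp q').fib l => Subtype.ext (hp n.1)) k)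
      (p.restrFib q (d l) (q'.fibEquiv q c d hq l k)) (fun n : p.fib (c k.1) => X n.1) y).trans
    (perm_perm_apply F (p'.restrFib q' l k) (Surj.fibEquiv p' p e c hp k.1)
      (fun n : p.fib (c k.1) => X n.1) y).symm

/-- Naturality of the comparison of terms in isomorphisms of chains of partitions. -/
theorem assocTerm_square {N K L N' K' L' : FinSet} (p : Surj N K) (q : Surj K L)
    (p' : Surj N' K') (q' : Surj K' L') (e : N' ≃ N) (c : K' ≃ K) (d : L' ≃ L)
    (hp : ∀ n, p (e n) = c (p' n)) (hq : ∀ k, q (c k) = d (q' k)) (X : N → PtdSpace)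
    (x : summand H G q (fun k => (F.obj (p.fib k)).obj fun n => X n.1)) :
    (comp H (comp G F)).perm e X (assocTerm H G F p q X x) =
      assocTerm H G F p' q' (fun n => X (e n))
        (summandMap H G q' (X := fun k => (F.obj (p.fib (c k))).obj fun n => X n.1)
          (Y := fun k => (F.obj (p'.fib k)).obj fun n => X (e n.1))
          (fun k => F.perm (Surj.fibEquiv p' p e c hp k) fun n => X n.1)
          (sqMap H G q' q c d hq (fun k => (F.obj (p.fib k)).obj fun n => X n.1) x)) := by
  have hpq : ∀ n, (p.comp q) (e n) = d ((p'.comp q') n) := fun n =>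
    (congrArg q (hp n)).trans (hq _)
  refine (compIncl_square H (comp G F) (p'.comp q') (p.comp q) e d hpq X _).trans ?_
  refine congrArg (compIncl H (comp G F) (p'.comp q') fun n => X (e n)) ?_
  refine (transport_map_apply H _ _ _ _).trans (Eq.trans ?_
    ((congrArg ((H.obj L').map
      (X := fun l => (G.obj (q'.fib l)).obj fun k => (F.obj (p'.fib k.1)).obj fun n => X (e n.1))
      (Y := fun l => ((comp G F).obj ((p'.comp q').fib l)).obj fun n => X (e n.1))
      (assocBlock G F p' q' fun n => X (e n))) (map_transport_apply H _ _ _ _)).trans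
      (map_transport_apply H _ _ _ _)).symm)
  refine transport_congr H _ (fun l => PtdSpace.hom_ext fun y => ?_) x
  refine (assocBlock_square G F p q p' q' e c d hp hq hpq X l y).trans ?_
  refine congrArg (assocBlock G F p' q' (fun n => X (e n)) l) ?_
  rfl

/-- The comparison `(H ∘ G) ∘ F ⟶ H ∘ (G ∘ F)` at given variables. -/
noncomputable def assocApp (N : FinSet) (X : N → PtdSpace) :
    ((comp (comp H G) F).obj N).obj X ⟶ ((comp H (comp G F)).obj N).obj X :=
  Wedge.desc (X := fun π : Setoid N => summand (comp H G) F (FinSet.proj π) X) fun π =>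
    Wedge.desc (X := fun ρ : Setoid (FinSet.quot π) => summand H G (FinSet.proj ρ)
      fun k => (F.obj ((FinSet.proj π).fib k)).obj fun n => X n.1) fun ρ =>
      assocTerm H G F (FinSet.proj π) (FinSet.proj ρ) X

theorem assocApp_incl {N K L : FinSet} (p : Surj N K) (q : Surj K L) (X : N → PtdSpace)
    (x : summand H G q (fun k => (F.obj (p.fib k)).obj fun n => X n.1)) :
    assocApp H G F N X (compIncl (comp H G) F p X (compIncl H G q _ x)) =
      assocTerm H G F p q X x := by
  let q' : Surj (FinSet.quot (Setoid.ker p)) L :=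
    ⟨fun k => q (p.kerEquiv k), q.surj.comp p.kerEquiv.surjective⟩
  let Y : K → PtdSpace := fun k => (F.obj (p.fib k)).obj fun n => X n.1
  let Y' : FinSet.quot (Setoid.ker p) → PtdSpace := fun k =>
    (F.obj ((FinSet.proj (Setoid.ker p)).fib k)).obj fun n => X n.1
  let h : ∀ k, Y (p.kerEquiv k) ⟶ Y' k := fun k => F.perm
    (Surj.fibEquiv (FinSet.proj (Setoid.ker p)) p (Equiv.refl N) p.kerEquiv (fun _ => rfl) k)
      fun n => X n.1
  have h₁ := compIncl_square H G q' q p.kerEquiv (Equiv.refl L) (fun _ => rfl) Y x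
  have h₂ := compIncl_map H G q' (X := fun k => Y (p.kerEquiv k)) (Y := Y') h
    (sqMap H G q' q p.kerEquiv (Equiv.refl L) (fun _ => rfl) Y x)
  have h₃ := assocTerm_square H G F p q (FinSet.proj (Setoid.ker p)) (FinSet.proj (Setoid.ker q'))
    (Equiv.refl N) p.kerEquiv q'.kerEquiv (fun _ => rfl) (fun _ => rfl) X x
  have h₄ := congrArg (fun k => PtdSpace.Hom.toFun k x)
    (sqMap_trans H G (FinSet.proj (Setoid.ker q')) q' q (Equiv.refl _) p.kerEquiv q'.kerEquiv
      (Equiv.refl L) q'.kerEquiv (fun _ => rfl) (fun _ => rfl) (fun _ => rfl) Y)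
  have h₅ := congrArg (fun k => PtdSpace.Hom.toFun k
      (sqMap H G q' q p.kerEquiv (Equiv.refl L) (fun _ => rfl) Y x))
    (sqMap_natural H G (FinSet.proj (Setoid.ker q')) q' (Equiv.refl _) q'.kerEquiv
      (fun _ => rfl) (X := fun k => Y (p.kerEquiv k)) (Y := Y') h)
  have h₆ := (congrArg (((comp H G).obj (FinSet.quot (Setoid.ker p))).map
    (X := fun k => Y (p.kerEquiv k)) (Y := Y') h) h₁).trans h₂
  refine (congrArg (Wedge.desc (X := fun ρ : Setoid (FinSet.quot (Setoid.ker p)) =>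
    summand H G (FinSet.proj ρ) Y') fun ρ =>
      assocTerm H G F (FinSet.proj (Setoid.ker p)) (FinSet.proj ρ) X) h₆).trans ?_
  refine (congrArg (assocTerm H G F (FinSet.proj (Setoid.ker p)) (FinSet.proj (Setoid.ker q')) X)
    (h₅.trans (congrArg (summandMap H G (FinSet.proj (Setoid.ker q'))
      (X := fun k => Y (p.kerEquiv k)) (Y := Y') h) h₄.symm))).trans ?_
  exact h₃.symm.trans (perm_refl_apply _ X _)

theorem comp_comp_hom_ext {N : FinSet} {X : N → PtdSpace} {Z : PtdSpace}
    {f g : ((comp (comp H G) F).obj N).obj X ⟶ Z}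
    (h : ∀ (K L : FinSet) (p : Surj N K) (q : Surj K L)
      (x : summand H G q (fun k => (F.obj (p.fib k)).obj fun n => X n.1)),
      f (compIncl (comp H G) F p X (compIncl H G q _ x)) =
        g (compIncl (comp H G) F p X (compIncl H G q _ x))) : f = g :=
  comp_hom_ext _ _ fun K p x => congrArg (fun k => PtdSpace.Hom.toFun k x)
    (comp_hom_ext H G (f := compIncl (comp H G) F p X ≫ f) (g := compIncl (comp H G) F p X ≫ g)
      fun L q x => h K L p q x)

theorem assocTerm_map {N K L : FinSet} (p : Surj N K) (q : Surj K L) {X Y : N → PtdSpace}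
    (f : ∀ n, X n ⟶ Y n) (x : summand H G q (fun k => (F.obj (p.fib k)).obj fun n => X n.1)) :
    ((comp H (comp G F)).obj N).map (X := X) (Y := Y) f (assocTerm H G F p q X x) =
      assocTerm H G F p q Y (summandMap H G q (fun k => (F.obj (p.fib k)).map
        (X := fun n => X n.1) (Y := fun n => Y n.1) fun n => f n.1) x) := by
  refine (compIncl_map H (comp G F) (p.comp q) f _).trans ?_
  refine congrArg (compIncl H (comp G F) (p.comp q) Y) ?_
  refine (map_map_apply H _ _ _).trans (Eq.trans ?_ (map_map_apply H _ _ _).symm)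
  refine map_congr H (fun l => PtdSpace.hom_ext fun y => ?_) x
  refine (compIncl_map G F (p.restr q l) (X := fun n => X n.1) (Y := fun n => Y n.1)
    (fun n => f n.1) _).trans ?_
  refine congrArg (compIncl G F (p.restr q l) fun n => Y n.1) ?_
  refine (map_map_apply G _ _ _).trans (Eq.trans ?_ (map_map_apply G _ _ _).symm)
  exact map_congr G (fun k => (F.perm_natural (p.restrFib q l k) (X := fun n => X n.1)
    (Y := fun n => Y n.1) fun n => f n.1).symm) y

variable {H G F} in
theorem assocTerm_hom {H' G' F' : SymmFunctor} (η : H ⟶ H') (θ : G ⟶ G') (ζ : F ⟶ F')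
    {N K L : FinSet} (p : Surj N K) (q : Surj K L) (X : N → PtdSpace)
    (x : summand H G q (fun k => (F.obj (p.fib k)).obj fun n => X n.1)) :
    ((compHom η (compHom θ ζ)).app N).app X (assocTerm H G F p q X x) =
      assocTerm H' G' F' p q X (summandHom η θ q _ (summandMap H G q
        (X := fun k => (F.obj (p.fib k)).obj fun n => X n.1)
        (Y := fun k => (F'.obj (p.fib k)).obj fun n => X n.1)
        (fun k => (ζ.app (p.fib k)).app fun n => X n.1) x)) := by
  refine (compIncl_hom η (compHom θ ζ) (p.comp q) X _).trans ?_
  refine congrArg (compIncl H' (comp G' F') (p.comp q) X) ?_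
  refine (hom_map_map_apply η
    (X := fun l => (G.obj (q.fib l)).obj fun k => (F.obj (p.fib k.1)).obj fun n => X n.1)
    (Z := fun l => ((comp G' F').obj ((p.comp q).fib l)).obj fun n => X n.1)
    (assocBlock G F p q X)
    (fun l => ((compHom θ ζ).app ((p.comp q).fib l)).app fun n => X n.1) x).trans ?_
  refine Eq.trans ?_ (congrArg ((H'.obj L).map
    (X := fun l => (G'.obj (q.fib l)).obj fun k => (F'.obj (p.fib k.1)).obj fun n => X n.1)
    (Y := fun l => ((comp G' F').obj ((p.comp q).fib l)).obj fun n => X n.1)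
    (assocBlock G' F' p q X)) (hom_map_map_apply η
    (X := fun l => (G.obj (q.fib l)).obj fun k => (F.obj (p.fib k.1)).obj fun n => X n.1)
    (Y := fun l => (G.obj (q.fib l)).obj fun k => (F'.obj (p.fib k.1)).obj fun n => X n.1)
    (Z := fun l => (G'.obj (q.fib l)).obj fun k => (F'.obj (p.fib k.1)).obj fun n => X n.1)
    (fun l => (G.obj (q.fib l)).map
      (X := fun k => (F.obj (p.fib k.1)).obj fun n => X n.1)
      (Y := fun k => (F'.obj (p.fib k.1)).obj fun n => X n.1)
      fun k => (ζ.app (p.fib k.1)).app fun n => X n.1)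
    (fun l => (θ.app (q.fib l)).app _) x).symm)
  refine Eq.trans ?_ (map_map_apply H' _ _ _).symm
  refine map_congr H' (fun l => PtdSpace.hom_ext fun y => ?_) _
  refine (compIncl_hom θ ζ (p.restr q l) (fun n => X n.1) _).trans ?_
  refine congrArg (compIncl G' F' (p.restr q l) fun n => X n.1) ?_
  refine (hom_map_map_apply θ
    (X := fun k : q.fib l => (F.obj (p.fib k.1)).obj fun n => X n.1)
    (Z := fun k : q.fib l => (F'.obj ((p.restr q l).fib k)).obj fun n => X n.1.1)
    (fun k : q.fib l => F.perm (p.restrFib q l k) fun n => X n.1)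
    (fun k : q.fib l => (ζ.app ((p.restr q l).fib k)).app fun n => X n.1.1) y).trans ?_
  refine Eq.trans ?_ (hom_map_map_apply θ
    (X := fun k : q.fib l => (F.obj (p.fib k.1)).obj fun n => X n.1)
    (Y := fun k : q.fib l => (F'.obj (p.fib k.1)).obj fun n => X n.1)
    (Z := fun k : q.fib l => (F'.obj ((p.restr q l).fib k)).obj fun n => X n.1.1)
    (fun k : q.fib l => (ζ.app (p.fib k.1)).app fun n => X n.1)
    (fun k : q.fib l => F'.perm (p.restrFib q l k) fun n => X n.1) y).symm
  exact map_congr G' (fun k => (ζ.equivariant (p.restrFib q l k) fun n => X n.1).symm) _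

theorem assocApp_map {N : FinSet} {X Y : N → PtdSpace} (f : ∀ n, X n ⟶ Y n) :
    ((comp (comp H G) F).obj N).map (X := X) (Y := Y) f ≫ assocApp H G F N Y =
      assocApp H G F N X ≫ ((comp H (comp G F)).obj N).map (X := X) (Y := Y) f :=
  comp_comp_hom_ext H G F fun K L p q x => by
    have h₁ := (compIncl_map (comp H G) F p f (compIncl H G q _ x)).trans
      (congrArg (compIncl (comp H G) F p Y) (compIncl_map H G q
        (X := fun k => (F.obj (p.fib k)).obj fun n => X n.1)
        (Y := fun k => (F.obj (p.fib k)).obj fun n => Y n.1)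
        (fun k => (F.obj (p.fib k)).map (X := fun n => X n.1) (Y := fun n => Y n.1)
          fun n => f n.1) x))
    have h₂ := (congrArg (((comp H (comp G F)).obj N).map (X := X) (Y := Y) f)
      (assocApp_incl H G F p q X x)).trans (assocTerm_map H G F p q f x)
    exact (congrArg (assocApp H G F N Y) h₁).trans ((assocApp_incl H G F p q Y _).trans h₂.symm)

theorem assocApp_perm {M N : FinSet} (e : M ≃ N) (X : N → PtdSpace) :
    assocApp H G F N X ≫ (comp H (comp G F)).perm e X =
      (comp (comp H G) F).perm e X ≫ assocApp H G F M fun m => X (e m) :=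
  comp_comp_hom_ext H G F fun K L p q x => by
    let p' : Surj M K := ⟨fun m => p (e m), p.surj.comp e.surjective⟩
    have h₀ := congrArg (fun k => PtdSpace.Hom.toFun k x)
      (sqMap_refl H G q (Equiv.refl L) (fun _ => rfl)
        fun k => (F.obj (p.fib k)).obj fun n => X n.1)
    have h₁ := assocTerm_square H G F p q p' q e (Equiv.refl K) (Equiv.refl L) (fun _ => rfl)
      (fun _ => rfl) X x
    have h₂ := compIncl_square (comp H G) F p' p e (Equiv.refl K) (fun _ => rfl) X
      (compIncl H G q _ x)
    have h₃ := transport_refl_apply (comp H G)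
      (Y := fun k => (F.obj (p.fib k)).obj fun n => X n.1)
      (Y' := fun k => (F.obj (p'.fib k)).obj fun n => X (e n.1))
      (fun k => F.perm (Surj.fibEquiv p' p e (Equiv.refl K) (fun _ => rfl) k) fun n => X n.1)
      (compIncl H G q _ x)
    have h₄ := compIncl_map H G q
      (X := fun k => (F.obj (p.fib k)).obj fun n => X n.1)
      (Y := fun k => (F.obj (p'.fib k)).obj fun n => X (e n.1))
      (fun k => F.perm (Surj.fibEquiv p' p e (Equiv.refl K) (fun _ => rfl) k) fun n => X n.1) x
    refine ((congrArg ((comp H (comp G F)).perm e X) (assocApp_incl H G F p q X x)).trans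
      h₁).trans (Eq.trans ?_ (congrArg (assocApp H G F M fun m => X (e m))
        (h₂.trans (congrArg (compIncl (comp H G) F p' fun m => X (e m)) (h₃.trans h₄)))).symm)
    refine Eq.trans ?_ (assocApp_incl H G F p' q (fun m => X (e m)) _).symm
    exact congrArg (fun y => assocTerm H G F p' q (fun m => X (e m))
      (summandMap H G q (X := fun k => (F.obj (p.fib k)).obj fun n => X n.1)
      (Y := fun k => (F.obj (p'.fib k)).obj fun n => X (e n.1))
      (fun k => F.perm (Surj.fibEquiv p' p e (Equiv.refl K) (fun _ => rfl) k) fun n => X n.1) y)) h₀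

/-- The comparison `(H ∘ G) ∘ F ⟶ H ∘ (G ∘ F)`. -/
noncomputable def assocHom : comp (comp H G) F ⟶ comp H (comp G F) :=
  Hom.mk (fun N => { app X := assocApp H G F N X, naturality X Y f := assocApp_map H G F f })
    fun e X => assocApp_perm H G F e X

end assoc
end SymmFunctor

/-! ### The unit comparisons for symmetric functor sequences -/

theorem PtdSpace.comp_comp_eq {T U V W Z : PtdSpace} (a : T ⟶ U) (b : U ⟶ V) (c : V ⟶ W)
    (d : T ⟶ Z) (e : Z ⟶ W) (h : ∀ x, c (b (a x)) = e (d x)) : (a ≫ b) ≫ c = d ≫ e :=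
  PtdSpace.hom_ext h

namespace SymmFunctor

theorem unit_perm_incl {M N : FinSet} (e : M ≃ N) (X : N → PtdSpace) (m : M)
    (hN : Subsingleton N) (hM : Subsingleton M) (x : X (e m)) :
    unit.perm e X (Wedge.incl (fun i : {_n : N // Subsingleton N} => X i.1) ⟨e m, hN⟩ x) =
      Wedge.incl (fun i : {_m : M // Subsingleton M} => X (e i.1)) ⟨m, hM⟩ x := by
  have : ∀ (m' : M) (h : m' = m) (h' : X (e m) = X (e m')),
      Wedge.incl (fun i : {_m : M // Subsingleton M} => X (e i.1)) ⟨m', hM⟩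
        ((eqToHom h' : X (e m) ⟶ X (e m')) x) =
        Wedge.incl (fun i : {_m : M // Subsingleton M} => X (e i.1)) ⟨m, hM⟩ x := by
    rintro m' rfl h'
    rfl
  exact this _ (e.symm_apply_apply m) _

theorem unit_transport_incl {M N : FinSet} (c : M ≃ N) {X : N → PtdSpace} {Y : M → PtdSpace}
    (h : ∀ m, X (c m) ⟶ Y m) (m : M) (hN : Subsingleton N) (hM : Subsingleton M) (x : X (c m)) :
    unit.transport c h (Wedge.incl (fun i : {_n : N // Subsingleton N} => X i.1) ⟨c m, hN⟩ x) =
      Wedge.incl (fun i : {_m : M // Subsingleton M} => Y i.1) ⟨m, hM⟩ (h m x) :=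
  congrArg ((unit.obj M).map (X := fun m => X (c m)) (Y := Y) h) (unit_perm_incl c X m hN hM x)

section
variable (F : SymmFunctor)

/-- The comparison `id ∘ F ⟶ F` at given variables. -/
def lamApp (N : FinSet) (X : N → PtdSpace) : ((comp unit F).obj N).obj X ⟶ (F.obj N).obj X :=
  Wedge.desc (X := fun π : Setoid N => summand unit F (FinSet.proj π) X) fun π =>
    Wedge.desc (X := fun i : {_k : FinSet.quot π // Subsingleton (FinSet.quot π)} =>
      (F.obj ((FinSet.proj π).fib i.1)).obj fun n => X n.1) fun i =>
      F.perm ((FinSet.proj π).onlyFib i.2 i.1) fun n => X n.1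

/-- The inclusion of the term `F_N(X)` of `(id ∘ F)_N(X)`, for a partition with one block. -/
noncomputable def lamIncl {N K : FinSet} (p : Surj N K) (hK : Subsingleton K) (k : K)
    (X : N → PtdSpace) :
    ((F.obj (p.fib k)).obj fun n => X n.1) ⟶ ((comp unit F).obj N).obj X :=
  Wedge.incl (fun i : {_k : K // Subsingleton K} =>
    (F.obj (p.fib i.1)).obj fun n => X n.1) ⟨k, hK⟩ ≫ compIncl unit F p X

theorem lamIncl_square {N K N' K' : FinSet} (p' : Surj N' K') (p : Surj N K) (e : N' ≃ N)
    (c : K' ≃ K) (h : ∀ n, p (e n) = c (p' n)) (hK : Subsingleton K) (hK' : Subsingleton K')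
    (k : K') (X : N → PtdSpace) (x : (F.obj (p.fib (c k))).obj fun n => X n.1) :
    (comp unit F).perm e X (lamIncl F p hK (c k) X x) =
      lamIncl F p' hK' k (fun n => X (e n))
        (F.perm (Surj.fibEquiv p' p e c h k) (fun n => X n.1) x) :=
  (compIncl_square unit F p' p e c h X _).trans
    (congrArg (compIncl unit F p' fun n => X (e n)) (unit_transport_incl c
      (X := fun k => (F.obj (p.fib k)).obj fun n => X n.1)
      (Y := fun k => (F.obj (p'.fib k)).obj fun n => X (e n.1)) _ k hK hK' x))

theorem lamApp_incl {N K : FinSet} (p : Surj N K) (hK : Subsingleton K) (k : K) (X : N → PtdSpace)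
    (x : (F.obj (p.fib k)).obj fun n => X n.1) :
    lamApp F N X (lamIncl F p hK k X x) = F.perm (p.onlyFib hK k) (fun n => X n.1) x := by
  obtain ⟨k, rfl⟩ := p.kerEquiv.surjective k
  have hK' : Subsingleton (FinSet.quot (Setoid.ker p)) := p.kerEquiv.subsingleton
  have h := unit_transport_incl p.kerEquiv
    (X := fun k => (F.obj (p.fib k)).obj fun n => X n.1)
    (Y := fun k => (F.obj ((FinSet.proj (Setoid.ker p)).fib k)).obj fun n => X n.1)
    (fun k => F.perm (Surj.fibEquiv (FinSet.proj (Setoid.ker p)) p (Equiv.refl N) p.kerEquiv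
      (fun _ => rfl) k) fun n => X n.1) k hK hK' x
  refine (congrArg (Wedge.desc (Y := (F.obj N).obj X)
    (X := fun i : {_k : FinSet.quot (Setoid.ker p) // Subsingleton (FinSet.quot (Setoid.ker p))} =>
      (F.obj ((FinSet.proj (Setoid.ker p)).fib i.1)).obj fun n => X n.1) fun i =>
      F.perm ((FinSet.proj (Setoid.ker p)).onlyFib i.2 i.1) fun n => X n.1) h).trans ?_
  exact perm_perm_apply F ((FinSet.proj (Setoid.ker p)).onlyFib hK' k)
    (Surj.fibEquiv (FinSet.proj (Setoid.ker p)) p (Equiv.refl N) p.kerEquiv (fun _ => rfl) k)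
    (fun n : p.fib (p.kerEquiv k) => X n.1) x

theorem comp_unit_hom_ext {N : FinSet} {X : N → PtdSpace} {Z : PtdSpace}
    {f g : ((comp unit F).obj N).obj X ⟶ Z}
    (h : ∀ (K : FinSet) (p : Surj N K) (hK : Subsingleton K) (k : K)
      (x : (F.obj (p.fib k)).obj fun n => X n.1),
      f (lamIncl F p hK k X x) = g (lamIncl F p hK k X x)) : f = g :=
  comp_hom_ext _ _ fun K p x => congrArg (fun k => PtdSpace.Hom.toFun k x)
    (Wedge.hom_ext (f := compIncl unit F p X ≫ f) (g := compIncl unit F p X ≫ g)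
      fun i => PtdSpace.hom_ext fun x => h K p i.2 i.1 x)

/-- The comparison `id ∘ F ⟶ F`. -/
def lamHom : comp unit F ⟶ F :=
  Hom.mk (fun N =>
    { app X := lamApp F N X
      naturality X Y f := comp_unit_hom_ext F fun K p hK k x =>
        (congrArg (lamApp F N Y) (compIncl_map unit F p f
          (Wedge.incl (fun i : {_k : K // Subsingleton K} =>
            (F.obj (p.fib i.1)).obj fun n => X n.1) ⟨k, hK⟩ x))).trans
          ((lamApp_incl F p hK k Y _).trans ((perm_map_apply F (p.onlyFib hK k)
            (X := fun n => X n.1) (Y := fun n => Y n.1) (fun n => f n.1) x).trans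
              (congrArg ((F.obj N).map f) (lamApp_incl F p hK k X x).symm))) })
    fun {M N} e X => comp_unit_hom_ext F fun K p hK k x => by
      let p' : Surj M K := ⟨fun m => p (e m), p.surj.comp e.surjective⟩
      refine (congrArg (F.perm e X) (lamApp_incl F p hK k X x)).trans (Eq.trans ?_
        ((congrArg (lamApp F M fun m => X (e m)) (lamIncl_square F p' p e (Equiv.refl K)
          (fun _ => rfl) hK hK k X x)).trans (lamApp_incl F p' hK k (fun m => X (e m)) _)).symm)
      exact (perm_perm_apply F e (p.onlyFib hK k) (fun n : p.fib k => X n.1) x).trans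
        (perm_perm_apply F (p'.onlyFib hK k)
          (Surj.fibEquiv p' p e (Equiv.refl K) (fun _ => rfl) k)
          (fun n : p.fib k => X n.1) x).symm

/-- The inclusion of a space as the value of the unit at it, for a block with one element of a
partition into points. -/
def unitIncl {N : FinSet} (X : N → PtdSpace) (n : N) :
    X n ⟶ (unit.obj ((Surj.id N).fib n)).obj fun m => X m.1 :=
  Wedge.incl (fun i : {_m : (Surj.id N).fib n // Subsingleton ((Surj.id N).fib n)} =>
    X i.1.1) ⟨⟨n, rfl⟩, (Surj.id N).fib_subsingleton (fun _ _ h => h) n⟩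

/-- The comparison `F ⟶ F ∘ id` at given variables. -/
noncomputable def rhoApp (N : FinSet) (X : N → PtdSpace) :
    (F.obj N).obj X ⟶ ((comp F unit).obj N).obj X :=
  (F.obj N).map (X := X)
      (Y := fun n => (SymmFunctor.unit.obj ((Surj.id N).fib n)).obj fun m => X m.1)
      (unitIncl X) ≫ compIncl F unit (Surj.id N) X

/-- The comparison `F ⟶ F ∘ id`. -/
noncomputable def rhoHom : F ⟶ comp F unit :=
  Hom.mk (fun N =>
    { app X := rhoApp F N X
      naturality X Y f := PtdSpace.hom_ext fun x => by
        refine Eq.trans ?_ (compIncl_map F unit (Surj.id N) f _).symm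
        refine congrArg (compIncl F unit (Surj.id N) Y) ?_
        exact (map_map_apply F (X := X) (Y := Y)
          (Z := fun n => (unit.obj ((Surj.id N).fib n)).obj fun m => Y m.1) f (unitIncl Y) x).trans
          (map_map_apply F (X := X)
            (Y := fun n => (unit.obj ((Surj.id N).fib n)).obj fun m => X m.1)
            (Z := fun n => (unit.obj ((Surj.id N).fib n)).obj fun m => Y m.1) (unitIncl X)
            (fun n => (unit.obj ((Surj.id N).fib n)).map (X := fun m => X m.1)
              (Y := fun m => Y m.1) fun m => f m.1) x).symm })
    fun {M N} e X => PtdSpace.hom_ext fun x => by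
      refine (compIncl_square F unit (Surj.id M) (Surj.id N) e e (fun _ => rfl) X _).trans ?_
      refine congrArg (compIncl F unit (Surj.id M) fun m => X (e m)) ?_
      refine (transport_map_apply F e _ _ x).trans ?_
      refine transport_congr F e (fun m => PtdSpace.hom_ext fun y => ?_) x
      exact unit_perm_incl (Surj.fibEquiv (Surj.id M) (Surj.id N) e e (fun _ => rfl) m)
        (fun n => X n.1) ⟨m, rfl⟩ _ _ y

end

section axioms

theorem comp_app_apply {F G H : SymmFunctor} (f : F ⟶ G) (g : G ⟶ H) (N : FinSet)
    (X : N → PtdSpace) (x : (F.obj N).obj X) :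
    (Hom.app (f ≫ g) N).app X x = (g.app N).app X ((f.app N).app X x) := rfl

theorem assocHom_incl (H G F : SymmFunctor) {N K L : FinSet} (p : Surj N K) (q : Surj K L)
    (X : N → PtdSpace) (x : summand H G q (fun k => (F.obj (p.fib k)).obj fun n => X n.1)) :
    ((assocHom H G F).app N).app X (compIncl (comp H G) F p X (compIncl H G q
      (fun k => (F.obj (p.fib k)).obj fun n => X n.1) x)) = assocTerm H G F p q X x :=
  assocApp_incl H G F p q X x

theorem lamHom_incl (F : SymmFunctor) {N K : FinSet} (p : Surj N K) (hK : Subsingleton K) (k : K)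
    (X : N → PtdSpace) (x : (F.obj (p.fib k)).obj fun n => X n.1) :
    ((lamHom F).app N).app X (lamIncl F p hK k X x) = F.perm (p.onlyFib hK k) (fun n => X n.1) x :=
  lamApp_incl F p hK k X x

theorem assocHom_lamIncl (A B : SymmFunctor) {N K L : FinSet} (p : Surj N K) (q : Surj K L)
    (hL : Subsingleton L) (l : L) (X : N → PtdSpace)
    (x : (A.obj (q.fib l)).obj fun k => (B.obj (p.fib k.1)).obj fun n => X n.1) :
    ((assocHom unit A B).app N).app X (compIncl (comp unit A) B p X (lamIncl A q hL l
      (fun k => (B.obj (p.fib k)).obj fun n => X n.1) x)) =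
      lamIncl (comp A B) (p.comp q) hL l X (assocBlock A B p q X l x) :=
  assocHom_incl unit A B p q X (Wedge.incl (fun i : {_l : L // Subsingleton L} =>
    (A.obj (q.fib i.1)).obj fun k => (B.obj (p.fib k.1)).obj fun n => X n.1) ⟨l, hL⟩ x)

theorem comp_comp_unit_hom_ext (A B : SymmFunctor) {N : FinSet} {X : N → PtdSpace} {Z : PtdSpace}
    {f g : ((comp (comp unit A) B).obj N).obj X ⟶ Z}
    (h : ∀ (K L : FinSet) (p : Surj N K) (q : Surj K L) (hL : Subsingleton L) (l : L)
      (x : (A.obj (q.fib l)).obj fun k => (B.obj (p.fib k.1)).obj fun n => X n.1),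
      f (compIncl (comp unit A) B p X (lamIncl A q hL l
        (fun k => (B.obj (p.fib k)).obj fun n => X n.1) x)) =
        g (compIncl (comp unit A) B p X (lamIncl A q hL l
          (fun k => (B.obj (p.fib k)).obj fun n => X n.1) x))) : f = g :=
  comp_hom_ext _ _ fun K p x => congrArg (fun k => PtdSpace.Hom.toFun k x)
    (comp_unit_hom_ext A (f := compIncl (comp unit A) B p X ≫ f)
      (g := compIncl (comp unit A) B p X ≫ g) fun L q hL l x => h K L p q hL l x)

/-- The values of `F` on the blocks of a labelled partition. -/
abbrev blocks (F : SymmFunctor) {N K : FinSet} (p : Surj N K) (X : N → PtdSpace) : K → PtdSpace :=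
  fun k => (F.obj (p.fib k)).obj fun n => X n.1

theorem comp_comp_comp_hom_ext (A B D E : SymmFunctor) {N : FinSet} {X : N → PtdSpace}
    {Z : PtdSpace} {f g : ((comp (comp (comp A B) D) E).obj N).obj X ⟶ Z}
    (h : ∀ (K L M : FinSet) (p : Surj N K) (q : Surj K L) (r : Surj L M)
      (x : summand A B r (blocks D q (blocks E p X))),
      f (compIncl (comp (comp A B) D) E p X (compIncl (comp A B) D q (blocks E p X)
          (compIncl A B r (blocks D q (blocks E p X)) x))) =
        g (compIncl (comp (comp A B) D) E p X (compIncl (comp A B) D q (blocks E p X)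
          (compIncl A B r (blocks D q (blocks E p X)) x)))) : f = g :=
  comp_comp_hom_ext (comp A B) D E fun K L p q x => congrArg (fun k => PtdSpace.Hom.toFun k x)
    (comp_hom_ext A B
      (f := compIncl (comp A B) D q (blocks E p X) ≫ compIncl (comp (comp A B) D) E p X ≫ f)
      (g := compIncl (comp A B) D q (blocks E p X) ≫ compIncl (comp (comp A B) D) E p X ≫ g)
      fun M r x => h K L M p q r x)

theorem compHom_left_apply {G G' : SymmFunctor} (g : G ⟶ G') (F : SymmFunctor) {N K : FinSet}
    (p : Surj N K) (X : N → PtdSpace) (x : summand G F p X) :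
    ((compHom g (𝟙 F)).app N).app X (compIncl G F p X x) =
      compIncl G' F p X ((g.app K).app (fun k => (F.obj (p.fib k)).obj fun n => X n.1) x) :=
  (compIncl_hom g (𝟙 F) p X x).trans (congrArg (compIncl G' F p X)
    (map_id_apply G' (X := fun k => (F.obj (p.fib k)).obj fun n => X n.1)
      (fun k => ((Hom.app (𝟙 F) (p.fib k)).app fun n => X n.1)) (fun _ => rfl) _))

theorem compHom_right_apply (G : SymmFunctor) {F F' : SymmFunctor} (f : F ⟶ F') {N K : FinSet}
    (p : Surj N K) (X : N → PtdSpace) (x : summand G F p X) :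
    ((compHom (𝟙 G) f).app N).app X (compIncl G F p X x) =
      compIncl G F' p X ((G.obj K).map (X := fun k => (F.obj (p.fib k)).obj fun n => X n.1)
        (Y := fun k => (F'.obj (p.fib k)).obj fun n => X n.1)
        (fun k => (f.app (p.fib k)).app fun n => X n.1) x) :=
  compIncl_hom (𝟙 G) f p X x

theorem assocHom_natural {H H' G G' F F' : SymmFunctor} (η : H ⟶ H') (θ : G ⟶ G') (ζ : F ⟶ F') :
    compHom (compHom η θ) ζ ≫ assocHom H' G' F' = assocHom H G F ≫ compHom η (compHom θ ζ) :=
  hom_ext fun N X => comp_comp_hom_ext H G F fun K L p q x => by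
    have h₁ := (compIncl_hom (compHom η θ) ζ p X (compIncl H G q _ x)).trans
      (congrArg (compIncl (comp H' G') F' p X)
        ((hom_map_apply (compHom η θ)
          (X := fun k => (F.obj (p.fib k)).obj fun n => X n.1)
          (Y := fun k => (F'.obj (p.fib k)).obj fun n => X n.1)
          (fun k => (ζ.app (p.fib k)).app fun n => X n.1) (compIncl H G q _ x)).symm.trans
        ((congrArg (((compHom η θ).app K).app _) (compIncl_map H G q
          (X := fun k => (F.obj (p.fib k)).obj fun n => X n.1)
          (Y := fun k => (F'.obj (p.fib k)).obj fun n => X n.1)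
          (fun k => (ζ.app (p.fib k)).app fun n => X n.1) x)).trans
          (compIncl_hom η θ q _ _))))
    exact (congrArg (assocApp H' G' F' N X) h₁).trans ((assocApp_incl H' G' F' p q X _).trans
      ((assocTerm_hom η θ ζ p q X x).symm.trans (congrArg
        (((compHom η (compHom θ ζ)).app N).app X) (assocApp_incl H G F p q X x).symm)))

theorem lamHom_natural {F F' : SymmFunctor} (η : F ⟶ F') :
    compHom (𝟙 unit) η ≫ lamHom F' = lamHom F ≫ η :=
  hom_ext fun N X => comp_unit_hom_ext F fun K p hK k x =>
    (congrArg (lamApp F' N X) (compHom_right_apply unit η p X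
      (Wedge.incl (fun i : {_k : K // Subsingleton K} =>
        (F.obj (p.fib i.1)).obj fun n => X n.1) ⟨k, hK⟩ x))).trans
      ((lamApp_incl F' p hK k X _).trans ((congrArg (fun k => PtdSpace.Hom.toFun k x)
        (η.equivariant (p.onlyFib hK k) fun n => X n.1)).trans
          (congrArg ((η.app N).app X) (lamApp_incl F p hK k X x).symm)))

theorem rhoHom_natural {F F' : SymmFunctor} (η : F ⟶ F') :
    rhoHom F ≫ compHom η (𝟙 unit) = η ≫ rhoHom F' :=
  hom_ext fun N X => PtdSpace.hom_ext fun x => by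
    refine (compIncl_hom η (𝟙 unit) (Surj.id N) X _).trans ?_
    refine congrArg (compIncl F' unit (Surj.id N) X) ?_
    refine (map_id_apply F' _ (fun _ => rfl) _).trans ?_
    exact hom_map_apply η _ x

/-- The comparison of blocks does not change, up to relabelling, when the partitions are restricted
to a block of a coarser partition. -/
theorem assocBlock_assocBlock (D E : SymmFunctor) {N K L M : FinSet} (p : Surj N K) (q : Surj K L)
    (r : Surj L M) (X : N → PtdSpace) (m : M) (l : r.fib m)
    (z : (D.obj (q.fib l.1)).obj fun k => (E.obj (p.fib k.1)).obj fun n => X n.1) :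
    (comp D E).perm ((p.comp q).restrFib r m l) (fun n => X n.1) (assocBlock D E p q X l.1 z) =
      assocBlock D E (p.restr (q.comp r) m) (q.restr r m) (fun n => X n.1) l
        (D.transport (q.restrFib r m l) (Y := fun k => (E.obj (p.fib k.1)).obj fun n => X n.1)
          (Y' := fun k => (E.obj ((p.restr (q.comp r) m).fib k.1)).obj fun n => X n.1.1)
          (fun k => E.perm (p.restrFib (q.comp r) m k.1) fun n => X n.1) z) := by
  refine (compIncl_square D E ((p.restr (q.comp r) m).restr (q.restr r m) l) (p.restr q l.1)
    ((p.comp q).restrFib r m l) (q.restrFib r m l) (fun _ => rfl)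
    (fun n : (p.comp q).fib l.1 => X n.1) _).trans ?_
  refine congrArg (compIncl D E ((p.restr (q.comp r) m).restr (q.restr r m) l) fun n => X n.1.1) ?_
  refine (transport_map_apply D _ _ _ _).trans (Eq.trans ?_ (map_transport_apply D _ _ _ _).symm)
  refine transport_congr D _ (fun k => PtdSpace.hom_ext fun y => ?_) z
  exact (perm_perm_apply E (Surj.fibEquiv ((p.restr (q.comp r) m).restr (q.restr r m) l)
      (p.restr q l.1) ((p.comp q).restrFib r m l) (q.restrFib r m l) (fun _ => rfl) k)
      (p.restrFib q l.1 (q.restrFib r m l k))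
      (fun n : p.fib k.1.1 => X n.1) y).trans
    (perm_perm_apply E ((p.restr (q.comp r) m).restrFib (q.restr r m) l k)
      (p.restrFib (q.comp r) m k.1) (fun n : p.fib k.1.1 => X n.1) y).symm

/-- The pentagon in a single variable of the outermost functor. -/
theorem assocHom_assocBlock (B D E : SymmFunctor) {N K L M : FinSet} (p : Surj N K) (q : Surj K L)
    (r : Surj L M) (X : N → PtdSpace) (m : M)
    (y : (B.obj (r.fib m)).obj fun l => (D.obj (q.fib l.1)).obj fun k =>
      (E.obj (p.fib k.1)).obj fun n => X n.1) :
    ((assocHom B D E).app ((p.comp (q.comp r)).fib m)).app (fun n => X n.1)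
        (assocBlock (comp B D) E p (q.comp r) X m (assocBlock B D q r
          (fun k => (E.obj (p.fib k)).obj fun n => X n.1) m y)) =
      assocBlock B (comp D E) (p.comp q) r X m ((B.obj (r.fib m)).map
        (X := fun l => (D.obj (q.fib l.1)).obj fun k => (E.obj (p.fib k.1)).obj fun n => X n.1)
        (Y := fun l => ((comp D E).obj ((p.comp q).fib l.1)).obj fun n => X n.1)
        (fun l => assocBlock D E p q X l.1) y) := by
  let Y : K → PtdSpace := fun k => (E.obj (p.fib k)).obj fun n => X n.1
  let Z : r.fib m → PtdSpace := fun l => (D.obj (q.fib l.1)).obj fun k => Y k.1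
  let Y' : (q.comp r).fib m → PtdSpace := fun k =>
    (E.obj ((p.restr (q.comp r) m).fib k)).obj fun n => X n.1.1
  let Z' : r.fib m → PtdSpace := fun l => (D.obj ((q.restr r m).fib l)).obj fun k => Y k.1.1
  let Z'' : r.fib m → PtdSpace := fun l => (D.obj ((q.restr r m).fib l)).obj fun k => Y' k.1
  let V : r.fib m → PtdSpace := fun l =>
    ((comp D E).obj (((p.comp q).restr r m).fib l)).obj fun n => X n.1.1
  let V' : r.fib m → PtdSpace := fun l =>
    ((comp D E).obj ((p.comp q).fib l.1)).obj fun n => X n.1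
  let a : ∀ l, Z l ⟶ Z' l := fun l => D.perm (q.restrFib r m l) fun k => Y k.1
  let b : ∀ k : (q.comp r).fib m, Y k.1 ⟶ Y' k := fun k =>
    E.perm (p.restrFib (q.comp r) m k) fun n => X n.1
  let b' : ∀ l, Z' l ⟶ Z'' l := fun l => (D.obj ((q.restr r m).fib l)).map
    (X := fun k => Y k.1.1) (Y := fun k => Y' k.1) fun k => b k.1
  let z := (B.obj (r.fib m)).map (X := Z) (Y := Z') a y
  have s₁ := congrArg (compIncl (comp B D) E (p.restr (q.comp r) m) fun n => X n.1)
    (compIncl_map B D (q.restr r m) (X := fun k => Y k.1) (Y := Y') b z)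
  have s₂ := assocApp_incl B D E (p.restr (q.comp r) m) (q.restr r m) (fun n => X n.1)
    ((B.obj (r.fib m)).map (X := Z') (Y := Z'') b' z)
  have s₃ := map_map_apply B (X := Z) (Y := Z') (Z := Z'') a b' y
  have s₄ := map_map_apply B (X := Z) (Y := Z'') (Z := V) (fun l => a l ≫ b' l)
    (assocBlock D E (p.restr (q.comp r) m) (q.restr r m) fun n => X n.1) y
  have s₅ := map_map_apply B (X := Z) (Y := V') (Z := V) (fun l => assocBlock D E p q X l.1)
    (fun l => (comp D E).perm ((p.comp q).restrFib r m l) fun n : (p.comp q).fib l.1 => X n.1) y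
  have s₆ := map_congr B (X := Z) (Y := V)
    (f := fun l => (a l ≫ b' l) ≫ assocBlock D E (p.restr (q.comp r) m) (q.restr r m)
      (fun n => X n.1) l)
    (g := fun l => assocBlock D E p q X l.1 ≫
      (comp D E).perm ((p.comp q).restrFib r m l) fun n : (p.comp q).fib l.1 => X n.1)
    (fun l => PtdSpace.hom_ext fun z => (assocBlock_assocBlock D E p q r X m l z).symm) y
  refine ((congrArg (assocApp B D E ((p.comp (q.comp r)).fib m) fun n => X n.1) s₁).trans s₂).trans
    ?_
  refine congrArg (compIncl B (comp D E) ((p.comp q).restr r m) fun n => X n.1) ?_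
  exact (congrArg ((B.obj (r.fib m)).map (X := Z'') (Y := V)
    (assocBlock D E (p.restr (q.comp r) m) (q.restr r m) fun n => X n.1)) s₃).trans
    (s₄.trans (s₆.trans s₅.symm))

-- The proof only uses the values of these maps on terms. Unfolding them is expensive.
attribute [local irreducible] compHom assocHom compIncl assocApp assocBlock in
theorem pentagon (A B D E : SymmFunctor) :
    compHom (assocHom A B D) (𝟙 E) ≫ assocHom A (comp B D) E ≫ compHom (𝟙 A) (assocHom B D E) =
      assocHom (comp A B) D E ≫ assocHom A B (comp D E) :=
  hom_ext fun N X => comp_comp_comp_hom_ext A B D E fun K L M p q r x => by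
    let Z' : L → PtdSpace := fun l => ((comp D E).obj ((p.comp q).fib l)).obj fun n => X n.1
    let T : M → PtdSpace := fun m => (B.obj (r.fib m)).obj fun l => blocks D q (blocks E p X) l.1
    let T' : M → PtdSpace := fun m => ((comp B D).obj ((q.comp r).fib m)).obj
      fun k => blocks E p X k.1
    let T'' : M → PtdSpace := fun m => (B.obj (r.fib m)).obj fun l => Z' l.1
    let V : M → PtdSpace := fun m =>
      ((comp B (comp D E)).obj ((p.comp (q.comp r)).fib m)).obj fun n => X n.1
    let V' : M → PtdSpace := fun m =>
      ((comp (comp B D) E).obj ((p.comp (q.comp r)).fib m)).obj fun n => X n.1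
    let a : ∀ m, T m ⟶ T' m := assocBlock B D q r (blocks E p X)
    let b : ∀ m, T' m ⟶ V' m := assocBlock (comp B D) E p (q.comp r) X
    let c : ∀ m, V' m ⟶ V m := fun m =>
      ((assocHom B D E).app ((p.comp (q.comp r)).fib m)).app fun n => X n.1
    let d : ∀ m, T m ⟶ T'' m := fun m => (B.obj (r.fib m)).map
      (X := fun l => blocks D q (blocks E p X) l.1)
      (Y := fun l => Z' l.1) fun l => assocBlock D E p q X l.1
    let e : ∀ m, T'' m ⟶ V m := assocBlock B (comp D E) (p.comp q) r X
    have l₁ := (compHom_left_apply (assocHom A B D) E p X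
      (compIncl (comp A B) D q (blocks E p X) (compIncl A B r (blocks D q (blocks E p X)) x))).trans
      (congrArg (compIncl (comp A (comp B D)) E p X) (assocHom_incl A B D q r (blocks E p X) x))
    have l₂ := (congrArg (((assocHom A (comp B D) E).app N).app X) l₁).trans
      (assocHom_incl A (comp B D) E p (q.comp r) X ((A.obj M).map (X := T) (Y := T') a x))
    have l₃ := (congrArg (((compHom (𝟙 A) (assocHom B D E)).app N).app X) l₂).trans
      (compHom_right_apply A (assocHom B D E) (p.comp (q.comp r)) X
        ((A.obj M).map (X := T') (Y := V') b ((A.obj M).map (X := T) (Y := T') a x)))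
    have r₁ := (assocHom_incl (comp A B) D E p q X
      (compIncl A B r (blocks D q (blocks E p X)) x)).trans
      (congrArg (compIncl (comp A B) (comp D E) (p.comp q) X)
        (compIncl_map A B r (X := blocks D q (blocks E p X)) (Y := Z') (assocBlock D E p q X) x))
    have r₂ := (congrArg (((assocHom A B (comp D E)).app N).app X) r₁).trans
      (assocHom_incl A B (comp D E) (p.comp q) r X ((A.obj M).map (X := T) (Y := T'') d x))
    have h₁ := (congrArg ((A.obj M).map (X := V') (Y := V) c)
      (map_map_apply A (X := T) (Y := T') (Z := V') a b x)).trans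
      (map_map_apply A (X := T) (Y := V') (Z := V) (fun m => a m ≫ b m) c x)
    have h₂ := map_map_apply A (X := T) (Y := T'') (Z := V) d e x
    have h₃ := map_congr A (X := T) (Y := V) (f := fun m => (a m ≫ b m) ≫ c m)
      (g := fun m => d m ≫ e m)
      (fun m => PtdSpace.comp_comp_eq (a m) (b m) (c m) (d m) (e m) fun y =>
        assocHom_assocBlock B D E p q r X m y) x
    refine (comp_app_apply _ _ _ _ _).trans ((comp_app_apply _ _ _ _ _).trans (Eq.trans ?_
      (comp_app_apply _ _ _ _ _).symm))
    exact l₃.trans ((congrArg (compIncl A (comp B (comp D E)) (p.comp (q.comp r)) X)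
      (h₁.trans (h₃.trans h₂.symm))).trans r₂.symm)

theorem assoc_lam (A B : SymmFunctor) :
    assocHom unit A B ≫ lamHom (comp A B) = compHom (lamHom A) (𝟙 B) :=
  hom_ext fun N X => comp_comp_unit_hom_ext A B fun K L p q hL l x => by
    let Y : K → PtdSpace := fun k => (B.obj (p.fib k)).obj fun n => X n.1
    have l₁ := (congrArg (((lamHom (comp A B)).app N).app X)
      (assocHom_lamIncl A B p q hL l X x)).trans
      (lamHom_incl (comp A B) (p.comp q) hL l X (assocBlock A B p q X l x))
    have r₁ := (compHom_left_apply (lamHom A) B p X (lamIncl A q hL l Y x)).trans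
      (congrArg (compIncl A B p X) (lamHom_incl A q hL l Y x))
    refine (comp_app_apply _ _ _ _ _).trans (l₁.trans (Eq.trans ?_ r₁.symm))
    refine (compIncl_square A B p (p.restr q l) ((p.comp q).onlyFib hL l) (q.onlyFib hL l)
      (fun _ => rfl) (fun n : (p.comp q).fib l => X n.1) _).trans ?_
    refine congrArg (compIncl A B p X) ?_
    refine (transport_map_apply A (q.onlyFib hL l) _ _ x).trans ?_
    refine map_id_apply A _ (fun k => PtdSpace.hom_ext fun y => ?_) _
    exact (perm_perm_apply B _ (p.restrFib q l (q.onlyFib hL l k))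
      (fun n : p.fib k => X n.1) y).trans (perm_refl_apply B (fun n : p.fib k => X n.1) y)

theorem triangle (A B : SymmFunctor) :
    compHom (rhoHom A) (𝟙 B) ≫ assocHom A unit B ≫ compHom (𝟙 A) (lamHom B) = 𝟙 (comp A B) :=
  hom_ext fun N X => comp_hom_ext A B fun K p x => by
    let Y : K → PtdSpace := fun k => (B.obj (p.fib k)).obj fun n => X n.1
    let Z : K → PtdSpace := fun k => ((comp unit B).obj (p.fib k)).obj fun n => X n.1
    let T : K → PtdSpace := fun k => (unit.obj ((Surj.id K).fib k)).obj fun k => Y k.1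
    have l₁ := compHom_left_apply (rhoHom A) B p X x
    have l₂ := (congrArg (assocApp A unit B N X) l₁).trans
      (assocApp_incl A unit B p (Surj.id K) X
        ((A.obj K).map (X := Y) (Y := T) (unitIncl Y) x))
    have l₃ := (congrArg (((compHom (𝟙 A) (lamHom B)).app N).app X) l₂).trans
      (compHom_right_apply A (lamHom B) p X ((A.obj K).map (X := T) (Y := Z)
        (assocBlock unit B p (Surj.id K) X) ((A.obj K).map (X := Y) (Y := T) (unitIncl Y) x)))
    refine l₃.trans (congrArg (compIncl A B p X) ?_)
    refine (congrArg ((A.obj K).map (X := Z) (Y := Y) fun k => lamApp B (p.fib k) fun n => X n.1)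
      (map_map_apply A (X := Y) (Y := T) (Z := Z)
      (unitIncl Y) (assocBlock unit B p (Surj.id K) X) x)).trans ?_
    refine (map_map_apply A (X := Y) (Y := Z) (Z := Y)
      (fun k => unitIncl Y k ≫ assocBlock unit B p (Surj.id K) X k)
      (fun k => lamApp B (p.fib k) fun n => X n.1) x).trans ?_
    refine map_id_apply A (X := Y) _ (fun k => PtdSpace.hom_ext fun y => ?_) x
    refine (lamApp_incl B (p.restr (Surj.id K) k) ((Surj.id K).fib_subsingleton (fun _ _ h => h) k)
      ⟨k, rfl⟩ (fun n => X n.1) _).trans ?_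
    exact (perm_perm_apply B _ (p.restrFib (Surj.id K) k ⟨k, rfl⟩)
      (fun n : p.fib k => X n.1) y).trans (perm_refl_apply B (fun n : p.fib k => X n.1) y)

theorem rho_assoc (A B : SymmFunctor) :
    rhoHom (comp A B) ≫ assocHom A B unit = compHom (𝟙 A) (rhoHom B) :=
  hom_ext fun N X => comp_hom_ext A B fun K p x => by
    have l₁ := congrArg (compIncl (comp A B) unit (Surj.id N) X)
      (compIncl_map A B p (X := X)
        (Y := fun n => (unit.obj ((Surj.id N).fib n)).obj fun m => X m.1) (unitIncl X) x)
    have l₂ := (congrArg (assocApp A B unit N X) l₁).trans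
      (assocApp_incl A B unit (Surj.id N) p X _)
    refine l₂.trans (Eq.trans ?_ (compIncl_hom (𝟙 A) (rhoHom B) p X x).symm)
    refine congrArg (compIncl A (comp B unit) p X) ?_
    refine (map_map_apply A _ _ x).trans ?_
    refine map_congr A (fun k => PtdSpace.hom_ext fun y => ?_) x
    refine congrArg (compIncl B unit (Surj.id (p.fib k)) fun n => X n.1) ?_
    refine (map_map_apply B _ _ y).trans ?_
    refine map_congr B (fun n => PtdSpace.hom_ext fun z => ?_) y
    exact unit_perm_incl ((Surj.id N).restrFib p k n) (fun n => X n.1) ⟨n, rfl⟩ _ _ z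

theorem rho_lam : rhoHom unit ≫ lamHom unit = 𝟙 unit :=
  hom_ext fun N X => Wedge.hom_ext fun i => PtdSpace.hom_ext fun x =>
    (lamApp_incl unit (Surj.id N) i.2 i.1 X _).trans
      (unit_perm_incl ((Surj.id N).onlyFib i.2 i.1) (fun n => X n.1) i.1 _ _ x)

end axioms
end SymmFunctor

/-! ### The skew-monoidal category of symmetric functor sequences -/

/-- If all other summands of a wedge are points, the inclusion of a summand is invertible. -/
theorem Wedge.isIso_incl {ι : Type} (X : ι → PtdSpace) (i : ι)
    (h : ∀ j, j ≠ i → Subsingleton (X j)) :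
    IsIso (Wedge.incl X i) := by
  classical
  let r : Wedge X ⟶ X i := Wedge.desc fun j =>
    if e : j = i then eqToHom (by rw [e]) else PtdSpace.zeroHom _ _
  have hr : ∀ x, r (Wedge.incl X i x) = x := fun x => by
    change (if e : i = i then eqToHom (by rw [e]) else PtdSpace.zeroHom (X i) (X i) : X i ⟶ X i) x =
      x
    rw [dif_pos rfl]
    rfl
  refine ⟨⟨r, PtdSpace.hom_ext hr, Wedge.hom_ext fun j => PtdSpace.hom_ext fun x => ?_⟩⟩
  by_cases e : j = i
  · subst e
    exact congrArg (Wedge.incl X j) (hr x)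
  · obtain rfl : x = (X j).pt := @Subsingleton.elim _ (h j e) _ _
    exact PtdSpace.Hom.map_pt (X := X j) (Wedge.incl X j ≫ r ≫ Wedge.incl X i) |>.trans
      (PtdSpace.Hom.map_pt (X := X j) (Wedge.incl X j ≫ 𝟙 _)).symm

theorem PtdSpace.comp_comp_eq_of_apply {P Q R S : PtdSpace} (a : P ⟶ Q) (b : Q ⟶ R) (c : R ⟶ S)
    (d : P ⟶ S) (h : ∀ x, c (b (a x)) = d x) : a ≫ b ≫ c = d :=
  PtdSpace.hom_ext h

theorem PtdSpace.inv_square {P Q R S : PtdSpace} (a : P ⟶ Q) (b : R ⟶ S) (u : P ⟶ R) (v : Q ⟶ S)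
    (ha : IsIso a) (hb : IsIso b) (h : u ≫ b = a ≫ v) : v ≫ inv b = inv a ≫ u := by
  rw [IsIso.comp_inv_eq, Category.assoc, h, IsIso.inv_hom_id_assoc]

namespace SymmFunctor

theorem comp_unit_section (F : SymmFunctor) {N : FinSet} {X : N → PtdSpace} {Y Z : PtdSpace}
    (a : ((comp unit F).obj N).obj X ⟶ Y) (b : Y ⟶ Z) (c : Z ⟶ ((comp unit F).obj N).obj X)
    (h : ∀ (K : FinSet) (p : Surj N K) (hK : Subsingleton K) (k : K)
      (x : (F.obj (p.fib k)).obj fun n => X n.1),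
      c (b (a (lamIncl F p hK k X x))) = lamIncl F p hK k X x) : a ≫ b ≫ c = 𝟙 _ :=
  comp_unit_hom_ext F h

theorem isIso_lamApp (F : SymmFunctor) (N : FinSet) (X : N → PtdSpace) : IsIso (lamApp F N X) := by
  let o : Surj N ⟨Unit⟩ := ⟨fun _ => (), fun _ => N.ne.elim fun n => ⟨n, rfl⟩⟩
  have ho : Subsingleton (⟨Unit⟩ : FinSet) := inferInstanceAs (Subsingleton Unit)
  refine ⟨⟨F.perm (o.onlyFib ho ()).symm X ≫ lamIncl F o ho () X,
    comp_unit_section F _ _ _ fun K p hK k x => ?_, PtdSpace.hom_ext fun x => ?_⟩⟩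
  · let c : (⟨Unit⟩ : FinSet) ≃ K := ⟨fun _ => k, fun _ => (), fun _ => rfl, fun _ => hK.elim _ _⟩
    have h := lamIncl_square F o p (Equiv.refl N) c (fun _ => hK.elim _ _) hK ho () X x
    have h' := (congrArg (F.perm (o.onlyFib ho ()).symm X) (lamApp_incl F p hK k X x)).trans
      (perm_perm_apply F (o.onlyFib ho ()).symm (p.onlyFib hK k) (fun n : p.fib k => X n.1) x)
    exact (congrArg (lamIncl F o ho () X) h').trans (h.symm.trans (perm_refl_apply _ X _))
  · refine (lamApp_incl F o ho () X _).trans ?_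
    exact (perm_perm_apply F (o.onlyFib ho ()) (o.onlyFib ho ()).symm X x).trans
      (perm_refl_apply F X x)

theorem isIso_unitIncl {N : FinSet} (X : N → PtdSpace) (n : N) : IsIso (unitIncl X n) :=
  Wedge.isIso_incl _ _ fun j hj => (hj (Subtype.ext (Subtype.ext j.1.2))).elim

theorem isIso_map (F : SymmFunctor) {N : FinSet} {X Y : N → PtdSpace} (f : ∀ n, X n ⟶ Y n)
    (h : ∀ n, IsIso (f n)) : IsIso ((F.obj N).map (X := X) (Y := Y) f) :=
  ⟨⟨(F.obj N).map (X := Y) (Y := X) fun n => inv (f n),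
    PtdSpace.hom_ext fun x => (map_map_apply F f (fun n => inv (f n)) x).trans
      (map_id_apply F _ (fun n => IsIso.hom_inv_id (f n)) x),
    PtdSpace.hom_ext fun x => (map_map_apply F (fun n => inv (f n)) f x).trans
      (map_id_apply F _ (fun n => IsIso.inv_hom_id (f n)) x)⟩⟩

/-- The inclusion of the term of the partition into points is invertible if the terms of all other
partitions are points. -/
theorem isIso_compIncl_id (G F : SymmFunctor) (N : FinSet) (X : N → PtdSpace)
    (h : ∀ π : Setoid N, ¬ Function.Injective (FinSet.proj π) →
      Subsingleton (summand G F (FinSet.proj π) X)) : IsIso (compIncl G F (Surj.id N) X) := by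
  have h₁ : IsIso (sqMap G F (FinSet.proj (Setoid.ker (Surj.id N))) (Surj.id N) (Equiv.refl N)
      (Surj.id N).kerEquiv (fun _ => rfl) X) := by
    refine ⟨⟨sqMap G F (Surj.id N) (FinSet.proj (Setoid.ker (Surj.id N))) (Equiv.refl N)
      (Surj.id N).kerEquiv.symm (fun n => ?_) X, ?_, ?_⟩⟩
    · exact ((Surj.id N).kerEquiv.symm_apply_apply _).symm
    · exact (sqMap_trans G F _ (FinSet.proj (Setoid.ker (Surj.id N))) (Surj.id N) (Equiv.refl N)
        (Equiv.refl N) _ _ (Equiv.refl N) (fun _ => rfl) _ (fun _ => rfl) X).symm.trans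
        (sqMap_refl G F (Surj.id N) _ _ X)
    · exact (sqMap_trans G F _ (Surj.id N) (FinSet.proj (Setoid.ker (Surj.id N))) (Equiv.refl N)
        (Equiv.refl N) _ _ (Equiv.refl _) _ (fun _ => rfl) (fun _ => rfl) X).symm.trans
        (sqMap_refl G F _ _ _ X)
  have h₂ : IsIso (Wedge.incl (fun π : Setoid N => summand G F (FinSet.proj π) X)
      (Setoid.ker (Surj.id N))) := Wedge.isIso_incl _ _ fun π hπ => h π fun hi => hπ (by
    ext a b
    exact ⟨fun hab => hi (Quotient.sound hab), fun hab => by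
      obtain rfl : a = b := hab
      exact π.refl a⟩)
  exact @IsIso.comp_isIso _ _ _ _ _ _ _ h₁ h₂

end SymmFunctor

namespace SymmFun

theorem isIso_of_component {F G : SymmFun} (η : F ⟶ G)
    (h : ∀ (N : FinSet) (X : N → PtdSpace), IsIso (component η X)) : IsIso η := by
  let η' : F.toSymmFunctor ⟶ G.toSymmFunctor := η
  let θ : G.toSymmFunctor ⟶ F.toSymmFunctor := SymmFunctor.Hom.mk
    (fun N =>
      { app X := @inv _ _ _ _ (component η X) (h N X)
        naturality X Y f := PtdSpace.inv_square _ _ _ _ (h N X) (h N Y) ((η'.app N).naturality f) })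
    (fun {M N} e X => (PtdSpace.inv_square _ _ _ _ (h N X) (h M fun m => X (e m))
      (η'.equivariant e X).symm).symm)
  exact ⟨⟨θ, SymmFunctor.hom_ext fun N X => @IsIso.hom_inv_id _ _ _ _ (component η X) (h N X),
    SymmFunctor.hom_ext fun N X => @IsIso.inv_hom_id _ _ _ _ (component η X) (h N X)⟩⟩

/-- The skew-monoidal structure of the composition of symmetric functor sequences. -/
noncomputable def skewMonoidal : SkewMonoidal compFunctor unit where
  assoc H G F := SymmFunctor.assocHom H.toSymmFunctor G.toSymmFunctor F.toSymmFunctor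
  lam F := SymmFunctor.lamHom F.toSymmFunctor
  rho F := SymmFunctor.rhoHom F.toSymmFunctor
  assoc_natural a b d := SymmFunctor.assocHom_natural a b d
  lam_natural a := SymmFunctor.lamHom_natural a
  rho_natural a := SymmFunctor.rhoHom_natural a
  pentagon A B D E := SymmFunctor.pentagon A.toSymmFunctor B.toSymmFunctor D.toSymmFunctor
    E.toSymmFunctor
  assoc_lam A B := SymmFunctor.assoc_lam A.toSymmFunctor B.toSymmFunctor
  triangle A B := SymmFunctor.triangle A.toSymmFunctor B.toSymmFunctor
  rho_assoc A B := SymmFunctor.rho_assoc A.toSymmFunctor B.toSymmFunctor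
  rho_lam := SymmFunctor.rho_lam

theorem isCanonicalFun_skewMonoidal : IsCanonicalFun skewMonoidal where
  assoc H G F {N K L} p q X := PtdSpace.comp_comp_eq_of_apply _ _ _ (SymmFunctor.assocTerm
    H.toSymmFunctor G.toSymmFunctor F.toSymmFunctor p q X) fun x =>
      SymmFunctor.assocHom_incl H.toSymmFunctor G.toSymmFunctor F.toSymmFunctor p q X x
  lam F {N K} p hK k X := PtdSpace.comp_comp_eq_of_apply _ _ _ _ fun x =>
    SymmFunctor.lamHom_incl F.toSymmFunctor p hK k X x
  rho F N X := rfl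

theorem isIso_lam (F : SymmFun) : IsIso (skewMonoidal.lam F) :=
  isIso_of_component _ fun N X => SymmFunctor.isIso_lamApp F.toSymmFunctor N X

theorem isIso_rho (F : SymmFun) : IsIso (skewMonoidal.rho F) :=
  isIso_of_component _ fun N X => by
    have h₁ := SymmFunctor.isIso_map F.toSymmFunctor (SymmFunctor.unitIncl X)
      (SymmFunctor.isIso_unitIncl X)
    have h₂ := SymmFunctor.isIso_compIncl_id F.toSymmFunctor SymmFunctor.unit N X fun π hπ => by
      simp only [Function.Injective, not_forall] at hπ
      obtain ⟨a, b, hab, hne⟩ := hπ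
      refine F.pointed _ _ (FinSet.proj π a) (Wedge.subsingleton fun i => ?_)
      exact (hne (congrArg Subtype.val (@Subsingleton.elim _ i.2 ⟨a, rfl⟩ ⟨b, hab.symm⟩))).elim
    exact @IsIso.comp_isIso _ _ _ _ _ _ _ h₁ h₂

end SymmFun

/-! ### Points of the composition product of symmetric sequences -/

namespace SymmSeq

theorem map_map_apply (A : SymmSeq) {K L M : FinSet} (e : K ≃ L) (d : L ≃ M) (a : A.obj K) :
    A.map (X := L) (Y := M) d (A.map (X := K) (Y := L) e a) =
      A.map (X := K) (Y := M) (e.trans d) a :=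
  congrArg (fun k => PtdSpace.Hom.toFun k a) (A.map_comp (X := K) (Y := L) (Z := M) e d).symm

theorem map_refl_apply (A : SymmSeq) {K : FinSet} (a : A.obj K) :
    A.map (X := K) (Y := K) (Equiv.refl K) a = a :=
  congrArg (fun k => PtdSpace.Hom.toFun k a) (A.map_id K)

theorem map_symm_apply (A : SymmSeq) {K L : FinSet} (e : K ≃ L) (a : A.obj K) :
    A.map (X := L) (Y := K) e.symm (A.map (X := K) (Y := L) e a) = a :=
  (map_map_apply A e e.symm a).trans (by rw [Equiv.self_trans_symm, map_refl_apply])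

theorem hom_map_apply {A B : SymmSeq} (η : A ⟶ B) {K L : FinSet} (e : K ≃ L) (a : A.obj K) :
    η.app L (A.map (X := K) (Y := L) e a) = B.map (X := K) (Y := L) e (η.app K a) :=
  congrArg (fun k => PtdSpace.Hom.toFun k a) (η.naturality (X := K) (Y := L) e)

section
variable {A B : SymmSeq} {N K : FinSet}

theorem compMk_square {N' K' : FinSet} (p' : Surj N' K') (p : Surj N K) (e : N' ≃ N)
    (c : K' ≃ K) (h : ∀ n, p (e n) = c (p' n)) (a : A.obj K) (b : ∀ k, B.obj (p.fib k)) :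
    (comp A B).map (X := N) (Y := N') e.symm (compMk p a b) =
      compMk p' (A.map (X := K) (Y := K') c.symm a) (fun k' =>
        B.map (X := p.fib (c k')) (Y := p'.fib k') (Surj.fibEquiv p' p e c h k').symm
          (b (c k'))) :=
  SymmFunctor.compIncl_square A.toFunctor B.constFunctor p' p e c h (fun _ => zeroSphere)
    (smash.mk a b)

/-- Relabelling of the blocks of a partition. -/
theorem compMk_relabel {K' : FinSet} (p' : Surj N K') (p : Surj N K) (c : K' ≃ K)
    (h : ∀ n, p n = c (p' n)) (a : A.obj K) (b : ∀ k, B.obj (p.fib k)) :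
    compMk p a b = compMk p' (A.map (X := K) (Y := K') c.symm a) (fun k' =>
        B.map (X := p.fib (c k')) (Y := p'.fib k')
          (Surj.fibEquiv p' p (Equiv.refl N) c h k').symm (b (c k'))) :=
  (map_refl_apply (comp A B) (compMk p a b)).symm.trans
    (compMk_square p' p (Equiv.refl N) c h a b)

theorem compMk_proj (π : Setoid N) (a : A.obj (FinSet.quot π))
    (b : ∀ k, B.obj ((FinSet.proj π).fib k)) : (compMk (FinSet.proj π) a b : (comp A B).obj N) =
      Wedge.incl (fun π : Setoid N => smash (A.obj (FinSet.quot π)) fun q =>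
        B.obj ((FinSet.proj π).fib q)) π (smash.mk a b) :=
  SymmFunctor.compIncl_proj A.toFunctor B.constFunctor π (fun _ => zeroSphere) (smash.mk a b)

theorem compMk_hom {A' B' : SymmSeq} (α : A ⟶ A') (β : B ⟶ B') (p : Surj N K) (a : A.obj K)
    (b : ∀ k, B.obj (p.fib k)) : (compHom α β).app N (compMk p a b) =
      compMk p (α.app K a) fun k => β.app (p.fib k) (b k) :=
  SymmFunctor.compIncl_hom (G := A.toFunctor) (F := B.constFunctor) (G' := A'.toFunctor)
    (F' := B'.constFunctor) _ _ p (fun _ => zeroSphere) (smash.mk a b)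

theorem compMk_pt_left (p : Surj N K) (b : ∀ k, B.obj (p.fib k)) :
    (compMk p (A.obj K).pt b : (comp A B).obj N) = ((comp A B).obj N).pt :=
  (congrArg (SymmFunctor.compIncl A.toFunctor B.constFunctor p fun _ => zeroSphere)
    (smash.mk_pt_left b)).trans (PtdSpace.Hom.map_pt _)

theorem compMk_pt_right (p : Surj N K) (a : A.obj K) (b : ∀ k, B.obj (p.fib k)) (k : K)
    (h : b k = (B.obj (p.fib k)).pt) :
    (compMk p a b : (comp A B).obj N) = ((comp A B).obj N).pt :=
  (congrArg (SymmFunctor.compIncl A.toFunctor B.constFunctor p fun _ => zeroSphere)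
    (smash.mk_pt_right a b k h)).trans (PtdSpace.Hom.map_pt _)

theorem continuous_compMk {T : Type} [TopologicalSpace T] [IsCG T] (p : Surj N K) {a : T → A.obj K}
    {b : ∀ k, T → B.obj (p.fib k)} (ha : Continuous a) (hb : ∀ k, Continuous (b k)) :
    Continuous fun t => (compMk p (a t) fun k => b k t : (comp A B).obj N) :=
  (PtdSpace.Hom.cont _).comp (smash.continuous_mk ha hb)

theorem comp_cases (x : (comp A B).obj N) : x = ((comp A B).obj N).pt ∨
    ∃ (π : Setoid N) (a : A.obj (FinSet.quot π)) (b : ∀ k, B.obj ((FinSet.proj π).fib k)),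
      x = compMk (FinSet.proj π) a b := by
  rcases Wedge.cases x with h | ⟨π, y, h⟩
  · exact Or.inl h
  · rcases smash.cases y with rfl | ⟨a, b, rfl⟩
    · exact Or.inl (h.trans (PtdSpace.Hom.map_pt _))
    · exact Or.inr ⟨π, a, b, h.trans (compMk_proj π a b).symm⟩

/-- Maps out of a composition product are determined by their values on the points of labelled
partitions. -/
theorem comp_hom_ext {Z : PtdSpace} {f g : (comp A B).obj N ⟶ Z}
    (h : ∀ (K : FinSet) (p : Surj N K) (a : A.obj K) (b : ∀ k, B.obj (p.fib k)),
      f (compMk p a b) = g (compMk p a b)) : f = g :=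
  PtdSpace.hom_ext fun x => by
    rcases comp_cases x with rfl | ⟨π, a, b, rfl⟩
    · exact f.map_pt.trans g.map_pt.symm
    · exact h _ _ a b

theorem comp_comp_hom_ext {C : SymmSeq} {Z : PtdSpace} {f g : (comp (comp A B) C).obj N ⟶ Z}
    (h : ∀ (K L : FinSet) (p : Surj N K) (q : Surj K L) (a : A.obj L) (b : ∀ l, B.obj (q.fib l))
      (c : ∀ k, C.obj (p.fib k)),
      f (compMk (A := comp A B) p (compMk q a b) c) =
        g (compMk (A := comp A B) p (compMk q a b) c)) : f = g :=
  comp_hom_ext fun K p x c => by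
    rcases comp_cases x with rfl | ⟨π, a, b, rfl⟩
    · rw [compMk_pt_left]
      exact f.map_pt.trans g.map_pt.symm
    · exact h _ _ p _ a b c

/-- The test maps of a composition product: tuples of test maps. -/
def CompTest (PA : ∀ (K : FinSet) (T : CompHaus.{0}), C(cptHaus T, A.obj K) → Prop)
    (PB : ∀ (K : FinSet) (T : CompHaus.{0}), C(cptHaus T, B.obj K) → Prop) (N : FinSet)
    (T : CompHaus.{0}) (f : C(cptHaus T, (comp A B).obj N)) : Prop :=
  (∀ t, f t = ((comp A B).obj N).pt) ∨ ∃ (π : Setoid N) (a : C(cptHaus T, A.obj (FinSet.quot π)))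
    (b : ∀ k, C(cptHaus T, B.obj ((FinSet.proj π).fib k))), PA _ T a ∧ (∀ k, PB _ T (b k)) ∧
      ∀ t, f t = compMk (FinSet.proj π) (a t) fun k => b k t

theorem detects_comp {PA : ∀ (K : FinSet) (T : CompHaus.{0}), C(cptHaus T, A.obj K) → Prop}
    {PB : ∀ (K : FinSet) (T : CompHaus.{0}), C(cptHaus T, B.obj K) → Prop}
    (hA : ∀ K, Detects (A.obj K) (PA K)) (cA : ∀ K, TestsClosed (PA K))
    (hB : ∀ K, Detects (B.obj K) (PB K)) (cB : ∀ K, TestsClosed (PB K)) (N : FinSet) :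
    Detects ((comp A B).obj N) (CompTest PA PB N) := by
  have h₀ := Wedge.detects
    (X := fun π : Setoid N => smash (A.obj (FinSet.quot π)) fun q => B.obj ((FinSet.proj π).fib q))
    (P := fun π => SmashTest (PA (FinSet.quot π)) fun q => PB ((FinSet.proj π).fib q))
    fun π => detects_smash (κ := FinSet.quot π) (A := A.obj (FinSet.quot π))
      (Y := fun q => B.obj ((FinSet.proj π).fib q)) (hA (FinSet.quot π)) (cA (FinSet.quot π))
      (fun q => hB ((FinSet.proj π).fib q)) fun q => cB ((FinSet.proj π).fib q)
  intro S Z _ g h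
  refine h₀ S Z g fun T f hf => h T f ?_
  rcases hf with hf | ⟨π, f', hf' | ⟨a, b, ha, hb, h'⟩, hf⟩
  · exact Or.inl hf
  · exact Or.inl fun t => (hf t).trans ((congrArg (Wedge.incl (fun π : Setoid N =>
      smash (A.obj (FinSet.quot π)) fun q => B.obj ((FinSet.proj π).fib q)) π) (hf' t)).trans
      (PtdSpace.Hom.map_pt _))
  · exact Or.inr ⟨π, a, b, ha, hb, fun t => (hf t).trans ((congrArg (Wedge.incl
      (fun π : Setoid N => smash (A.obj (FinSet.quot π)) fun q => B.obj ((FinSet.proj π).fib q)) π)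
      (h' t)).trans (compMk_proj π (a t) fun k => b k t).symm)⟩

theorem testsClosed_comp {PA : ∀ (K : FinSet) (T : CompHaus.{0}), C(cptHaus T, A.obj K) → Prop}
    {PB : ∀ (K : FinSet) (T : CompHaus.{0}), C(cptHaus T, B.obj K) → Prop}
    (cA : ∀ K, TestsClosed (PA K)) (cB : ∀ K, TestsClosed (PB K)) (N : FinSet) :
    TestsClosed (CompTest PA PB N) := by
  rintro T T' f h (hf | ⟨π, a, b, ha, hb, hf⟩)
  · exact Or.inl fun t => hf _
  · exact Or.inr ⟨π, a.comp h, fun k => (b k).comp h, cA _ _ _ _ _ ha, fun k => cB _ _ _ _ _ (hb k),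
      fun t => hf _⟩

end

/-! ### The associativity of the composition product -/

section assoc
variable {A B C : SymmSeq}

/-- The point `(a; (b; c))` of `A ∘ (B ∘ C)` for partitions `N ↠ K ↠ L`. -/
noncomputable def assocVal {N K L : FinSet} (p : Surj N K) (q : Surj K L) (a : A.obj L)
    (b : ∀ l, B.obj (q.fib l)) (c : ∀ k, C.obj (p.fib k)) : (comp A (comp B C)).obj N :=
  compMk (B := comp B C) (p.comp q) a fun l =>
    compMk (p.restr q l) (b l) fun k =>
      C.map (X := p.fib k.1) (Y := (p.restr q l).fib k) (p.restrFib q l k).symm (c k.1)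

theorem assocVal_square {N K L N' K' L' : FinSet} (p : Surj N K) (q : Surj K L)
    (p' : Surj N' K') (q' : Surj K' L') (e : N' ≃ N) (f : K' ≃ K) (d : L' ≃ L)
    (hp : ∀ n, p (e n) = f (p' n)) (hq : ∀ k, q (f k) = d (q' k)) (a : A.obj L)
    (b : ∀ l, B.obj (q.fib l)) (c : ∀ k, C.obj (p.fib k)) :
    (comp A (comp B C)).map (X := N) (Y := N') e.symm (assocVal p q a b c) =
      assocVal p' q' (A.map (X := L) (Y := L') d.symm a)
        (fun l => B.map (X := q.fib (d l)) (Y := q'.fib l) (Surj.fibEquiv q' q f d hq l).symm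
          (b (d l)))
        (fun k => C.map (X := p.fib (f k)) (Y := p'.fib k) (Surj.fibEquiv p' p e f hp k).symm
          (c (f k))) := by
  have hpq : ∀ n, (p.comp q) (e n) = d ((p'.comp q') n) := fun n =>
    (congrArg q (hp n)).trans (hq _)
  refine (compMk_square (B := comp B C) (p'.comp q') (p.comp q) e d hpq a _).trans ?_
  refine congrArg (compMk (B := comp B C) (p'.comp q') _) (funext fun l => ?_)
  refine (compMk_square (p'.restr q' l) (p.restr q (d l))
    (Surj.fibEquiv (p'.comp q') (p.comp q) e d hpq l) (Surj.fibEquiv q' q f d hq l)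
    (fun n : (p'.comp q').fib l => Subtype.ext (hp n.1)) (b (d l)) _).trans ?_
  refine congrArg (compMk (p'.restr q' l) _) (funext fun k => ?_)
  exact (map_map_apply C _ _ (c (f k.1))).trans (map_map_apply C
    (Surj.fibEquiv p' p e f hp k.1).symm (p'.restrFib q' l k).symm (c (f k.1))).symm

theorem assocVal_pt_left {N K L : FinSet} (p : Surj N K) (q : Surj K L)
    (b : ∀ l, B.obj (q.fib l)) (c : ∀ k, C.obj (p.fib k)) :
    assocVal p q (A.obj L).pt b c = ((comp A (comp B C)).obj N).pt := compMk_pt_left _ _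

theorem assocVal_pt_middle {N K L : FinSet} (p : Surj N K) (q : Surj K L) (a : A.obj L)
    (b : ∀ l, B.obj (q.fib l)) (c : ∀ k, C.obj (p.fib k)) (l : L)
    (h : b l = (B.obj (q.fib l)).pt) :
    assocVal p q a b c = ((comp A (comp B C)).obj N).pt :=
  compMk_pt_right _ _ _ l (by rw [h, compMk_pt_left])

theorem assocVal_pt_right {N K L : FinSet} (p : Surj N K) (q : Surj K L) (a : A.obj L)
    (b : ∀ l, B.obj (q.fib l)) (c : ∀ k, C.obj (p.fib k)) (k : K)
    (h : c k = (C.obj (p.fib k)).pt) :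
    assocVal p q a b c = ((comp A (comp B C)).obj N).pt :=
  compMk_pt_right _ _ _ (q k) (compMk_pt_right _ _ _ ⟨k, rfl⟩ (by
    rw [h]; exact PtdSpace.Hom.map_pt _))

theorem continuous_assocVal {T : Type} [TopologicalSpace T] [IsCG T] {N K L : FinSet}
    (p : Surj N K) (q : Surj K L) {a : T → A.obj L} {b : ∀ l, T → B.obj (q.fib l)}
    {c : ∀ k, T → C.obj (p.fib k)} (ha : Continuous a) (hb : ∀ l, Continuous (b l))
    (hc : ∀ k, Continuous (c k)) :
    Continuous fun t => assocVal p q (a t) (fun l => b l t) fun k => c k t :=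
  continuous_compMk (B := comp B C) (p.comp q) ha fun l => continuous_compMk _ (hb l) fun k =>
    (PtdSpace.Hom.cont _).comp (hc k.1)

/-- The rebracketing `((a; b); c) ↦ (a; (b; c))` for a fixed partition and a fixed `c`. -/
noncomputable def assocInner {N : FinSet} (π : Setoid N)
    (c : ∀ k, C.obj ((FinSet.proj π).fib k)) :
    (comp A B).obj (FinSet.quot π) ⟶ (comp A (comp B C)).obj N :=
  Wedge.desc (X := fun ρ : Setoid (FinSet.quot π) => smash (A.obj (FinSet.quot ρ)) fun q =>
      B.obj ((FinSet.proj ρ).fib q)) fun ρ =>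
    smash.desc (fun a b => assocVal (FinSet.proj π) (FinSet.proj ρ) a b c)
      (fun T a b => continuous_assocVal _ _ a.continuous (fun l => (b l).continuous)
        fun k => continuous_const)
      (fun b => assocVal_pt_left _ _ _ _) fun a b l h => assocVal_pt_middle _ _ _ _ _ l h

theorem assocInner_compMk {N : FinSet} (π : Setoid N) (c : ∀ k, C.obj ((FinSet.proj π).fib k))
    (ρ : Setoid (FinSet.quot π)) (a : A.obj (FinSet.quot ρ))
    (b : ∀ l, B.obj ((FinSet.proj ρ).fib l)) :
    assocInner π c (compMk (FinSet.proj ρ) a b) =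
      assocVal (FinSet.proj π) (FinSet.proj ρ) a b c :=
  congrArg (assocInner π c) (compMk_proj ρ a b)

/-- The rebracketing `(A ∘ B) ∘ C ⟶ A ∘ (B ∘ C)` on a finite set. -/
noncomputable def assocApp (N : FinSet) :
    (comp (comp A B) C).obj N ⟶ (comp A (comp B C)).obj N :=
  Wedge.desc (X := fun π : Setoid N => smash ((comp A B).obj (FinSet.quot π)) fun q =>
      C.obj ((FinSet.proj π).fib q)) fun π =>
    smash.desc (fun x c => assocInner π c x)
      (fun T x c => by
        refine (detects_comp (PA := fun _ _ _ => True) (PB := fun _ _ _ => True)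
          (fun K => detects_all (A.obj K)) (fun K => testsClosed_all _)
          (fun K => detects_all (B.obj K)) (fun K => testsClosed_all _)
          (FinSet.quot π)).continuous_diag
          (g := fun y => assocInner π (fun k => c k y.1) y.2) (fun S f hf => ?_) x
        rcases hf with hf | ⟨ρ, a, b, -, -, hf⟩
        · simp only [hf]
          exact continuous_const.congr fun y => (PtdSpace.Hom.map_pt _).symm
        · simp only [hf, assocInner_compMk]
          exact continuous_assocVal (T := CompHaus.of (cptHaus T × cptHaus S)) _ _
            (a.continuous.comp continuous_snd)
            (fun l => (b l).continuous.comp continuous_snd)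
            fun k => (c k).continuous.comp continuous_fst)
      (fun c => PtdSpace.Hom.map_pt _) fun x c k h => by
        rcases comp_cases x with rfl | ⟨ρ, a, b, rfl⟩
        · exact PtdSpace.Hom.map_pt _
        · exact (assocInner_compMk _ _ _ _ _).trans (assocVal_pt_right _ _ _ _ _ k h)

theorem assocApp_compMk {N K L : FinSet} (p : Surj N K) (q : Surj K L) (a : A.obj L)
    (b : ∀ l, B.obj (q.fib l)) (c : ∀ k, C.obj (p.fib k)) :
    assocApp N (compMk (A := comp A B) p (compMk q a b) c) = assocVal p q a b c := by
  let q' : Surj (FinSet.quot (Setoid.ker p)) L :=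
    ⟨fun k => q (p.kerEquiv k), q.surj.comp p.kerEquiv.surjective⟩
  have h₁ := compMk_relabel (A := comp A B) (FinSet.proj (Setoid.ker p)) p p.kerEquiv
    (fun _ => rfl) (compMk q a b) c
  have h₂ := compMk_square (FinSet.proj (Setoid.ker q')) q p.kerEquiv q'.kerEquiv (fun _ => rfl) a b
  have h₃ := assocVal_square p q (FinSet.proj (Setoid.ker p)) (FinSet.proj (Setoid.ker q'))
    (Equiv.refl N) p.kerEquiv q'.kerEquiv (fun _ => rfl) (fun _ => rfl) a b c
  rw [h₁, compMk_proj]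
  refine (congrArg (assocInner (Setoid.ker p) _) h₂).trans ((assocInner_compMk _ _ _ _ _).trans
    (h₃.symm.trans (map_refl_apply _ _)))

end assoc
end SymmSeq

/-! ### Equality of points of the composition product -/

namespace PQuot
variable {E : Type} [TopologicalSpace E] [IsCG E] {z : E → Prop}

open Classical in
/-- The representative of a point of a quotient that only collapses points to the base point. -/
noncomputable def rep : PQuot E (fun _ _ => False) z → Option E :=
  Quot.lift (Sum.elim (fun _ => none) fun e => if z e then none else some e) (by
    rintro _ _ (⟨hab⟩ | ⟨ha⟩)
    · exact hab.elim
    · exact if_pos ha)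

theorem rep_mk {e : E} (h : ¬ z e) : rep (mk e : PQuot E (fun _ _ => False) z) = some e := if_neg h

theorem of_mk_eq_pt {e : E}
    (h : (mk e : PQuot E (fun _ _ => False) z) = (PQuot E (fun _ _ => False) z).pt) : z e := by
  by_contra hz
  have := (rep_mk hz).symm.trans (congrArg rep h)
  exact absurd this (by simp [rep, PQuot])

theorem eq_of_mk_eq {e e' : E} (h : (mk e : PQuot E (fun _ _ => False) z) = mk e')
    (hz : ¬ z e) : e = e' := by
  have hz' : ¬ z e' := fun h' => hz (of_mk_eq_pt (h.trans (mk_base h')))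
  exact Option.some_injective _ ((rep_mk hz).symm.trans ((congrArg rep h).trans (rep_mk hz')))

end PQuot

namespace SymmSeq

theorem smash.of_mk_eq_pt {κ : Type} {A : PtdSpace} {Y : κ → PtdSpace} {a : A} {y : ∀ k, Y k}
    (h : (smash.mk a y : smash A Y) = (smash A Y).pt) : a = A.pt ∨ ∃ k, y k = (Y k).pt :=
  PQuot.of_mk_eq_pt (E := Kify (A × ∀ k, Y k)) (z := fun e =>
    (WithGeneratedByTopology.equiv (X := cptHaus) e).1 = A.pt ∨
      ∃ k, (WithGeneratedByTopology.equiv (X := cptHaus) e).2 k = (Y k).pt) h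

theorem smash.eq_of_mk_eq {κ : Type} {A : PtdSpace} {Y : κ → PtdSpace} {a a' : A} {y y' : ∀ k, Y k}
    (h : (smash.mk a y : smash A Y) = smash.mk a' y')
    (hp : (smash.mk a y : smash A Y) ≠ (smash A Y).pt) : a = a' ∧ y = y' :=
  Prod.mk.inj ((WithGeneratedByTopology.equiv (X := cptHaus)).symm.injective
    (PQuot.eq_of_mk_eq (E := Kify (A × ∀ k, Y k)) (z := fun e =>
      (WithGeneratedByTopology.equiv (X := cptHaus) e).1 = A.pt ∨
        ∃ k, (WithGeneratedByTopology.equiv (X := cptHaus) e).2 k = (Y k).pt) h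
      fun hz => hp (PQuot.mk_base hz)))

end SymmSeq

theorem Wedge.of_incl_eq_pt {ι : Type} {X : ι → PtdSpace} {i : ι} {x : X i}
    (h : Wedge.incl X i x = (Wedge X).pt) : x = (X i).pt :=
  PQuot.of_mk_eq_pt (E := Σ i, X i) (z := fun e => e.2 = (X e.1).pt) h

theorem Wedge.eq_of_incl_eq {ι : Type} {X : ι → PtdSpace} {i j : ι} {x : X i} {y : X j}
    (h : Wedge.incl X i x = Wedge.incl X j y) (hp : x ≠ (X i).pt) :
    (⟨i, x⟩ : Σ i, X i) = ⟨j, y⟩ :=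
  PQuot.eq_of_mk_eq (E := Σ i, X i) (z := fun e => e.2 = (X e.1).pt) h hp

namespace SymmSeq

theorem map_eq_pt (A : SymmSeq) {K L : FinSet} (e : K ≃ L) {a : A.obj K}
    (h : A.map (X := K) (Y := L) e a = (A.obj L).pt) : a = (A.obj K).pt := by
  rw [← map_symm_apply A e a, h]
  exact PtdSpace.Hom.map_pt _

theorem map_injective (A : SymmSeq) {K L : FinSet} (e : K ≃ L) {a a' : A.obj K}
    (h : A.map (X := K) (Y := L) e a = A.map (X := K) (Y := L) e a') : a = a' := by
  rw [← map_symm_apply A e a, h, map_symm_apply]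

section
variable {A B : SymmSeq} {N K : FinSet}

theorem compMk_eq_incl (p : Surj N K) (a : A.obj K) (b : ∀ k, B.obj (p.fib k)) :
    (compMk p a b : (comp A B).obj N) =
      Wedge.incl (fun π : Setoid N => smash (A.obj (FinSet.quot π)) fun q =>
        B.obj ((FinSet.proj π).fib q)) (Setoid.ker p)
        (smash.mk (A.map (X := K) (Y := FinSet.quot (Setoid.ker p)) p.kerEquiv.symm a) fun q =>
          B.map (X := p.fib (p.kerEquiv q)) (Y := (FinSet.proj (Setoid.ker p)).fib q)
            (Surj.fibEquiv (FinSet.proj (Setoid.ker p)) p (Equiv.refl N) p.kerEquiv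
              (fun _ => rfl) q).symm (b (p.kerEquiv q))) := rfl

theorem of_compMk_eq_pt {p : Surj N K} {a : A.obj K} {b : ∀ k, B.obj (p.fib k)}
    (h : (compMk p a b : (comp A B).obj N) = ((comp A B).obj N).pt) :
    a = (A.obj K).pt ∨ ∃ k, b k = (B.obj (p.fib k)).pt := by
  rw [compMk_eq_incl] at h
  rcases smash.of_mk_eq_pt (Wedge.of_incl_eq_pt
    (X := fun π : Setoid N => smash (A.obj (FinSet.quot π)) fun q =>
      B.obj ((FinSet.proj π).fib q)) h) with h | ⟨k, h⟩
  · exact Or.inl (map_eq_pt A _ h)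
  · exact Or.inr ⟨p.kerEquiv k, map_eq_pt B _ h⟩

theorem ker_eq_of_compMk_eq {K' : FinSet} {p : Surj N K} {p' : Surj N K'} {a : A.obj K}
    {b : ∀ k, B.obj (p.fib k)} {a' : A.obj K'} {b' : ∀ k, B.obj (p'.fib k)}
    (h : (compMk p a b : (comp A B).obj N) = compMk p' a' b')
    (hp : (compMk p a b : (comp A B).obj N) ≠ ((comp A B).obj N).pt) :
    Setoid.ker p = Setoid.ker p' := by
  rw [compMk_eq_incl, compMk_eq_incl] at h
  refine congrArg Sigma.fst (Wedge.eq_of_incl_eq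
    (X := fun π : Setoid N => smash (A.obj (FinSet.quot π)) fun q =>
      B.obj ((FinSet.proj π).fib q)) h fun h' => hp ?_)
  rw [compMk_eq_incl, h']
  exact PtdSpace.Hom.map_pt _

/-- A point different from the base point determines its entries for a given labelled partition. -/
theorem eq_of_compMk_eq {p : Surj N K} {a a' : A.obj K} {b b' : ∀ k, B.obj (p.fib k)}
    (h : (compMk p a b : (comp A B).obj N) = compMk p a' b')
    (hp : (compMk p a b : (comp A B).obj N) ≠ ((comp A B).obj N).pt) : a = a' ∧ b = b' := by
  have hp' := hp
  rw [compMk_eq_incl, compMk_eq_incl] at h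
  rw [compMk_eq_incl] at hp'
  have h₁ := Wedge.eq_of_incl_eq (X := fun π : Setoid N => smash (A.obj (FinSet.quot π)) fun q =>
      B.obj ((FinSet.proj π).fib q)) h fun h' => hp' (by
    rw [h']; exact PtdSpace.Hom.map_pt _)
  obtain ⟨h₂, h₃⟩ := smash.eq_of_mk_eq (eq_of_heq (Sigma.mk.inj h₁).2) fun h' => hp' (by
    rw [h']; exact PtdSpace.Hom.map_pt _)
  refine ⟨map_injective A _ h₂, funext fun k => ?_⟩
  obtain ⟨k, rfl⟩ := p.kerEquiv.surjective k
  exact map_injective B _ (congrFun h₃ k)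

end

/-! ### The associativity isomorphism of the composition product -/

section assoc
variable {A B C : SymmSeq}

/-- A point that is rebracketed to the base point is the base point. -/
theorem of_assocVal_eq_pt {N K L : FinSet} {p : Surj N K} {q : Surj K L} {a : A.obj L}
    {b : ∀ l, B.obj (q.fib l)} {c : ∀ k, C.obj (p.fib k)}
    (h : assocVal p q a b c = ((comp A (comp B C)).obj N).pt) :
    (compMk (A := comp A B) p (compMk q a b) c : (comp (comp A B) C).obj N) =
      ((comp (comp A B) C).obj N).pt := by
  rcases of_compMk_eq_pt h with rfl | ⟨l, h⟩
  · rw [compMk_pt_left]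
    exact compMk_pt_left _ _
  · rcases of_compMk_eq_pt h with h | ⟨k, h⟩
    · rw [compMk_pt_right q a b l h]
      exact compMk_pt_left _ _
    · exact compMk_pt_right _ _ _ k.1 (map_eq_pt C _ h)

theorem comp_comp_cases {N : FinSet} (x : (comp (comp A B) C).obj N) :
    x = ((comp (comp A B) C).obj N).pt ∨
      ∃ (π : Setoid N) (ρ : Setoid (FinSet.quot π)) (a : A.obj (FinSet.quot ρ))
        (b : ∀ l, B.obj ((FinSet.proj ρ).fib l)) (c : ∀ k, C.obj ((FinSet.proj π).fib k)),
        x = compMk (A := comp A B) (FinSet.proj π) (compMk (FinSet.proj ρ) a b) c := by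
  rcases comp_cases x with h | ⟨π, y, c, rfl⟩
  · exact Or.inl h
  · rcases comp_cases y with rfl | ⟨ρ, a, b, rfl⟩
    · exact Or.inl (compMk_pt_left _ _)
    · exact Or.inr ⟨π, ρ, a, b, c, rfl⟩

/-- Both partitions are determined by the rebracketed point: the coarse one by the outer
composition, and the fine one by its restrictions to the blocks of the coarse one. -/
theorem ker_eq_of_assocVal_eq {N K L K' L' : FinSet} {p : Surj N K} {q : Surj K L} {a : A.obj L}
    {b : ∀ l, B.obj (q.fib l)} {c : ∀ k, C.obj (p.fib k)} {p' : Surj N K'} {q' : Surj K' L'}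
    {a' : A.obj L'} {b' : ∀ l, B.obj (q'.fib l)} {c' : ∀ k, C.obj (p'.fib k)}
    (h : assocVal p q a b c = assocVal p' q' a' b' c')
    (hp : assocVal p q a b c ≠ ((comp A (comp B C)).obj N).pt) :
    Setoid.ker (p.comp q) = Setoid.ker (p'.comp q') ∧ Setoid.ker p = Setoid.ker p' := by
  have h₁ := ker_eq_of_compMk_eq (B := comp B C) h hp
  have h₁' : ∀ n m, q (p n) = q (p m) ↔ q' (p' n) = q' (p' m) := fun n m =>
    Iff.of_eq (congrArg (fun s => s.r (n) (m)) h₁)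
  refine ⟨h₁, ?_⟩
  let d : L ≃ L' := (p.comp q).kerEquiv.symm.trans
    ((Quotient.congr (Equiv.refl N) h₁').trans (p'.comp q').kerEquiv)
  have hd : ∀ n, (p'.comp q') n = d ((p.comp q) n) := fun n => by
    have : (p.comp q).kerEquiv.symm ((p.comp q) n) = Quotient.mk _ n :=
      (p.comp q).kerEquiv.symm_apply_apply (Quotient.mk _ n)
    simp only [d, Equiv.trans_apply, this]
    rfl
  have h₂ := h.trans (compMk_relabel (B := comp B C) (p.comp q) (p'.comp q') d hd a' _)
  have h₃ := (eq_of_compMk_eq (B := comp B C) h₂ hp).2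
  have key : ∀ n m : N, q (p n) = q (p m) → (p n = p m ↔ p' n = p' m) := fun n m hnm => by
    have h₄ := congrFun h₃ (q (p n))
    let r : Surj ((p.comp q).fib (q (p n))) (q'.fib (d (q (p n)))) :=
      ⟨fun i => p'.restr q' (d (q (p n))) (Surj.fibEquiv (p.comp q) (p'.comp q') (Equiv.refl N) d hd
        (q (p n)) i), (p'.restr q' _).surj.comp (Equiv.surjective _)⟩
    have h₅ := h₄.trans (compMk_square r (p'.restr q' (d (q (p n))))
      (Surj.fibEquiv (p.comp q) (p'.comp q') (Equiv.refl N) d hd (q (p n))) (Equiv.refl _)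
      (fun _ => rfl) (b' (d (q (p n)))) _)
    have h₆ := ker_eq_of_compMk_eq h₅ fun h' => hp (compMk_pt_right _ _ _ (q (p n)) h')
    have h₇ := Iff.of_eq (congrArg (fun s => s.r (⟨n, rfl⟩) (⟨m, hnm.symm⟩)) h₆)
    have h₈ : (p.restr q (q (p n)) ⟨n, rfl⟩ = p.restr q (q (p n)) ⟨m, hnm.symm⟩) ↔ p n = p m :=
      Subtype.ext_iff
    have h₉ : (r ⟨n, rfl⟩ = r ⟨m, hnm.symm⟩) ↔ p' n = p' m := Subtype.ext_iff
    exact h₈.symm.trans (h₇.trans h₉)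
  ext n m
  change p n = p m ↔ p' n = p' m
  constructor
  · intro hnm
    exact (key n m (congrArg q hnm)).1 hnm
  · intro hnm
    exact (key n m ((h₁' n m).2 (congrArg q' hnm))).2 hnm

/-- Away from the base point, the rebracketed point determines both partitions and then the
entries. -/
theorem assocApp_injective (N : FinSet) : Function.Injective
    (assocApp (A := A) (B := B) (C := C) N) := by
  intro x x' h
  rcases comp_comp_cases x with rfl | ⟨π, ρ, a, b, c, rfl⟩
  · rcases comp_comp_cases x' with rfl | ⟨π', ρ', a', b', c', rfl⟩
    · rfl
    · rw [assocApp_compMk, PtdSpace.Hom.map_pt] at h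
      exact (of_assocVal_eq_pt h.symm).symm
  · rw [assocApp_compMk] at h
    by_cases hp : assocVal (FinSet.proj π) (FinSet.proj ρ) a b c = ((comp A (comp B C)).obj N).pt
    · rw [of_assocVal_eq_pt hp]
      rw [hp] at h
      rcases comp_comp_cases x' with rfl | ⟨π', ρ', a', b', c', rfl⟩
      · rfl
      · rw [assocApp_compMk] at h
        exact (of_assocVal_eq_pt h.symm).symm
    rcases comp_comp_cases x' with rfl | ⟨π', ρ', a', b', c', rfl⟩
    · rw [PtdSpace.Hom.map_pt] at h
      exact (hp h).elim
    rw [assocApp_compMk] at h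
    obtain ⟨h₁, h₂⟩ := ker_eq_of_assocVal_eq h hp
    obtain rfl : π = π' := by
      have e₁ : Setoid.ker (FinSet.proj π) = π := Setoid.ker_mk_eq π
      have e₂ : Setoid.ker (FinSet.proj π') = π' := Setoid.ker_mk_eq π'
      rw [← e₁, h₂, e₂]
    obtain rfl : ρ = ρ' := by
      ext k l
      obtain ⟨n, rfl⟩ := (FinSet.proj π).surj k
      obtain ⟨m, rfl⟩ := (FinSet.proj π).surj l
      have := Iff.of_eq (congrArg (fun s => s.r (n) (m)) h₁)
      exact (Quotient.eq (r := ρ)).symm.trans (this.trans (Quotient.eq (r := ρ')))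
    obtain ⟨rfl, h₃⟩ := eq_of_compMk_eq (B := comp B C) h hp
    have h₄ := fun l => eq_of_compMk_eq (congrFun h₃ l) fun h' => hp (compMk_pt_right _ _ _ l h')
    obtain rfl : b = b' := funext fun l => (h₄ l).1
    obtain rfl : c = c' := funext fun k =>
      map_injective C _ (congrFun (h₄ (FinSet.proj ρ k)).2 ⟨k, rfl⟩)
    rfl

/-- The labels of the blocks of all the partitions of the blocks of a partition. -/
def sumLabels {L : FinSet} (K : L → FinSet) : FinSet where
  carrier := Σ l, K l
  ne := L.ne.elim fun l => (K l).ne.elim fun k => ⟨⟨l, k⟩⟩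

/-- The partition into the blocks of given partitions of the blocks of a partition. -/
def refine {N L : FinSet} (q : Surj N L) {K : L → FinSet} (p : ∀ l, Surj (q.fib l) (K l)) :
    Surj N (sumLabels K) :=
  ⟨fun n => ⟨q n, p (q n) ⟨n, rfl⟩⟩, by
    rintro ⟨l, k⟩
    obtain ⟨⟨n, rfl⟩, rfl⟩ := (p l).surj k
    exact ⟨n, rfl⟩⟩

/-- The map from the blocks of `refine q p` to the blocks of `q`. -/
def sumProj {L : FinSet} (K : L → FinSet) : Surj (sumLabels K) L :=
  ⟨Sigma.fst, fun l => (K l).ne.elim fun k => ⟨⟨l, k⟩, rfl⟩⟩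

/-- The blocks of the refinement in a block of the coarse partition. -/
def sumFib {L : FinSet} (K : L → FinSet) (l : L) : (sumProj K).fib l ≃ K l where
  toFun k := k.2 ▸ k.1.2
  invFun k := ⟨⟨l, k⟩, rfl⟩
  left_inv := by rintro ⟨⟨l, k⟩, rfl⟩; rfl
  right_inv k := rfl

theorem sumFib_refine {N L : FinSet} (q : Surj N L) {K : L → FinSet} (p : ∀ l, Surj (q.fib l) (K l))
    (l : L) (n : q.fib l) :
    p l n = sumFib K l ((refine q p).restr (sumProj K) l n) := by
  obtain ⟨n, rfl⟩ := n
  rfl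

/-- Every point of `A ∘ (B ∘ C)` is rebracketed from a point of `(A ∘ B) ∘ C`. -/
theorem compMk_compMk_eq_assocVal {N L : FinSet} (q : Surj N L) {K : L → FinSet}
    (p : ∀ l, Surj (q.fib l) (K l)) (a : A.obj L) (b : ∀ l, B.obj (K l))
    (c : ∀ l k, C.obj ((p l).fib k)) :
    (compMk (B := comp B C) q a fun l => compMk (p l) (b l) (c l)) =
      assocVal (refine q p) (sumProj K) a
        (fun l => B.map (X := K l) (Y := (sumProj K).fib l) (sumFib K l).symm (b l))
        (fun k => C.map (X := (p k.1).fib k.2) (Y := (refine q p).fib k)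
          ((Surj.fibEquiv ((refine q p).restr (sumProj K) k.1) (p k.1) (Equiv.refl _)
            (sumFib K k.1) (sumFib_refine q p k.1) ⟨k, rfl⟩).symm.trans
            ((refine q p).restrFib (sumProj K) k.1 ⟨k, rfl⟩)) (c k.1 k.2)) := by
  refine congrArg (compMk (B := comp B C) q a) (funext fun l => ?_)
  refine (compMk_relabel ((refine q p).restr (sumProj K) l) (p l) (sumFib K l)
    (sumFib_refine q p l) (b l) (c l)).trans ?_
  refine congrArg (compMk ((refine q p).restr (sumProj K) l) _) (funext fun k => ?_)
  obtain ⟨⟨l, k⟩, rfl⟩ := k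
  refine Eq.trans ?_ (map_map_apply C
    ((Surj.fibEquiv ((refine q p).restr (sumProj K) l) (p l) (Equiv.refl _)
      (sumFib K l) (sumFib_refine q p l) ⟨⟨l, k⟩, rfl⟩).symm.trans
      ((refine q p).restrFib (sumProj K) l ⟨⟨l, k⟩, rfl⟩))
    ((refine q p).restrFib (sumProj K) l ⟨⟨l, k⟩, rfl⟩).symm (c l k)).symm
  rfl

theorem assocApp_surjective (N : FinSet) :
    Function.Surjective (assocApp (A := A) (B := B) (C := C) N) := by
  intro x
  rcases comp_cases x with rfl | ⟨ρ, a, y, rfl⟩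
  · exact ⟨_, PtdSpace.Hom.map_pt _⟩
  by_cases hy : ∃ l, y l = ((comp B C).obj ((FinSet.proj ρ).fib l)).pt
  · obtain ⟨l, hl⟩ := hy
    refine ⟨_, (PtdSpace.Hom.map_pt _).trans (compMk_pt_right _ _ _ l hl).symm⟩
  · have := fun l => (comp_cases (y l)).resolve_left fun h => hy ⟨l, h⟩
    choose π b c h using this
    obtain rfl : y = _ := funext h
    rw [compMk_compMk_eq_assocVal, ← assocApp_compMk]
    exact ⟨_, rfl⟩

/-- The rebracketing is bijective, and its inverse is continuous because it has a continuous formula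
on the test maps of `A ∘ (B ∘ C)`. -/
theorem isIso_assocApp (N : FinSet) : IsIso (assocApp (A := A) (B := B) (C := C) N) := by
  let g := Function.surjInv (assocApp_surjective (A := A) (B := B) (C := C) N)
  have hg : ∀ y, assocApp N (g y) = y := Function.surjInv_eq _
  have hg' : ∀ x, g (assocApp N x) = x := fun x => assocApp_injective N (hg _)
  refine PtdSpace.isIso_of_leftInverse _ g hg' hg ?_
  have hA := fun K => detects_all (A.obj K)
  have cA := fun K => testsClosed_all (A.obj K)
  have hB := fun K => detects_all (B.obj K)
  have cB := fun K => testsClosed_all (B.obj K)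
  have hC := fun K => detects_all (C.obj K)
  have cC := fun K => testsClosed_all (C.obj K)
  refine (detects_comp (B := comp B C) hA cA (detects_comp hB cB hC cC) (testsClosed_comp cB cC)
    N).continuous fun T f hf => ?_
  have hpt : g ((comp A (comp B C)).obj N).pt = ((comp (comp A B) C).obj N).pt := by
    rw [← hg' ((comp (comp A B) C).obj N).pt, PtdSpace.Hom.map_pt]
  rcases hf with hf | ⟨ρ, a, y, -, hy, hf⟩
  · simp only [hf]
    exact continuous_const
  by_cases hy' : ∃ l, ∀ t, y l t = ((comp B C).obj ((FinSet.proj ρ).fib l)).pt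
  · obtain ⟨l, hl⟩ := hy'
    have : ∀ t, f t = ((comp A (comp B C)).obj N).pt := fun t =>
      (hf t).trans (compMk_pt_right (B := comp B C) _ _ _ l (hl t))
    simp only [this]
    exact continuous_const
  · have := fun l => (hy l).resolve_left fun h => hy' ⟨l, h⟩
    choose π b c _ _ h using this
    have hf' : ∀ t, g (f t) = _ := fun t => by
      rw [hf t, show (fun k => y k t) = _ from funext fun l => h l t, compMk_compMk_eq_assocVal,
        ← assocApp_compMk, hg']
    simp only [hf']
    exact continuous_compMk (A := comp A B) _ (continuous_compMk _ a.continuous fun l =>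
      (PtdSpace.Hom.cont _).comp (b l).continuous) fun k =>
        (PtdSpace.Hom.cont _).comp (c k.1 k.2).continuous

end assoc
end SymmSeq

/-! ### The monoidal category of symmetric sequences -/

theorem continuous_of_discrete_parameter {T X Y : Type} [TopologicalSpace T] [TopologicalSpace X]
    [DiscreteTopology X] [TopologicalSpace Y] (F : X → T → Y) (h : ∀ x, Continuous (F x))
    {u : T → X} (hu : Continuous u) : Continuous fun t => F (u t) t :=
  (continuous_prod_of_discrete_left (f := fun y : X × T => F y.1 y.2)).2 h |>.comp
    (hu.prodMk continuous_id)

theorem zeroSphereIf.discreteTopology (P : Prop) : DiscreteTopology (zeroSphereIf P) :=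
  discreteTopology_iff_forall_isOpen.2 fun s => isOpen_coinduced.2 (isOpen_discrete
    (α := Unit ⊕ {_u : Unit // P}) _)

namespace SymmSeq

instance (N : FinSet) : DiscreteTopology (unit.obj N) := zeroSphereIf.discreteTopology _

theorem unit_cases {N : FinSet} (x : unit.obj N) :
    x = (unit.obj N).pt ∨ ∃ h : Subsingleton N, x = unitPoint h := by
  revert x
  exact PQuot.ind (Or.inl rfl) fun e => Or.inr ⟨e.2, rfl⟩

section assoc
variable {A B C : SymmSeq}

/-- The partition pulled back along a bijection. -/
def _root_.Surj.precomp {N N' K : FinSet} (p : Surj N K) (e : N' ≃ N) : Surj N' K :=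
  ⟨fun n => p (e n), p.surj.comp e.surjective⟩

theorem assocApp_map {N N' : FinSet} (e : N' ≃ N) :
    (comp (comp A B) C).map (X := N) (Y := N') e.symm ≫ assocApp N' =
      assocApp N ≫ (comp A (comp B C)).map (X := N) (Y := N') e.symm := by
  refine comp_comp_hom_ext fun K L p q a b c => ?_
  rw [PtdSpace.comp_apply, PtdSpace.comp_apply, assocApp_compMk,
    assocVal_square p q (p.precomp e) q e (Equiv.refl K) (Equiv.refl L) (fun _ => rfl)
      (fun _ => rfl),
    compMk_square (A := comp A B) (p.precomp e) p e (Equiv.refl K) (fun _ => rfl),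
    compMk_square q q (Equiv.refl K) (Equiv.refl L) (fun _ => rfl), assocApp_compMk]

/-- The rebracketing of the composition product. -/
noncomputable def assocHom (A B C : SymmSeq) : comp (comp A B) C ⟶ comp A (comp B C) where
  app N := assocApp N
  naturality N N' e := assocApp_map (Equiv.symm e)

theorem assocVal_hom {A' B' C' : SymmSeq} (α : A ⟶ A') (β : B ⟶ B') (γ : C ⟶ C')
    {N K L : FinSet} (p : Surj N K) (q : Surj K L) (a : A.obj L)
    (b : ∀ l, B.obj (q.fib l)) (c : ∀ k, C.obj (p.fib k)) :
    (compHom α (compHom β γ)).app N (assocVal p q a b c) =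
      assocVal p q (α.app L a) (fun l => β.app (q.fib l) (b l)) fun k => γ.app (p.fib k) (c k) := by
  unfold assocVal
  rw [compMk_hom]
  refine congrArg (compMk (B := comp B' C') (p.comp q) _) (funext fun l => ?_)
  rw [compMk_hom]
  refine congrArg (compMk (p.restr q l) _) (funext fun k => ?_)
  exact hom_map_apply γ _ _

theorem assocHom_natural {A' B' C' : SymmSeq} (α : A ⟶ A') (β : B ⟶ B') (γ : C ⟶ C') :
    compHom (compHom α β) γ ≫ assocHom A' B' C' =
      assocHom A B C ≫ compHom α (compHom β γ) := by
  refine NatTrans.ext (funext fun N => comp_comp_hom_ext fun K L p q a b c => ?_)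
  rw [NatTrans.comp_app, NatTrans.comp_app, PtdSpace.comp_apply, PtdSpace.comp_apply]
  refine Eq.trans ?_ ((congrArg ((compHom α (compHom β γ)).app N)
    (assocApp_compMk p q a b c)).trans (assocVal_hom α β γ p q a b c)).symm
  rw [compMk_hom, compMk_hom]
  exact assocApp_compMk p q _ _ _

end assoc

section unit
variable {A : SymmSeq}

/-- The map `(1; a) ↦ a` on the summand of a partition, for a fixed `a`. -/
noncomputable def lamInner {N : FinSet} (π : Setoid N) (a : ∀ k, A.obj ((FinSet.proj π).fib k)) :
    unit.obj (FinSet.quot π) ⟶ A.obj N :=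
  PQuot.desc (fun v : {_u : Unit // Subsingleton (FinSet.quot π)} =>
      A.map (X := (FinSet.proj π).fib (FinSet.quot π).ne.some) (Y := N)
        ((FinSet.proj π).onlyFib v.2 (FinSet.quot π).ne.some).symm (a (FinSet.quot π).ne.some))
    continuous_of_discreteTopology (fun _ _ h => h.elim) fun _ h => h.elim

theorem lamInner_unitPoint {N : FinSet} (π : Setoid N) (a : ∀ k, A.obj ((FinSet.proj π).fib k))
    (h : Subsingleton (FinSet.quot π)) (k : FinSet.quot π) : lamInner π a (unitPoint h) =
      A.map (X := (FinSet.proj π).fib k) (Y := N) ((FinSet.proj π).onlyFib h k).symm (a k) := by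
  obtain rfl : k = (FinSet.quot π).ne.some := Subsingleton.elim _ _
  rfl

/-- The left unit isomorphism `(1; a) ↦ a` on a finite set. -/
noncomputable def lamApp (A : SymmSeq) (N : FinSet) : (comp unit A).obj N ⟶ A.obj N :=
  Wedge.desc (X := fun π : Setoid N => smash (unit.obj (FinSet.quot π)) fun q =>
      A.obj ((FinSet.proj π).fib q)) fun π =>
    smash.desc (fun x a => lamInner π a x)
      (fun T x a => by
        refine continuous_of_discrete_parameter
          (fun x (t : cptHaus T) => lamInner π (fun k => a k t) x)
          (fun x => ?_) x.continuous
        rcases unit_cases x with rfl | ⟨h, rfl⟩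
        · exact continuous_const.congr fun t => (PtdSpace.Hom.map_pt _).symm
        · exact (PtdSpace.Hom.cont _).comp (a _).continuous)
      (fun a => PtdSpace.Hom.map_pt _) fun x a k h => by
        rcases unit_cases x with rfl | ⟨h', rfl⟩
        · exact PtdSpace.Hom.map_pt _
        · rw [lamInner_unitPoint π a h' k, h]
          exact PtdSpace.Hom.map_pt _

theorem lamApp_compMk {N K : FinSet} (p : Surj N K) (hK : Subsingleton K) (k : K)
    (a : ∀ k, A.obj (p.fib k)) : lamApp A N (compMk p (unitPoint hK) a) =
      A.map (X := p.fib k) (Y := N) (p.onlyFib hK k).symm (a k) := by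
  obtain ⟨k, rfl⟩ := p.kerEquiv.surjective k
  rw [compMk_relabel (FinSet.proj (Setoid.ker p)) p p.kerEquiv (fun _ => rfl), compMk_proj]
  exact (lamInner_unitPoint (Setoid.ker p) _ (p.kerEquiv.subsingleton) k).trans
    (map_map_apply A _ _ _)

theorem comp_unit_hom_ext {N : FinSet} {Z : PtdSpace} {f g : (comp unit A).obj N ⟶ Z}
    (h : ∀ (K : FinSet) (p : Surj N K) (hK : Subsingleton K) (a : ∀ k, A.obj (p.fib k)),
      f (compMk p (unitPoint hK) a) = g (compMk p (unitPoint hK) a)) : f = g :=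
  comp_hom_ext fun K p x a => by
    rcases unit_cases x with rfl | ⟨hK, rfl⟩
    · rw [compMk_pt_left]
      exact f.map_pt.trans g.map_pt.symm
    · exact h K p hK a

theorem lamApp_map {N N' : FinSet} (e : N' ≃ N) :
    (comp unit A).map (X := N) (Y := N') e.symm ≫ lamApp A N' =
      lamApp A N ≫ A.map (X := N) (Y := N') e.symm := by
  refine comp_unit_hom_ext fun K p hK a => ?_
  rw [PtdSpace.comp_apply, PtdSpace.comp_apply, lamApp_compMk p hK (Classical.arbitrary K),
    compMk_square (p.precomp e) p e (Equiv.refl K) (fun _ => rfl)]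
  exact (lamApp_compMk (p.precomp e) hK (Classical.arbitrary K) _).trans
    ((map_map_apply A _ _ _).trans (map_map_apply A (p.onlyFib hK (Classical.arbitrary K)).symm
      e.symm (a (Classical.arbitrary K))).symm)

/-- The left unit isomorphism of the composition product. -/
noncomputable def lamHom (A : SymmSeq) : comp unit A ⟶ A where
  app N := lamApp A N
  naturality N N' e := lamApp_map (Equiv.symm e)

theorem lamHom_natural {A' : SymmSeq} (α : A ⟶ A') :
    compHom (𝟙 unit) α ≫ lamHom A' = lamHom A ≫ α := by
  refine NatTrans.ext (funext fun N => comp_unit_hom_ext fun K p hK a => ?_)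
  rw [NatTrans.comp_app, NatTrans.comp_app, PtdSpace.comp_apply, PtdSpace.comp_apply, compMk_hom]
  refine (lamApp_compMk p hK (Classical.arbitrary K) _).trans ?_
  exact (hom_map_apply α (p.onlyFib hK (Classical.arbitrary K)).symm _).symm.trans
    (congrArg (α.app N) (lamApp_compMk p hK (Classical.arbitrary K) a).symm)

theorem isIso_lamApp (N : FinSet) : IsIso (lamApp A N) := by
  let p : Surj N ⟨Unit⟩ := ⟨fun _ => (), fun _ => ⟨Classical.arbitrary N, rfl⟩⟩
  let hU : Subsingleton (FinSet.mk Unit) := inferInstanceAs (Subsingleton Unit)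
  have hl : ∀ a : A.obj N, lamApp A N (compMk p (unitPoint hU) fun k =>
      A.map (X := N) (Y := p.fib k) (p.onlyFib hU k) a) = a := fun a =>
    (lamApp_compMk p hU () _).trans (map_symm_apply A (p.onlyFib hU ()) a)
  refine PtdSpace.isIso_of_leftInverse _ (fun a => compMk p (unitPoint hU) fun k =>
      A.map (X := N) (Y := p.fib k) (p.onlyFib hU k) a) (fun x => ?_) hl
    (continuous_compMk p continuous_const fun k => PtdSpace.Hom.cont _)
  rcases comp_cases x with rfl | ⟨π, y, a, rfl⟩
  · rw [PtdSpace.Hom.map_pt]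
    exact compMk_pt_right _ _ _ () (PtdSpace.Hom.map_pt _)
  rcases unit_cases y with rfl | ⟨h, rfl⟩
  · rw [compMk_pt_left, PtdSpace.Hom.map_pt]
    exact compMk_pt_right _ _ _ () (PtdSpace.Hom.map_pt _)
  · let k := (FinSet.quot π).ne.some
    let c : FinSet.quot π ≃ FinSet.mk Unit :=
      ⟨fun _ => (), fun _ => k, fun _ => Subsingleton.elim _ _, fun _ => rfl⟩
    rw [lamApp_compMk (FinSet.proj π) h k,
      compMk_relabel p (FinSet.proj π) c.symm (fun n => Subsingleton.elim _ _)]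
    refine congrArg (compMk p (unitPoint hU)) (funext fun u => ?_)
    exact map_map_apply A _ _ _

/-- The right unit isomorphism `a ↦ (a; 1, …, 1)` on a finite set. -/
noncomputable def rhoApp (A : SymmSeq) (N : FinSet) : A.obj N ⟶ (comp A unit).obj N where
  toFun a := compMk (Surj.id N) a fun n =>
    unitPoint ((Surj.id N).fib_subsingleton (fun _ _ h => h) n)
  cont := continuous_compMk _ continuous_id fun _ => continuous_const
  map_pt := compMk_pt_left _ _

/-- The right unit isomorphism of the composition product. -/
noncomputable def rhoHom (A : SymmSeq) : A ⟶ comp A unit where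
  app N := rhoApp A N
  naturality N N' e := PtdSpace.hom_ext fun a =>
    (compMk_square (Surj.id N') (Surj.id N) (Equiv.symm e) (Equiv.symm e) (fun _ => rfl) a
      fun n => unitPoint ((Surj.id N).fib_subsingleton (fun _ _ h => h) n)).symm

theorem rhoHom_natural {A' : SymmSeq} (α : A ⟶ A') :
    rhoHom A ≫ compHom α (𝟙 unit) = α ≫ rhoHom A' :=
  NatTrans.ext (funext fun N => PtdSpace.hom_ext fun a => compMk_hom α (𝟙 unit) (Surj.id N) a
    fun n => unitPoint ((Surj.id N).fib_subsingleton (fun _ _ h => h) n))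

theorem isIso_rhoApp (N : FinSet) : IsIso (rhoApp A N) := by
  have hpt : ∀ a : A.obj N, rhoApp A N a = ((comp A unit).obj N).pt → a = (A.obj N).pt :=
    fun a h => (of_compMk_eq_pt h).resolve_right fun ⟨n, h⟩ => PQuot.of_mk_eq_pt
      (z := fun _ : {_u : Unit // Subsingleton ((Surj.id N).fib n)} => False) h
  have hinj : Function.Injective (rhoApp A N) := fun a a' h => by
    by_cases hp : rhoApp A N a = ((comp A unit).obj N).pt
    · rw [hpt a hp, hpt a' (h.symm.trans hp)]
    · exact (eq_of_compMk_eq h hp).1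
  have hval : ∀ (π : Setoid N) (b : ∀ k, unit.obj ((FinSet.proj π).fib k)),
      (∃ k, b k = (unit.obj ((FinSet.proj π).fib k)).pt) ∨
        ∃ c : N ≃ FinSet.quot π, ∀ a : A.obj (FinSet.quot π),
          compMk (FinSet.proj π) a b = rhoApp A N
            (A.map (X := FinSet.quot π) (Y := N) c.symm a) := by
    intro π b
    by_cases hb : ∃ k, b k = (unit.obj ((FinSet.proj π).fib k)).pt
    · exact Or.inl hb
    have := fun k => (unit_cases (b k)).resolve_left fun h => hb ⟨k, h⟩
    choose h hb using this
    obtain rfl : b = _ := funext hb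
    refine Or.inr ⟨Equiv.ofBijective (FinSet.proj π) ⟨fun n m hnm => ?_, (FinSet.proj π).surj⟩,
      fun a => compMk_relabel (Surj.id N) (FinSet.proj π) _ (fun _ => rfl) a _⟩
    exact congrArg Subtype.val (Subsingleton.elim
      (h := h (FinSet.proj π m)) ⟨n, hnm⟩ ⟨m, rfl⟩)
  have hsurj : Function.Surjective (rhoApp A N) := fun x => by
    rcases comp_cases x with rfl | ⟨π, a, b, rfl⟩
    · exact ⟨_, PtdSpace.Hom.map_pt _⟩
    rcases hval π b with ⟨k, hk⟩ | ⟨c, hc⟩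
    · exact ⟨_, (PtdSpace.Hom.map_pt _).trans (compMk_pt_right _ _ _ k hk).symm⟩
    · exact ⟨_, (hc a).symm⟩
  let g := Function.surjInv hsurj
  have hg : ∀ y, rhoApp A N (g y) = y := Function.surjInv_eq _
  refine PtdSpace.isIso_of_leftInverse _ g (fun x => hinj (hg _)) hg ?_
  refine (detects_comp (PA := fun _ _ _ => True) (PB := fun _ _ _ => True)
    (fun K => detects_all (A.obj K)) (fun K => testsClosed_all (A.obj K))
    (fun K => detects_all (unit.obj K)) (fun K => testsClosed_all (unit.obj K)) N).continuous
    fun T f hf => ?_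
  rcases hf with hf | ⟨π, a, b, -, -, hf⟩
  · simp only [hf]
    exact continuous_const
  simp only [hf]
  refine continuous_of_discrete_parameter (fun (b : ∀ k, unit.obj ((FinSet.proj π).fib k))
    (t : cptHaus T) => g (compMk (FinSet.proj π) (a t) b)) (fun b => ?_)
    (continuous_pi fun k => (b k).continuous)
  rcases hval π b with ⟨k, hk⟩ | ⟨c, hc⟩
  · simp only [compMk_pt_right _ _ _ k hk]
    exact continuous_const
  · refine ((PtdSpace.Hom.cont (A.map (X := FinSet.quot π) (Y := N) c.symm)).comp
      a.continuous).congr fun t => hinj ?_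
    rw [hg, hc]
    rfl

end unit

section axioms
variable (A B C D : SymmSeq)

theorem pentagon : compHom (assocHom A B C) (𝟙 D) ≫ assocHom A (comp B C) D ≫
    compHom (𝟙 A) (assocHom B C D) = assocHom (comp A B) C D ≫ assocHom A B (comp C D) := by
  refine NatTrans.ext (funext fun N => comp_comp_hom_ext fun K L p q y c d => ?_)
  rcases comp_cases y with rfl | ⟨ρ, a, b, rfl⟩
  · simp only [compMk_pt_left, PtdSpace.Hom.map_pt]
  generalize FinSet.proj ρ = r at a b
  simp only [NatTrans.comp_app, PtdSpace.comp_apply]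
  have h₁ : (compHom (assocHom A B C) (𝟙 D)).app N (compMk (A := comp (comp A B) C) p
        (compMk (A := comp A B) q (compMk r a b) c) d) =
      compMk (A := comp A (comp B C)) p (assocVal q r a b c) d :=
    (compMk_hom (assocHom A B C) (𝟙 D) p _ d).trans (congrArg (fun x =>
      compMk (A := comp A (comp B C)) p x d) (assocApp_compMk q r a b c))
  have h₂ : (assocHom A (comp B C) D).app N (compMk (A := comp A (comp B C)) p
      (assocVal q r a b c) d) = assocVal (B := comp B C) p (q.comp r) a
        (fun m => compMk (q.restr r m) (b m) fun l =>
          C.map (X := q.fib l.1) (Y := (q.restr r m).fib l) (q.restrFib r m l).symm (c l.1)) d :=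
    assocApp_compMk p (q.comp r) a _ d
  have h₃ : (assocHom (comp A B) C D).app N (compMk (A := comp (comp A B) C) p
        (compMk (A := comp A B) q (compMk r a b) c) d) =
      assocVal (A := comp A B) p q (compMk r a b) c d := assocApp_compMk p q _ c d
  have h₄ : (assocHom A B (comp C D)).app N (assocVal (A := comp A B) p q (compMk r a b) c d) =
      assocVal (C := comp C D) (p.comp q) r a b _ := assocApp_compMk (p.comp q) r a b _
  refine (congrArg (fun x => (compHom (𝟙 A) (assocHom B C D)).app N
    ((assocHom A (comp B C) D).app N x)) h₁).trans ((congrArg ((compHom (𝟙 A)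
      (assocHom B C D)).app N) h₂).trans ?_)
  refine Eq.trans ?_ ((congrArg ((assocHom A B (comp C D)).app N) h₃).trans h₄).symm
  refine (compMk_hom (𝟙 A) (assocHom B C D) _ a _).trans ?_
  refine congrArg (compMk (B := comp B (comp C D)) (p.comp (q.comp r)) a) (funext fun m => ?_)
  refine (assocApp_compMk (p.restr (q.comp r) m) (q.restr r m) (b m) _ _).trans ?_
  refine congrArg (compMk (B := comp C D) ((p.comp q).restr r m) (b m)) (funext fun l => ?_)
  refine Eq.trans ?_ (compMk_square ((p.restr (q.comp r) m).restr (q.restr r m) l)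
    (p.restr q l.1) ((p.comp q).restrFib r m l) (q.restrFib r m l) (fun _ => rfl) (c l.1) _).symm
  refine congrArg (compMk _ _) (funext fun k => ?_)
  refine (map_map_apply D _ _ _).trans (Eq.trans ?_ (map_map_apply D (p.restrFib q l.1
    (q.restrFib r m l k)).symm (Surj.fibEquiv ((p.restr (q.comp r) m).restr (q.restr r m) l)
      (p.restr q l.1) ((p.comp q).restrFib r m l) (q.restrFib r m l) (fun _ => rfl) k).symm
        (d k.1.1)).symm)
  rfl

theorem assoc_lam : assocHom unit A B ≫ lamHom (comp A B) = compHom (lamHom A) (𝟙 B) := by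
  refine NatTrans.ext (funext fun N => comp_hom_ext fun K p y b => ?_)
  rcases comp_cases y with rfl | ⟨ρ, u, a, rfl⟩
  · simp only [compMk_pt_left, PtdSpace.Hom.map_pt]
  rcases unit_cases u with rfl | ⟨hL, rfl⟩
  · simp only [compMk_pt_left, PtdSpace.Hom.map_pt]
  let l := (FinSet.quot ρ).ne.some
  generalize FinSet.proj ρ = q at a
  have h₁ : (compHom (lamHom A) (𝟙 B)).app N (compMk (A := comp unit A) p
      (compMk q (unitPoint hL) a) b) =
      compMk p (A.map (X := q.fib l) (Y := K) (q.onlyFib hL l).symm (a l)) b :=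
    (compMk_hom (lamHom A) (𝟙 B) p _ b).trans (congrArg (fun x => compMk p x b)
      (lamApp_compMk q hL l a))
  rw [NatTrans.comp_app, PtdSpace.comp_apply, h₁]
  refine (congrArg ((lamHom (comp A B)).app N) (assocApp_compMk p q (unitPoint hL) a b)).trans ?_
  refine (lamApp_compMk (A := comp A B) (p.comp q) hL l _).trans ?_
  refine (compMk_square p (p.restr q l) ((p.comp q).onlyFib hL l) (q.onlyFib hL l)
    (fun _ => rfl) (a l) _).trans ?_
  refine congrArg (compMk p _) (funext fun k => ?_)
  exact (map_map_apply B _ _ _).trans (map_refl_apply B (b k))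

theorem triangle : compHom (rhoHom A) (𝟙 B) ≫ assocHom A unit B ≫ compHom (𝟙 A) (lamHom B) =
    𝟙 (comp A B) := by
  refine NatTrans.ext (funext fun N => comp_hom_ext fun K p a b => ?_)
  simp only [NatTrans.comp_app, PtdSpace.comp_apply]
  have hu : ∀ k, Subsingleton ((Surj.id K).fib k) :=
    (Surj.id K).fib_subsingleton (fun _ _ h => h)
  have h₁ : (compHom (rhoHom A) (𝟙 B)).app N (compMk p a b) =
      compMk (A := comp A unit) p (compMk (Surj.id K) a fun k => unitPoint (hu k)) b :=
    compMk_hom (rhoHom A) (𝟙 B) p a b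
  have h₂ : (assocHom A unit B).app N (compMk (A := comp A unit) p
      (compMk (Surj.id K) a fun k => unitPoint (hu k)) b) =
      assocVal p (Surj.id K) a (fun k => unitPoint (hu k)) b :=
    assocApp_compMk p (Surj.id K) a _ b
  refine (congrArg (fun x => (compHom (𝟙 A) (lamHom B)).app N ((assocHom A unit B).app N x))
    h₁).trans ((congrArg ((compHom (𝟙 A) (lamHom B)).app N) h₂).trans ?_)
  refine (compMk_hom (𝟙 A) (lamHom B) (p.comp (Surj.id K)) a _).trans ?_
  refine congrArg (compMk p a) (funext fun k => ?_)
  refine (lamApp_compMk (A := B) (p.restr (Surj.id K) k) (hu k) ⟨k, rfl⟩ _).trans ?_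
  exact (map_map_apply B _ _ _).trans (map_refl_apply B (b k))

theorem rho_assoc : rhoHom (comp A B) ≫ assocHom A B unit = compHom (𝟙 A) (rhoHom B) := by
  refine NatTrans.ext (funext fun N => comp_hom_ext fun K p a b => ?_)
  rw [NatTrans.comp_app, PtdSpace.comp_apply]
  exact (assocApp_compMk (Surj.id N) p a b _).trans (compMk_hom (𝟙 A) (rhoHom B) p a b).symm

theorem rho_lam : rhoHom unit ≫ lamHom unit = 𝟙 unit := by
  refine NatTrans.ext (funext fun N => PtdSpace.hom_ext fun x => ?_)
  rcases unit_cases x with rfl | ⟨h, rfl⟩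
  · simp only [PtdSpace.Hom.map_pt]
  rw [NatTrans.comp_app, PtdSpace.comp_apply]
  exact lamApp_compMk (Surj.id N) h (Classical.arbitrary N) _

end axioms

/-- The monoidal structure of the composition product. -/
noncomputable def skewMonoidal : SkewMonoidal compFunctor unit where
  assoc A B C := assocHom A B C
  lam A := lamHom A
  rho A := rhoHom A
  assoc_natural α β γ := assocHom_natural α β γ
  lam_natural α := lamHom_natural α
  rho_natural α := rhoHom_natural α
  pentagon A B C D := pentagon A B C D
  assoc_lam A B := assoc_lam A B
  triangle A B := triangle A B
  rho_assoc A B := rho_assoc A B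
  rho_lam := rho_lam

theorem isCanonicalSeq_skewMonoidal : IsCanonicalSeq skewMonoidal where
  assoc A B C _ _ _ p q a b c := assocApp_compMk p q a b c
  lam A _ _ p hK k a := lamApp_compMk p hK k a
  rho A N a := rfl

theorem isIso_assoc (A B C : SymmSeq) : IsIso (skewMonoidal.assoc A B C) :=
  have : ∀ N, IsIso ((assocHom A B C).app N) := fun N => isIso_assocApp N
  NatIso.isIso_of_isIso_app (assocHom A B C)

theorem isIso_lam (A : SymmSeq) : IsIso (skewMonoidal.lam A) :=
  have : ∀ N, IsIso ((lamHom A).app N) := fun N => isIso_lamApp N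
  NatIso.isIso_of_isIso_app (lamHom A)

theorem isIso_rho (A : SymmSeq) : IsIso (skewMonoidal.rho A) :=
  have : ∀ N, IsIso ((rhoHom A).app N) := fun N => isIso_rhoApp N
  NatIso.isIso_of_isIso_app (rhoHom A)

end SymmSeq

/-! ### Spheres at points with finite coordinates -/

namespace Sphere

theorem insert_fin {A B : Type} (φ : A ↪ B) (w : B → PosReal) (y : A → PosReal) :
    insert φ (fun b => (w b : Circ)) (fin y) = fin (Function.extend φ y w) :=
  congrArg mk (funext fun b => by
    by_cases hb : ∃ a, φ a = b
    · obtain ⟨a, rfl⟩ := hb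
      rw [φ.injective.extend_apply, φ.injective.extend_apply]
    · rw [Function.extend_apply' _ _ _ hb, Function.extend_apply' _ _ _ hb])

/-- Smashing with a point `u` of the sphere with coordinates in the first summand. -/
noncomputable def join {A B C : Type} (c : A ⊕ B ≃ C) (u : A → PosReal) : Sphere B ⟶ Sphere C :=
  PtdSpace.mapSpace.toHom (pairing c (fin u))

theorem join_fin {A B C : Type} (c : A ⊕ B ≃ C) (u : A → PosReal) (y : B → PosReal) :
    join c u (fin y) = fin fun i => Sum.elim u y (c.symm i) :=
  (pairing_mk c _ _).trans (congrArg mk (funext fun i =>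
    (Sum.comp_elim (fun r : PosReal => (r : Circ)) u y ▸ rfl :
      Sum.elim (fun a => (u a : Circ)) (fun b => (y b : Circ)) (c.symm i) =
        ((Sum.elim u y (c.symm i) : PosReal) : Circ))))

end Sphere

/-! ### The product of loops for arbitrary labels of the coordinates -/

namespace SymmFun

section block
variable (F : SymmFun) {J : FinSet} {A : Type} {V W : J → FinInj}
  (c : ∀ n, A ⊕ Fin (V n).card ≃ Fin (W n).card)

/-- The sums of the coordinates with labels in `A`. -/
noncomputable def blockSum (w : (Σ n, Fin (W n).card) → PosReal) (a : A) : PosReal :=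
  posSum fun n => w ⟨n, c n (Sum.inl a)⟩

/-- The polar coordinates of the coordinates with labels in `A`, and the remaining coordinates. -/
noncomputable def blockSimplex (w : (Σ n, Fin (W n).card) → PosReal) : BlockParam J A V :=
  (fun a => (polar fun n => w ⟨n, c n (Sum.inl a)⟩).1, fun b => w ⟨b.1, c b.1 (Sum.inr b.2)⟩)

theorem blockHom_apply (g : F.loops V) (w : (Σ n, Fin (W n).card) → PosReal) (x : A → PosReal) :
    blockHom F c g (blockSimplex c w) (Sphere.fin x) =
      (F.obj J).map (X := spheres V) (Y := spheres W)
        (fun n => Sphere.join (c n) fun a => w ⟨n, c n (Sum.inl a)⟩ / blockSum c w a * x a)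
        (PtdSpace.mapSpace.toHom g (Sphere.fin fun b => w ⟨b.1, c b.1 (Sum.inr b.2)⟩)) := by
  refine SymmFunctor.map_congr F.toSymmFunctor (X := spheres V) (Y := spheres W) (fun n => ?_) _
  refine congrArg (Sphere.join (c n)) (funext fun a => congrArg (· * x a) (Subtype.ext ?_))
  rfl

theorem stab_apply {U U' : J → FinInj} (φ : ∀ n, U n ⟶ U' n) (f : F.loops U)
    (w : (Σ n, Fin (U' n).card) → PosReal) :
    PtdSpace.mapSpace.toHom (F.stab φ f) (Sphere.fin w) =
      (F.obj J).map (X := spheres U) (Y := spheres U')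
        (fun n => Sphere.insert (φ n) fun b => (w ⟨n, b⟩ : Circ))
        (PtdSpace.mapSpace.toHom f (Sphere.fin fun a => w ⟨a.1, φ a.1 a.2⟩)) := rfl

/-- Compatibility of the assembled maps with stabilization along injections. A coordinate `r` of the
sphere outside the image of `φ` is multiplied by a point of the open simplex, which by polar
coordinates recovers the coordinates outside the image of `ψ`. -/
theorem blockHom_stab {A' : Type} {V' W' : J → FinInj}
    (c' : ∀ n, A' ⊕ Fin (V' n).card ≃ Fin (W' n).card) (φ : A ↪ A') (χ : ∀ n, V n ⟶ V' n)
    (ψ : ∀ n, W n ⟶ W' n) (h : ∀ n i, ψ n (c n i) = c' n (Sum.map φ (χ n) i)) (g : F.loops V)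
    (w : (Σ n, Fin (W' n).card) → PosReal) (x : A → PosReal) :
    (F.obj J).map (X := spheres W) (Y := spheres W')
        (fun n => Sphere.insert (ψ n) fun b => (w ⟨n, b⟩ : Circ))
        (blockHom F c g (blockSimplex c fun a => w ⟨a.1, ψ a.1 a.2⟩) (Sphere.fin x)) =
      blockHom F c' (F.stab χ g) (blockSimplex c' w)
        (Sphere.insert φ (fun a => (blockSum c' w a : Circ)) (Sphere.fin x)) := by
  have hl : ∀ n a, ψ n (c n (Sum.inl a)) = c' n (Sum.inl (φ a)) := fun n a => h n (Sum.inl a)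
  have hr : ∀ n b, ψ n (c n (Sum.inr b)) = c' n (Sum.inr (χ n b)) := fun n b => h n (Sum.inr b)
  rw [blockHom_apply, Sphere.insert_fin, blockHom_apply, stab_apply]
  refine (SymmFunctor.map_map_apply F.toSymmFunctor (X := spheres V) (Y := spheres W)
    (Z := spheres W') _ _ _).trans (Eq.trans ?_ (SymmFunctor.map_map_apply F.toSymmFunctor
      (X := spheres V) (Y := spheres V') (Z := spheres W') _ _ _).symm)
  simp only [hr]
  refine SymmFunctor.map_congr F.toSymmFunctor (X := spheres V) (Y := spheres W') (fun n => ?_) _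
  refine Sphere.hom_ext_fin fun y => ?_
  refine (congrArg (Sphere.insert (ψ n) fun b => (w ⟨n, b⟩ : Circ)) (Sphere.join_fin _ _ _)).trans
    ((Sphere.insert_fin (ψ n) (fun b => w ⟨n, b⟩) _).trans ?_)
  refine Eq.trans ?_ ((congrArg (Sphere.join (c' n) _) (Sphere.insert_fin (χ n)
    (fun b => w ⟨n, c' n (Sum.inr b)⟩) y)).trans (Sphere.join_fin _ _ _)).symm
  refine congrArg Sphere.fin (funext fun i => ?_)
  have hψ : Function.Injective (ψ n) := (FinInj.emb (ψ n)).injective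
  have hχ : Function.Injective (χ n) := (FinInj.emb (χ n)).injective
  obtain ⟨a' | b', rfl⟩ := (c' n).surjective i
  · rw [Equiv.symm_apply_apply, Sum.elim_inl]
    by_cases ha : ∃ a, φ a = a'
    · obtain ⟨a, rfl⟩ := ha
      rw [← hl]
      refine (hψ.extend_apply _ _ _).trans ?_
      rw [Equiv.symm_apply_apply, Sum.elim_inl, φ.injective.extend_apply]
      have hs : blockSum c (fun a => w ⟨a.1, ψ a.1 a.2⟩) a = blockSum c' w (φ a) :=
        congrArg posSum (funext fun m => congrArg (fun j => w ⟨m, j⟩) (hl m a))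
      rw [hs]
    · rw [Function.extend_apply' _ _ _ ha, div_mul_cancel]
      refine Function.extend_apply' _ _ _ ?_
      rintro ⟨j, hj⟩
      obtain ⟨a | b, rfl⟩ := (c n).surjective j
      · exact ha ⟨a, Sum.inl_injective ((c' n).injective ((hl n a).symm.trans hj))⟩
      · exact Sum.inr_ne_inl ((c' n).injective ((hr n b).symm.trans hj))
  · rw [Equiv.symm_apply_apply, Sum.elim_inr]
    by_cases hb : ∃ b, χ n b = b'
    · obtain ⟨b, rfl⟩ := hb
      rw [← hr]
      refine (hψ.extend_apply _ _ _).trans (Eq.trans ?_ (hχ.extend_apply _ _ _).symm)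
      rw [Equiv.symm_apply_apply, Sum.elim_inr]
    · refine (Function.extend_apply' _ _ _ ?_).trans (Function.extend_apply'
        (f := FinInj.emb (χ n)) y (fun b => w ⟨n, c' n (Sum.inr b)⟩) b' hb).symm
      rintro ⟨j, hj⟩
      obtain ⟨a | b, rfl⟩ := (c n).surjective j
      · exact Sum.inl_ne_inr ((c' n).injective ((hl n a).symm.trans hj))
      · exact hb ⟨b, Sum.inr_injective ((c' n).injective ((hr n b).symm.trans hj))⟩

theorem loopsMap_apply {F F' : SymmFun} (η : F ⟶ F') {U : J → FinInj} (f : F.loops U)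
    (x : Sphere (Σ n, Fin (U n).card)) :
    PtdSpace.mapSpace.toHom (loopsMap η U f) x =
      (SymmFunctor.Hom.app η J).app (spheres U) (PtdSpace.mapSpace.toHom f x) := rfl

theorem blockHom_loopsMap {F F' : SymmFun} (η : F ⟶ F') (g : F.loops V)
    (w : (Σ n, Fin (W n).card) → PosReal) (x : A → PosReal) :
    (SymmFunctor.Hom.app η J).app (spheres W) (blockHom F c g (blockSimplex c w) (Sphere.fin x)) =
      blockHom F' c (loopsMap η V g) (blockSimplex c w) (Sphere.fin x) := by
  rw [blockHom_apply, blockHom_apply, loopsMap_apply]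
  exact SymmFunctor.hom_map_apply (G := F.toSymmFunctor) (G' := F'.toSymmFunctor) η
    (X := spheres V) (Y := spheres W) _ _

theorem permLoops_apply {J' : FinSet} (e : J' ≃ J) {U : J → FinInj} (f : F.loops U)
    (w : (Σ n, Fin (U (e n)).card) → PosReal) :
    PtdSpace.mapSpace.toHom (F.permLoops e U f) (Sphere.fin w) = F.perm e (spheres U)
      (PtdSpace.mapSpace.toHom f (Sphere.fin fun a =>
        w ((Equiv.sigmaCongrLeft (β := fun n => Fin (U n).card) e).symm a))) := rfl

theorem permLoops_apply_comp {J' : FinSet} (e : J' ≃ J) {U : J → FinInj} (f : F.loops U)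
    (w : (Σ n, Fin (U n).card) → PosReal) :
    PtdSpace.mapSpace.toHom (F.permLoops e U f) (Sphere.fin fun a => w ⟨e a.1, a.2⟩) =
      F.perm e (spheres U) (PtdSpace.mapSpace.toHom f (Sphere.fin w)) := by
  rw [permLoops_apply]
  refine congrArg (fun v => F.perm e (spheres U) (PtdSpace.mapSpace.toHom f (Sphere.fin v)))
    (funext fun a => ?_)
  obtain ⟨⟨m, a⟩, rfl⟩ := (Equiv.sigmaCongrLeft (β := fun n => Fin (U n).card) e).surjective a
  rw [Equiv.symm_apply_apply]
  rfl

theorem posSum_equiv {J J' : FinSet} (e : J' ≃ J) (u : J → PosReal) :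
    posSum (fun j => u (e j)) = posSum u :=
  Subtype.ext (finsum_comp_equiv e (f := fun j => (u j : ℝ)))

/-- Compatibility of the assembled maps with bijections of the variables of `F`. -/
theorem blockHom_perm {J' : FinSet} (e : J' ≃ J) (g : F.loops V)
    (w : (Σ n, Fin (W n).card) → PosReal) (x : A → PosReal) :
    F.perm e (spheres W) (blockHom F c g (blockSimplex c w) (Sphere.fin x)) =
      blockHom F (V := fun n => V (e n)) (W := fun n => W (e n)) (fun n => c (e n))
        (F.permLoops e V g)
        (blockSimplex (V := fun n => V (e n)) (W := fun n => W (e n)) (fun n => c (e n))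
          fun a => w ⟨e a.1, a.2⟩) (Sphere.fin x) := by
  rw [blockHom_apply, blockHom_apply]
  refine (SymmFunctor.perm_map_apply F.toSymmFunctor e (X := spheres V) (Y := spheres W) _ _).trans
    ?_
  refine Eq.trans ?_ (congrArg (PtdSpace.Hom.toFun ((F.obj J').map (X := fun n => spheres V (e n))
    (Y := fun n => spheres W (e n)) _)) (permLoops_apply_comp F e g
      fun b => w ⟨b.1, c b.1 (Sum.inr b.2)⟩)).symm
  refine SymmFunctor.map_congr F.toSymmFunctor (X := fun n => spheres V (e n))
    (Y := fun n => spheres W (e n)) (fun n => ?_) _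
  refine congrArg (Sphere.join (c (e n))) (funext fun a => ?_)
  congr 2
  exact (posSum_equiv e fun n => w ⟨n, c n (Sum.inl a)⟩).symm

end block

section value
variable {N K : FinSet} (p : Surj N K) {U : K → FinInj} {V : ∀ k, p.fib k → FinInj}
  {W : N → FinInj}
  (c : ∀ (k : K) (n : p.fib k), Fin (U k).card ⊕ Fin (V k n).card ≃ Fin (W n.1).card)

/-- The restriction of a family of coordinates to a block. -/
abbrev blockRestr (w : (Σ n, Fin (W n).card) → PosReal) (k : K) :
    (Σ n : p.fib k, Fin (W n.1).card) → PosReal := fun a => w ⟨a.1.1, a.2⟩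

/-- The values of the product of loops, for arbitrary identifications `c` of the coordinates `W_n`
with `U_k ⊔ V_{k,n}`. -/
noncomputable def joinValue (G F : SymmFun) (f : G.loops U) (g : ∀ k, F.loops (V k))
    (w : (Σ n, Fin (W n).card) → PosReal) : ((comp G F).obj N).obj (spheres W) :=
  incl G F p (spheres W)
    ((G.obj K).map (X := spheres U)
      (Y := fun k => (F.obj (p.fib k)).obj fun n => spheres W n.1)
      (fun k => blockHom F (W := fun n : p.fib k => W n.1) (c k) (g k)
        (blockSimplex (W := fun n : p.fib k => W n.1) (c k) (blockRestr p w k)))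
      (PtdSpace.mapSpace.toHom f (Sphere.fin fun a =>
        blockSum (W := fun n : p.fib a.1 => W n.1) (c a.1) (blockRestr p w a.1) a.2)))

theorem productValue_eq_joinValue (U : K → FinInj) (V : ∀ k, p.fib k → FinInj) (G F : SymmFun)
    (f : G.loops U) (g : ∀ k, F.loops (V k))
    (w : (Σ n, Fin (joinSets p U V n).card) → PosReal) :
    productValue p U V G F f g w = joinValue p (joinEquiv p U V) G F f g w := rfl

/-- Compatibility of the product of loops with stabilization along injections. -/
theorem joinValue_stab (G F : SymmFun) {U' : K → FinInj} {V' : ∀ k, p.fib k → FinInj}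
    {W' : N → FinInj}
    (c' : ∀ (k : K) (n : p.fib k), Fin (U' k).card ⊕ Fin (V' k n).card ≃ Fin (W' n.1).card)
    (φ : ∀ k, U k ⟶ U' k) (χ : ∀ k n, V k n ⟶ V' k n) (ψ : ∀ n, W n ⟶ W' n)
    (h : ∀ k (n : p.fib k) i, ψ n.1 (c k n i) = c' k n (Sum.map (φ k) (χ k n) i))
    (f : G.loops U) (g : ∀ k, F.loops (V k)) (w : (Σ n, Fin (W' n).card) → PosReal) :
    ((comp G F).obj N).map (X := spheres W) (Y := spheres W')
        (fun n => Sphere.insert (ψ n) fun b => (w ⟨n, b⟩ : Circ))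
        (joinValue p c G F f g fun a => w ⟨a.1, ψ a.1 a.2⟩) =
      joinValue p c' G F (G.stab φ f) (fun k => F.stab (χ k) (g k)) w := by
  refine (SymmFunctor.compIncl_map G.toSymmFunctor F.toSymmFunctor p _ _).trans ?_
  refine congrArg (incl G F p (spheres W')) ?_
  refine (SymmFunctor.map_map_apply G.toSymmFunctor (X := spheres U)
    (Y := fun k => (F.obj (p.fib k)).obj fun n => spheres W n.1)
    (Z := fun k => (F.obj (p.fib k)).obj fun n => spheres W' n.1) _ _ _).trans ?_
  rw [stab_apply]
  refine Eq.trans ?_ (SymmFunctor.map_map_apply G.toSymmFunctor (X := spheres U) (Y := spheres U')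
    (Z := fun k => (F.obj (p.fib k)).obj fun n => spheres W' n.1) _ _ _).symm
  have hr : (fun a : Σ k, Fin (U k).card => blockSum (W := fun n : p.fib a.1 => W n.1) (c a.1)
      (blockRestr p (fun a => w ⟨a.1, ψ a.1 a.2⟩) a.1) a.2) =
      fun a => blockSum (W := fun n : p.fib a.1 => W' n.1) (c' a.1) (blockRestr p w a.1)
        (φ a.1 a.2) := funext fun a => congrArg posSum (funext fun n =>
          congrArg (fun j => w ⟨n.1, j⟩) (h a.1 n (Sum.inl a.2)))
  rw [hr]
  refine SymmFunctor.map_congr G.toSymmFunctor (X := spheres U)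
    (Y := fun k => (F.obj (p.fib k)).obj fun n => spheres W' n.1)
    (fun k => Sphere.hom_ext_fin fun x => ?_) _
  exact blockHom_stab F (W := fun n : p.fib k => W n.1) (W' := fun n : p.fib k => W' n.1) (c k)
    (c' k) (FinInj.emb (φ k)) (χ k) (fun n => ψ n.1) (h k) (g k) (blockRestr p w k) x

/-- Naturality of the product of loops in both functor sequences. -/
theorem joinValue_hom {G G' F F' : SymmFun} (η : G ⟶ G') (θ : F ⟶ F') (f : G.loops U)
    (g : ∀ k, F.loops (V k)) (w : (Σ n, Fin (W n).card) → PosReal) :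
    ((SymmFunctor.compHom η θ).app N).app (spheres W) (joinValue p c G F f g w) =
      joinValue p c G' F' (loopsMap η U f) (fun k => loopsMap θ (V k) (g k)) w := by
  refine (SymmFunctor.compIncl_hom η θ p (spheres W) _).trans ?_
  refine congrArg (incl G' F' p (spheres W)) ?_
  refine (SymmFunctor.hom_map_map_apply (G := G.toSymmFunctor) (G' := G'.toSymmFunctor) η
    (X := spheres U) (Y := fun k => (F.obj (p.fib k)).obj fun n => spheres W n.1)
    (Z := fun k => (F'.obj (p.fib k)).obj fun n => spheres W n.1) _ _ _).trans ?_
  rw [loopsMap_apply]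
  refine SymmFunctor.map_congr G'.toSymmFunctor (X := spheres U)
    (Y := fun k => (F'.obj (p.fib k)).obj fun n => spheres W n.1)
    (fun k => Sphere.hom_ext_fin fun x => ?_) _
  exact blockHom_loopsMap (W := fun n : p.fib k => W n.1) (c k) θ (g k) (blockRestr p w k) x

/-- Compatibility of the product of loops with isomorphisms of labelled partitions. -/
theorem joinValue_square (G F : SymmFun) {N' K' : FinSet} (p' : Surj N' K') (e : N' ≃ N)
    (d : K' ≃ K) (h : ∀ n, p (e n) = d (p' n)) (f : G.loops U) (g : ∀ k, F.loops (V k))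
    (w : (Σ n, Fin (W n).card) → PosReal) :
    (comp G F).perm e (spheres W) (joinValue p c G F f g w) =
      joinValue p' (U := fun k => U (d k))
        (V := fun k n => V (d k) (Surj.fibEquiv p' p e d h k n)) (W := fun n => W (e n))
        (fun k n => c (d k) (Surj.fibEquiv p' p e d h k n)) G F (G.permLoops d U f)
        (fun k => F.permLoops (Surj.fibEquiv p' p e d h k) (V (d k)) (g (d k)))
        fun a => w ⟨e a.1, a.2⟩ := by
  refine (SymmFunctor.compIncl_square G.toSymmFunctor F.toSymmFunctor p' p e d h (spheres W)
    _).trans ?_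
  refine congrArg (incl G F p' fun n => spheres W (e n)) ?_
  refine (SymmFunctor.transport_map_apply G.toSymmFunctor d (X := spheres U)
    (Y := fun k => (F.obj (p.fib k)).obj fun n => spheres W n.1)
    (Y' := fun k => (F.obj (p'.fib k)).obj fun n => spheres W (e n.1)) _ _ _).trans ?_
  have hr : (fun a : Σ k, Fin (U (d k)).card => blockSum (V := fun n => V (d a.1)
      (Surj.fibEquiv p' p e d h a.1 n)) (W := fun n : p'.fib a.1 => W (e n.1))
      (fun n => c (d a.1) (Surj.fibEquiv p' p e d h a.1 n))
      (fun b => w ⟨e b.1.1, b.2⟩) a.2) =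
      fun a => blockSum (W := fun n : p.fib (d a.1) => W n.1) (c (d a.1)) (blockRestr p w (d a.1))
        a.2 := funext fun a => posSum_equiv (Surj.fibEquiv p' p e d h a.1)
          fun n => w ⟨n.1, c (d a.1) n (Sum.inl a.2)⟩
  have hf := permLoops_apply_comp G d f (fun a => blockSum (W := fun n : p.fib a.1 => W n.1)
    (c a.1) (blockRestr p w a.1) a.2)
  refine Eq.trans ?_ (congrArg (PtdSpace.Hom.toFun ((G.obj K').map (X := fun k => spheres U (d k))
    (Y := fun k => (F.obj (p'.fib k)).obj fun n => spheres W (e n.1)) _))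
      ((congrArg (fun v => PtdSpace.mapSpace.toHom (G.permLoops d U f) (Sphere.fin v)) hr).trans
        hf)).symm
  refine SymmFunctor.map_congr G.toSymmFunctor (X := fun k => spheres U (d k))
    (Y := fun k => (F.obj (p'.fib k)).obj fun n => spheres W (e n.1))
    (fun k => Sphere.hom_ext_fin fun x => ?_) _
  exact blockHom_perm F (W := fun n : p.fib (d k) => W n.1) (c (d k))
    (Surj.fibEquiv p' p e d h k) (g (d k)) (blockRestr p w (d k)) x

end value
end SymmFun

/-! ### Associativity of the product of loops -/

theorem posSum_fib {N K : FinSet} (p : Surj N K) (u : N → PosReal) :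
    posSum (fun k => posSum fun n : p.fib k => u n.1) = posSum u := by
  classical
  have := Fintype.ofFinite N
  have := Fintype.ofFinite K
  refine Subtype.ext ?_
  change ∑ᶠ k, ∑ᶠ n : {n : N // p n = k}, (u n.1 : ℝ) = ∑ᶠ n, (u n : ℝ)
  simp only [finsum_eq_sum_of_fintype]
  exact Fintype.sum_fiberwise p.toFun fun n => (u n : ℝ)

namespace SymmFun

/-- Associativity of the product of loops in a single block of the coarse partition: the spheres
with coordinates `A` can be assembled into the variables of `F` directly or in two steps. The
coordinates of the sphere operad multiply. -/
theorem blockHom_blockHom (G F : SymmFun) {J Q : FinSet} (r : Surj J Q) {A : Type}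
    {V R : Q → FinInj} {Z : ∀ k, r.fib k → FinInj} {S T : J → FinInj}
    (c₁ : ∀ k, A ⊕ Fin (V k).card ≃ Fin (R k).card)
    (c₂ : ∀ k (n : r.fib k), Fin (R k).card ⊕ Fin (Z k n).card ≃ Fin (S n.1).card)
    (d₁ : ∀ k (n : r.fib k), Fin (V k).card ⊕ Fin (Z k n).card ≃ Fin (T n.1).card)
    (d₂ : ∀ n, A ⊕ Fin (T n).card ≃ Fin (S n).card)
    (h₁ : ∀ k (n : r.fib k) a, c₂ k n (Sum.inl (c₁ k (Sum.inl a))) = d₂ n.1 (Sum.inl a))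
    (h₂ : ∀ k (n : r.fib k) b, c₂ k n (Sum.inl (c₁ k (Sum.inr b))) =
      d₂ n.1 (Sum.inr (d₁ k n (Sum.inl b))))
    (h₃ : ∀ k (n : r.fib k) z, c₂ k n (Sum.inr z) = d₂ n.1 (Sum.inr (d₁ k n (Sum.inr z))))
    (g : G.loops V) (h : ∀ k, F.loops (Z k)) (gh : (comp G F).loops T)
    (hgh : ∀ w, PtdSpace.mapSpace.toHom gh (Sphere.fin w) = joinValue r d₁ G F g h w)
    (w : (Σ n, Fin (S n).card) → PosReal) (x : A → PosReal) :
    incl G F r (spheres S) ((G.obj Q).map (X := spheres R)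
      (Y := fun k => (F.obj (r.fib k)).obj fun n => spheres S n.1)
      (fun k => blockHom F (W := fun n : r.fib k => S n.1) (c₂ k) (h k)
        (blockSimplex (W := fun n : r.fib k => S n.1) (c₂ k) (blockRestr r w k)))
      (blockHom G c₁ g (blockSimplex c₁ fun a =>
        blockSum (W := fun n : r.fib a.1 => S n.1) (c₂ a.1) (blockRestr r w a.1) a.2)
          (Sphere.fin x))) =
      blockHom (comp G F) d₂ gh (blockSimplex d₂ w) (Sphere.fin x) := by
  rw [blockHom_apply, blockHom_apply, hgh]
  refine Eq.trans ?_ (SymmFunctor.compIncl_map G.toSymmFunctor F.toSymmFunctor r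
    (X := spheres T) (Y := spheres S) _ _).symm
  refine congrArg (incl G F r (spheres S)) ?_
  refine (SymmFunctor.map_map_apply G.toSymmFunctor (X := spheres V) (Y := spheres R)
    (Z := fun k => (F.obj (r.fib k)).obj fun n => spheres S n.1) _ _ _).trans ?_
  refine Eq.trans ?_ (SymmFunctor.map_map_apply G.toSymmFunctor (X := spheres V)
    (Y := fun k => (F.obj (r.fib k)).obj fun n => spheres T n.1)
    (Z := fun k => (F.obj (r.fib k)).obj fun n => spheres S n.1) _ _ _).symm
  have hv : (fun b : Σ k, Fin (V k).card => blockSum (W := fun n : r.fib b.1 => S n.1) (c₂ b.1)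
      (blockRestr r w b.1) (c₁ b.1 (Sum.inr b.2))) =
      fun b => blockSum (W := fun n : r.fib b.1 => T n.1) (d₁ b.1)
        (blockRestr r (fun b => w ⟨b.1, d₂ b.1 (Sum.inr b.2)⟩) b.1) b.2 :=
    funext fun b => congrArg posSum (funext fun n => congrArg (fun j => w ⟨n.1, j⟩) (h₂ b.1 n b.2))
  rw [hv]
  refine SymmFunctor.map_congr G.toSymmFunctor (X := spheres V)
    (Y := fun k => (F.obj (r.fib k)).obj fun n => spheres S n.1)
    (fun k => Sphere.hom_ext_fin fun y => ?_) _
  refine (congrArg (PtdSpace.Hom.toFun (blockHom F (W := fun n : r.fib k => S n.1) (c₂ k) (h k)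
    (blockSimplex (W := fun n : r.fib k => S n.1) (c₂ k) (blockRestr r w k))))
      (Sphere.join_fin _ _ _)).trans ?_
  refine (blockHom_apply F (W := fun n : r.fib k => S n.1) (c₂ k) (h k) _ _).trans ?_
  refine Eq.trans ?_ (congrArg (PtdSpace.Hom.toFun ((F.obj (r.fib k)).map
    (X := fun n => spheres T n.1) (Y := fun n => spheres S n.1) fun n => Sphere.join (d₂ n.1)
      fun a =>
      w ⟨n.1, d₂ n.1 (Sum.inl a)⟩ / blockSum d₂ w a * x a))
    (blockHom_apply F (W := fun n : r.fib k => T n.1) (d₁ k) (h k) _ y)).symm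
  refine Eq.trans ?_ (SymmFunctor.map_map_apply F.toSymmFunctor (X := spheres (Z k))
    (Y := fun n => spheres T n.1) (Z := fun n => spheres S n.1) _ _ _).symm
  have hz : (fun b : Σ n, Fin (Z k n).card => blockRestr r w k ⟨b.1, c₂ k b.1 (Sum.inr b.2)⟩) =
      fun b => blockRestr r (fun b => w ⟨b.1, d₂ b.1 (Sum.inr b.2)⟩) k
        ⟨b.1, d₁ k b.1 (Sum.inr b.2)⟩ :=
    funext fun b => congrArg (fun j => w ⟨b.1.1, j⟩) (h₃ k b.1 b.2)
  rw [hz]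
  refine SymmFunctor.map_congr F.toSymmFunctor (X := spheres (Z k))
    (Y := fun n => spheres S n.1) (fun n => Sphere.hom_ext_fin fun z => ?_) _
  refine (Sphere.join_fin _ _ _).trans (Eq.trans ?_ ((congrArg (Sphere.join (d₂ n.1) _)
    (Sphere.join_fin _ _ _)).trans (Sphere.join_fin _ _ _)).symm)
  refine congrArg Sphere.fin (funext fun i => ?_)
  obtain ⟨a | t, rfl⟩ := (d₂ n.1).surjective i
  -- At a coordinate with label in `A` the intermediate sum cancels.
  · rw [Equiv.symm_apply_apply, Sum.elim_inl, ← h₁ k n, Equiv.symm_apply_apply, Sum.elim_inl,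
      Equiv.symm_apply_apply, Sum.elim_inl]
    have hs : blockSum c₁ (fun a => blockSum (W := fun n : r.fib a.1 => S n.1) (c₂ a.1)
        (blockRestr r w a.1) a.2) a = blockSum d₂ w a := by
      refine Eq.trans ?_ (posSum_fib r fun n => w ⟨n, d₂ n (Sum.inl a)⟩)
      exact congrArg posSum (funext fun k => congrArg posSum (funext fun n =>
        congrArg (fun j => w ⟨n.1, j⟩) (h₁ k n a)))
    rw [hs, ← mul_assoc, div_mul_div_cancel]
  · rw [Equiv.symm_apply_apply, Sum.elim_inr]
    obtain ⟨b | z', rfl⟩ := (d₁ k n).surjective t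
    · rw [← h₂, Equiv.symm_apply_apply, Sum.elim_inl, Equiv.symm_apply_apply,
        Equiv.symm_apply_apply,
        Sum.elim_inl, Sum.elim_inr]
      have hs : blockSum (W := fun n : r.fib k => S n.1) (c₂ k) (blockRestr r w k)
          (c₁ k (Sum.inr b)) = blockSum (W := fun n : r.fib k => T n.1) (d₁ k)
            (blockRestr r (fun b => w ⟨b.1, d₂ b.1 (Sum.inr b.2)⟩) k) b :=
        congrFun hv ⟨k, b⟩
      rw [hs]
      exact congrArg (fun j => w ⟨n.1, j⟩ / _ * y b) (h₂ k n b)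
    · rw [← h₃, Equiv.symm_apply_apply, Equiv.symm_apply_apply, Sum.elim_inr, Sum.elim_inr]

/-- Associativity of the product of loops. -/
theorem joinValue_assoc (H G F : SymmFun) {N K L : FinSet} (p : Surj N K) (q : Surj K L)
    {U : L → FinInj} {V : ∀ l, q.fib l → FinInj} {R : K → FinInj} {Z : ∀ k, p.fib k → FinInj}
    {S : N → FinInj} {T : ∀ l, (p.comp q).fib l → FinInj}
    (c₁ : ∀ l (k : q.fib l), Fin (U l).card ⊕ Fin (V l k).card ≃ Fin (R k.1).card)
    (c₂ : ∀ k (n : p.fib k), Fin (R k).card ⊕ Fin (Z k n).card ≃ Fin (S n.1).card)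
    (d₁ : ∀ l (k : q.fib l) (n : (p.restr q l).fib k),
      Fin (V l k).card ⊕ Fin (Z k.1 (p.restrFib q l k n)).card ≃ Fin (T l n.1).card)
    (d₂ : ∀ l (n : (p.comp q).fib l), Fin (U l).card ⊕ Fin (T l n).card ≃ Fin (S n.1).card)
    (h₁ : ∀ l (k : q.fib l) (n : (p.restr q l).fib k) a,
      c₂ k.1 (p.restrFib q l k n) (Sum.inl (c₁ l k (Sum.inl a))) = d₂ l n.1 (Sum.inl a))
    (h₂ : ∀ l (k : q.fib l) (n : (p.restr q l).fib k) b,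
      c₂ k.1 (p.restrFib q l k n) (Sum.inl (c₁ l k (Sum.inr b))) =
        d₂ l n.1 (Sum.inr (d₁ l k n (Sum.inl b))))
    (h₃ : ∀ l (k : q.fib l) (n : (p.restr q l).fib k) z,
      c₂ k.1 (p.restrFib q l k n) (Sum.inr z) = d₂ l n.1 (Sum.inr (d₁ l k n (Sum.inr z))))
    (f : H.loops U) (g : ∀ l, G.loops (V l)) (h : ∀ k, F.loops (Z k)) (fg : (comp H G).loops R)
    (hfg : ∀ w, PtdSpace.mapSpace.toHom fg (Sphere.fin w) = joinValue q c₁ H G f g w)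
    (gh : ∀ l, (comp G F).loops (T l))
    (hgh : ∀ l w, PtdSpace.mapSpace.toHom (gh l) (Sphere.fin w) =
      joinValue (p.restr q l) (U := V l) (V := fun k n => Z k.1 (p.restrFib q l k n)) (d₁ l) G F
        (g l) (fun k => F.permLoops (p.restrFib q l k) (Z k.1) (h k.1)) w)
    (w : (Σ n, Fin (S n).card) → PosReal) :
    ((SymmFunctor.assocHom H.toSymmFunctor G.toSymmFunctor F.toSymmFunctor).app N).app (spheres S)
        (joinValue p c₂ (comp H G) F fg h w) =
      joinValue (p.comp q) d₂ H (comp G F) f gh w := by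
  have e₁ : joinValue p c₂ (comp H G) F fg h w = incl (comp H G) F p (spheres S) (incl H G q
      (fun k => (F.obj (p.fib k)).obj fun n => spheres S n.1) ((H.obj L).map (X := spheres U)
        (Y := fun l => (G.obj (q.fib l)).obj fun k => (F.obj (p.fib k.1)).obj fun n =>
          spheres S n.1)
        (fun l => blockHom G (W := fun k : q.fib l => R k.1) (c₁ l) (g l)
          (blockSimplex (W := fun k : q.fib l => R k.1) (c₁ l) (blockRestr q (fun a =>
            blockSum (W := fun n : p.fib a.1 => S n.1) (c₂ a.1) (blockRestr p w a.1) a.2) l)) ≫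
          (G.obj (q.fib l)).map (X := fun k => spheres R k.1)
            (Y := fun k => (F.obj (p.fib k.1)).obj fun n => spheres S n.1)
            fun k => blockHom F (W := fun n : p.fib k.1 => S n.1) (c₂ k.1) (h k.1)
              (blockSimplex (W := fun n : p.fib k.1 => S n.1) (c₂ k.1) (blockRestr p w k.1)))
        (PtdSpace.mapSpace.toHom f (Sphere.fin fun a => blockSum (W := fun k : q.fib a.1 => R k.1)
          (c₁ a.1) (blockRestr q (fun a => blockSum (W := fun n : p.fib a.1 => S n.1) (c₂ a.1)
            (blockRestr p w a.1) a.2) a.1) a.2)))) := by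
    unfold joinValue
    rw [hfg]
    refine congrArg (incl (comp H G) F p (spheres S)) ?_
    refine (SymmFunctor.compIncl_map H.toSymmFunctor G.toSymmFunctor q (X := spheres R)
      (Y := fun k => (F.obj (p.fib k)).obj fun n => spheres S n.1) _ _).trans ?_
    refine congrArg (incl H G q fun k => (F.obj (p.fib k)).obj fun n => spheres S n.1) ?_
    exact SymmFunctor.map_map_apply H.toSymmFunctor (X := spheres U)
      (Y := fun l => (G.obj (q.fib l)).obj fun k => spheres R k.1)
      (Z := fun l => (G.obj (q.fib l)).obj fun k => (F.obj (p.fib k.1)).obj fun n =>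
          spheres S n.1) _ _ _
  rw [e₁]
  refine (SymmFunctor.assocHom_incl H.toSymmFunctor G.toSymmFunctor F.toSymmFunctor p q (spheres S)
    _).trans ?_
  refine congrArg (incl H (comp G F) (p.comp q) (spheres S)) ?_
  refine (SymmFunctor.map_map_apply H.toSymmFunctor (X := spheres U)
      (Y := fun l => (G.obj (q.fib l)).obj fun k => (F.obj (p.fib k.1)).obj fun n =>
          spheres S n.1)
      (Z := fun l => ((comp G F).obj ((p.comp q).fib l)).obj fun n => spheres S n.1) _ _ _).trans ?_
  have hs : (fun a : Σ l, Fin (U l).card => blockSum (W := fun k : q.fib a.1 => R k.1)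
          (c₁ a.1) (blockRestr q (fun a => blockSum (W := fun n : p.fib a.1 => S n.1) (c₂ a.1)
            (blockRestr p w a.1) a.2) a.1) a.2) =
      fun a => blockSum (W := fun n : (p.comp q).fib a.1 => S n.1) (d₂ a.1)
        (blockRestr (p.comp q) w a.1) a.2 := funext fun a => by
    refine Eq.trans ?_ (posSum_fib (p.restr q a.1) fun n => w ⟨n.1, d₂ a.1 n (Sum.inl a.2)⟩)
    refine congrArg posSum (funext fun k => ?_)
    refine (posSum_equiv (p.restrFib q a.1 k) _).symm.trans (congrArg posSum (funext fun n => ?_))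
    exact congrArg (fun j => w ⟨n.1.1, j⟩) (h₁ a.1 k n a.2)
  rw [hs]
  refine SymmFunctor.map_congr H.toSymmFunctor (X := spheres U)
    (Y := fun l => ((comp G F).obj ((p.comp q).fib l)).obj fun n => spheres S n.1)
    (fun l => Sphere.hom_ext_fin fun x => ?_) _
  refine Eq.trans ?_ (blockHom_blockHom G F (p.restr q l) (R := fun k => R k.1)
    (Z := fun k n => Z k.1 (p.restrFib q l k n)) (S := fun n => S n.1) (c₁ l)
    (fun k n => c₂ k.1 (p.restrFib q l k n)) (d₁ l) (d₂ l) (h₁ l) (h₂ l) (h₃ l) (g l)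
    (fun k => F.permLoops (p.restrFib q l k) (Z k.1) (h k.1)) (gh l) (hgh l)
    (blockRestr (p.comp q) w l) x)
  refine congrArg (incl G F (p.restr q l) fun n => spheres S n.1) ?_
  have hw : blockRestr q (fun a => blockSum (W := fun n : p.fib a.1 => S n.1) (c₂ a.1)
      (blockRestr p w a.1) a.2) l = fun a => blockSum (V := fun n : (p.restr q l).fib a.1 =>
        Z a.1.1 (p.restrFib q l a.1 n)) (W := fun n : (p.restr q l).fib a.1 => S n.1.1)
        (fun n => c₂ a.1.1 (p.restrFib q l a.1 n))
        (blockRestr (p.restr q l) (W := fun n => S n.1) (blockRestr (p.comp q) w l) a.1) a.2 :=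
    funext fun a => (posSum_equiv (p.restrFib q l a.1) _).symm
  rw [hw]
  refine (SymmFunctor.map_map_apply G.toSymmFunctor (X := fun k : q.fib l => spheres R k.1)
    (Y := fun k => (F.obj (p.fib k.1)).obj fun n => spheres S n.1)
    (Z := fun k => (F.obj ((p.restr q l).fib k)).obj fun n => spheres S n.1.1) _ _ _).trans ?_
  refine SymmFunctor.map_congr G.toSymmFunctor (X := fun k : q.fib l => spheres R k.1)
    (Y := fun k => (F.obj ((p.restr q l).fib k)).obj fun n => spheres S n.1.1)
    (fun k => Sphere.hom_ext_fin fun y => ?_) _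
  exact blockHom_perm F (W := fun n : p.fib k.1 => S n.1) (c₂ k.1) (p.restrFib q l k) (h k.1)
    (blockRestr p w k.1) y

end SymmFun

/-! ### The product maps of homotopy colimits -/

namespace SymmFun

section
variable {N K : FinSet} (p : Surj N K)

/-- The indexing categories of the factors of the term of a partition `p`: `none` labels the factor
of the outer functor and `some k` the one of the inner functor on the block of `k`. -/
def JoinIndex : Option K → Type
  | none => K → FinInj
  | some k => p.fib k → FinInj

instance : ∀ i, SmallCategory (JoinIndex p i)
  | none => inferInstanceAs (SmallCategory (K → FinInj))
  | some k => inferInstanceAs (SmallCategory (p.fib k → FinInj))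

/-- The loop diagrams of the factors of the term of a partition. -/
noncomputable def joinDiagrams (G F : SymmFun) : ∀ i, JoinIndex p i ⥤ PtdSpace
  | none => G.loopDiagram K
  | some k => F.loopDiagram (p.fib k)

theorem addMap_finSumFinEquiv {m m' n n' : FinInj} (f : m ⟶ m') (g : n ⟶ n')
    (i : Fin m.card ⊕ Fin n.card) :
    FinInj.addMap f g (finSumFinEquiv i) = finSumFinEquiv (Sum.map f g i) :=
  congrArg finSumFinEquiv (congrArg (Sum.map f g) (finSumFinEquiv.symm_apply_apply i))

/-- Functoriality of the tuples `W_n = U_{p(n)} ⊔ V_n`. -/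
def joinMap {U U' : K → FinInj} {V V' : ∀ k, p.fib k → FinInj} (φ : ∀ k, U k ⟶ U' k)
    (χ : ∀ k n, V k n ⟶ V' k n) (n : N) : joinSets p U V n ⟶ joinSets p U' V' n :=
  FinInj.addMap (φ (p n)) (χ (p n) ⟨n, rfl⟩)

theorem joinMap_joinEquiv {U U' : K → FinInj} {V V' : ∀ k, p.fib k → FinInj}
    (φ : ∀ k, U k ⟶ U' k) (χ : ∀ k n, V k n ⟶ V' k n) (k : K) (n : p.fib k)
    (i : Fin (U k).card ⊕ Fin (V k n).card) :
    joinMap p φ χ n.1 (joinEquiv p U V k n i) = joinEquiv p U' V' k n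
      (Sum.map (φ k) (χ k n) i) := by
  obtain ⟨n, rfl⟩ := n
  exact addMap_finSumFinEquiv _ _ i

/-- The reindexing along the disjoint union `W_n = U_{p(n)} ⊔ V_n`. -/
def joinFunctor : (∀ i, JoinIndex p i) ⥤ (N → FinInj) where
  obj c := joinSets p (c none) fun k => c (some k)
  map φ := joinMap p (φ none) fun k => φ (some k)
  map_id c := funext fun n => FinInj.addMap_id _ _
  map_comp φ χ := funext fun n => FinInj.addMap_comp _ _ _ _

theorem prodLoop_stab (G F : SymmFun) {U U' : K → FinInj} {V V' : ∀ k, p.fib k → FinInj}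
    (φ : ∀ k, U k ⟶ U' k) (χ : ∀ k n, V k n ⟶ V' k n) (f : G.loops U) (g : ∀ k, F.loops (V k)) :
    (comp G F).stab (joinMap p φ χ) (prodLoop p U V G F f g) =
      prodLoop p U' V' G F (G.stab φ f) fun k => F.stab (χ k) (g k) :=
  loops_ext_fin _ fun w => by
    rw [stab_apply, prodLoop_fin, prodLoop_fin, productValue_eq_joinValue,
      productValue_eq_joinValue]
    exact joinValue_stab p (joinEquiv p U V) G F (joinEquiv p U' V') φ χ _
      (joinMap_joinEquiv p φ χ) f g w

/-- The product of loops as a natural family of multipointed maps. -/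
noncomputable def joinMultiMap (G F : SymmFun) :
    Hocolim.MultiMap (joinDiagrams p G F) ((comp G F).loopDiagram N) (joinFunctor p) where
  app c x := prodLoop p (c none) (fun k => c (some k)) G F (x none) fun k => x (some k)
  natural φ x := prodLoop_stab p G F (φ none) (fun k => φ (some k)) (x none) fun k => x (some k)
  zero c x i h := prodLoop_pt p (c none) (fun k => c (some k)) G F (x none) (fun k => x (some k))
    <| by
    rcases i with _ | k
    · exact Or.inl h
    · exact Or.inr ⟨k, h⟩
  cont c T x := continuous_prodLoop p (c none) (fun k => c (some k)) G F T (x none)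
    fun k => x (some k)

/-- A tuple of points of the factors of the term of a partition. -/
def joinPoints (G F : SymmFun) (x : Hocolim (G.loopDiagram K))
    (y : ∀ k, Hocolim (F.loopDiagram (p.fib k))) : ∀ i, Hocolim (joinDiagrams p G F i)
  | none => x
  | some k => y k

/-- The product of points of the homotopy colimits. -/
noncomputable def prodPt (G F : SymmFun) (x : G.multilin.obj K)
    (y : ∀ k, F.multilin.obj (p.fib k)) :
    (comp G F).multilin.obj N :=
  (joinMultiMap p G F).prod (joinPoints p G F x y)

/-- A tuple of chains for the factors of the term of a partition. -/
def joinChains (G F : SymmFun) {n : ℕ} (σ : Hocolim.ChainPt (G.loopDiagram K) n)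
    (τ : ∀ k, Hocolim.ChainPt (F.loopDiagram (p.fib k)) n) :
    ∀ i, Hocolim.ChainPt (joinDiagrams p G F i) n
  | none => σ
  | some k => τ k

/-- The product of points presented by chains with the same barycentric coordinates is presented by
the chain of the disjoint unions and the product of the loops. -/
theorem prodPt_mk (G F : SymmFun) {n : ℕ} (t : stdSimplex ℝ (Fin (n + 1)))
    (σ : ComposableArrows (K → FinInj) n) (τ : ∀ k, ComposableArrows (p.fib k → FinInj) n)
    (f : G.loops (σ.obj 0)) (g : ∀ k, F.loops ((τ k).obj 0)) :
    prodPt p G F (Hocolim.mk (X := G.loopDiagram K) σ t f)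
        (fun k => Hocolim.mk (X := F.loopDiagram (p.fib k)) (τ k) t (g k)) =
      Hocolim.mk (X := (comp G F).loopDiagram N) (joinChain p σ τ) t
        (prodLoop p (σ.obj 0) (fun k => (τ k).obj 0) G F f g) := by
  refine Eq.trans ?_ ((joinMultiMap p G F).prod_mk t
    (joinChains p G F ⟨σ, f⟩ fun k => ⟨τ k, g k⟩))
  refine congrArg (joinMultiMap p G F).prod (funext fun i => ?_)
  rcases i with _ | k <;> rfl

theorem prodPt_pt_left (G F : SymmFun) (y : ∀ k, F.multilin.obj (p.fib k)) :
    prodPt p G F (G.multilin.obj K).pt y = ((comp G F).multilin.obj N).pt :=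
  (joinMultiMap p G F).prod_pt _ none rfl

theorem prodPt_pt_right (G F : SymmFun) (x : G.multilin.obj K)
    (y : ∀ k, F.multilin.obj (p.fib k)) (k : K) (h : y k = (F.multilin.obj (p.fib k)).pt) :
    prodPt p G F x y = ((comp G F).multilin.obj N).pt :=
  (joinMultiMap p G F).prod_pt _ (some k) h

theorem continuous_prodPt (G F : SymmFun) (T : CompHaus.{0}) (x : C(cptHaus T, G.multilin.obj K))
    (y : ∀ k, C(cptHaus T, F.multilin.obj (p.fib k))) :
    Continuous fun a => prodPt p G F (x a) fun k => y k a := by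
  refine ((joinMultiMap p G F).continuous_prod T (fun i => match i with
    | none => x
    | some k => y k)).congr fun a => ?_
  refine congrArg (joinMultiMap p G F).prod (funext fun i => ?_)
  rcases i with _ | k <;> rfl

end

end SymmFun

/-! ### Common presentations of points of homotopy colimits -/

/-- Finitely many conditions on chains that are stable under degeneration, and each of which holds
for some chain, hold for chains of the same length with the same barycentric coordinates. -/
theorem Hocolim.exists_common_of_pull {ι : Type} [Finite ι]
    (P : ι → ∀ m, stdSimplex ℝ (Fin (m + 1)) → Prop)
    (hP : ∀ i m n (θ : Fin (m + 1) →o Fin (n + 1)) (u : stdSimplex ℝ (Fin (m + 1))),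
      P i n (stdSimplex.map θ u) → P i m u) (h : ∀ i, ∃ n t, P i n t) :
    ∃ m u, ∀ i, P i m u := by
  classical
  have := Fintype.ofFinite ι
  choose n t h using h
  obtain ⟨s, c, w, -, hw⟩ := Coupling.exists_common t
  refine ⟨s, w, fun i => hP i s (n i) ((Pi.evalOrderHom i).comp c) w ?_⟩
  have h' : stdSimplex.map ((Pi.evalOrderHom i).comp c) w = t i := hw i
  rw [h']
  exact h i

/-- Every point except possibly the base point is presented by a chain. -/
theorem Hocolim.exists_hasChain {C : Type} [SmallCategory C] {X : C ⥤ PtdSpace} {y : Hocolim X}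
    (h : y ≠ (Hocolim X).pt) :
    ∃ (n : ℕ) (t : stdSimplex ℝ (Fin (n + 1))), HasChain y t := by
  obtain ⟨n, σ, t, x, h⟩ := (Hocolim.cases y).resolve_left h
  exact ⟨n, t, σ, x, h⟩

/-- Finitely many points, none of them the base point, are presented by chains with the same
barycentric coordinates. -/
theorem Hocolim.exists_common {ι : Type} [Finite ι] {C : ι → Type} [∀ i, SmallCategory (C i)]
    {X : ∀ i, C i ⥤ PtdSpace} (y : ∀ i, Hocolim (X i)) :
    (∃ i, y i = (Hocolim (X i)).pt) ∨
      ∃ (m : ℕ) (u : stdSimplex ℝ (Fin (m + 1))), ∀ i, HasChain (y i) u := by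
  by_cases hpt : ∃ i, y i = (Hocolim (X i)).pt
  · exact Or.inl hpt
  · refine Or.inr (exists_common_of_pull (fun i m u => HasChain (y i) u)
      (fun i m n θ u h => h.pull θ) fun i =>
      exists_hasChain fun h => hpt ⟨i, h⟩)

namespace SymmFun

/-- A point of the factors of a term either has the base point as an entry, or is presented by
chains with the same barycentric coordinates. -/
theorem prodPt_cases {N K : FinSet} (p : Surj N K) (G F : SymmFun) (x : G.multilin.obj K)
    (y : ∀ k, F.multilin.obj (p.fib k)) :
    (x = (G.multilin.obj K).pt ∨ ∃ k, y k = (F.multilin.obj (p.fib k)).pt) ∨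
    ∃ (n : ℕ) (t : stdSimplex ℝ (Fin (n + 1))) (σ : ComposableArrows (K → FinInj) n)
      (τ : ∀ k, ComposableArrows (p.fib k → FinInj) n) (f : G.loops (σ.obj 0))
      (g : ∀ k, F.loops ((τ k).obj 0)), x = Hocolim.mk (X := G.loopDiagram K) σ t f ∧
        y = fun k => Hocolim.mk (X := F.loopDiagram (p.fib k)) (τ k) t (g k) := by
  rcases Hocolim.exists_common (joinPoints p G F x y) with ⟨_ | k, h⟩ | ⟨n, t, h⟩
  · exact Or.inl (Or.inl h)
  · exact Or.inl (Or.inr ⟨k, h⟩)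
  · obtain ⟨σ, f, hx⟩ := h none
    choose τ g hy using fun k => h (some k)
    exact Or.inr ⟨n, t, σ, τ, f, g, hx, funext hy⟩

/-! ### The naturality of the product maps -/

section square
variable {N K N' : FinSet} (p : Surj N K) (e : N' ≃ N)

/-- The pullback of a partition along a bijection, with the set of blocks as set of labels. -/
def pullSurj : Surj N' (FinSet.quot (Setoid.ker (p.precomp e))) :=
  FinSet.proj (Setoid.ker (p.precomp e))

/-- The labels of a pulled back partition. -/
noncomputable def pullEquiv : FinSet.quot (Setoid.ker (p.precomp e)) ≃ K := (p.precomp e).kerEquiv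

/-- The blocks of a pulled back partition. -/
noncomputable def pullFib (k) : (pullSurj p e).fib k ≃ p.fib (pullEquiv p e k) :=
  Surj.fibEquiv (pullSurj p e) p e (pullEquiv p e) (fun _ => rfl) k

/-- The product of loops for a pulled back partition. -/
theorem prodLoop_perm (G F : SymmFun) {U : K → FinInj} {V : ∀ k, p.fib k → FinInj} (f : G.loops U)
    (g : ∀ k, F.loops (V k)) :
    (comp G F).permLoops e (joinSets p U V) (prodLoop p U V G F f g) =
      prodLoop (pullSurj p e) (fun k => U (pullEquiv p e k))
        (fun k n => V (pullEquiv p e k) (pullFib p e k n)) G F (G.permLoops (pullEquiv p e) U f)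
        fun k => F.permLoops (pullFib p e k) (V (pullEquiv p e k)) (g (pullEquiv p e k)) :=
  loops_ext_fin _ fun w => by
    obtain ⟨w, rfl⟩ : ∃ w', w = fun a => w' ⟨e a.1, a.2⟩ :=
      ⟨fun a => w ((Equiv.sigmaCongrLeft (β := fun n => Fin (joinSets p U V n).card) e).symm a),
        funext fun a => congrArg w ((Equiv.sigmaCongrLeft
          (β := fun n => Fin (joinSets p U V n).card) e).symm_apply_apply a).symm⟩
    refine (permLoops_apply_comp (comp G F) e (prodLoop p U V G F f g) w).trans ?_
    rw [prodLoop_fin, productValue_eq_joinValue]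
    refine (joinValue_square p (joinEquiv p U V) G F (pullSurj p e) e (pullEquiv p e)
      (fun _ => rfl) f g w).trans (Eq.trans ?_ (prodLoop_fin (pullSurj p e)
        (fun k => U (pullEquiv p e k)) (fun k n => V (pullEquiv p e k) (pullFib p e k n)) G F
          _ _ _).symm)
    have hc : (fun k n => joinEquiv p U V (pullEquiv p e k) (pullFib p e k n)) =
        joinEquiv (pullSurj p e) (fun k => U (pullEquiv p e k))
          (fun k n => V (pullEquiv p e k) (pullFib p e k n)) :=
      funext fun k => funext fun n => by obtain ⟨n, rfl⟩ := n; rfl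
    exact congrArg (fun c => joinValue (pullSurj p e) (U := fun k => U (pullEquiv p e k))
      (V := fun k n => V (pullEquiv p e k) (pullFib p e k n)) (W := fun n => joinSets p U V (e n))
      c G F (G.permLoops (pullEquiv p e) U f)
      (fun k => F.permLoops (pullFib p e k) (V (pullEquiv p e k)) (g (pullEquiv p e k)))
      fun a => w ⟨e a.1, a.2⟩) hc

theorem multilin_map_pt (F : SymmFun) {N M : FinSet} (e : N ≃ M) :
    F.multilin.map (X := N) (Y := M) e (F.multilin.obj N).pt = (F.multilin.obj M).pt :=
  PtdSpace.Hom.map_pt _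

/-- Compatibility of the products of points with bijections of the finite set. -/
theorem prodPt_map (G F : SymmFun) (x : G.multilin.obj K) (y : ∀ k, F.multilin.obj (p.fib k)) :
    (comp G F).multilin.map (X := N) (Y := N') e.symm (prodPt p G F x y) =
      prodPt (pullSurj p e) G F
        (G.multilin.map (X := K) (Y := FinSet.quot (Setoid.ker (p.precomp e)))
          (pullEquiv p e).symm x)
        fun k => F.multilin.map (X := p.fib (pullEquiv p e k)) (Y := (pullSurj p e).fib k)
          (pullFib p e k).symm (y (pullEquiv p e k)) := by
  rcases prodPt_cases p G F x y with (rfl | ⟨k, h⟩) | ⟨n, t, σ, τ, f, g, rfl, rfl⟩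
  · rw [prodPt_pt_left, multilin_map_pt, multilin_map_pt, prodPt_pt_left]
  · obtain ⟨k, rfl⟩ := (pullEquiv p e).surjective k
    rw [prodPt_pt_right p G F x y _ h, multilin_map_pt]
    refine (prodPt_pt_right (pullSurj p e) G F _ _ k ?_).symm
    rw [h, multilin_map_pt]
  · rw [prodPt_mk]
    refine Eq.trans ?_ (prodPt_mk (pullSurj p e) G F t (σ ⋙ relabelSets (pullEquiv p e))
      (fun k => τ (pullEquiv p e k) ⋙ relabelSets (pullFib p e k))
      (G.permLoops (pullEquiv p e) (σ.obj 0) f)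
      fun k => F.permLoops (pullFib p e k) ((τ (pullEquiv p e k)).obj 0)
        (g (pullEquiv p e k))).symm
    exact congrArg (Hocolim.mk (X := (comp G F).loopDiagram N')
      (joinChain p σ τ ⋙ relabelSets e) t) (prodLoop_perm p e G F f g)

end square

/-- The composition of morphisms of functor sequences. -/
def compMap {G G' F F' : SymmFun} (η : G ⟶ G') (θ : F ⟶ F') : comp G F ⟶ comp G' F' :=
  SymmFunctor.compHom η θ

theorem prodLoop_hom {G G' F F' : SymmFun} (η : G ⟶ G') (θ : F ⟶ F') {N K : FinSet}
    (p : Surj N K) {U : K → FinInj} {V : ∀ k, p.fib k → FinInj} (f : G.loops U)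
    (g : ∀ k, F.loops (V k)) :
    loopsMap (compMap η θ) (joinSets p U V) (prodLoop p U V G F f g) =
      prodLoop p U V G' F' (loopsMap η U f) fun k => loopsMap θ (V k) (g k) :=
  loops_ext_fin _ fun w => by
    rw [loopsMap_apply, prodLoop_fin, prodLoop_fin, productValue_eq_joinValue,
      productValue_eq_joinValue]
    exact joinValue_hom p (joinEquiv p U V) η θ f g w

/-- The action of a morphism of functor sequences on the multilinearizations. -/
noncomputable def multilinHom {F F' : SymmFun} (η : F ⟶ F') : F.multilin ⟶ F'.multilin :=
  multilinFunctor.map η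

theorem multilinHom_pt {F F' : SymmFun} (η : F ⟶ F') (N : FinSet) :
    (multilinHom η).app N (F.multilin.obj N).pt = (F'.multilin.obj N).pt := PtdSpace.Hom.map_pt _

theorem multilinHom_mk {F F' : SymmFun} (η : F ⟶ F') {N : FinSet} {n : ℕ}
    (σ : ComposableArrows (N → FinInj) n) (t : stdSimplex ℝ (Fin (n + 1)))
    (f : F.loops (σ.obj 0)) :
    (multilinHom η).app N (Hocolim.mk (X := F.loopDiagram N) σ t f) =
      Hocolim.mk (X := F'.loopDiagram N) σ t (loopsMap η (σ.obj 0) f) := rfl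

/-- Naturality of the products of points in both functor sequences. -/
theorem prodPt_hom {G G' F F' : SymmFun} (η : G ⟶ G') (θ : F ⟶ F') {N K : FinSet} (p : Surj N K)
    (x : G.multilin.obj K) (y : ∀ k, F.multilin.obj (p.fib k)) :
    (multilinHom (compMap η θ)).app N (prodPt p G F x y) =
      prodPt p G' F' ((multilinHom η).app K x) fun k => (multilinHom θ).app (p.fib k) (y k) := by
  rcases prodPt_cases p G F x y with (rfl | ⟨k, h⟩) | ⟨n, t, σ, τ, f, g, rfl, rfl⟩
  · rw [prodPt_pt_left, multilinHom_pt, multilinHom_pt, prodPt_pt_left]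
  · rw [prodPt_pt_right p G F x y _ h, multilinHom_pt]
    refine (prodPt_pt_right p G' F' _ _ k ?_).symm
    rw [h, multilinHom_pt]
  · rw [prodPt_mk, multilinHom_mk]
    refine Eq.trans ?_ (prodPt_mk p G' F' t σ τ (loopsMap η _ f)
      fun k => loopsMap θ _ (g k)).symm
    exact congrArg (Hocolim.mk (X := (comp G' F').loopDiagram N) (joinChain p σ τ) t)
      (prodLoop_hom η θ p f g)

/-- The product map on a finite set. -/
noncomputable def muApp (G F : SymmFun) (N : FinSet) :
    (SymmSeq.comp G.multilin F.multilin).obj N ⟶ (comp G F).multilin.obj N :=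
  Wedge.desc (X := fun π : Setoid N => SymmSeq.smash (G.multilin.obj (FinSet.quot π)) fun q =>
      F.multilin.obj ((FinSet.proj π).fib q)) fun π =>
    SymmSeq.smash.desc (prodPt (FinSet.proj π) G F) (fun T a b => continuous_prodPt _ G F T a b)
      (prodPt_pt_left _ G F) fun a b k h => prodPt_pt_right _ G F a b k h

theorem compMk_pull (A B : SymmSeq) {N K N' : FinSet} (p : Surj N K) (e : N' ≃ N) (x : A.obj K)
    (y : ∀ k, B.obj (p.fib k)) :
    (SymmSeq.comp A B).map (X := N) (Y := N') e.symm (SymmSeq.compMk p x y) =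
      SymmSeq.compMk (pullSurj p e)
        (A.map (X := K) (Y := FinSet.quot (Setoid.ker (p.precomp e))) (pullEquiv p e).symm x)
        fun k => B.map (X := p.fib (pullEquiv p e k)) (Y := (pullSurj p e).fib k)
          (pullFib p e k).symm (y (pullEquiv p e k)) :=
  SymmSeq.compMk_square (A := A) (B := B) (pullSurj p e) p e (pullEquiv p e) (fun _ => rfl) x y

theorem muApp_compMk (G F : SymmFun) {N K : FinSet} (p : Surj N K) (x : G.multilin.obj K)
    (y : ∀ k, F.multilin.obj (p.fib k)) :
    muApp G F N (SymmSeq.compMk p x y) = prodPt p G F x y := by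
  have e₁ := (SymmSeq.map_refl_apply _ _).symm.trans
    (compMk_pull G.multilin F.multilin p (Equiv.refl N) x y)
  have e₂ := (SymmSeq.map_refl_apply _ _).symm.trans (prodPt_map p (Equiv.refl N) G F x y)
  rw [e₁, e₂]
  exact congrArg (muApp G F N) (SymmSeq.compMk_proj _ _ _)

theorem muApp_map (G F : SymmFun) {N N' : FinSet} (e : N' ≃ N) :
    (SymmSeq.comp G.multilin F.multilin).map (X := N) (Y := N') e.symm ≫ muApp G F N' =
      muApp G F N ≫ (comp G F).multilin.map (X := N) (Y := N') e.symm :=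
  SymmSeq.comp_hom_ext fun K p x y => by
    rw [PtdSpace.comp_apply, PtdSpace.comp_apply, compMk_pull, muApp_compMk, muApp_compMk,
      prodPt_map]

/-- The product map `D(G) ∘ D(F) ⟶ D(G ∘ F)` for the multilinearization `D`. -/
noncomputable def mu (G F : SymmFun) :
    SymmSeq.comp G.multilin F.multilin ⟶ (comp G F).multilin where
  app N := muApp G F N
  naturality N N' e := muApp_map G F (Equiv.symm e : N' ≃ N)

theorem mu_compMk (G F : SymmFun) {N K : FinSet} (p : Surj N K) (x : G.multilin.obj K)
    (y : ∀ k, F.multilin.obj (p.fib k)) :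
    (mu G F).app N (SymmSeq.compMk p x y) = prodPt p G F x y := muApp_compMk G F p x y

theorem isProductMap_mu (G F : SymmFun) : IsProductMap G F (mu G F) :=
  fun p n t σ τ f g => ⟨prodLoop p (σ.obj 0) (fun k => (τ k).obj 0) G F f g,
    prodLoop_fin p (σ.obj 0) (fun k => (τ k).obj 0) G F f g,
    (mu_compMk G F p _ _).trans (prodPt_mk p G F t σ τ f g)⟩

theorem mu_natural {G G' F F' : SymmFun} (η : G ⟶ G') (θ : F ⟶ F') :
    SymmSeq.compHom (multilinHom η) (multilinHom θ) ≫ mu G' F' =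
      mu G F ≫ multilinHom (compMap η θ) :=
  NatTrans.ext (funext fun N => SymmSeq.comp_hom_ext fun K p x y => by
    refine (congrArg ((mu G' F').app N) (SymmSeq.compMk_hom (multilinHom η)
      (multilinHom θ) p x y)).trans ((mu_compMk G' F' p _ _).trans ?_)
    refine (prodPt_hom η θ p x y).symm.trans ?_
    exact congrArg ((multilinHom (compMap η θ)).app N) (mu_compMk G F p x y).symm)

end SymmFun

/-! ### Loops of the unit and the unit map -/

namespace Sphere

/-- Smashing with a sphere without coordinates relabels the coordinates. -/
theorem join_eq_insert {A B C : Type} [IsEmpty A] (c : A ⊕ B ≃ C) (ψ : B ↪ C)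
    (h : ∀ b, ψ b = c (Sum.inr b)) (u : A → PosReal) (w : C → PosReal) :
    join c u = insert ψ fun i => (w i : Circ) :=
  hom_ext_fin fun y => by
    rw [join_fin, insert_fin]
    refine congrArg fin (funext fun i => ?_)
    obtain ⟨a | b, rfl⟩ := c.surjective i
    · exact isEmptyElim a
    · rw [Equiv.symm_apply_apply, ← h, ψ.injective.extend_apply, Sum.elim_inr]

end Sphere

namespace SymmFun

/-- The tuple of empty sets. -/
abbrev emptySets (N : FinSet) : N → FinInj := fun _ => ⟨0⟩

/-- The point of `id(S^0)` different from the base point, as a loop without loop coordinates. -/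
def unitLoop (N : FinSet) (hN : Subsingleton N) (n : N) : unit.loops (emptySets N) :=
  PtdSpace.mapSpace.ofHom (PQuot.desc
    (fun _ => Wedge.incl (fun i : {_n : N // Subsingleton N} => spheres (emptySets N) i.1) ⟨n, hN⟩
      (Sphere.fin fun a => Fin.elim0 a))
    continuous_const (fun _ _ h => h.elim) fun _ ⟨u, h⟩ => Fin.elim0 u.2)

theorem unitLoop_fin (N : FinSet) (hN : Subsingleton N) (n : N)
    (w : (Σ n, Fin (emptySets N n).card) → PosReal) :
    PtdSpace.mapSpace.toHom (unitLoop N hN n) (Sphere.fin w) =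
      Wedge.incl (fun i : {_n : N // Subsingleton N} => spheres (emptySets N) i.1) ⟨n, hN⟩
        (Sphere.fin fun a => Fin.elim0 a) := rfl

theorem unit_map_incl {N : FinSet} {X Y : N → PtdSpace} (f : ∀ n, X n ⟶ Y n) (n : N)
    (hN : Subsingleton N) (x : X n) :
    (unit.obj N).map f (Wedge.incl (fun i : {_n : N // Subsingleton N} => X i.1) ⟨n, hN⟩ x) =
      Wedge.incl (fun i : {_n : N // Subsingleton N} => Y i.1) ⟨n, hN⟩ (f n x) := rfl

/-- The product with the unit on the left. Without coordinates to be split, assembly is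
stabilization along an injection onto all coordinates. -/
theorem joinValue_unit_left (F : SymmFun) {N K : FinSet} (p : Surj N K) (hK : Subsingleton K)
    (k : K) {V : ∀ k, p.fib k → FinInj} {W : N → FinInj}
    (c : ∀ (k : K) (n : p.fib k), Fin (emptySets K k).card ⊕ Fin (V k n).card ≃ Fin (W n.1).card)
    (ψ : ∀ n, V k (p.onlyFib hK k n) ⟶ W n)
    (h : ∀ n b, ψ n b = c k (p.onlyFib hK k n) (Sum.inr b)) (g : ∀ k, F.loops (V k))
    (w : (Σ n, Fin (W n).card) → PosReal) :
    ((SymmFunctor.lamHom F.toSymmFunctor).app N).app (spheres W)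
        (joinValue p c unit F (unitLoop K hK k) g w) =
      PtdSpace.mapSpace.toHom (F.stab ψ (F.permLoops (p.onlyFib hK k) (V k) (g k)))
        (Sphere.fin w) := by
  have e₁ : joinValue p c unit F (unitLoop K hK k) g w =
      SymmFunctor.lamIncl F.toSymmFunctor p hK k (spheres W)
        (blockHom F (W := fun n : p.fib k => W n.1) (c k) (g k)
          (blockSimplex (W := fun n : p.fib k => W n.1) (c k) (blockRestr p w k))
          (Sphere.fin fun a => Fin.elim0 a)) := by
    unfold joinValue
    rw [unitLoop_fin]
    exact congrArg (incl unit F p (spheres W)) (unit_map_incl (N := K) (X := spheres (emptySets K))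
      (Y := fun k => (F.obj (p.fib k)).obj fun n => spheres W n.1) _ k hK _)
  rw [e₁]
  refine (SymmFunctor.lamHom_incl F.toSymmFunctor p hK k (spheres W) _).trans ?_
  rw [blockHom_apply, stab_apply]
  refine (SymmFunctor.perm_map_apply F.toSymmFunctor (p.onlyFib hK k) (X := spheres (V k))
    (Y := fun n => spheres W n.1) _ _).trans ?_
  have e₂ := permLoops_apply_comp F (p.onlyFib hK k) (g k) fun b => w ⟨b.1.1, c k b.1 (Sum.inr b.2)⟩
  have e₃ : (fun a : Σ n, Fin (V k (p.onlyFib hK k n)).card => w ⟨a.1, ψ a.1 a.2⟩) =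
      fun a => w ⟨a.1, c k (p.onlyFib hK k a.1) (Sum.inr a.2)⟩ :=
    funext fun a => congrArg (fun i => w ⟨a.1, i⟩) (h a.1 a.2)
  rw [e₃]
  refine Eq.trans ?_ (congrArg (PtdSpace.Hom.toFun ((F.obj N).map
    (X := fun n => spheres (V k) (p.onlyFib hK k n)) (Y := spheres W) _)) e₂).symm
  refine SymmFunctor.map_congr F.toSymmFunctor (X := fun n => spheres (V k) (p.onlyFib hK k n))
    (Y := spheres W) (fun n => ?_) _
  exact Sphere.join_eq_insert (A := Fin 0) (c k (p.onlyFib hK k n)) (FinInj.emb (ψ n)) (h n) _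
    fun b => w ⟨n, b⟩

/-- The product with units on the right. The blocks are points, so the open simplices are points and
polar coordinates are the identity. -/
theorem joinValue_unit_right (F : SymmFun) {N : FinSet} {U W : N → FinInj}
    (c : ∀ (k : N) (n : (Surj.id N).fib k),
      Fin (U k).card ⊕ Fin (emptySets ((Surj.id N).fib k) n).card ≃ Fin (W n.1).card)
    (ψ : ∀ n, U n ⟶ W n) (h : ∀ n a, ψ n a = c n ⟨n, rfl⟩ (Sum.inl a)) (f : F.loops U)
    (hs : ∀ k : N, Subsingleton ((Surj.id N).fib k)) (w : (Σ n, Fin (W n).card) → PosReal) :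
    joinValue (Surj.id N) c F unit f (fun k => unitLoop ((Surj.id N).fib k) (hs k) ⟨k, rfl⟩) w =
      SymmFunctor.rhoApp F.toSymmFunctor N (spheres W)
        (PtdSpace.mapSpace.toHom (F.stab ψ f) (Sphere.fin w)) := by
  rw [stab_apply]
  refine congrArg (incl F unit (Surj.id N) (spheres W)) ?_
  refine Eq.trans ?_ (SymmFunctor.map_map_apply F.toSymmFunctor (X := spheres U) (Y := spheres W)
    (Z := fun n => (SymmFunctor.unit.obj ((Surj.id N).fib n)).obj fun m => spheres W m.1) _ _
      _).symm
  have hsum : ∀ (k : N) (u : (Surj.id N).fib k → PosReal), posSum u = u ⟨k, rfl⟩ := fun k u =>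
    Subtype.ext (by
      change ∑ᶠ j, (u j : ℝ) = u ⟨k, rfl⟩
      exact @finsum_unique ℝ ((Surj.id N).fib k) _ ⟨⟨⟨k, rfl⟩⟩, fun a => (hs k).elim _ _⟩
        fun j => (u j : ℝ))
  have hw : (fun a : Σ k, Fin (U k).card => blockSum (W := fun n : (Surj.id N).fib a.1 => W n.1)
      (c a.1) (blockRestr (Surj.id N) w a.1) a.2) = fun a => w ⟨a.1, ψ a.1 a.2⟩ :=
    funext fun a => (hsum _ _).trans (congrArg (fun i => w ⟨a.1, i⟩) (h a.1 a.2).symm)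
  rw [hw]
  refine SymmFunctor.map_congr F.toSymmFunctor (X := spheres U)
    (Y := fun n => (SymmFunctor.unit.obj ((Surj.id N).fib n)).obj fun m => spheres W m.1)
    (fun n => Sphere.hom_ext_fin fun x => ?_) _
  refine (blockHom_apply unit (W := fun m : (Surj.id N).fib n => W m.1) (c n) _ _ x).trans ?_
  rw [unitLoop_fin]
  refine (unit_map_incl (N := (Surj.id N).fib n) (X := spheres (emptySets ((Surj.id N).fib n)))
    (Y := fun m => spheres W m.1) _ ⟨n, rfl⟩ (hs n) _).trans ?_
  refine congrArg (Wedge.incl (fun i : {_m : (Surj.id N).fib n // Subsingleton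
    ((Surj.id N).fib n)} =>
    spheres W i.1.1) ⟨⟨n, rfl⟩, hs n⟩) ?_
  refine (Sphere.join_fin _ _ _).trans (Eq.trans ?_ (Sphere.insert_fin (FinInj.emb (ψ n))
    (fun b => w ⟨n, b⟩) x).symm)
  refine congrArg Sphere.fin (funext fun i => ?_)
  obtain ⟨a | b, rfl⟩ := (c n ⟨n, rfl⟩).surjective i
  · rw [Equiv.symm_apply_apply, Sum.elim_inl, ← h]
    refine Eq.trans ?_ ((FinInj.emb (ψ n)).injective.extend_apply _ _ _).symm
    have : blockSum (W := fun m : (Surj.id N).fib n => W m.1) (c n) (blockRestr (Surj.id N) w n) a =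
      w ⟨n, ψ n a⟩ := congrFun hw ⟨n, a⟩
    rw [this]
    exact (congrArg (· * x a) (div_self' _)).trans (one_mul _)
  · exact Fin.elim0 b

/-- The unit map on a finite set: the inclusion of the loop `unitLoop`. -/
noncomputable def epsApp (N : FinSet) : SymmSeq.unit.obj N ⟶ unit.multilin.obj N :=
  PQuot.desc (fun u : {_u : Unit // Subsingleton N} =>
      Hocolim.mk (X := unit.loopDiagram N) (ComposableArrows.mk₀ (emptySets N))
        (stdSimplex.vertex 0) (unitLoop N u.2 (Classical.arbitrary N)))
    continuous_of_discreteTopology (fun _ _ h => h.elim) fun _ h => h.elim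

theorem epsApp_unitPoint {N : FinSet} (hN : Subsingleton N) (n : N) :
    epsApp N (SymmSeq.unitPoint hN) = Hocolim.mk (X := unit.loopDiagram N)
        (ComposableArrows.mk₀ (emptySets N)) (stdSimplex.vertex 0) (unitLoop N hN n) := by
  obtain rfl : n = Classical.arbitrary N := Subsingleton.elim _ _
  rfl

theorem permLoops_unitLoop {N N' : FinSet} (e : N' ≃ N) (hN : Subsingleton N)
    (hN' : Subsingleton N') (n : N') :
    unit.permLoops e (emptySets N) (unitLoop N hN (e n)) = unitLoop N' hN' n :=
  loops_ext_fin unit fun w => by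
    rw [permLoops_apply, unitLoop_fin]
    exact SymmFunctor.unit_perm_incl e (spheres (emptySets N)) n hN hN' _

/-- The unit map `id ⟶ D(id)` for the multilinearization `D`. -/
noncomputable def eps : SymmSeq.unit ⟶ unit.multilin where
  app N := epsApp N
  naturality N N' e := PQuot.hom_ext fun ⟨u, hN⟩ => by
    have hN' : Subsingleton N' := (Equiv.symm e : N' ≃ N).subsingleton
    let n : N' := Classical.arbitrary N'
    refine (epsApp_unitPoint hN' n).trans (Eq.symm ?_)
    refine (congrArg (unit.multilin.map (X := N) (Y := N') e)
      (epsApp_unitPoint hN ((Equiv.symm e : N' ≃ N) n))).trans ?_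
    exact congrArg (Hocolim.mk (X := unit.loopDiagram N') (ComposableArrows.mk₀ (emptySets N'))
      (stdSimplex.vertex 0)) (permLoops_unitLoop (Equiv.symm e) hN hN' n)

theorem isUnitMap_eps : IsUnitMap eps := fun N hN n =>
  ⟨unitLoop N hN n, unitLoop_fin N hN n _, epsApp_unitPoint hN n⟩

end SymmFun

/-! ### Rebracketing of chains -/

/-- The bijection of finite sets of the same cardinality that preserves the order. -/
def FinInj.castHom {m n : FinInj} (h : m.card = n.card) : m ⟶ n := (finCongr h).toEmbedding

theorem FinInj.ext {m n : FinInj} (h : m.card = n.card) : m = n := congrArg FinInj.mk h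

namespace SymmFun

/-- Chains that agree up to casts of finite sets give the same points of the homotopy colimit. -/
theorem mk_congr (F : SymmFun) {N : FinSet} {n : ℕ} {σ σ' : ComposableArrows (N → FinInj) n}
    (hobj : ∀ i m, (σ.obj i m).card = (σ'.obj i m).card)
    (hmap : ∀ i j (f : i ⟶ j) m (a : Fin (σ.obj i m).card),
      Fin.cast (hobj j m) (σ.map f m a) = σ'.map f m (Fin.cast (hobj i m) a))
    (t : stdSimplex ℝ (Fin (n + 1))) (x : F.loops (σ.obj 0)) :
    Hocolim.mk (X := F.loopDiagram N) σ t x = Hocolim.mk (X := F.loopDiagram N) σ' t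
      (F.stab (fun m => FinInj.castHom (hobj 0 m)) x) := by
  obtain ⟨obj, map, h₁, h₂⟩ := σ
  obtain ⟨obj', map', h₁', h₂'⟩ := σ'
  obtain rfl : obj = obj' := funext fun i => funext fun m => FinInj.ext (hobj i m)
  obtain rfl : @map = @map' := by
    funext i j f m
    exact Function.Embedding.ext fun a => hmap i j f m a
  exact congrArg (Hocolim.mk (X := F.loopDiagram N) _ t)
    (congrArg (fun k => PtdSpace.Hom.toFun k x) ((F.loopDiagram N).map_id (obj 0))).symm

theorem stab_id (F : SymmFun) {N : FinSet} {U : N → FinInj} (f : F.loops U) :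
    F.stab (fun n => 𝟙 (U n)) f = f :=
  congrArg (fun k => PtdSpace.Hom.toFun k f) ((F.loopDiagram N).map_id U)

/-- The chain that is constant at the tuple of empty sets. -/
def emptyChain (N : FinSet) (n : ℕ) : ComposableArrows (N → FinInj) n :=
  (Functor.const _).obj (emptySets N)

/-- The unit point is presented by constant chains of every length and by all barycentric
coordinates. -/
theorem epsApp_unitPoint_eq {N : FinSet} (hN : Subsingleton N) (m : N) {n : ℕ}
    (t : stdSimplex ℝ (Fin (n + 1))) :
    epsApp N (SymmSeq.unitPoint hN) =
      Hocolim.mk (X := unit.loopDiagram N) (emptyChain N n) t (unitLoop N hN m) := by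
  rw [epsApp_unitPoint hN m]
  have h := Hocolim.mk_pull (X := unit.loopDiagram N) (OrderHom.const (Fin (n + 1)) (0 : Fin 1))
    ⟨ComposableArrows.mk₀ (emptySets N), unitLoop N hN m⟩ t
  have e : stdSimplex.map (OrderHom.const (Fin (n + 1)) (0 : Fin 1)) t =
    (stdSimplex.vertex 0 : stdSimplex ℝ (Fin 1)) := Subsingleton.elim _ _
  rw [e] at h
  refine h.symm.trans ?_
  exact congrArg (Hocolim.mk (X := unit.loopDiagram N) (emptyChain N n) t)
    (stab_id unit (unitLoop N hN m))

/-! ### Unitality of the products -/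

/-- The left unit map of the composition of functor sequences. -/
def lamMap (F : SymmFun) : comp unit F ⟶ F := SymmFunctor.lamHom F.toSymmFunctor

/-- The right unit map of the composition of functor sequences. -/
noncomputable def rhoMap (F : SymmFun) : F ⟶ comp F unit := SymmFunctor.rhoHom F.toSymmFunctor

/-- The associativity map of the composition of functor sequences. -/
noncomputable def assocMap (H G F : SymmFun) : comp (comp H G) F ⟶ comp H (comp G F) :=
  SymmFunctor.assocHom H.toSymmFunctor G.toSymmFunctor F.toSymmFunctor

section left
variable {N K : FinSet} (p : Surj N K) (hK : Subsingleton K) (k : K)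

theorem card_unit_left (V : ∀ k, p.fib k → FinInj) (n : N) :
    (V k (p.onlyFib hK k n)).card = (joinSets p (emptySets K) V n).card := by
  obtain rfl : p n = k := hK.elim _ _
  exact (Nat.zero_add _).symm

theorem cast_unit_left (V : ∀ k, p.fib k → FinInj) (n : N)
    (b : Fin (V k (p.onlyFib hK k n)).card) :
    Fin.cast (card_unit_left p hK k V n) b =
      joinEquiv p (emptySets K) V k (p.onlyFib hK k n) (Sum.inr b) := by
  obtain rfl : p n = k := hK.elim _ _
  exact Fin.ext (Nat.zero_add _).symm

/-- The left unit axiom for loops. -/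
theorem prodLoop_unit_left (F : SymmFun) {V : ∀ k, p.fib k → FinInj} (g : ∀ k, F.loops (V k)) :
    loopsMap (lamMap F) (joinSets p (emptySets K) V)
        (prodLoop p (emptySets K) V unit F (unitLoop K hK k) g) =
      F.stab (fun n => FinInj.castHom (card_unit_left p hK k V n))
        (F.permLoops (p.onlyFib hK k) (V k) (g k)) :=
  loops_ext_fin F fun w => by
    rw [loopsMap_apply, prodLoop_fin, productValue_eq_joinValue]
    exact joinValue_unit_left F p hK k (joinEquiv p (emptySets K) V)
      (fun n => FinInj.castHom (card_unit_left p hK k V n))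
      (fun n b => cast_unit_left p hK k V n b) g w

/-- The left unit axiom for points of the homotopy colimits. -/
theorem prodPt_unit_left (F : SymmFun) (y : ∀ k, F.multilin.obj (p.fib k)) :
    (multilinHom (lamMap F)).app N
        (prodPt p unit F (epsApp K (SymmSeq.unitPoint hK)) y) =
      F.multilin.map (X := p.fib k) (Y := N) (p.onlyFib hK k).symm (y k) := by
  rcases Hocolim.exists_common (X := fun k => F.loopDiagram (p.fib k)) y with ⟨k', h⟩ | ⟨n, t, h⟩
  · obtain rfl : k = k' := hK.elim _ _
    rw [prodPt_pt_right p unit F _ y k h, multilinHom_pt]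
    exact ((congrArg (F.multilin.map (X := p.fib k) (Y := N) (p.onlyFib hK k).symm) h).trans
      (multilin_map_pt F _)).symm
  · choose τ g hy using h
    obtain rfl : y = fun k => Hocolim.mk (X := F.loopDiagram (p.fib k)) (τ k) t (g k) := funext hy
    rw [epsApp_unitPoint_eq hK k t]
    refine (congrArg ((multilinHom (lamMap F)).app N)
        (prodPt_mk p unit F t (emptyChain K n) τ (unitLoop K hK k) g)).trans ?_
    refine (multilinHom_mk (lamMap F) (joinChain p (emptyChain K n) τ) t _).trans ?_
    refine Eq.trans ?_ (mk_congr F (σ := τ k ⋙ relabelSets (p.onlyFib hK k))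
      (σ' := joinChain p (emptyChain K n) τ)
      (fun i m => card_unit_left p hK k (fun k => (τ k).obj i) m) (fun i j f m a => ?_) t
      (F.permLoops (p.onlyFib hK k) ((τ k).obj 0) (g k))).symm
    · exact congrArg (Hocolim.mk (X := F.loopDiagram N) (joinChain p (emptyChain K n) τ) t)
        (prodLoop_unit_left p hK k F fun k => g k)
    · have e₁ := cast_unit_left p hK k (fun k => (τ k).obj i) m a
      have e₂ := cast_unit_left p hK k (fun k => (τ k).obj j) m ((τ k).map f (p.onlyFib hK k m) a)
      refine e₂.trans (Eq.trans ?_ (congrArg ((joinChain p (emptyChain K n) τ).map f m) e₁).symm)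
      exact (joinMap_joinEquiv p (U := emptySets K) (U' := emptySets K) (fun _ => 𝟙 _)
        (fun k => (τ k).map f) k (p.onlyFib hK k m) (Sum.inr a)).symm

end left

/-- The right unit axiom for loops. -/
theorem prodLoop_unit_right (F : SymmFun) {N : FinSet} {U : N → FinInj} (f : F.loops U)
    (hs : ∀ k : N, Subsingleton ((Surj.id N).fib k)) :
    prodLoop (Surj.id N) U (fun k => emptySets ((Surj.id N).fib k)) F unit f
        (fun k => unitLoop ((Surj.id N).fib k) (hs k) ⟨k, rfl⟩) =
      loopsMap (rhoMap F) (joinSets (Surj.id N) U fun k => emptySets ((Surj.id N).fib k))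
        (F.stab (U' := joinSets (Surj.id N) U fun k => emptySets ((Surj.id N).fib k))
          (fun n => FinInj.castHom (Nat.add_zero _).symm) f) :=
  loops_ext_fin (comp F unit) fun w => by
    rw [prodLoop_fin, productValue_eq_joinValue, loopsMap_apply]
    exact joinValue_unit_right F (joinEquiv (Surj.id N) U
      fun k => emptySets ((Surj.id N).fib k)) _ (fun n a => rfl) f hs w

/-- The right unit axiom for points of the homotopy colimits. -/
theorem prodPt_unit_right (F : SymmFun) {N : FinSet} (x : F.multilin.obj N) :
    prodPt (Surj.id N) F unit x (fun n => epsApp ((Surj.id N).fib n)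
        (SymmSeq.unitPoint ((Surj.id N).fib_subsingleton (fun _ _ h => h) n))) =
      (multilinHom (rhoMap F)).app N x := by
  rcases Hocolim.cases (X := F.loopDiagram N) x with rfl | ⟨n, σ, t, f, rfl⟩
  · exact (prodPt_pt_left (Surj.id N) F unit _).trans
      (multilinHom_pt (rhoMap F) N).symm
  · have hs := (Surj.id N).fib_subsingleton (fun _ _ h => h)
    have he : (fun n => epsApp ((Surj.id N).fib n) (SymmSeq.unitPoint (hs n))) = fun k =>
        Hocolim.mk (X := unit.loopDiagram ((Surj.id N).fib k)) (emptyChain ((Surj.id N).fib k) n) t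
          (unitLoop ((Surj.id N).fib k) (hs k) ⟨k, rfl⟩) :=
      funext fun k => epsApp_unitPoint_eq (hs k) ⟨k, rfl⟩ t
    refine (congrArg (prodPt (Surj.id N) F unit _) he).trans ((prodPt_mk (Surj.id N) F unit t σ
      (fun k => emptyChain ((Surj.id N).fib k) n) f
      fun k => unitLoop ((Surj.id N).fib k) (hs k) ⟨k, rfl⟩).trans ?_)
    have hσ := mk_congr F (σ := σ)
      (σ' := joinChain (Surj.id N) σ fun k => emptyChain ((Surj.id N).fib k) n)
      (fun i m => (Nat.add_zero _).symm) (fun i j g m a => ?_) t f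
    · refine Eq.trans ?_ (congrArg ((multilinHom (rhoMap F)).app N) hσ).symm
      exact congrArg (Hocolim.mk (X := (comp F unit).loopDiagram N)
        (joinChain (Surj.id N) σ fun k => emptyChain ((Surj.id N).fib k) n) t)
        (prodLoop_unit_right F f hs)
    · exact (joinMap_joinEquiv (Surj.id N) (U := σ.obj i) (U' := σ.obj j)
        (V := fun k => emptySets ((Surj.id N).fib k)) (V' := fun k => emptySets ((Surj.id N).fib k))
        (σ.map g) (fun _ _ => 𝟙 _) m ⟨m, rfl⟩ (Sum.inl a)).symm

/-! ### Associativity of the products -/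

section assoc
variable {N K L : FinSet} (p : Surj N K) (q : Surj K L)

/-- The sets `(U ⊔ V) ⊔ Z` and `U ⊔ (V ⊔ Z)` have the same cardinality. In the skeleton of the
category of finite sets, the rebracketing is the cast along this equality. -/
theorem card_assoc (U : L → FinInj) (V : ∀ l, q.fib l → FinInj) (Z : ∀ k, p.fib k → FinInj)
    (n : N) : (joinSets p (joinSets q U V) Z n).card =
      (joinSets (p.comp q) U (fun l => joinSets (p.restr q l) (V l)
        fun k m => Z k.1 (p.restrFib q l k m)) n).card :=
  Nat.add_assoc _ _ _

/-- The rebracketing on the summand `U`. -/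
theorem cast_assoc_outer (U : L → FinInj) (V : ∀ l, q.fib l → FinInj)
    (Z : ∀ k, p.fib k → FinInj) (l : L) (k : q.fib l) (n : (p.restr q l).fib k)
    (a : Fin (U l).card) :
    Fin.cast (card_assoc p q U V Z n.1.1) (joinEquiv p (joinSets q U V) Z k.1
        (p.restrFib q l k n) (Sum.inl (joinEquiv q U V l k (Sum.inl a)))) =
      joinEquiv (p.comp q) U (fun l => joinSets (p.restr q l) (V l)
        fun k m => Z k.1 (p.restrFib q l k m)) l n.1 (Sum.inl a) := by
  obtain ⟨⟨n, rfl⟩, rfl⟩ := n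
  rfl

/-- The rebracketing on the summand `V`. -/
theorem cast_assoc_middle (U : L → FinInj) (V : ∀ l, q.fib l → FinInj)
    (Z : ∀ k, p.fib k → FinInj) (l : L) (k : q.fib l) (n : (p.restr q l).fib k)
    (b : Fin (V l k).card) :
    Fin.cast (card_assoc p q U V Z n.1.1) (joinEquiv p (joinSets q U V) Z k.1
        (p.restrFib q l k n) (Sum.inl (joinEquiv q U V l k (Sum.inr b)))) =
      joinEquiv (p.comp q) U (fun l => joinSets (p.restr q l) (V l)
        fun k m => Z k.1 (p.restrFib q l k m)) l n.1 (Sum.inr (joinEquiv (p.restr q l) (V l)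
          (fun k m => Z k.1 (p.restrFib q l k m)) k n (Sum.inl b))) := by
  obtain ⟨⟨n, rfl⟩, rfl⟩ := n
  rfl

/-- The rebracketing on the summand `Z`. -/
theorem cast_assoc_inner (U : L → FinInj) (V : ∀ l, q.fib l → FinInj)
    (Z : ∀ k, p.fib k → FinInj) (l : L) (k : q.fib l) (n : (p.restr q l).fib k)
    (z : Fin (Z k.1 (p.restrFib q l k n)).card) :
    Fin.cast (card_assoc p q U V Z n.1.1) (joinEquiv p (joinSets q U V) Z k.1
        (p.restrFib q l k n) (Sum.inr z)) =
      joinEquiv (p.comp q) U (fun l => joinSets (p.restr q l) (V l)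
        fun k m => Z k.1 (p.restrFib q l k m)) l n.1 (Sum.inr (joinEquiv (p.restr q l) (V l)
          (fun k m => Z k.1 (p.restrFib q l k m)) k n (Sum.inr z))) := by
  obtain ⟨⟨n, rfl⟩, rfl⟩ := n
  exact Fin.ext (Nat.add_assoc _ _ _)

/-- The rebracketing is natural in injections. -/
theorem joinMap_assoc {U U' : L → FinInj} {V V' : ∀ l, q.fib l → FinInj}
    {Z Z' : ∀ k, p.fib k → FinInj} (φ : ∀ l, U l ⟶ U' l) (χ : ∀ l k, V l k ⟶ V' l k)
    (ζ : ∀ k n, Z k n ⟶ Z' k n) (n : N) (a : Fin (joinSets p (joinSets q U V) Z n).card) :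
    Fin.cast (card_assoc p q U' V' Z' n) (joinMap p (joinMap q φ χ) ζ n a) =
      joinMap (p.comp q) φ (fun l => joinMap (p.restr q l) (χ l)
        fun k m => ζ k.1 (p.restrFib q l k m)) n (Fin.cast (card_assoc p q U V Z n) a) := by
  let l : L := q (p n)
  let k : q.fib l := ⟨p n, rfl⟩
  let m : (p.restr q l).fib k := ⟨⟨n, rfl⟩, rfl⟩
  have e := fun i => joinMap_joinEquiv p (joinMap q φ χ) ζ (p n) ⟨n, rfl⟩ i
  have e' := fun i => joinMap_joinEquiv (p.comp q) φ (fun l => joinMap (p.restr q l) (χ l)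
        fun k m => ζ k.1 (p.restrFib q l k m)) l ⟨n, rfl⟩ i
  obtain ⟨a | z, rfl⟩ := (joinEquiv p (joinSets q U V) Z (p n) ⟨n, rfl⟩).surjective a
  · obtain ⟨a | b, rfl⟩ := (joinEquiv q U V l k).surjective a
    · refine (congrArg (Fin.cast (card_assoc p q U' V' Z' n)) ((e
        (Sum.inl (joinEquiv q U V l k (Sum.inl a)))).trans (congrArg
          (fun i => joinEquiv p (joinSets q U' V') Z' (p n) ⟨n, rfl⟩ (Sum.inl i))
            (joinMap_joinEquiv q φ χ l k (Sum.inl a))))).trans ?_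
      refine (cast_assoc_outer p q U' V' Z' l k m (φ l a)).trans (Eq.symm ?_)
      exact (congrArg _ (cast_assoc_outer p q U V Z l k m a)).trans (e' _)
    · refine (congrArg (Fin.cast (card_assoc p q U' V' Z' n)) ((e
        (Sum.inl (joinEquiv q U V l k (Sum.inr b)))).trans (congrArg
          (fun i => joinEquiv p (joinSets q U' V') Z' (p n) ⟨n, rfl⟩ (Sum.inl i))
            (joinMap_joinEquiv q φ χ l k (Sum.inr b))))).trans ?_
      refine (cast_assoc_middle p q U' V' Z' l k m (χ l k b)).trans (Eq.symm ?_)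
      refine (congrArg _ (cast_assoc_middle p q U V Z l k m b)).trans ((e' _).trans ?_)
      exact congrArg (fun i => joinEquiv (p.comp q) U' _ l ⟨n, rfl⟩ (Sum.inr i))
        (joinMap_joinEquiv (p.restr q l) (χ l) (fun k m => ζ k.1 (p.restrFib q l k m)) k m _)
  · refine (congrArg (Fin.cast (card_assoc p q U' V' Z' n)) (e _)).trans ?_
    refine (cast_assoc_inner p q U' V' Z' l k m (ζ (p n) ⟨n, rfl⟩ z)).trans (Eq.symm ?_)
    refine (congrArg _ (cast_assoc_inner p q U V Z l k m z)).trans ((e' _).trans ?_)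
    exact congrArg (fun i => joinEquiv (p.comp q) U' _ l ⟨n, rfl⟩ (Sum.inr i))
      (joinMap_joinEquiv (p.restr q l) (χ l) (fun k m => ζ k.1 (p.restrFib q l k m)) k m _)

/-- Associativity of the product of loops. -/
theorem prodLoop_assoc (H G F : SymmFun) {U : L → FinInj} {V : ∀ l, q.fib l → FinInj}
    {Z : ∀ k, p.fib k → FinInj} (f : H.loops U) (g : ∀ l, G.loops (V l))
    (h : ∀ k, F.loops (Z k)) :
    loopsMap (assocMap H G F) _ ((comp (comp H G) F).stab
        (fun n => FinInj.castHom (card_assoc p q U V Z n))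
        (prodLoop p (joinSets q U V) Z (comp H G) F (prodLoop q U V H G f g) h)) =
      prodLoop (p.comp q) U (fun l => joinSets (p.restr q l) (V l)
          fun k m => Z k.1 (p.restrFib q l k m)) H (comp G F) f fun l =>
        prodLoop (p.restr q l) (V l) (fun k m => Z k.1 (p.restrFib q l k m)) G F (g l)
          fun k => F.permLoops (p.restrFib q l k) (Z k.1) (h k.1) :=
  loops_ext_fin _ fun w => by
    rw [loopsMap_apply, prodLoop_fin, productValue_eq_joinValue, stab_apply, prodLoop_fin,
      productValue_eq_joinValue]
    let c : ∀ (k : K) (n : p.fib k), Fin (joinSets q U V k).card ⊕ Fin (Z k n).card ≃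
        Fin (joinSets (p.comp q) U (fun l => joinSets (p.restr q l) (V l)
          fun k m => Z k.1 (p.restrFib q l k m)) n.1).card := fun k n =>
      (joinEquiv p (joinSets q U V) Z k n).trans (finCongr (card_assoc p q U V Z n.1))
    have hs := joinValue_stab p (joinEquiv p (joinSets q U V) Z) (comp H G) F c
      (fun k => 𝟙 _) (fun k n => 𝟙 _) (fun n => FinInj.castHom (card_assoc p q U V Z n))
      (fun k n i => by rcases i with i | i <;> rfl) (prodLoop q U V H G f g) h w
    rw [hs]
    simp only [stab_id]
    exact joinValue_assoc H G F p q (joinEquiv q U V) c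
      (fun l => joinEquiv (p.restr q l) (V l) fun k m => Z k.1 (p.restrFib q l k m))
      (joinEquiv (p.comp q) U fun l => joinSets (p.restr q l) (V l)
          fun k m => Z k.1 (p.restrFib q l k m))
      (cast_assoc_outer p q U V Z) (cast_assoc_middle p q U V Z) (cast_assoc_inner p q U V Z)
      f g h _ (prodLoop_fin q U V H G f g) _ (fun l => prodLoop_fin _ _ _ _ _ _ _) w

/-- Associativity of the products of points of the homotopy colimits. -/
theorem prodPt_assoc (H G F : SymmFun) (x : H.multilin.obj L) (y : ∀ l, G.multilin.obj (q.fib l))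
    (z : ∀ k, F.multilin.obj (p.fib k)) :
    (multilinHom (assocMap H G F)).app N (prodPt p (comp H G) F (prodPt q H G x y) z) =
      prodPt (p.comp q) H (comp G F) x fun l => prodPt (p.restr q l) G F (y l) fun k =>
        F.multilin.map (X := p.fib k.1) (Y := (p.restr q l).fib k) (p.restrFib q l k).symm
          (z k.1) := by
  by_cases hx : x = (H.multilin.obj L).pt
  · rw [hx, prodPt_pt_left, prodPt_pt_left, multilinHom_pt, prodPt_pt_left]
  by_cases hy : ∃ l, y l = (G.multilin.obj (q.fib l)).pt
  · obtain ⟨l, hl⟩ := hy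
    rw [prodPt_pt_right q H G x y l hl, prodPt_pt_left, multilinHom_pt]
    refine (prodPt_pt_right (p.comp q) H (comp G F) x _ l ?_).symm
    rw [hl, prodPt_pt_left]
  by_cases hz : ∃ k, z k = (F.multilin.obj (p.fib k)).pt
  · obtain ⟨k, hk⟩ := hz
    rw [prodPt_pt_right p (comp H G) F _ z k hk, multilinHom_pt]
    refine (prodPt_pt_right (p.comp q) H (comp G F) x _ (q k)
      (prodPt_pt_right (p.restr q (q k)) G F _ _ ⟨k, rfl⟩ ?_)).symm
    exact (congrArg _ hk).trans (multilin_map_pt F _)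
  -- All points are presented by chains with the same barycentric coordinates.
  obtain ⟨n, t, h⟩ := Hocolim.exists_common_of_pull (ι := Option (L ⊕ K))
    (fun i m u => match i with
      | none => Hocolim.HasChain (X := H.loopDiagram L) x u
      | some (Sum.inl l) => Hocolim.HasChain (X := G.loopDiagram (q.fib l)) (y l) u
      | some (Sum.inr k) => Hocolim.HasChain (X := F.loopDiagram (p.fib k)) (z k) u)
    (fun i m n θ u h => match i with
      | none => Hocolim.HasChain.pull (X := H.loopDiagram L) θ h
      | some (Sum.inl l) => Hocolim.HasChain.pull (X := G.loopDiagram (q.fib l)) θ h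
      | some (Sum.inr k) => Hocolim.HasChain.pull (X := F.loopDiagram (p.fib k)) θ h)
    (fun i => match i with
      | none => Hocolim.exists_hasChain (X := H.loopDiagram L) hx
      | some (Sum.inl l) => Hocolim.exists_hasChain (X := G.loopDiagram (q.fib l))
        fun h => hy ⟨l, h⟩
      | some (Sum.inr k) => Hocolim.exists_hasChain (X := F.loopDiagram (p.fib k))
        fun h => hz ⟨k, h⟩)
  obtain ⟨σ, f, rfl⟩ := h none
  choose τ g hg using fun l => h (some (Sum.inl l))
  choose ρ j hj using fun k => h (some (Sum.inr k))
  obtain rfl : y = fun l => Hocolim.mk (X := G.loopDiagram (q.fib l)) (τ l) t (g l) := funext hg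
  obtain rfl : z = fun k => Hocolim.mk (X := F.loopDiagram (p.fib k)) (ρ k) t (j k) := funext hj
  have e₁ := (congrArg (fun x => prodPt p (comp H G) F x
      fun k => Hocolim.mk (X := F.loopDiagram (p.fib k)) (ρ k) t (j k))
    (prodPt_mk q H G t σ τ f g)).trans (prodPt_mk p (comp H G) F t (joinChain q σ τ) ρ
      (prodLoop q (σ.obj 0) (fun l => (τ l).obj 0) H G f g) j)
  -- The chains of both sides agree up to the rebracketing of disjoint unions.
  have e₂ := mk_congr (comp (comp H G) F) (σ := joinChain p (joinChain q σ τ) ρ)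
    (σ' := joinChain (p.comp q) σ fun l => joinChain (p.restr q l) (τ l) fun k =>
      ρ k.1 ⋙ relabelSets (p.restrFib q l k))
    (fun i => card_assoc p q (σ.obj i) (fun l => (τ l).obj i) fun k => (ρ k).obj i)
    (fun i i' φ m a => joinMap_assoc p q (σ.map φ) (fun l => (τ l).map φ) (fun k => (ρ k).map φ) m
      a) t
    (prodLoop p (joinSets q (σ.obj 0) fun l => (τ l).obj 0) (fun k => (ρ k).obj 0) (comp H G) F
      (prodLoop q (σ.obj 0) (fun l => (τ l).obj 0) H G f g) j)
  have e₃ : ∀ l, prodPt (p.restr q l) G F (Hocolim.mk (X := G.loopDiagram (q.fib l)) (τ l) t (g l))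
      (fun k => F.multilin.map (X := p.fib k.1) (Y := (p.restr q l).fib k) (p.restrFib q l k).symm
        (Hocolim.mk (X := F.loopDiagram (p.fib k.1)) (ρ k.1) t (j k.1))) = _ := fun l =>
    prodPt_mk (p.restr q l) G F t (τ l) (fun k => ρ k.1 ⋙ relabelSets (p.restrFib q l k)) (g l)
      fun k => F.permLoops (p.restrFib q l k) ((ρ k.1).obj 0) (j k.1)
  refine (congrArg ((multilinHom (assocMap H G F)).app N) (e₁.trans e₂)).trans ?_
  refine (multilinHom_mk (assocMap H G F) _ t _).trans ?_
  refine Eq.trans ?_ ((congrArg (prodPt (p.comp q) H (comp G F)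
    (Hocolim.mk (X := H.loopDiagram L) σ t f)) (funext e₃)).trans
    (prodPt_mk (p.comp q) H (comp G F) t σ (fun l => joinChain (p.restr q l) (τ l) fun k =>
      ρ k.1 ⋙ relabelSets (p.restrFib q l k)) f _)).symm
  exact congrArg (Hocolim.mk (X := (comp H (comp G F)).loopDiagram N) _ t)
    (prodLoop_assoc p q H G F f g j)

end assoc

/-! ### The lax monoidal functor -/

theorem mu_associativity (H G F : SymmFun) :
    SymmSeq.compHom (mu H G) (𝟙 F.multilin) ≫ mu (comp H G) F ≫ multilinHom (assocMap H G F) =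
      SymmSeq.assocHom H.multilin G.multilin F.multilin ≫
        SymmSeq.compHom (𝟙 H.multilin) (mu G F) ≫ mu H (comp G F) :=
  NatTrans.ext (funext fun N => SymmSeq.comp_comp_hom_ext fun K L p q x y z => by
    have h₁ : (mu (comp H G) F).app N ((SymmSeq.compHom (mu H G) (𝟙 F.multilin)).app N
        (SymmSeq.compMk (A := SymmSeq.comp H.multilin G.multilin) p (SymmSeq.compMk q x y) z)) =
        prodPt p (comp H G) F (prodPt q H G x y) z :=
      (congrArg ((mu (comp H G) F).app N) (SymmSeq.compMk_hom (mu H G) (𝟙 F.multilin) p _ z)).trans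
        ((mu_compMk _ _ p _ _).trans (congrArg (fun x => prodPt p (comp H G) F x z)
          (mu_compMk H G q x y)))
    have h₂ : (SymmSeq.assocHom H.multilin G.multilin F.multilin).app N
        (SymmSeq.compMk (A := SymmSeq.comp H.multilin G.multilin) p (SymmSeq.compMk q x y) z) =
        SymmSeq.assocVal p q x y z := SymmSeq.assocApp_compMk p q x y z
    have h₃ : (mu H (comp G F)).app N ((SymmSeq.compHom (𝟙 H.multilin) (mu G F)).app N
        (SymmSeq.assocVal p q x y z)) = prodPt (p.comp q) H (comp G F) x fun l =>
          prodPt (p.restr q l) G F (y l) fun k =>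
            F.multilin.map (X := p.fib k.1) (Y := (p.restr q l).fib k) (p.restrFib q l k).symm
              (z k.1) :=
      (congrArg ((mu H (comp G F)).app N) (SymmSeq.compMk_hom (𝟙 H.multilin) (mu G F)
        (p.comp q) x _)).trans ((mu_compMk _ _ (p.comp q) _ _).trans
          (congrArg (prodPt (p.comp q) H (comp G F) x) (funext fun l => mu_compMk G F _ _ _)))
    have h₄ := (congrArg ((multilinHom (assocMap H G F)).app N) h₁).trans
      (prodPt_assoc p q H G F x y z)
    have h₅ := (congrArg (fun v => (mu H (comp G F)).app N
      ((SymmSeq.compHom (𝟙 H.multilin) (mu G F)).app N v)) h₂).trans h₃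
    exact h₄.trans h₅.symm)

theorem mu_left_unitality (F : SymmFun) :
    SymmSeq.compHom eps (𝟙 F.multilin) ≫ mu unit F ≫ multilinHom (lamMap F) =
      SymmSeq.lamHom F.multilin :=
  NatTrans.ext (funext fun N => SymmSeq.comp_unit_hom_ext fun K p hK y => by
    let k : K := Classical.arbitrary K
    have h₁ : (mu unit F).app N ((SymmSeq.compHom eps (𝟙 F.multilin)).app N
        (SymmSeq.compMk p (SymmSeq.unitPoint hK) y)) =
        prodPt p unit F (epsApp K (SymmSeq.unitPoint hK)) y :=
      (congrArg ((mu unit F).app N) (SymmSeq.compMk_hom eps (𝟙 F.multilin) p _ y)).trans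
        (mu_compMk _ _ p _ _)
    have h₂ : (SymmSeq.lamHom F.multilin).app N (SymmSeq.compMk p (SymmSeq.unitPoint hK) y) =
        F.multilin.map (X := p.fib k) (Y := N) (p.onlyFib hK k).symm (y k) :=
      SymmSeq.lamApp_compMk p hK k y
    have h₃ := (congrArg ((multilinHom (lamMap F)).app N) h₁).trans (prodPt_unit_left p hK k F y)
    exact h₃.trans h₂.symm)

theorem mu_right_unitality (F : SymmFun) :
    SymmSeq.rhoHom F.multilin ≫ SymmSeq.compHom (𝟙 F.multilin) eps ≫ mu F unit =
      multilinHom (rhoMap F) :=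
  NatTrans.ext (funext fun N => PtdSpace.hom_ext fun x => by
    have h₁ : (mu F unit).app N ((SymmSeq.compHom (𝟙 F.multilin) eps).app N
        (SymmSeq.rhoApp F.multilin N x)) =
        prodPt (Surj.id N) F unit x (fun n => epsApp ((Surj.id N).fib n)
          (SymmSeq.unitPoint ((Surj.id N).fib_subsingleton (fun _ _ h => h) n))) :=
      (congrArg ((mu F unit).app N) (SymmSeq.compMk_hom (𝟙 F.multilin) eps (Surj.id N) x _)).trans
        (mu_compMk _ _ (Surj.id N) _ _)
    exact h₁.trans (prodPt_unit_right F x))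

/-- The multilinearization is a lax monoidal functor. -/
noncomputable def laxMonoidal : LaxMonoidal skewMonoidal SymmSeq.skewMonoidal multilinFunctor where
  ε := eps
  μ G F := mu G F
  μ_natural η θ := mu_natural η θ
  associativity H G F := mu_associativity H G F
  left_unitality F := mu_left_unitality F
  right_unitality F := mu_right_unitality F

end SymmFun

theorem mainTheorem1 :
    ∃ (S : SkewMonoidal SymmFun.compFunctor SymmFun.unit)
      (S' : SkewMonoidal SymmSeq.compFunctor SymmSeq.unit)
      (L : LaxMonoidal S S' SymmFun.multilinFunctor),
      IsCanonicalFun S ∧ (∀ F, IsIso (S.lam F)) ∧ (∀ F, IsIso (S.rho F)) ∧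
      IsCanonicalSeq S' ∧ (∀ A B C, IsIso (S'.assoc A B C)) ∧ (∀ A, IsIso (S'.lam A)) ∧
        (∀ A, IsIso (S'.rho A)) ∧
      SymmFun.IsUnitMap L.ε ∧ ∀ G F : SymmFun, SymmFun.IsProductMap G F (L.μ G F) :=
  ⟨SymmFun.skewMonoidal, SymmSeq.skewMonoidal, SymmFun.laxMonoidal,
    SymmFun.isCanonicalFun_skewMonoidal, SymmFun.isIso_lam, SymmFun.isIso_rho,
    SymmSeq.isCanonicalSeq_skewMonoidal, SymmSeq.isIso_assoc,
    SymmSeq.isIso_lam, SymmSeq.isIso_rho, SymmFun.isUnitMap_eps,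
    SymmFun.isProductMap_mu⟩
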